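/- **Setting.** Let $X$ be a complete smooth split toric variety over $\mathbb Q$ with fan $\Sigma$, torus $T$, and $r=\operatorname{rk}\operatorname{Pic}(X)\ge 2$. Let $\Sigma_{\max}$ be the set of maximal cones of $\Sigma$, let $\mathfrak D_1,\dots,\mathfrak D_s\in\operatorname{Pic}(X)$ be the pairwise distinct classes of the torus-invariant prime divisors, and let $D_{i,1},\dots,D_{i,n_i}$ be the torus-invariant prime divisors of class $\mathfrak D_i$, with rays $\rho_{i,j}$ and primitive generators $u_{i,j}$. Let $L=\sum a_{i,j}D_{i,j}$ be a semiample torus-invariant $\mathbb Q$-divisor. For $\sigma\in\Sigma_{\max}$ let $u_{\sigma,L}$ be the rational character with $u_{\sigma,L}(u_{i,j})=a_{i,j}$ whenever $\rho_{i,j}\subseteq\sigma$, let $\alpha_{i,j,\sigma}=a_{i,j}-u_{\sigma,L}(u_{i,j})$ and $\alpha_{i,\sigma}=\sum_j\alpha_{i,j,\sigma}$. Assume that for every $i$ there is $\sigma\in\Sigma_{\max}$ with $\alpha_{i,\sigma}>0$ (this holds if $L$ is ample). In Cox coordinates $\mathbf x=(x_{i,j})$ the height is $H_L(\mathbf x)=\prod_{v}\max_{\sigma\in\Sigma_{\max}}\prod_{i,j}|x_{i,j}|_v^{\alpha_{i,j,\sigma}}$,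 the product being over all places $v$ of $\mathbb Q$. Let $g_1,\dots,g_t\in\mathbb Z[x_{i,j}]$ be $\operatorname{Pic}(X)$-homogeneous elements of the Cox ring (with $\deg x_{i,j}=\mathfrak D_i$), and let $V\subseteq X$ be the subscheme they define. Fix integers $m_{i,j}\ge1$. Let $N_V(B)$ be the number of points in $V(\mathbb Q)\cap T(\mathbb Q)$ of height $H_L\le B$ that are Campana $\mathbb Z$-points for $\sum_{i,j}(1-\frac1{m_{i,j}})\mathscr D_{i,j}$, i.e. whose intersection multiplicity at every prime $p$ with the closure $\mathscr D_{i,j}$ of $D_{i,j}$ in the toric scheme of $\Sigma$ over $\mathbb Z$ is $0$ or at least $m_{i,j}$, for all $i,j$. For $\mathbf d\in\mathbb Z_{>0}^s$ and $B_1,\dots,B_s\ge1$ let $F_{\mathbf d}(B_1,\dots,B_s)$ be the number of $(x_{i,j})$ with all $x_{i,j}\in\mathbb Z\setminus\{0\}$, $d_i\mid x_{i,j}$, $x_{i,j}$ $m_{i,j}$-full (every prime $p\mid x_{i,j}$ satisfies $p^{m_{i,j}}\mid x_{i,j}$), $g_1(\mathbf x)=\dots=g_t(\mathbf x)=0$,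 and $\max_j|x_{i,j}|\le B_i$ for all $i$. For $\sigma\in\Sigma_{\max}$ let $I_\sigma$ be the set of $i$ such that some $\rho_{i,j}\not\subseteq\sigma$. Let $\chi(\mathbf b)=1$ if $\gcd_{\sigma\in\Sigma_{\max}}\prod_{i\in I_\sigma}b_i=1$ and $\chi(\mathbf b)=0$ otherwise $(\mathbf b\in\mathbb Z_{>0}^s)$, and let $\mu:\mathbb Z_{>0}^s\to\mathbb Z$ be the unique function with $\chi(\mathbf b)=\sum_{d_i\mid b_i\,\forall i}\mu(\mathbf d)$. For $\beta\in\mathbb R^s$ let $f_\beta=\min\{\sum_i\beta_ie_i:\ 0\ne\mathbf e\in\mathbb Z_{\ge0}^s,\ \mu(p^{e_1},\dots,p^{e_s})\neq0\}$, which does not depend on the prime $p$. A function $A:\mathbb Z_{>0}^s\to\mathbb R$ is *compatible with Möbius inversion on $X$* if there is $\beta\in\mathbb R^s$ with $f_\beta>1$ and $A(\mathbf d)\ll\prod_id_i^{-\beta_i}$. **Lemma.** Assume that $$F_{\mathbf d}(B_1,\dots,B_s)=C_{M,\mathbf d}\prod_{i=1}^sB_i^{\varpi_i}+O\Big(C_{E,\mathbf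 d}\big(\min_{1\le i\le s}B_i\big)^{-\epsilon}\prod_{i=1}^sB_i^{\varpi_i}\Big)$$ for all $\mathbf d\in\mathbb Z_{>0}^s$ and $B_1,\dots,B_s\geq 1$, with an implied constant independent of $\mathbf d$ and the $B_i$, where $C_{M,\mathbf d},C_{E,\mathbf d},\varpi_1,\dots,\varpi_s,\epsilon>0$ and $C_{M,\mathbf d}$, $C_{E,\mathbf d}$ are, as functions of $\mathbf d$, compatible with Möbius inversion on $X$. Let $\mathcal P\subseteq\mathbb R^s$ be the polytope defined by $\sum_i\alpha_{i,\sigma}u_i\le1$ for all $\sigma\in\Sigma_{\max}$ and $u_i\ge0$ for all $i$. Then $\sum_i\varpi_iu_i$ attains a maximal value $a$ on $\mathcal P$, and $N_V(B)$ is finite for every $B$. Let $F$ be the face of $\mathcal P$ where $\sum_i\varpi_iu_i=a$, and let $k=\dim F$. (i) If $F$ is not contained in a coordinate hyperplane of $\mathbb R^s$, then, as $B\to\infty$, $$N_V(B)=cB^a(\log B)^k+O\big(B^a(\log B)^{k-1}(\log\log B)^s\big),\qquad c=(s-1-k)!\,c_{\mathcal P}\,2^{-r}\sum_{\mathbf d\in\mathbb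 Z_{>0}^s}\mu(\mathbf d)C_{M,\mathbf d},$$ where the series converges absolutely and the limit $c_{\mathcal P}=\lim_{\delta\to0^+}\delta^{k+1-s}\operatorname{meas}_{s-1}(H_\delta\cap\mathcal P)$ exists; here $H_\delta$ is the hyperplane $\sum_i\varpi_iu_i=a-\delta$ and $\operatorname{meas}_{s-1}$ is the measure on it given by $\prod_{i\ne\tilde\imath}(\varpi_i\,\mathrm du_i)$, for any choice of $\tilde\imath\in\{1,\dots,s\}$. (ii) If $L$ is ample, then $a=\inf\{t\in\mathbb R: t[L]-\sum_i\varpi_i\mathfrak D_i\text{ is effective}\}$ in $\operatorname{Pic}(X)\otimes\mathbb R$, and $k+1$ is the codimension of the minimal face of the effective cone of $X$ containing $a[L]-\sum_i\varpi_i\mathfrak D_i$. (iii) If $L$ is ample and $[L]=\sum_i\varpi_i\mathfrak D_i$ in $\operatorname{Pic}(X)\otimes\mathbb R$, then $F$ is not contained in a coordinate hyperplane of $\mathbb R^s$, $a=1$ and $k=r-1$. -/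

import Mathlib

open Filter Topology Asymptotics MeasureTheory

noncomputable section

/-- A complete smooth fan in `N = ℤ^rk`, given by the primitive generators `gen ρ` of
its rays `ρ : ι` and by its maximal cones, each encoded as the set of its rays. As the fan is
smooth and complete, every maximal cone is generated by a `ℤ`-basis of `N`, and the fan consists
of the faces of its maximal cones. Such fans are the same thing as complete smooth split toric
varieties `X` over `ℚ`, with torus `T = 𝔾_m^rk` and character lattice `M = ℤ^rk`. -/
structure SmoothCompleteFan (rk : ℕ) (ι : Type) [DecidableEq ι] where
  /-- the primitive generator of a ray -/
  gen : ι → Fin rk → ℤ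
  /-- the maximal cones -/
  maxCones : Finset (Finset ι)
  /-- every ray is a face of a maximal cone -/
  ray_mem : ∀ ρ, ∃ σ ∈ maxCones, ρ ∈ σ
  /-- smoothness: the generators of a maximal cone are a basis of the lattice -/
  linearIndependent : ∀ σ ∈ maxCones, LinearIndependent ℤ (fun ρ : σ => gen ρ)
  span_eq_top : ∀ σ ∈ maxCones, Submodule.span ℤ (gen '' (σ : Set ι)) = ⊤
  /-- two maximal cones meet in their common face -/
  inter : ∀ σ ∈ maxCones, ∀ τ ∈ maxCones,
    PointedCone.hull ℝ ((fun ρ k => (gen ρ k : ℝ)) '' (σ : Set ι)) ⊓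
        PointedCone.hull ℝ ((fun ρ k => (gen ρ k : ℝ)) '' (τ : Set ι)) =
      PointedCone.hull ℝ ((fun ρ k => (gen ρ k : ℝ)) '' ((σ ∩ τ : Finset ι) : Set ι))
  /-- completeness: the maximal cones cover `N ⊗ ℝ` -/
  complete : ∀ v : Fin rk → ℝ, ∃ σ ∈ maxCones,
    v ∈ PointedCone.hull ℝ ((fun ρ k => (gen ρ k : ℝ)) '' (σ : Set ι))

namespace SmoothCompleteFan

section General

variable {rk : ℕ} {ι : Type} [Fintype ι] [DecidableEq ι] (X : SmoothCompleteFan rk ι)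

/-! ### Divisors and the Picard group

A torus-invariant divisor `∑ a_ρ D_ρ` with coefficients in `ℤ`, `ℚ` or `ℝ` is its coefficient
vector `a`. -/

/-- The divisor `∑_ρ ⟨m, gen ρ⟩ D_ρ` of the character `m`. -/
def charDiv : (Fin rk → ℤ) →ₗ[ℤ] (ι → ℤ) where
  toFun m ρ := ∑ k, m k * X.gen ρ k
  map_add' m m' := by ext ρ; simp [add_mul, Finset.sum_add_distrib]
  map_smul' c m := by ext ρ; simp [Finset.mul_sum, mul_assoc]

/-- The same with real coefficients. -/
def charDivReal : (Fin rk → ℝ) →ₗ[ℝ] (ι → ℝ) where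
  toFun m ρ := ∑ k, m k * X.gen ρ k
  map_add' m m' := by ext ρ; simp [add_mul, Finset.sum_add_distrib]
  map_smul' c m := by ext ρ; simp [Finset.mul_sum, mul_assoc]

/-- `Pic(X)`: torus-invariant divisors modulo divisors of characters. -/
abbrev Pic : Type := (ι → ℤ) ⧸ LinearMap.range X.charDiv

/-- `Pic(X) ⊗ ℝ`. -/
abbrev PicReal : Type := (ι → ℝ) ⧸ LinearMap.range X.charDivReal

/-- The class in `Pic(X)` of the torus-invariant prime divisor `D_ρ`. -/
def primeClass (ρ : ι) : X.Pic := Submodule.Quotient.mk (Pi.single ρ (1 : ℤ))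

/-- The class in `Pic(X) ⊗ ℝ` of a torus-invariant `ℝ`-divisor. -/
def realClass (D : ι → ℝ) : X.PicReal := Submodule.Quotient.mk D

/-- The effective cone of `X`, generated by the classes of the torus-invariant prime divisors. -/
def effectiveCone : PointedCone ℝ X.PicReal :=
  PointedCone.hull ℝ (Set.range fun ρ : ι => X.realClass (Pi.single ρ 1))

/-- `O(D)` is generated by global sections: for each maximal cone `σ`, some effective
torus-invariant divisor linearly equivalent to `D` (the divisor of a monomial section) avoids the
torus-fixed point, hence the affine chart, of `σ`. -/
def IsGloballyGenerated (D : ι → ℤ) : Prop :=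
  ∀ σ ∈ X.maxCones, ∃ E : ι → ℤ, (∀ ρ, 0 ≤ E ρ) ∧ (∀ ρ ∈ σ, E ρ = 0) ∧
    E - D ∈ LinearMap.range X.charDiv

/-- A `ℚ`-divisor is semiample if a positive multiple is integral and globally generated. -/
def IsSemiample (L : ι → ℚ) : Prop :=
  ∃ q : ℕ, 0 < q ∧ ∃ D : ι → ℤ, (∀ ρ, (D ρ : ℚ) = q * L ρ) ∧ X.IsGloballyGenerated D

/-- A `ℚ`-divisor is ample if it has a positive integral multiple `D` such that, for every
divisor `E`, `E + l D` is globally generated for all large `l`. -/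
def IsAmple (L : ι → ℚ) : Prop :=
  ∃ q : ℕ, 0 < q ∧ ∃ D : ι → ℤ, (∀ ρ, (D ρ : ℚ) = q * L ρ) ∧
    ∀ E : ι → ℤ, ∃ l₀ : ℕ, ∀ l : ℕ, l₀ ≤ l → X.IsGloballyGenerated (E + l • D)

open Classical in
/-- The rational character `u_{σ,L}` with `u_{σ,L}(gen ρ) = a_ρ` for the rays `ρ` of `σ`, where
`L = ∑ a_ρ D_ρ`. It exists and is unique if `σ` is a maximal cone. -/
def localChar (L : ι → ℚ) (σ : Finset ι) : Fin rk → ℚ :=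
  if h : ∃ w : Fin rk → ℚ, ∀ ρ ∈ σ, ∑ k, w k * X.gen ρ k = L ρ then h.choose else 0

/-- The coefficient of `D_ρ` in `L(σ) = L - ∑_ρ u_{σ,L}(gen ρ) D_ρ`. -/
def localCoeff (L : ι → ℚ) (σ : Finset ι) (ρ : ι) : ℚ :=
  L ρ - ∑ k, X.localChar L σ k * X.gen ρ k

/-! ### Rational points of the torus, heights and Campana points -/

/-- The value `χ^m(t)` of the character `m` at `t ∈ T(ℚ)`. -/
def charValue (m : Fin rk → ℤ) (t : Fin rk → ℚˣ) : ℚˣ := ∏ k, t k ^ m k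

/-- The restriction `(ℚˣ)^ι → T(ℚ)` of the universal torsor of `X` (Cox coordinates). -/
def torsorMap (x : ι → ℚˣ) : Fin rk → ℚˣ := fun k => ∏ ρ, x ρ ^ X.gen ρ k

/-- The factor `sup_σ |x^{L(σ)}|_v` of the height at a place `v` with absolute value `av`. -/
def localHeight (L : ι → ℚ) (av : ℚ → ℝ) (x : ι → ℚˣ) : ℝ :=
  ⨆ σ : X.maxCones, ∏ ρ, av (x ρ) ^ (X.localCoeff L σ ρ : ℝ)

/-- The height `H_L` at the point with Cox coordinates `x`: the product over all places of `ℚ`. -/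
def height (L : ι → ℚ) (x : ι → ℚˣ) : ℝ :=
  X.localHeight L (fun z => |(z : ℝ)|) x *
    ∏ᶠ p : Nat.Primes, X.localHeight L (fun z => (padicNorm p z : ℝ)) x

/-- The characters in `σ^∨ ∩ M`, the coordinate functions of the chart `Spec ℤ[σ^∨ ∩ M]` of the
toric scheme over `ℤ`. -/
def dualChars (σ : Finset ι) : Set (Fin rk → ℤ) := {m | ∀ ρ ∈ σ, 0 ≤ ∑ k, m k * X.gen ρ k}

/-- The `ℤ_p`-point of the toric scheme extending `t` lies in the chart of `σ`. -/
def InChart (p : ℕ) (σ : Finset ι) (t : Fin rk → ℚˣ) : Prop :=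
  ∀ m ∈ X.dualChars σ, 0 ≤ padicValRat p (charValue m t : ℚ)

/-- Intersection multiplicity at `p` of `t` with the closure of `D_ρ`, `ρ ∈ σ`, computed in the
chart of `σ` (for `t` in this chart). There the closure of `D_ρ` is defined by the ideal generated
by the `χ^m` with `m ∈ σ^∨ ∩ M` and `⟨m, gen ρ⟩ > 0`, and the colength of its pullback to `ℤ_p` is
the least valuation of the `χ^m(t)`. -/
def interMult (p : ℕ) (σ : Finset ι) (ρ : ι) (t : Fin rk → ℚˣ) : ℕ :=
  sInf {e : ℕ | ∃ m ∈ X.dualChars σ, 0 < ∑ k, m k * X.gen ρ k ∧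
    padicValRat p (charValue m t : ℚ) = e}

/-- `t ∈ T(ℚ)` is a Campana `ℤ`-point for the boundary `∑_ρ (1 - 1/m_ρ) D_ρ` on the toric scheme
over `ℤ`: all intersection multiplicities are `0` or at least `m_ρ`. (In the chart of `σ` there is
no intersection with `D_ρ` for `ρ ∉ σ`.) -/
def IsCampana (m : ι → ℕ) (t : Fin rk → ℚˣ) : Prop :=
  ∀ p : ℕ, p.Prime → ∀ σ ∈ X.maxCones, X.InChart p σ t → ∀ ρ ∈ σ,
    X.interMult p σ ρ t = 0 ∨ m ρ ≤ X.interMult p σ ρ t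

/-- The points counted by `N_V(B)`: Campana points in `V ∩ T` of `H_L`-height at most `B`, where
`V` is defined by the homogeneous elements `g l` of the Cox ring. Height and vanishing of the
`g l` do not depend on the choice of Cox coordinates `x` of `t`. -/
def countedPoints (L : ι → ℚ) {n : ℕ} (g : Fin n → MvPolynomial ι ℤ) (m : ι → ℕ) (B : ℝ) :
    Set (Fin rk → ℚˣ) :=
  {t | X.IsCampana m t ∧ ∃ x : ι → ℚˣ, X.torsorMap x = t ∧
    (∀ l, MvPolynomial.aeval (fun ρ => (x ρ : ℚ)) (g l) = 0) ∧ X.height L x ≤ B}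

/-- `N_V(B)`. -/
def pointCount (L : ι → ℚ) {n : ℕ} (g : Fin n → MvPolynomial ι ℤ) (m : ι → ℕ) (B : ℝ) : ℕ :=
  (X.countedPoints L g m B).ncard

end General

section Grouped

/-! ### Rays grouped by divisor class

The rays are indexed by pairs `(i, j)` with `i : Fin s` and `j : Fin (n i)`, where `i` stands for
the class of the divisor. -/

variable {rk s : ℕ} {n : Fin s → ℕ} (X : SmoothCompleteFan rk (Σ i : Fin s, Fin (n i)))

/-- `D_{i,j}` and `D_{i',j'}` are linearly equivalent exactly if `i = i'`; all `n i` are positive,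
so that every `i` stands for a class. -/
def GroupedByClass : Prop :=
  (∀ i, 0 < n i) ∧ ∀ ρ ρ', X.primeClass ρ = X.primeClass ρ' ↔ ρ.1 = ρ'.1

/-- The class of the real combination `∑_i w_i 𝔇_i` of the distinct classes `𝔇_i = [D_{i,j}]`. The
divisor with coefficients `w_i / n_i` at `D_{i,j}` represents it. -/
def groupClass (w : Fin s → ℝ) : X.PicReal := X.realClass fun ρ => w ρ.1 / n ρ.1

/-- `I_σ`: the `i` such that some `ρ_{i,j}` is not a ray of `σ`. -/
def groupIdx (σ : Finset (Σ i : Fin s, Fin (n i))) : Finset (Fin s) :=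
  Finset.univ.filter fun i => ∃ j, (⟨i, j⟩ : Σ i : Fin s, Fin (n i)) ∉ σ

/-- `α_{i,σ} = ∑_j α_{i,j,σ}`. -/
def groupCoeff (L : (Σ i : Fin s, Fin (n i)) → ℚ) (σ : Finset (Σ i : Fin s, Fin (n i)))
    (i : Fin s) : ℚ :=
  ∑ j, X.localCoeff L σ ⟨i, j⟩

/-! ### The Möbius function of `X` -/

/-- Characteristic function of the `b` with `∑_σ ∏_{i ∈ I_σ} (b_i) = (1)` as ideals of `ℤ`. -/
def chi (b : Fin s → ℕ) : ℤ :=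
  if X.maxCones.gcd (fun σ => ∏ i ∈ groupIdx σ, b i) = 1 then 1 else 0

/-- The generalized Möbius function: the unique function with `χ(b) = ∑_{d ∣ b} μ(d)`. -/
def mu (b : Fin s → ℕ) : ℤ :=
  X.chi b - ∑ d ∈ ((Fintype.piFinset fun i => (b i).divisors).erase b).attach, mu d.1
termination_by ∑ i, b i
decreasing_by
  obtain ⟨d, hd⟩ := d
  rw [Finset.mem_erase, Fintype.mem_piFinset] at hd
  have hle : ∀ i, d i ≤ b i := fun i => Nat.divisor_le (hd.2 i)
  obtain ⟨i, hi⟩ := Function.ne_iff.mp hd.1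
  exact Finset.sum_lt_sum (fun i _ => hle i) ⟨i, Finset.mem_univ i, lt_of_le_of_ne (hle i) hi⟩

/-- The defining relation of the Möbius function. -/
theorem sum_mu (b : Fin s → ℕ) (hb : ∀ i, 0 < b i) :
    ∑ d ∈ Fintype.piFinset (fun i => (b i).divisors), X.mu d = X.chi b := by
  have hmem : b ∈ Fintype.piFinset (fun i => (b i).divisors) := by
    rw [Fintype.mem_piFinset]
    exact fun i => Nat.mem_divisors_self _ (hb i).ne'
  rw [← Finset.add_sum_erase _ _ hmem, mu, Finset.sum_attach _ (fun d => X.mu d)]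
  ring

/-- `f_β = min {∑ β_i e_i : e ≠ 0, μ(p^{e_1}, …, p^{e_s}) ≠ 0}` (the same for all primes `p`). -/
def mobiusMin (p : ℕ) (β : Fin s → ℝ) : ℝ :=
  sInf {z : ℝ | ∃ e : Fin s → ℕ, e ≠ 0 ∧ X.mu (fun i => p ^ e i) ≠ 0 ∧ z = ∑ i, β i * e i}

/-- Compatibility with Möbius inversion on `X`. -/
def MobiusCompatible (A : (Fin s → ℕ+) → ℝ) : Prop :=
  ∃ β : Fin s → ℝ, (∀ p : ℕ, p.Prime → 1 < X.mobiusMin p β) ∧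
    ∃ K : ℝ, ∀ d, |A d| ≤ K * ∏ i, ((d i : ℕ) : ℝ) ^ (-β i)

/-! ### The polytope -/

/-- The polytope `𝒫 ⊆ ℝ^s`. -/
def polytope (L : (Σ i : Fin s, Fin (n i)) → ℚ) : Set (Fin s → ℝ) :=
  {u | (∀ σ ∈ X.maxCones, ∑ i, (X.groupCoeff L σ i : ℝ) * u i ≤ 1) ∧ ∀ i, 0 ≤ u i}

/-- `a`: the maximal value of `∑ ϖ_i u_i` on `𝒫`. -/
def maxValue (L : (Σ i : Fin s, Fin (n i)) → ℚ) (ϖ : Fin s → ℝ) : ℝ :=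
  sSup ((fun u => ∑ i, ϖ i * u i) '' X.polytope L)

/-- The face `F` of `𝒫` where the maximum is attained. -/
def maxFace (L : (Σ i : Fin s, Fin (n i)) → ℚ) (ϖ : Fin s → ℝ) : Set (Fin s → ℝ) :=
  {u ∈ X.polytope L | ∑ i, ϖ i * u i = X.maxValue L ϖ}

/-- `k`: the dimension of `F`. -/
def faceDim (L : (Σ i : Fin s, Fin (n i)) → ℚ) (ϖ : Fin s → ℝ) : ℕ :=
  Module.finrank ℝ (vectorSpan ℝ (X.maxFace L ϖ))

/-- `meas_{s-1}(H_δ ∩ 𝒫)` for the measure `∏_{i ≠ i₀} ϖ_i du_i` on the hyperplane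
`H_δ : ∑ ϖ_i u_i = a - δ`, which is parametrized by the coordinates `u_i`, `i ≠ i₀`. -/
def sliceMeasure (L : (Σ i : Fin s, Fin (n i)) → ℚ) (ϖ : Fin s → ℝ) (i₀ : Fin s) (δ : ℝ) : ℝ :=
  (∏ i : {i // i ≠ i₀}, ϖ i) *
    (volume ((fun (u : Fin s → ℝ) (i : {i // i ≠ i₀}) => u i) ''
      {u ∈ X.polytope L | ∑ i, ϖ i * u i = X.maxValue L ϖ - δ})).toReal

end Grouped

end SmoothCompleteFan

/-! ### The box counts -/

/-- `z` is `m`-full: `p ∣ z` implies `p ^ m ∣ z` for all primes `p`. -/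
def IsFull (m : ℕ) (z : ℤ) : Prop := ∀ p : ℕ, p.Prime → (p : ℤ) ∣ z → (p : ℤ) ^ m ∣ z

/-- `f_d(y)`: the number of `x` with nonzero integral coordinates, `d_i ∣ x_{i,j}`, `x_{i,j}`
`m_{i,j}`-full, `g_1(x) = … = g_t(x) = 0` and `sup_j |x_{i,j}| = y_i`. -/
def fiberCount {s : ℕ} {n : Fin s → ℕ} {t : ℕ}
    (g : Fin t → MvPolynomial (Σ i : Fin s, Fin (n i)) ℤ) (m : (Σ i : Fin s, Fin (n i)) → ℕ)
    (d : Fin s → ℕ+) (y : Fin s → ℕ) : ℕ :=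
  {x : (Σ i : Fin s, Fin (n i)) → ℤ | (∀ ρ, x ρ ≠ 0) ∧ (∀ ρ, ((d ρ.1 : ℕ) : ℤ) ∣ x ρ) ∧
    (∀ ρ, IsFull (m ρ) (x ρ)) ∧ (∀ l, MvPolynomial.eval x (g l) = 0) ∧
    ∀ i, Finset.univ.sup (fun j : Fin (n i) => (x ⟨i, j⟩).natAbs) = y i}.ncard

/-- `F_d(B_1, …, B_s) = ∑_{1 ≤ y_i ≤ B_i} f_d(y)`. -/
def boxCount {s : ℕ} {n : Fin s → ℕ} {t : ℕ}
    (g : Fin t → MvPolynomial (Σ i : Fin s, Fin (n i)) ℤ) (m : (Σ i : Fin s, Fin (n i)) → ℕ)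
    (d : Fin s → ℕ+) (B : Fin s → ℝ) : ℕ :=
  ∑ y ∈ Fintype.piFinset (fun i => Finset.Icc 1 ⌊B i⌋₊), fiberCount g m d y

end

/-! The count is lifted to integral Cox coordinates and turned into a sum over lattice points whose
logarithms lie in a dilated polytope. A point of $T(\mathbb Q)$ has exactly $2^r$ lifts to integral
tuples $\mathbf x$ such that, for each prime $p$, the rays with $p\mid x_\rho$ lie in one cone
(`ncard_coprimeTuple`): the $p$-adic valuations of the point form a lattice vector, and completeness
and smoothness write it uniquely as a nonnegative integral combination of the generators of a cone.
For such tuples the Campana condition says that every $x_\rho$ is $m_\rho$-full (`isCampana_iff`),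
and all finite places contribute $1$ to the height (`height_le_iff`).

Linear equivalence within a class has two consequences. Coprimality depends only on the gcd of the
coordinates in each class (`isCoprimeTuple_iff_chi`), so Möbius inversion with $\mu$ applies. The
family of height conditions depends only on $y_i=\max_j|x_{i,j}|$ (`forall_localCoeff_le_iff`) and
says $\log\mathbf y\in\log B\cdot\mathcal P$. Hence $2^rN_V(B)=\sum_{\mathbf d}\mu(\mathbf
d)\sum_{\log\mathbf y\in\lambda\mathcal P}f_{\mathbf d}(\mathbf y)$ with $\lambda=\log B$
(`hasSum_mu_mul_fiberCount`).

The inner sum is compared with $C_{M,\mathbf d}\prod_i\varpi_i\int_{\lambda\mathcal P}e^{\varpi\cdot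
b}\,db$ (`exists_hyperbola_bound`). Space is cut into cubes of side $1/\lambda$, and
inclusion-exclusion turns the box counts into counts for cubes. This needs all coordinates of $b$ to
be at least a large multiple of $\log\lambda$. The excluded slabs carry only a share
$O(\log\lambda/\lambda)$ of the integral, because for each $i$ the face $F$ has a point with
positive $i$-th coordinate, towards which the slab can be pushed (`integral_inter_slab_le`).

For the integral, scaling independently along $F$ and transversally to it shows that the slice at
distance $\delta$ has measure $c_{\mathcal P}\delta^N+O(\delta^{N+1})$ with $N=s-1-k$. The Laplace
transform and the dilation by $\lambda$ then give $N!\,c_{\mathcal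
P}e^{a\lambda}\lambda^k(1+O(1/\lambda))$ when $c_{\mathcal P}\ne0$, and in general the same main
term with error $O(e^{a\lambda}\lambda^{k-1})$. All bounds are uniform in $\mathbf d$, and
$\sum|\mu(\mathbf d)|\prod d_i^{-\beta_i}$ converges by comparison with an Euler product
(`summable_mu_mul`).

Parts (ii) and (iii) are linear duality. A nonzero linear form on
$\operatorname{Pic}(X)\otimes\mathbb R$ that is nonnegative on the effective cone becomes a point of
$\mathcal P$ after normalization at $L$. Conversely, points of $F$ are such linear forms
(`exists_dual_of_mem_maxFace`), although general points of $\mathcal P$ need not be. So the cone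
over $F$ consists of the forms that are nonnegative on the effective cone and vanish at
$a[L]-\sum_i\varpi_i\mathfrak D_i$. By Farkas' lemma their span has dimension equal to the
codimension of the minimal face. -/

namespace SmoothCompleteFan

/-! ### Dual bases and unique decompositions in a smooth complete fan -/

section Cones

variable {rk : ℕ} {ι : Type} [DecidableEq ι] (X : SmoothCompleteFan rk ι)

/-- Smoothness makes the generators of `σ` a lattice basis. The two identities say that the matrix
of its dual basis is inverse to it from both sides. -/
theorem exists_dualBasis {σ : Finset ι} (hσ : σ ∈ X.maxCones) :
    ∃ e : ι → Fin rk → ℤ,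
      (∀ ρ ∈ σ, ∀ τ ∈ σ, ∑ k, e ρ k * X.gen τ k = if ρ = τ then 1 else 0) ∧
      ∀ k l, ∑ ρ ∈ σ, e ρ k * X.gen ρ l = if k = l then 1 else 0 := by
  classical
  have hspan : ⊤ ≤ Submodule.span ℤ (Set.range fun ρ : σ => X.gen ρ) := by
    rw [← X.span_eq_top σ hσ]
    apply Submodule.span_mono
    rintro _ ⟨ρ, hρ, rfl⟩
    exact ⟨⟨ρ, hρ⟩, rfl⟩
  let b := Module.Basis.mk (X.linearIndependent σ hσ) hspan
  have hb : ∀ ρ : σ, b ρ = X.gen ρ := fun ρ => by simp [b]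
  have hlin : ∀ (v : Fin rk → ℤ) (ρ : σ), b.repr v ρ = ∑ k, b.repr (Pi.single k 1) ρ * v k := by
    intro v ρ
    conv_lhs => rw [pi_eq_sum_univ' v]
    rw [map_sum, Finsupp.finsetSum_apply]
    refine Finset.sum_congr rfl fun k _ => ?_
    rw [map_smul, Finsupp.smul_apply, smul_eq_mul, mul_comm]
  refine ⟨fun ρ k => if h : ρ ∈ σ then b.repr (Pi.single k 1) ⟨ρ, h⟩ else 0, ?_, ?_⟩
  · intro ρ hρ τ hτ
    simp only [hρ, dif_pos]
    rw [← hlin, show X.gen τ = b ⟨τ, hτ⟩ from (hb ⟨τ, hτ⟩).symm, b.repr_self,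
      Finsupp.single_apply]
    simp [eq_comm]
  · intro k l
    have h := congrFun (b.sum_repr (Pi.single k 1)) l
    rw [Finset.sum_apply] at h
    rw [← Finset.sum_coe_sort]
    simp only [Finset.coe_mem, dif_pos, Subtype.coe_eta]
    simp only [Pi.smul_apply, hb, smul_eq_mul] at h
    rw [h, Pi.single_apply]
    simp [eq_comm]

open Classical in
/-- The basis of the character lattice dual to the generators of a maximal cone. -/
noncomputable def dualBasis (σ : Finset ι) : ι → Fin rk → ℤ :=
  if h : σ ∈ X.maxCones then (X.exists_dualBasis h).choose else 0

variable {X} {σ τ : Finset ι}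

theorem dualBasis_pairing (hσ : σ ∈ X.maxCones) {ρ ρ' : ι} (hρ : ρ ∈ σ) (hρ' : ρ' ∈ σ) :
    ∑ k, X.dualBasis σ ρ k * X.gen ρ' k = if ρ = ρ' then 1 else 0 := by
  rw [dualBasis, dif_pos hσ]
  exact (X.exists_dualBasis hσ).choose_spec.1 ρ hρ ρ' hρ'

theorem sum_dualBasis_mul_gen (hσ : σ ∈ X.maxCones) (k l : Fin rk) :
    ∑ ρ ∈ σ, X.dualBasis σ ρ k * X.gen ρ l = if k = l then 1 else 0 := by
  rw [dualBasis, dif_pos hσ]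
  exact (X.exists_dualBasis hσ).choose_spec.2 k l

variable (X) in
/-- The coordinate at `ρ` of a vector with respect to the generators of `σ`. -/
noncomputable def coord (R : Type*) [CommRing R] (σ : Finset ι) (ρ : ι) (v : Fin rk → R) : R :=
  ∑ k, (X.dualBasis σ ρ k : R) * v k

section Ring

variable {R : Type*} [CommRing R]

theorem coord_sum_gen (hσ : σ ∈ X.maxCones) (c : ι → R) {ρ : ι} (hρ : ρ ∈ σ) :
    X.coord R σ ρ (fun k => ∑ τ ∈ σ, c τ * X.gen τ k) = c ρ := by
  have : ∀ τ ∈ σ, c τ * ((∑ k, X.dualBasis σ ρ k * X.gen τ k : ℤ) : R) =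
      if ρ = τ then c τ else 0 := fun τ hτ => by
    rw [dualBasis_pairing hσ hρ hτ]; split_ifs <;> simp
  rw [coord]
  simp_rw [Finset.mul_sum]
  rw [Finset.sum_comm]
  calc _ = ∑ τ ∈ σ, c τ * ((∑ k, X.dualBasis σ ρ k * X.gen τ k : ℤ) : R) := by
        refine Finset.sum_congr rfl fun τ _ => ?_
        push_cast
        rw [Finset.mul_sum]
        exact Finset.sum_congr rfl fun k _ => by ring
    _ = c ρ := by rw [Finset.sum_congr rfl this, Finset.sum_ite_eq, if_pos hρ]

theorem sum_coord_gen (hσ : σ ∈ X.maxCones) (v : Fin rk → R) (l : Fin rk) :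
    ∑ ρ ∈ σ, X.coord R σ ρ v * X.gen ρ l = v l := by
  simp_rw [coord, Finset.sum_mul]
  rw [Finset.sum_comm]
  have : ∀ k, ∑ ρ ∈ σ, (X.dualBasis σ ρ k : R) * v k * X.gen ρ l =
      if k = l then v k else 0 := fun k => by
    have h := congrArg (Int.cast : ℤ → R) (sum_dualBasis_mul_gen hσ k l)
    push_cast at h
    calc _ = (∑ ρ ∈ σ, (X.dualBasis σ ρ k : R) * X.gen ρ l) * v k := by
          rw [Finset.sum_mul]; exact Finset.sum_congr rfl fun k _ => by ring
      _ = _ := by rw [h]; split_ifs <;> simp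
  simp [this]

theorem eq_of_pairing_eq (hσ : σ ∈ X.maxCones) {w w' : Fin rk → R}
    (h : ∀ ρ ∈ σ, ∑ k, w k * X.gen ρ k = ∑ k, w' k * X.gen ρ k) : w = w' := by
  have key : ∀ w : Fin rk → R, ∀ k, w k =
      ∑ ρ ∈ σ, (X.dualBasis σ ρ k : R) * ∑ l, w l * X.gen ρ l := fun w k => by
    simp_rw [Finset.mul_sum]
    rw [Finset.sum_comm]
    have : ∀ l, ∑ ρ ∈ σ, (X.dualBasis σ ρ k : R) * (w l * X.gen ρ l) =
        if k = l then w l else 0 := fun l => by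
      have h := congrArg (Int.cast : ℤ → R) (sum_dualBasis_mul_gen hσ k l)
      push_cast at h
      calc _ = (∑ ρ ∈ σ, (X.dualBasis σ ρ k : R) * X.gen ρ l) * w l := by
            rw [Finset.sum_mul]; exact Finset.sum_congr rfl fun k _ => by ring
        _ = _ := by rw [h]; split_ifs <;> simp
    simp [this]
  ext k
  rw [key w, key w']
  exact Finset.sum_congr rfl fun ρ hρ => by rw [h ρ hρ]

end Ring

theorem mem_hull_gen_iff {v : Fin rk → ℝ} :
    v ∈ PointedCone.hull ℝ ((fun ρ k => (X.gen ρ k : ℝ)) '' (σ : Set ι)) ↔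
      ∃ c : ι → ℝ, (∀ ρ, 0 ≤ c ρ) ∧ (∀ ρ ∉ σ, c ρ = 0) ∧
        ∀ k, v k = ∑ ρ ∈ σ, c ρ * X.gen ρ k := by
  rw [PointedCone.hull, Submodule.mem_span_image_finset_iff_exists_fun]
  constructor
  · rintro ⟨c, rfl⟩
    refine ⟨fun ρ => if h : ρ ∈ σ then (c ⟨ρ, h⟩ : ℝ) else 0, fun ρ => ?_, fun ρ hρ => ?_,
      fun k => ?_⟩
    · dsimp only
      split_ifs
      exacts [(c _).2, le_rfl]
    · simp [hρ]
    · rw [← Finset.sum_coe_sort σ, Finset.sum_apply]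
      refine Finset.sum_congr rfl fun ρ _ => ?_
      simp only [Finset.coe_mem, dif_pos]
      rfl
  · rintro ⟨c, hc, -, hv⟩
    refine ⟨fun ρ => ⟨c ρ, hc ρ⟩, ?_⟩
    ext k
    rw [hv k, ← Finset.sum_coe_sort σ, Finset.sum_apply]
    exact Finset.sum_congr rfl fun ρ _ => rfl

/-- The common vector lies in both cones, hence in the cone over `σ ∩ τ`. By linear independence
each of the two expansions agrees with the expansion there. -/
theorem eq_of_sum_gen_eq (hσ : σ ∈ X.maxCones) (hτ : τ ∈ X.maxCones) {c c' : ι → ℝ}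
    (hc : ∀ ρ, 0 ≤ c ρ) (hcσ : ∀ ρ ∉ σ, c ρ = 0) (hc' : ∀ ρ, 0 ≤ c' ρ) (hcτ : ∀ ρ ∉ τ, c' ρ = 0)
    (h : ∀ k, ∑ ρ ∈ σ, c ρ * X.gen ρ k = ∑ ρ ∈ τ, c' ρ * X.gen ρ k) : c = c' := by
  have h1 := mem_hull_gen_iff (X := X).2 ⟨c, hc, hcσ, fun k => rfl⟩
  have h2 := mem_hull_gen_iff (X := X).2 ⟨c', hc', hcτ, h⟩
  have h3 := Submodule.mem_inf.2 ⟨h1, h2⟩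
  rw [X.inter σ hσ τ hτ] at h3
  obtain ⟨d, -, hd, hs⟩ := mem_hull_gen_iff.1 h3
  have ext_sum : ∀ π : Finset ι, σ ∩ τ ⊆ π → ∀ k,
      ∑ ρ ∈ σ ∩ τ, d ρ * X.gen ρ k = ∑ ρ ∈ π, d ρ * X.gen ρ k := fun π hπ k =>
    Finset.sum_subset hπ fun ρ _ hρ => by simp [hd ρ hρ]
  have e1 : c = d := by
    ext ρ
    by_cases hρ : ρ ∈ σ
    · rw [← coord_sum_gen hσ c hρ, ← coord_sum_gen hσ d hρ]
      congr 1; ext k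
      rw [hs k, ext_sum σ Finset.inter_subset_left]
    · rw [hcσ ρ hρ, hd ρ fun h => hρ (Finset.mem_inter.1 h).1]
  have e2 : c' = d := by
    ext ρ
    by_cases hρ : ρ ∈ τ
    · rw [← coord_sum_gen hτ c' hρ, ← coord_sum_gen hτ d hρ]
      congr 1; ext k
      rw [← h k, hs k, ext_sum τ Finset.inter_subset_right]
    · rw [hcτ ρ hρ, hd ρ fun h => hρ (Finset.mem_inter.1 h).2]
  rw [e1, e2]

theorem exists_nonneg_coord (X : SmoothCompleteFan rk ι) (v : Fin rk → ℝ) :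
    ∃ σ ∈ X.maxCones, ∀ ρ ∈ σ, 0 ≤ X.coord ℝ σ ρ v := by
  obtain ⟨σ, hσ, hv⟩ := X.complete v
  obtain ⟨c, hc, -, hv⟩ := mem_hull_gen_iff.1 hv
  refine ⟨σ, hσ, fun ρ hρ => ?_⟩
  rw [show v = fun k => ∑ τ ∈ σ, c τ * X.gen τ k from funext hv, coord_sum_gen hσ c hρ]
  exact hc ρ

theorem coord_intCast (σ : Finset ι) (ρ : ι) (v : Fin rk → ℤ) :
    X.coord ℝ σ ρ (fun k => (v k : ℝ)) = (X.coord ℤ σ ρ v : ℤ) := by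
  simp [coord]

/-- Completeness provides a cone with nonnegative coordinates, and smoothness makes these
coordinates integers. Applied to valuation vectors, this yields integral Cox coordinates. -/
theorem exists_int_decomposition (X : SmoothCompleteFan rk ι) (v : Fin rk → ℤ) :
    ∃ σ ∈ X.maxCones, ∃ c : ι → ℕ, (∀ ρ ∉ σ, c ρ = 0) ∧
      ∀ k, v k = ∑ ρ ∈ σ, (c ρ : ℤ) * X.gen ρ k := by
  obtain ⟨σ, hσ, h⟩ := X.exists_nonneg_coord fun k => (v k : ℝ)
  have h' : ∀ ρ ∈ σ, 0 ≤ X.coord ℤ σ ρ v := fun ρ hρ => by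
    have := h ρ hρ
    rw [coord_intCast] at this
    exact_mod_cast this
  refine ⟨σ, hσ, fun ρ => if ρ ∈ σ then (X.coord ℤ σ ρ v).toNat else 0, fun ρ hρ => by simp [hρ],
    fun k => ?_⟩
  rw [← sum_coord_gen hσ v k]
  refine Finset.sum_congr rfl fun ρ hρ => ?_
  simp [hρ, h' ρ hρ]

theorem nat_eq_of_sum_gen_eq (hσ : σ ∈ X.maxCones) (hτ : τ ∈ X.maxCones) {c c' : ι → ℕ}
    (hcσ : ∀ ρ ∉ σ, c ρ = 0) (hcτ : ∀ ρ ∉ τ, c' ρ = 0)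
    (h : ∀ k, ∑ ρ ∈ σ, (c ρ : ℤ) * X.gen ρ k = ∑ ρ ∈ τ, (c' ρ : ℤ) * X.gen ρ k) : c = c' := by
  have := eq_of_sum_gen_eq hσ hτ (c := fun ρ => (c ρ : ℝ)) (c' := fun ρ => (c' ρ : ℝ))
    (fun _ => Nat.cast_nonneg _) (fun ρ hρ => by simp [hcσ ρ hρ]) (fun _ => Nat.cast_nonneg _)
    (fun ρ hρ => by simp [hcτ ρ hρ]) (fun k => by exact_mod_cast h k)
  ext ρ
  exact_mod_cast congrFun this ρ

end Cones

/-! ### Linearly equivalent rays and cones of the fan -/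

section Faces

variable {rk : ℕ} {ι : Type} [DecidableEq ι] {X : SmoothCompleteFan rk ι}

theorem exists_char_of_primeClass_eq {ρ ρ' : ι} (h : X.primeClass ρ = X.primeClass ρ') :
    ∃ w : Fin rk → ℤ, ∀ τ, ∑ k, w k * X.gen τ k =
      (if τ = ρ then 1 else 0) - (if τ = ρ' then 1 else 0) := by
  obtain ⟨w, hw⟩ := (Submodule.Quotient.eq _).1 h
  refine ⟨w, fun τ => ?_⟩
  have := congrFun hw τ
  simpa [charDiv, Pi.single_apply] using this

/-- A set of rays spans a cone of the fan as soon as this holds after removing a ray `ρ` for which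
the set misses a linearly equivalent ray. -/
theorem exists_maxCone_of_erase {Z : Finset ι} {ρ ρ' : ι} (hρ : ρ ∈ Z) (hρ' : ρ' ∉ Z)
    (h : X.primeClass ρ = X.primeClass ρ') (hZ : ∃ σ ∈ X.maxCones, Z.erase ρ ⊆ σ) :
    ∃ σ ∈ X.maxCones, Z ⊆ σ := by
  obtain ⟨σ, hσ, hZσ⟩ := hZ
  obtain ⟨w, hw⟩ := exists_char_of_primeClass_eq h
  have hne : ρ ≠ ρ' := fun e => hρ' (e ▸ hρ)
  -- The character `w` takes the value 1 on `gen ρ`, -1 on `gen ρ'` and 0 on all other generators.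
  -- Hence it takes the value 1 on the sum of the generators in `Z`, and any decomposition of this
  -- sum has coefficient at least 1 at `ρ`.
  obtain ⟨τ, hτ, c, hcτ, hc⟩ := X.exists_int_decomposition fun k => ∑ π ∈ Z, X.gen π k
  have hpair : ∀ (T : Finset ι) (b : ι → ℤ), ∑ k, w k * ∑ π ∈ T, b π * X.gen π k =
      ∑ π ∈ T, b π * ((if π = ρ then 1 else 0) - (if π = ρ' then 1 else 0)) := by
    intro T b
    simp_rw [← hw, Finset.mul_sum]
    rw [Finset.sum_comm]
    exact Finset.sum_congr rfl fun π _ => Finset.sum_congr rfl fun k _ => by ring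
  have h1 := hpair Z fun _ => 1
  have h2 := hpair τ fun π => (c π : ℤ)
  simp only [one_mul, hc] at h1
  rw [h1] at h2
  simp only [mul_sub, mul_ite, mul_one, mul_zero, Finset.sum_sub_distrib, Finset.sum_ite_eq',
    hρ, hρ', if_true, if_false] at h2
  have hρτ : ρ ∈ τ := by
    by_contra hn
    rw [if_neg hn] at h2
    split_ifs at h2 <;> omega
  have hcρ : 1 ≤ c ρ := by
    rw [if_pos hρτ] at h2
    split_ifs at h2 <;> omega
  -- Removing `gen ρ` once leaves the sum over `Z.erase ρ`, whose rays lie in `σ`. Uniqueness of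
  -- decompositions then places all of them in `τ` as well.
  have key := nat_eq_of_sum_gen_eq hσ hτ (c := fun π => if π ∈ Z.erase ρ then 1 else 0)
    (c' := fun π => c π - if π = ρ then 1 else 0)
    (fun π hπ => if_neg fun h => hπ (hZσ h))
    (fun π hπ => by simp [hcτ π hπ]) (fun k => ?_)
  · refine ⟨τ, hτ, fun π hπ => ?_⟩
    by_cases e : π = ρ
    · exact e ▸ hρτ
    by_contra hn
    have := congrFun key π
    simp [e, hπ, hcτ π hn] at this
  · have e1 : ∑ π ∈ σ, ((if π ∈ Z.erase ρ then 1 else 0 : ℕ) : ℤ) * X.gen π k =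
        ∑ π ∈ Z.erase ρ, X.gen π k := by
      simp only [Nat.cast_ite, Nat.cast_one, Nat.cast_zero, ite_mul, one_mul, zero_mul]
      rw [Finset.sum_ite_mem, Finset.inter_eq_right.2 hZσ]
    have e2 : ∀ π ∈ τ, ((c π - if π = ρ then 1 else 0 : ℕ) : ℤ) * X.gen π k =
        (c π : ℤ) * X.gen π k - if π = ρ then X.gen π k else 0 := fun π _ => by
      split_ifs with e
      · subst e; push_cast [hcρ]; ring
      · simp
    rw [e1, Finset.sum_congr rfl e2, Finset.sum_sub_distrib, ← hc k, Finset.sum_ite_eq',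
      if_pos hρτ, ← Finset.add_sum_erase _ _ hρ]
    ring

/-- Rays of `Z` that are linearly equivalent to a ray outside `Z` do not matter for `Z` to span a
cone of the fan. -/
theorem exists_maxCone_of_subset {Z Z₀ : Finset ι} (hZ₀ : Z₀ ⊆ Z)
    (h : ∀ ρ ∈ Z \ Z₀, ∃ ρ' ∉ Z, X.primeClass ρ' = X.primeClass ρ)
    (hZ : ∃ σ ∈ X.maxCones, Z₀ ⊆ σ) : ∃ σ ∈ X.maxCones, Z ⊆ σ := by
  suffices H : ∀ T : Finset ι, T ⊆ Z \ Z₀ → ∃ σ ∈ X.maxCones, Z₀ ∪ T ⊆ σ by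
    obtain ⟨σ, hσ, h⟩ := H (Z \ Z₀) subset_rfl
    rw [Finset.union_sdiff_of_subset hZ₀] at h
    exact ⟨σ, hσ, h⟩
  intro T
  induction T using Finset.induction_on with
  | empty => intro _; simpa using hZ
  | insert ρ T hρT ih =>
    intro hT
    have hsub : Z₀ ∪ insert ρ T ⊆ Z := Finset.union_subset hZ₀ (hT.trans Finset.sdiff_subset)
    obtain ⟨ρ', hn, hρ'⟩ := h ρ (hT (Finset.mem_insert_self _ _))
    refine exists_maxCone_of_erase (ρ := ρ) (ρ' := ρ') (by simp) (fun h => hn (hsub h)) hρ'.symm ?_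
    obtain ⟨σ, hσ, h⟩ := ih ((Finset.subset_insert _ _).trans hT)
    refine ⟨σ, hσ, subset_trans ?_ h⟩
    intro π hπ
    simp only [Finset.mem_erase, Finset.mem_union, Finset.mem_insert] at hπ ⊢
    tauto

end Faces

end SmoothCompleteFan

namespace SmoothCompleteFan

/-! ### Height exponents and their pairing with real vectors -/

section LocalCoeff

variable {rk : ℕ} {ι : Type} [DecidableEq ι] {X : SmoothCompleteFan rk ι} {σ : Finset ι}

theorem localChar_pairing (L : ι → ℚ) (hσ : σ ∈ X.maxCones) {ρ : ι} (hρ : ρ ∈ σ) :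
    ∑ k, X.localChar L σ k * X.gen ρ k = L ρ := by
  have h : ∃ w : Fin rk → ℚ, ∀ ρ ∈ σ, ∑ k, w k * X.gen ρ k = L ρ := by
    refine ⟨fun k => ∑ τ ∈ σ, L τ * X.dualBasis σ τ k, fun ρ hρ => ?_⟩
    simp_rw [Finset.sum_mul]
    rw [Finset.sum_comm]
    have : ∀ τ ∈ σ, ∑ k, L τ * X.dualBasis σ τ k * X.gen ρ k = if τ = ρ then L τ else 0 := by
      intro τ hτ
      have h := congrArg (Int.cast : ℤ → ℚ) (dualBasis_pairing hσ hτ hρ)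
      push_cast at h
      simp_rw [mul_assoc]
      rw [← Finset.mul_sum, h]
      split_ifs <;> simp
    rw [Finset.sum_congr rfl this, Finset.sum_ite_eq', if_pos hρ]
  rw [localChar, dif_pos h]
  exact h.choose_spec ρ hρ

theorem localCoeff_eq_zero (L : ι → ℚ) (hσ : σ ∈ X.maxCones) {ρ : ι} (hρ : ρ ∈ σ) :
    X.localCoeff L σ ρ = 0 := by
  rw [localCoeff, localChar_pairing L hσ hρ, sub_self]

/-- A multiple `q L` is linearly equivalent to an effective divisor `E` that vanishes on the rays of
`σ`. Characters are determined by their values on `σ`, so the exponents are `E / q`. -/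
theorem localCoeff_nonneg {L : ι → ℚ} (hL : X.IsSemiample L) (hσ : σ ∈ X.maxCones) (ρ : ι) :
    0 ≤ X.localCoeff L σ ρ := by
  obtain ⟨q, hq, D, hD, hgg⟩ := hL
  obtain ⟨E, hE0, hEσ, w, hw⟩ := hgg σ hσ
  have hq' : (0 : ℚ) < q := by exact_mod_cast hq
  have hw' : ∀ ρ, (E ρ : ℚ) = q * L ρ + ∑ k, (w k : ℚ) * X.gen ρ k := fun ρ => by
    have := congrFun hw ρ
    simp only [charDiv, LinearMap.coe_mk, AddHom.coe_mk, Pi.sub_apply] at this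
    rw [← hD ρ]
    have h2 : (E ρ : ℤ) = D ρ + ∑ k, w k * X.gen ρ k := by rw [this]; ring
    exact_mod_cast h2
  have hchar : X.localChar L σ = fun k => -(w k : ℚ) / q := by
    refine eq_of_pairing_eq hσ fun ρ hρ => ?_
    rw [localChar_pairing L hσ hρ]
    have := hw' ρ
    rw [hEσ ρ hρ] at this
    have h3 : ∑ k, -(w k : ℚ) / q * X.gen ρ k = -(∑ k, (w k : ℚ) * X.gen ρ k) / q := by
      rw [← Finset.sum_neg_distrib, Finset.sum_div]
      exact Finset.sum_congr rfl fun k _ => by ring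
    rw [h3, eq_div_iff hq'.ne']
    push_cast at this
    linarith
  have h3 : ∑ k, -(w k : ℚ) / q * X.gen ρ k = -(∑ k, (w k : ℚ) * X.gen ρ k) / q := by
    rw [← Finset.sum_neg_distrib, Finset.sum_div]
    exact Finset.sum_congr rfl fun k _ => by ring
  have : X.localCoeff L σ ρ = E ρ / q := by
    rw [localCoeff, hchar, h3, hw' ρ]
    field_simp
    ring
  rw [this]
  have : (0 : ℚ) ≤ E ρ := by exact_mod_cast hE0 ρ
  positivity

theorem coe_sub_localCoeff (L : ι → ℚ) (σ : Finset ι) (ρ : ι) :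
    (L ρ : ℝ) - X.localCoeff L σ ρ = ∑ k, (X.localChar L σ k : ℝ) * X.gen ρ k := by
  rw [localCoeff]
  push_cast
  ring

theorem localCoeff_sub_mem_range (L : ι → ℚ) (σ : Finset ι) :
    (fun ρ => (X.localCoeff L σ ρ : ℝ)) - (fun ρ => (L ρ : ℝ)) ∈
      LinearMap.range X.charDivReal := by
  refine ⟨fun k => -(X.localChar L σ k : ℝ), ?_⟩
  ext ρ
  have := coe_sub_localCoeff (X := X) L σ ρ
  simp only [charDivReal, LinearMap.coe_mk, AddHom.coe_mk, Pi.sub_apply, neg_mul,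
    Finset.sum_neg_distrib]
  linarith

/-- The pairing of `w` with the divisors linearly equivalent to multiples of a fixed divisor, in
terms of a maximal cone that contains `-∑ w_ρ gen ρ`. -/
theorem exists_pairing_eq [Fintype ι] (X : SmoothCompleteFan rk ι) (w : ι → ℝ) :
    ∃ σ ∈ X.maxCones, ∃ c : ι → ℝ, (∀ ρ ∈ σ, 0 ≤ c ρ) ∧
      (∀ k, ∑ ρ, w ρ * X.gen ρ k = -∑ ρ ∈ σ, c ρ * X.gen ρ k) ∧
      ∀ (L : ι → ℚ) (t : ℝ) (E : ι → ℝ),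
        E - t • (fun ρ => (L ρ : ℝ)) ∈ LinearMap.range X.charDivReal →
        ∑ ρ, E ρ * w ρ = t * ∑ ρ, (X.localCoeff L σ ρ : ℝ) * w ρ - ∑ ρ ∈ σ, c ρ * E ρ := by
  obtain ⟨σ, hσ, hc⟩ := X.exists_nonneg_coord fun k => -∑ ρ, w ρ * X.gen ρ k
  set c := fun ρ => X.coord ℝ σ ρ fun k => -∑ ρ, w ρ * X.gen ρ k with hcdef
  have hsum : ∀ k, ∑ ρ, w ρ * X.gen ρ k = -∑ ρ ∈ σ, c ρ * X.gen ρ k := fun k => by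
    have := sum_coord_gen hσ (fun k => -∑ ρ, w ρ * (X.gen ρ k : ℝ)) k
    rw [hcdef, this, neg_neg]
  refine ⟨σ, hσ, c, hc, hsum, fun L t E hE => ?_⟩
  obtain ⟨m, hm⟩ := hE
  let m' : Fin rk → ℝ := fun k => m k + t * X.localChar L σ k
  have hE' : ∀ ρ, E ρ - t * X.localCoeff L σ ρ = ∑ k, m' k * X.gen ρ k := fun ρ => by
    have h1 := congrFun hm ρ
    have h2 := coe_sub_localCoeff (X := X) L σ ρ
    simp only [charDivReal, LinearMap.coe_mk, AddHom.coe_mk, Pi.sub_apply, Pi.smul_apply,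
      smul_eq_mul] at h1
    simp only [m', add_mul, Finset.sum_add_distrib, h1, mul_assoc, ← Finset.mul_sum, ← h2]
    ring
  have hEσ : ∀ ρ ∈ σ, E ρ = ∑ k, m' k * X.gen ρ k := fun ρ hρ => by
    rw [← hE' ρ, localCoeff_eq_zero L hσ hρ]; simp
  -- `E - t L(σ)` is the divisor of the real character `m'`, so pairing it with `w` evaluates `m'`
  -- at `∑ w_ρ gen ρ`, which is minus a combination of generators of `σ`. On those generators `m'`
  -- equals `E`, because `L(σ)` vanishes there.
  have h1 : ∑ ρ, (E ρ - t * X.localCoeff L σ ρ) * w ρ = -∑ ρ ∈ σ, c ρ * E ρ := by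
    calc _ = ∑ k, m' k * ∑ ρ, w ρ * X.gen ρ k := by
          simp_rw [hE', Finset.sum_mul, Finset.mul_sum]
          rw [Finset.sum_comm]
          exact Finset.sum_congr rfl fun k _ => Finset.sum_congr rfl fun ρ _ => by ring
      _ = -∑ ρ ∈ σ, c ρ * ∑ k, m' k * X.gen ρ k := by
          simp_rw [hsum, Finset.mul_sum, mul_neg, Finset.mul_sum, Finset.sum_neg_distrib]
          rw [Finset.sum_comm]
          congr 1
          exact Finset.sum_congr rfl fun k _ => Finset.sum_congr rfl fun ρ _ => by ring
      _ = _ := by rw [Finset.sum_congr rfl fun ρ hρ => by rw [← hEσ ρ hρ]]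
  simp only [sub_mul, Finset.sum_sub_distrib, mul_assoc, ← Finset.mul_sum] at h1
  linarith

end LocalCoeff

section Grouped

variable {rk s : ℕ} {n : Fin s → ℕ} {X : SmoothCompleteFan rk (Σ i : Fin s, Fin (n i))}

theorem single_sub_single_mem_range {ι : Type} [DecidableEq ι] {X : SmoothCompleteFan rk ι}
    {ρ ρ' : ι} (h : X.primeClass ρ = X.primeClass ρ') :
    (Pi.single ρ 1 - Pi.single ρ' 1 : ι → ℝ) ∈ LinearMap.range X.charDivReal := by
  obtain ⟨w, hw⟩ := exists_char_of_primeClass_eq h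
  refine ⟨fun k => (w k : ℝ), ?_⟩
  ext τ
  have := congrArg (Int.cast : ℤ → ℝ) (hw τ)
  push_cast at this
  simpa [charDivReal, Pi.single_apply] using this

/-- Such a divisor is a combination of differences of linearly equivalent prime divisors. -/
theorem mem_range_of_group_sum_eq_zero (hX : X.GroupedByClass)
    {D : (Σ i : Fin s, Fin (n i)) → ℝ} (h : ∀ i, ∑ j, D ⟨i, j⟩ = 0) :
    D ∈ LinearMap.range X.charDivReal := by
  let rep : Fin s → Σ i : Fin s, Fin (n i) := fun i => ⟨i, ⟨0, hX.1 i⟩⟩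
  have hD : D = ∑ ρ, D ρ • (Pi.single ρ 1 - Pi.single (rep ρ.1) 1) := by
    have h0 : ∑ ρ, D ρ • (Pi.single (rep ρ.1) 1 : (Σ i : Fin s, Fin (n i)) → ℝ) = 0 := by
      rw [Fintype.sum_sigma]
      refine Finset.sum_eq_zero fun i _ => ?_
      simp only
      rw [← Finset.sum_smul, h i, zero_smul]
    simp_rw [smul_sub, Finset.sum_sub_distrib]
    rw [h0, sub_zero]
    ext τ
    simp [Finset.sum_apply, Pi.single_apply]
  rw [hD]
  exact Submodule.sum_mem _ fun ρ _ => Submodule.smul_mem _ _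
    (single_sub_single_mem_range ((hX.2 _ _).2 rfl))

theorem groupCoeff_nonneg {L : (Σ i : Fin s, Fin (n i)) → ℚ} (hL : X.IsSemiample L)
    {σ : Finset (Σ i : Fin s, Fin (n i))} (hσ : σ ∈ X.maxCones) (i : Fin s) :
    0 ≤ X.groupCoeff L σ i :=
  Finset.sum_nonneg fun _ _ => localCoeff_nonneg hL hσ _

theorem coe_groupCoeff (L : (Σ i : Fin s, Fin (n i)) → ℚ) (σ : Finset (Σ i : Fin s, Fin (n i)))
    (i : Fin s) : (X.groupCoeff L σ i : ℝ) = ∑ j, (X.localCoeff L σ ⟨i, j⟩ : ℝ) := by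
  simp [groupCoeff]

theorem sum_groupCoeff_mul (L : (Σ i : Fin s, Fin (n i)) → ℚ)
    (σ : Finset (Σ i : Fin s, Fin (n i))) (v : Fin s → ℝ) :
    ∑ i, (X.groupCoeff L σ i : ℝ) * v i = ∑ ρ, (X.localCoeff L σ ρ : ℝ) * v ρ.1 := by
  rw [Fintype.sum_sigma]
  exact Finset.sum_congr rfl fun i _ => by rw [coe_groupCoeff, Finset.sum_mul]

/-- The height conditions in terms of all coordinates and in terms of the maxima over the
coordinates of the same class. -/
theorem forall_localCoeff_le_iff (hX : X.GroupedByClass) {L : (Σ i : Fin s, Fin (n i)) → ℚ}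
    (hL : X.IsSemiample L) {w : (Σ i : Fin s, Fin (n i)) → ℝ} {v : Fin s → ℝ}
    (hwv : ∀ ρ, w ρ ≤ v ρ.1) (hv : ∀ i, ∃ j, w ⟨i, j⟩ = v i) (lam : ℝ) :
    (∀ σ ∈ X.maxCones, ∑ ρ, (X.localCoeff L σ ρ : ℝ) * w ρ ≤ lam) ↔
      ∀ σ ∈ X.maxCones, ∑ i, (X.groupCoeff L σ i : ℝ) * v i ≤ lam := by
  constructor
  · intro h σ hσ
    choose j hj using hv
    -- `E` concentrates the total exponent of each class on a coordinate where the maximum is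
    -- attained. It remains effective and linearly equivalent to `L`, so the pairing identity bounds
    -- its value at `w` by that of `L(τ)`. The cone `τ` depends on `w` and in general differs from
    -- `σ`, so only the whole families of inequalities are equivalent.
    let E : (Σ i : Fin s, Fin (n i)) → ℝ := fun ρ =>
      if ρ.2 = j ρ.1 then (X.groupCoeff L σ ρ.1 : ℝ) else 0
    obtain ⟨τ, hτ, c, hc, -, hpair⟩ := X.exists_pairing_eq w
    have hEsum : ∀ i, ∑ j, E ⟨i, j⟩ = X.groupCoeff L σ i := fun i => by simp [E]
    have hE : E - (1 : ℝ) • (fun ρ => (L ρ : ℝ)) ∈ LinearMap.range X.charDivReal := by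
      have h1 : E - (fun ρ => (X.localCoeff L σ ρ : ℝ)) ∈ LinearMap.range X.charDivReal :=
        mem_range_of_group_sum_eq_zero hX fun i => by
          simp only [Pi.sub_apply, Finset.sum_sub_distrib, hEsum, coe_groupCoeff, sub_self]
      have := Submodule.add_mem _ h1 (localCoeff_sub_mem_range (X := X) L σ)
      simpa using this
    have hE0 : ∀ ρ, 0 ≤ E ρ := fun ρ => by
      have : (0 : ℝ) ≤ X.groupCoeff L σ ρ.1 := by exact_mod_cast groupCoeff_nonneg hL hσ ρ.1
      simp only [E]; split_ifs
      exacts [this, le_rfl]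
    have h2 := hpair L 1 E hE
    have h3 : ∑ ρ, E ρ * w ρ = ∑ i, (X.groupCoeff L σ i : ℝ) * v i := by
      rw [Fintype.sum_sigma]
      refine Finset.sum_congr rfl fun i _ => ?_
      simp [E, ite_mul, hj]
    have h4 : 0 ≤ ∑ ρ ∈ τ, c ρ * E ρ :=
      Finset.sum_nonneg fun ρ hρ => mul_nonneg (hc ρ hρ) (hE0 ρ)
    rw [← h3, h2]
    linarith [h τ hτ]
  · intro h σ hσ
    refine le_trans ?_ (h σ hσ)
    rw [sum_groupCoeff_mul]
    refine Finset.sum_le_sum fun ρ _ => mul_le_mul_of_nonneg_left (hwv ρ) ?_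
    exact_mod_cast localCoeff_nonneg hL hσ ρ

end Grouped

end SmoothCompleteFan

/-! ### Valuations and the product formula over ℚ -/

theorem padicValRat_prod_zpow {α : Type*} (p : ℕ) [Fact p.Prime] (s : Finset α) (x : α → ℚˣ)
    (a : α → ℤ) :
    padicValRat p ((∏ i ∈ s, x i ^ a i : ℚˣ) : ℚ) = ∑ i ∈ s, a i * padicValRat p (x i : ℚ) := by
  classical
  induction s using Finset.induction_on with
  | empty => simp
  | insert i s hi ih =>
    rw [Finset.prod_insert hi, Finset.sum_insert hi, Units.val_mul,
      padicValRat.mul (Units.ne_zero _) (Units.ne_zero _), ih, Units.val_zpow_eq_zpow_val,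
      padicValRat.zpow]

theorem Rat.units_eq_or_eq_neg {q q' : ℚˣ}
    (h : ∀ p : ℕ, p.Prime → padicValRat p (q : ℚ) = padicValRat p (q' : ℚ)) :
    q = q' ∨ q = -q' := by
  set z : ℚ := q / q' with hz
  have hz0 : z ≠ 0 := div_ne_zero (Units.ne_zero _) (Units.ne_zero _)
  have hv : ∀ p : ℕ, p.Prime → padicValRat p z = 0 := fun p hp => by
    have := Fact.mk hp
    rw [hz, padicValRat.div (Units.ne_zero _) (Units.ne_zero _), h p hp, sub_self]
  have hnum0 : z.num ≠ 0 := Rat.num_ne_zero.2 hz0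
  have hiff : ∀ p : ℕ, p.Prime → ¬ p ∣ z.num.natAbs ∧ ¬ p ∣ z.den := fun p hp => by
    have := Fact.mk hp
    have h1 := hv p hp
    rw [padicValRat_def, padicValInt] at h1
    have h2 : ¬ (p ∣ z.num.natAbs ∧ p ∣ z.den) := fun ⟨ha, hb⟩ =>
      Nat.Prime.not_dvd_one hp (z.reduced ▸ Nat.dvd_gcd ha hb)
    have h3 : padicValNat p z.num.natAbs = padicValNat p z.den := by omega
    have h4 := dvd_iff_padicValNat_ne_zero (p := p) (Int.natAbs_ne_zero.2 hnum0)
    have h5 := dvd_iff_padicValNat_ne_zero (p := p) z.den_nz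
    rw [h3] at h4
    tauto
  have h1 : z.num.natAbs = 1 := by
    by_contra hne
    obtain ⟨p, hp, hd⟩ := Nat.exists_prime_and_dvd hne
    exact (hiff p hp).1 hd
  have h2 : z.den = 1 := by
    by_contra hne
    obtain ⟨p, hp, hd⟩ := Nat.exists_prime_and_dvd hne
    exact (hiff p hp).2 hd
  have h3 : z = z.num := by
    conv_lhs => rw [← Rat.num_div_den z]
    rw [h2]; simp
  have hq : (q : ℚ) = z * q' := by rw [hz, div_mul_cancel₀ _ (Units.ne_zero _)]
  rcases Int.natAbs_eq z.num with h4 | h4 <;> rw [h1] at h4 <;> rw [h4] at h3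
  · left; ext; rw [hq, h3]; simp
  · right; ext; rw [hq, h3]; simp

theorem finite_mulSupport_padicNorm (z : ℚˣ) (a : ℝ) :
    (Function.mulSupport fun p : Nat.Primes => ((padicNorm p z : ℚ) : ℝ) ^ a).Finite := by
  have : Function.mulSupport (fun p : Nat.Primes => ((padicNorm p z : ℚ) : ℝ) ^ a) ⊆
      (fun p : Nat.Primes => (p : ℕ)) ⁻¹'
        ((((z : ℚ).num.natAbs * (z : ℚ).den).primeFactors : Finset ℕ) : Set ℕ) := by
    intro p hp
    by_contra hn
    apply hp
    have hp' : Fact (p : ℕ).Prime := ⟨p.2⟩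
    have hn0 : (z : ℚ).num.natAbs ≠ 0 := Int.natAbs_ne_zero.2 (Rat.num_ne_zero.2 z.ne_zero)
    have h1 : ¬ (p : ℕ) ∣ (z : ℚ).num.natAbs ∧ ¬ (p : ℕ) ∣ (z : ℚ).den := by
      simp only [Set.mem_preimage, Finset.mem_coe, Nat.mem_primeFactors, not_and, not_not] at hn
      have := hn p.2
      constructor <;> intro h
      · exact absurd (this (dvd_mul_of_dvd_left h _)) (mul_ne_zero hn0 (z : ℚ).den_nz)
      · exact absurd (this (dvd_mul_of_dvd_right h _)) (mul_ne_zero hn0 (z : ℚ).den_nz)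
    change ((padicNorm p z : ℚ) : ℝ) ^ a = 1
    rw [padicNorm.eq_zpow_of_nonzero z.ne_zero, padicValRat_def, padicValInt,
      padicValNat.eq_zero_of_not_dvd h1.1, padicValNat.eq_zero_of_not_dvd h1.2]
    simp
  exact ((Finset.finite_toSet _).preimage (Nat.Primes.coe_nat_injective.injOn)).subset this

theorem finprod_padicNorm_nat (n : ℕ) (hn : n ≠ 0) (a : ℝ) :
    ∏ᶠ p : Nat.Primes, ((padicNorm p (n : ℚ) : ℚ) : ℝ) ^ a = (n : ℝ) ^ (-a) := by
  have h1 : ∏ᶠ p : Nat.Primes, ((padicNorm p (n : ℚ) : ℚ) : ℝ) ^ a =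
      ∏ᶠ (p : ℕ) (_ : p.Prime), ((padicNorm p (n : ℚ) : ℚ) : ℝ) ^ a :=
    finprod_subtype_eq_finprod_cond (f := fun p : ℕ => ((padicNorm p (n : ℚ) : ℚ) : ℝ) ^ a)
      (Nat.Prime)
  have hval : ∀ p : ℕ, p.Prime → ((padicNorm p (n : ℚ) : ℚ) : ℝ) =
      ((p : ℝ) ^ n.factorization p)⁻¹ := fun p hp => by
    rw [padicNorm.eq_zpow_of_nonzero (by exact_mod_cast hn), padicValRat.of_nat,
      Nat.factorization_def _ hp]
    simp
  rw [h1, finprod_cond_eq_prod_of_cond_iff (t := n.primeFactors)]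
  · rw [Finset.prod_congr rfl fun p hp => by rw [hval p (Nat.prime_of_mem_primeFactors hp)],
      Real.finsetProd_rpow _ _ fun p _ => by positivity, Finset.prod_inv_distrib,
      Real.inv_rpow (by positivity), ← Real.rpow_neg (by positivity)]
    congr 1
    have := Nat.prod_factorization_pow_eq_self hn
    conv_rhs => rw [← this]
    rw [Finsupp.prod]
    push_cast
    rfl
  · intro p hp
    rw [Nat.mem_primeFactors]
    refine ⟨fun h => ⟨h, ?_, hn⟩, fun h => h.1⟩
    by_contra hnd
    apply hp
    rw [hval p h, Nat.factorization_eq_zero_of_not_dvd hnd]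
    simp

/-- The product formula with a real exponent, from unique factorization of numerator and
denominator. It makes the height independent of the choice of Cox coordinates. -/
theorem finprod_padicNorm_rpow (z : ℚˣ) (a : ℝ) :
    ∏ᶠ p : Nat.Primes, ((padicNorm p z : ℚ) : ℝ) ^ a = |((z : ℚ) : ℝ)| ^ (-a) := by
  have hn0 : (z : ℚ).num.natAbs ≠ 0 := Int.natAbs_ne_zero.2 (Rat.num_ne_zero.2 z.ne_zero)
  have hd0 := (z : ℚ).den_nz
  have e : ∀ p : Nat.Primes, ((padicNorm p z : ℚ) : ℝ) ^ a =
      ((padicNorm p ((z : ℚ).num.natAbs : ℚ) : ℚ) : ℝ) ^ a /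
        ((padicNorm p ((z : ℚ).den : ℚ) : ℚ) : ℝ) ^ a := fun p => by
    have : Fact (p : ℕ).Prime := ⟨p.2⟩
    rw [← Real.div_rpow (by exact_mod_cast padicNorm.nonneg _)
      (by exact_mod_cast padicNorm.nonneg _)]
    congr 1
    rw [← Rat.cast_div, ← padicNorm.div]
    have : padicNorm p (z : ℚ) = padicNorm p |(z : ℚ)| := by
      rcases abs_choice (z : ℚ) with h | h <;> rw [h]
      exact (padicNorm.neg _).symm
    rw [this]
    congr 2
    rw [Nat.cast_natAbs, Int.cast_abs]
    conv_lhs => rw [← Rat.num_div_den (z : ℚ)]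
    rw [abs_div]
    simp
  have f1 := finite_mulSupport_padicNorm
    (Units.mk0 ((z : ℚ).num.natAbs : ℚ) (by exact_mod_cast hn0)) a
  have f2 := finite_mulSupport_padicNorm (Units.mk0 ((z : ℚ).den : ℚ) (by exact_mod_cast hd0)) a
  simp only [Units.val_mk0] at f1 f2
  rw [finprod_congr e, finprod_div_distrib f1 f2, finprod_padicNorm_nat _ hn0,
    finprod_padicNorm_nat _ hd0, ← Real.div_rpow (by positivity) (by positivity)]
  congr 1
  have : ((z : ℚ) : ℝ) = (z : ℚ).num / (z : ℚ).den := by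
    conv_lhs => rw [← Rat.num_div_den (z : ℚ)]
    push_cast; rfl
  rw [this, abs_div, Nat.cast_natAbs]
  simp

theorem zpow_finsetSum {G α : Type*} [CommGroup G] (a : G) (s : Finset α) (f : α → ℤ) :
    a ^ ∑ i ∈ s, f i = ∏ i ∈ s, a ^ f i := by
  classical
  induction s using Finset.induction_on with
  | empty => simp
  | insert i s hi ih => rw [Finset.sum_insert hi, Finset.prod_insert hi, zpow_add, ih]

/-! ### The torsor map and integral Cox coordinates -/

namespace SmoothCompleteFan

section Units

variable {ι : Type*}

/-- A tuple of nonzero integers as a tuple of rational units. -/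
noncomputable def toUnits (x : ι → ℤ) : ι → ℚˣ := fun ρ =>
  if h : x ρ ≠ 0 then Units.mk0 (x ρ : ℚ) (by exact_mod_cast h) else 1

theorem coe_toUnits {x : ι → ℤ} (hx : ∀ ρ, x ρ ≠ 0) (ρ : ι) : (toUnits x ρ : ℚ) = x ρ := by
  simp [toUnits, hx ρ]

theorem padicValRat_toUnits {x : ι → ℤ} (hx : ∀ ρ, x ρ ≠ 0) (p : ℕ) (ρ : ι) :
    padicValRat p (toUnits x ρ : ℚ) = padicValNat p (x ρ).natAbs := by
  rw [coe_toUnits hx, padicValRat.of_int, padicValInt]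

theorem padicValNat_natAbs_eq_zero {p : ℕ} {z : ℤ} (h : ¬ (p : ℤ) ∣ z) :
    padicValNat p z.natAbs = 0 :=
  padicValNat.eq_zero_of_not_dvd fun hd => h (Int.natCast_dvd.2 hd)

/-- Multiplication of an integral tuple by signs. -/
def signMul (ε : ι → ℤˣ) (x : ι → ℤ) : ι → ℤ := fun ρ => (ε ρ : ℤ) * x ρ

end Units

variable {rk : ℕ} {ι : Type} [DecidableEq ι] {X : SmoothCompleteFan rk ι}

theorem exists_maxCone (X : SmoothCompleteFan rk ι) : ∃ σ, σ ∈ X.maxCones := by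
  obtain ⟨σ, hσ, -⟩ := X.complete 0
  exact ⟨σ, hσ⟩

theorem charDiv_injective (X : SmoothCompleteFan rk ι) : Function.Injective X.charDiv := by
  intro w w' h
  obtain ⟨σ, hσ⟩ := X.exists_maxCone
  refine eq_of_pairing_eq hσ fun ρ _ => ?_
  have := congrFun h ρ
  simpa [charDiv] using this

theorem charDivReal_injective (X : SmoothCompleteFan rk ι) :
    Function.Injective X.charDivReal := by
  intro w w' h
  obtain ⟨σ, hσ⟩ := X.exists_maxCone
  refine eq_of_pairing_eq hσ fun ρ _ => ?_
  have := congrFun h ρ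
  simpa [charDivReal] using this

section TorsorHom

variable [Fintype ι] {G : Type*} [CommGroup G]

variable (X G) in
/-- The torsor map with values in an arbitrary commutative group. -/
def torsorHom : (ι → G) →* (Fin rk → G) where
  toFun x k := ∏ ρ, x ρ ^ X.gen ρ k
  map_one' := by ext; simp
  map_mul' x y := by ext k; simp [mul_zpow, Finset.prod_mul_distrib]

theorem torsorHom_apply (x : ι → G) (k : Fin rk) :
    X.torsorHom G x k = ∏ ρ, x ρ ^ X.gen ρ k := rfl

theorem torsorMap_eq (x : ι → ℚˣ) : X.torsorMap x = X.torsorHom ℚˣ x := rfl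

/-- The dual basis of one maximal cone gives a section supported on the rays of that cone. -/
theorem torsorHom_surjective : Function.Surjective (X.torsorHom G) := by
  intro t
  obtain ⟨σ, hσ⟩ := X.exists_maxCone
  refine ⟨fun ρ => if ρ ∈ σ then ∏ k, t k ^ X.dualBasis σ ρ k else 1, ?_⟩
  ext l
  rw [torsorHom_apply]
  have h1 : ∀ ρ, (if ρ ∈ σ then ∏ k, t k ^ X.dualBasis σ ρ k else 1) ^ X.gen ρ l =
      if ρ ∈ σ then ∏ k, t k ^ (X.dualBasis σ ρ k * X.gen ρ l) else 1 := fun ρ => by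
    split_ifs
    · rw [← Finset.prod_zpow]
      exact Finset.prod_congr rfl fun k _ => by rw [zpow_mul]
    · simp
  simp_rw [h1]
  rw [Finset.prod_ite_mem, Finset.univ_inter, Finset.prod_comm]
  have h2 : ∀ k, ∏ ρ ∈ σ, t k ^ (X.dualBasis σ ρ k * X.gen ρ l) = if k = l then t k else 1 :=
    fun k => by
      rw [← zpow_finsetSum, sum_dualBasis_mul_gen hσ]
      split_ifs <;> simp
  simp [h2]

/-- Surjectivity on sign vectors determines the order of the kernel. This is the source of the
factor $2^{-r}$ in the leading constant. -/
theorem card_ker_torsorHom (X : SmoothCompleteFan rk ι) :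
    Nat.card (X.torsorHom ℤˣ).ker * 2 ^ rk = 2 ^ Fintype.card ι := by
  have h1 := Subgroup.card_mul_index (X.torsorHom ℤˣ).ker
  rw [Subgroup.index_ker, MonoidHom.range_eq_top.2 torsorHom_surjective] at h1
  simpa [Nat.card_eq_fintype_card] using h1

theorem finrank_pic_add (X : SmoothCompleteFan rk ι) :
    Module.finrank ℤ X.Pic + rk = Fintype.card ι := by
  have h := Submodule.finrank_quotient_add_finrank (LinearMap.range X.charDiv)
  rw [LinearMap.finrank_range_of_inj X.charDiv_injective] at h
  simpa using h

theorem finrank_picReal_add (X : SmoothCompleteFan rk ι) :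
    Module.finrank ℝ X.PicReal + rk = Fintype.card ι := by
  have h := Submodule.finrank_quotient_add_finrank (LinearMap.range X.charDivReal)
  rw [LinearMap.finrank_range_of_inj X.charDivReal_injective] at h
  simpa using h

theorem finrank_picReal (X : SmoothCompleteFan rk ι) :
    Module.finrank ℝ X.PicReal = Module.finrank ℤ X.Pic := by
  have h1 := X.finrank_pic_add
  have h2 := X.finrank_picReal_add
  omega

theorem card_ker_torsorHom_eq (X : SmoothCompleteFan rk ι) :
    Nat.card (X.torsorHom ℤˣ).ker = 2 ^ Module.finrank ℤ X.Pic := by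
  have h := X.card_ker_torsorHom
  rw [← X.finrank_pic_add, pow_add] at h
  exact Nat.eq_of_mul_eq_mul_right (by positivity) h

end TorsorHom

/-! ### Integral Cox coordinates -/

variable (X) in
/-- Tuples of nonzero integers that are Cox coordinates of an integral point. -/
def IsCoprimeTuple (x : ι → ℤ) : Prop :=
  (∀ ρ, x ρ ≠ 0) ∧ ∀ p : ℕ, p.Prime → ∃ σ ∈ X.maxCones, ∀ ρ ∉ σ, ¬ (p : ℤ) ∣ x ρ

theorem IsCoprimeTuple.signMul {x : ι → ℤ} (hx : X.IsCoprimeTuple x) (ε : ι → ℤˣ) :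
    X.IsCoprimeTuple (signMul ε x) := by
  refine ⟨fun ρ => mul_ne_zero (Units.ne_zero _) (hx.1 ρ), fun p hp => ?_⟩
  obtain ⟨σ, hσ, h⟩ := hx.2 p hp
  exact ⟨σ, hσ, fun ρ hρ hd => h ρ hρ ((Units.dvd_mul_left).1 hd)⟩

section Valuations

variable [Fintype ι]

theorem padicValRat_torsorMap (p : ℕ) [Fact p.Prime] (x : ι → ℚˣ) (k : Fin rk) :
    padicValRat p (X.torsorMap x k : ℚ) = ∑ ρ, padicValRat p (x ρ : ℚ) * X.gen ρ k := by
  rw [torsorMap, padicValRat_prod_zpow]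
  exact Finset.sum_congr rfl fun ρ _ => mul_comm _ _

theorem padicValRat_charValue (p : ℕ) [Fact p.Prime] (x : ι → ℚˣ) (w : Fin rk → ℤ) :
    padicValRat p (charValue w (X.torsorMap x) : ℚ) =
      ∑ ρ, padicValRat p (x ρ : ℚ) * ∑ k, w k * X.gen ρ k := by
  rw [charValue, padicValRat_prod_zpow]
  simp_rw [padicValRat_torsorMap, Finset.mul_sum]
  rw [Finset.sum_comm]
  exact Finset.sum_congr rfl fun ρ _ => Finset.sum_congr rfl fun k _ => by ring

/-- At each prime, the valuations of the coordinates are coefficients supported on a cone, and their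
combination of generators is prescribed by the image point. Such coefficients are unique. -/
theorem natAbs_eq_of_torsorMap_eq {x y : ι → ℤ} (hx : X.IsCoprimeTuple x)
    (hy : X.IsCoprimeTuple y)
    (h : ∀ p : ℕ, p.Prime → ∀ k, padicValRat p (X.torsorMap (toUnits x) k : ℚ) =
      padicValRat p (X.torsorMap (toUnits y) k : ℚ)) (ρ : ι) :
    (x ρ).natAbs = (y ρ).natAbs := by
  refine Nat.eq_of_factorization_eq (Int.natAbs_ne_zero.2 (hx.1 ρ))
    (Int.natAbs_ne_zero.2 (hy.1 ρ)) fun p => ?_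
  by_cases hp : p.Prime
  swap
  · simp [Nat.factorization_eq_zero_of_not_prime _ hp]
  have := Fact.mk hp
  rw [Nat.factorization_def _ hp, Nat.factorization_def _ hp]
  obtain ⟨σ, hσ, hxσ⟩ := hx.2 p hp
  obtain ⟨τ, hτ, hyτ⟩ := hy.2 p hp
  have key := nat_eq_of_sum_gen_eq hσ hτ (c := fun ρ => padicValNat p (x ρ).natAbs)
    (c' := fun ρ => padicValNat p (y ρ).natAbs)
    (fun ρ hρ => padicValNat_natAbs_eq_zero (hxσ ρ hρ))
    (fun ρ hρ => padicValNat_natAbs_eq_zero (hyτ ρ hρ)) (fun k => ?_)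
  · exact congrFun key ρ
  · have := h p hp k
    simp_rw [padicValRat_torsorMap, padicValRat_toUnits hx.1, padicValRat_toUnits hy.1] at this
    rw [Finset.sum_subset (Finset.subset_univ σ) fun ρ _ hρ => by
        simp [padicValNat_natAbs_eq_zero (hxσ ρ hρ)],
      Finset.sum_subset (Finset.subset_univ τ) fun ρ _ hρ => by
        simp [padicValNat_natAbs_eq_zero (hyτ ρ hρ)]]
    exact this

/-- At each prime the valuation vector of `t` is decomposed in the fan, and its coefficients become
the exponents of that prime in the coordinates. Only finitely many primes matter. The signs are
adjusted afterwards. -/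
theorem exists_coprimeTuple_padicVal (X : SmoothCompleteFan rk ι) (t : Fin rk → ℚˣ) :
    ∃ x : ι → ℤ, X.IsCoprimeTuple x ∧ ∀ p : ℕ, p.Prime → ∀ k,
      padicValRat p (X.torsorMap (toUnits x) k : ℚ) = padicValRat p (t k : ℚ) := by
  classical
  choose σ hσ c hcσ hc using fun p : ℕ =>
    X.exists_int_decomposition fun k => padicValRat p (t k : ℚ)
  let S : Finset ℕ := Finset.univ.biUnion fun k =>
    ((t k : ℚ).num.natAbs * (t k : ℚ).den).primeFactors
  have hS : ∀ p : ℕ, p.Prime → p ∉ S → c p = 0 := fun p hp hpS => by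
    have hz : ∀ k, padicValRat p (t k : ℚ) = 0 := fun k => by
      have hnum : (t k : ℚ).num.natAbs ≠ 0 :=
        Int.natAbs_ne_zero.2 (Rat.num_ne_zero.2 (t k).ne_zero)
      have : p ∉ ((t k : ℚ).num.natAbs * (t k : ℚ).den).primeFactors := fun h =>
        hpS (Finset.mem_biUnion.2 ⟨k, Finset.mem_univ _, h⟩)
      rw [Nat.mem_primeFactors] at this
      have h0 := mul_ne_zero hnum (t k : ℚ).den_nz
      have hnd : ¬ p ∣ (t k : ℚ).num.natAbs * (t k : ℚ).den := fun h => this ⟨hp, h, h0⟩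
      rw [padicValRat_def, padicValInt,
        padicValNat.eq_zero_of_not_dvd fun h => hnd (dvd_mul_of_dvd_left h _),
        padicValNat.eq_zero_of_not_dvd fun h => hnd (dvd_mul_of_dvd_right h _)]
      simp
    refine nat_eq_of_sum_gen_eq (hσ p) (hσ p) (hcσ p) (fun _ _ => rfl) fun k => ?_
    rw [← hc p k, hz k]
    simp
  have hSp : ∀ p ∈ S, p.Prime := fun p hp => by
    obtain ⟨k, -, hk⟩ := Finset.mem_biUnion.1 hp
    exact Nat.prime_of_mem_primeFactors hk
  let x : ι → ℤ := fun ρ => ((∏ p ∈ S, p ^ c p ρ : ℕ) : ℤ)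
  have hx0 : ∀ ρ, x ρ ≠ 0 := fun ρ => by
    simp only [x, ne_eq, Nat.cast_eq_zero, Finset.prod_eq_zero_iff, not_exists, not_and]
    exact fun p hp => pow_ne_zero _ (hSp p hp).ne_zero
  have hval : ∀ p : ℕ, p.Prime → ∀ ρ, padicValNat p (x ρ).natAbs = c p ρ := fun p hp ρ => by
    simp only [x, Int.natAbs_natCast]
    rw [← Nat.factorization_def _ hp, Nat.factorization_prod fun q hq =>
      pow_ne_zero _ (hSp q hq).ne_zero, Finset.sum_apply']
    rw [Finset.sum_congr rfl fun q hq => by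
      rw [(hSp q hq).factorization_pow, Finsupp.single_apply]]
    rw [Finset.sum_ite_eq']
    split_ifs with h
    · rfl
    · rw [hS p hp h]; rfl
  refine ⟨x, ⟨hx0, fun p hp => ⟨σ p, hσ p, fun ρ hρ hd => ?_⟩⟩, fun p hp k => ?_⟩
  · have := Fact.mk hp
    have h1 := dvd_iff_padicValNat_ne_zero (p := p) (Int.natAbs_ne_zero.2 (hx0 ρ))
    rw [hval p hp, hcσ p ρ hρ] at h1
    exact h1.1 (Int.natCast_dvd.1 hd) rfl
  · have := Fact.mk hp
    rw [padicValRat_torsorMap, hc p k]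
    simp_rw [padicValRat_toUnits hx0, hval p hp]
    exact (Finset.sum_subset (Finset.subset_univ _) fun ρ _ hρ => by simp [hcσ p ρ hρ]).symm

theorem torsorMap_signMul {x : ι → ℤ} (hx : ∀ ρ, x ρ ≠ 0) (ε : ι → ℤˣ) (k : Fin rk) :
    X.torsorMap (toUnits (signMul ε x)) k =
      Units.map (Int.castRingHom ℚ : ℤ →* ℚ) (X.torsorHom ℤˣ ε k) * X.torsorMap (toUnits x) k := by
  have : toUnits (signMul ε x) = fun ρ =>
      Units.map (Int.castRingHom ℚ : ℤ →* ℚ) (ε ρ) * toUnits x ρ := by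
    ext ρ
    rw [coe_toUnits (x := signMul ε x) (fun ρ => mul_ne_zero (Units.ne_zero _) (hx ρ)), Units.val_mul,
      coe_toUnits hx]
    simp [signMul]
  simp only [torsorMap, this, mul_zpow, Finset.prod_mul_distrib, torsorHom_apply, map_prod,
    map_zpow]

theorem exists_coprimeTuple (X : SmoothCompleteFan rk ι) (t : Fin rk → ℚˣ) :
    ∃ x : ι → ℤ, X.IsCoprimeTuple x ∧ X.torsorMap (toUnits x) = t := by
  obtain ⟨x, hx, hv⟩ := X.exists_coprimeTuple_padicVal t
  have h : ∀ k, ∃ ε : ℤˣ, t k =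
      Units.map (Int.castRingHom ℚ : ℤ →* ℚ) ε * X.torsorMap (toUnits x) k := fun k => by
    rcases Rat.units_eq_or_eq_neg fun p hp => (hv p hp k).symm with h | h
    · exact ⟨1, by simp [h]⟩
    · refine ⟨-1, ?_⟩
      rw [h]
      ext
      simp
  choose ε hε using h
  obtain ⟨η, hη⟩ := torsorHom_surjective (X := X) ε
  refine ⟨signMul η x, hx.signMul η, ?_⟩
  ext k
  rw [torsorMap_signMul hx.1, hη, hε k]

/-- Every rational point of the torus has exactly `2 ^ rank Pic(X)` integral Cox coordinates. -/
theorem ncard_coprimeTuple (X : SmoothCompleteFan rk ι) (t : Fin rk → ℚˣ) :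
    {x : ι → ℤ | X.IsCoprimeTuple x ∧ X.torsorMap (toUnits x) = t}.ncard =
      2 ^ Module.finrank ℤ X.Pic := by
  obtain ⟨x, hx, rfl⟩ := X.exists_coprimeTuple t
  rw [← card_ker_torsorHom_eq, ← Nat.card_coe_set_eq]
  -- The sign vectors in the kernel act simply transitively on the integral lifts of the point.
  refine (Nat.card_congr (Equiv.ofBijective (fun ε : (X.torsorHom ℤˣ).ker =>
    (⟨signMul ε.1 x, hx.signMul ε.1, ?_⟩ :
      {y : ι → ℤ | X.IsCoprimeTuple y ∧ X.torsorMap (toUnits y) =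
        X.torsorMap (toUnits x)})) ⟨?_, ?_⟩)).symm
  · ext k
    rw [torsorMap_signMul hx.1, MonoidHom.mem_ker.1 ε.2]
    simp
  · rintro ⟨ε, hε⟩ ⟨η, hη⟩ h
    simp only [Subtype.mk.injEq] at h ⊢
    ext ρ
    exact mul_right_cancel₀ (hx.1 ρ) (congrFun h ρ)
  · rintro ⟨y, hy, hyt⟩
    have habs := natAbs_eq_of_torsorMap_eq hy hx fun p _ k => by rw [hyt]
    have h : ∀ ρ, ∃ ε : ℤˣ, y ρ = (ε : ℤ) * x ρ := fun ρ => by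
      rcases Int.natAbs_eq_natAbs_iff.1 (habs ρ) with h | h
      · exact ⟨1, by simp [h]⟩
      · exact ⟨-1, by simp [h]⟩
    choose ε hε using h
    have hyε : y = signMul ε x := funext hε
    have hker : ε ∈ (X.torsorHom ℤˣ).ker := by
      rw [MonoidHom.mem_ker]
      ext k
      have h1 := torsorMap_signMul (X := X) hx.1 ε k
      rw [← hyε, hyt] at h1
      have h2 : Units.map (Int.castRingHom ℚ : ℤ →* ℚ) (X.torsorHom ℤˣ ε k) = 1 :=
        mul_eq_right.1 h1.symm
      have h3 := congrArg Units.val h2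
      simp only [Units.coe_map, MonoidHom.coe_coe, eq_intCast, Units.val_one] at h3
      simpa using h3
    exact ⟨⟨ε, hker⟩, Subtype.ext hyε.symm⟩

end Valuations

end SmoothCompleteFan

/-! ### Campana points in integral Cox coordinates -/

theorem isFull_iff_padicValNat {m : ℕ} {z : ℤ} (hz : z ≠ 0) :
    IsFull m z ↔ ∀ p : ℕ, p.Prime →
      padicValNat p z.natAbs = 0 ∨ m ≤ padicValNat p z.natAbs := by
  refine forall₂_congr fun p hp => ?_
  have := Fact.mk hp
  have hz' := Int.natAbs_ne_zero.2 hz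
  rw [Int.natCast_dvd, dvd_iff_padicValNat_ne_zero hz', ← Nat.cast_pow, Int.natCast_dvd,
    padicValNat_dvd_iff_le hz']
  tauto

namespace SmoothCompleteFan

variable {rk : ℕ} {ι : Type} [Fintype ι] [DecidableEq ι] {X : SmoothCompleteFan rk ι}

theorem sum_val_charValue {x : ι → ℤ} (hx : ∀ ρ, x ρ ≠ 0) (p : ℕ) [Fact p.Prime]
    (w : Fin rk → ℤ) :
    padicValRat p (charValue w (X.torsorMap (toUnits x)) : ℚ) =
      ∑ ρ, (padicValNat p (x ρ).natAbs : ℤ) * ∑ k, w k * X.gen ρ k := by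
  rw [padicValRat_charValue]
  simp_rw [padicValRat_toUnits hx]

/-- The characters of the dual basis of `σ` have nonnegative valuation, so the valuation vector lies
in the cone of `σ`. By uniqueness of decompositions the valuations of the coordinates are its
coefficients there. -/
theorem padicValNat_eq_zero_of_inChart {x : ι → ℤ} (hx : X.IsCoprimeTuple x) {p : ℕ}
    (hp : p.Prime) {σ : Finset ι} (hσ : σ ∈ X.maxCones)
    (h : X.InChart p σ (X.torsorMap (toUnits x))) {ρ : ι} (hρ : ρ ∉ σ) :
    padicValNat p (x ρ).natAbs = 0 := by
  have := Fact.mk hp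
  obtain ⟨τ, hτ, hxτ⟩ := hx.2 p hp
  set v : Fin rk → ℤ := fun k => ∑ ρ, (padicValNat p (x ρ).natAbs : ℤ) * X.gen ρ k with hv
  have hcoord : ∀ π ∈ σ, 0 ≤ X.coord ℤ σ π v := fun π hπ => by
    have h1 := h (X.dualBasis σ π) fun ρ' hρ' => by
      rw [dualBasis_pairing hσ hπ hρ']; split_ifs <;> simp
    rw [sum_val_charValue hx.1] at h1
    convert h1 using 1
    simp only [coord, hv, Finset.mul_sum, Int.cast_id]
    rw [Finset.sum_comm]
    exact Finset.sum_congr rfl fun ρ _ => Finset.sum_congr rfl fun k _ => by ring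
  have key := nat_eq_of_sum_gen_eq hσ hτ
    (c := fun π => if π ∈ σ then (X.coord ℤ σ π v).toNat else 0)
    (c' := fun π => padicValNat p (x π).natAbs) (fun π hπ => if_neg hπ)
    (fun π hπ => padicValNat_natAbs_eq_zero (hxτ π hπ)) (fun k => ?_)
  · rw [← congrFun key ρ, if_neg hρ]
  · rw [Finset.sum_subset (Finset.subset_univ τ) fun ρ _ hρ => by
        simp [padicValNat_natAbs_eq_zero (hxτ ρ hρ)]]
    change _ = v k
    rw [← sum_coord_gen hσ v k]
    refine Finset.sum_congr rfl fun π hπ => ?_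
    simp [hπ, hcoord π hπ]

theorem inChart_of_padicValNat {x : ι → ℤ} (hx : ∀ ρ, x ρ ≠ 0) {p : ℕ} (hp : p.Prime)
    {σ : Finset ι} (h : ∀ ρ ∉ σ, padicValNat p (x ρ).natAbs = 0) :
    X.InChart p σ (X.torsorMap (toUnits x)) := by
  have := Fact.mk hp
  intro w hw
  rw [sum_val_charValue hx]
  refine Finset.sum_nonneg fun ρ _ => ?_
  by_cases hρ : ρ ∈ σ
  · exact mul_nonneg (Nat.cast_nonneg _) (hw ρ hρ)
  · simp [h ρ hρ]

/-- The minimum is attained by the dual basis character of `ρ`. Any competing character pairs with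
`gen ρ` to an integer at least 1, and the other rays contribute nonnegatively. -/
theorem interMult_eq {x : ι → ℤ} (hx : ∀ ρ, x ρ ≠ 0) {p : ℕ} (hp : p.Prime)
    {σ : Finset ι} (hσ : σ ∈ X.maxCones) (h : ∀ ρ ∉ σ, padicValNat p (x ρ).natAbs = 0) {ρ : ι}
    (hρ : ρ ∈ σ) :
    X.interMult p σ ρ (X.torsorMap (toUnits x)) = padicValNat p (x ρ).natAbs := by
  have := Fact.mk hp
  have hsum : ∀ w : Fin rk → ℤ, padicValRat p (charValue w (X.torsorMap (toUnits x)) : ℚ) =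
      ∑ ρ ∈ σ, (padicValNat p (x ρ).natAbs : ℤ) * ∑ k, w k * X.gen ρ k := fun w => by
    rw [sum_val_charValue hx]
    exact (Finset.sum_subset (Finset.subset_univ σ) fun ρ _ hρ => by simp [h ρ hρ]).symm
  have hmem : padicValNat p (x ρ).natAbs ∈ {e : ℕ | ∃ m ∈ X.dualChars σ,
      0 < ∑ k, m k * X.gen ρ k ∧
      padicValRat p (charValue m (X.torsorMap (toUnits x)) : ℚ) = e} := by
    refine ⟨X.dualBasis σ ρ, fun ρ' hρ' => ?_, ?_, ?_⟩
    · rw [dualBasis_pairing hσ hρ hρ']; split_ifs <;> simp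
    · rw [dualBasis_pairing hσ hρ hρ]; simp
    · rw [hsum, Finset.sum_congr rfl fun π hπ => by rw [dualBasis_pairing hσ hρ hπ]]
      simp [hρ]
  refine le_antisymm (Nat.sInf_le hmem) (le_csInf ⟨_, hmem⟩ ?_)
  rintro e ⟨w, hw, hpos, he⟩
  rw [hsum] at he
  have h1 : (padicValNat p (x ρ).natAbs : ℤ) * ∑ k, w k * X.gen ρ k ≤
      ∑ ρ ∈ σ, (padicValNat p (x ρ).natAbs : ℤ) * ∑ k, w k * X.gen ρ k :=
    Finset.single_le_sum (f := fun ρ => (padicValNat p (x ρ).natAbs : ℤ) * ∑ k, w k * X.gen ρ k)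
      (fun π hπ => mul_nonneg (Nat.cast_nonneg _) (hw π hπ)) hρ
  rw [he] at h1
  have h2 : (padicValNat p (x ρ).natAbs : ℤ) ≤ e :=
    le_trans (le_mul_of_one_le_right (Nat.cast_nonneg _) hpos) h1
  exact_mod_cast h2

theorem isCampana_iff {x : ι → ℤ} (hx : X.IsCoprimeTuple x) {m : ι → ℕ} :
    X.IsCampana m (X.torsorMap (toUnits x)) ↔ ∀ ρ, IsFull (m ρ) (x ρ) := by
  constructor
  · intro h ρ
    rw [isFull_iff_padicValNat (hx.1 ρ)]
    intro p hp
    obtain ⟨σ, hσ, hxσ⟩ := hx.2 p hp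
    have hσ0 : ∀ ρ ∉ σ, padicValNat p (x ρ).natAbs = 0 := fun ρ hρ =>
      padicValNat_natAbs_eq_zero (hxσ ρ hρ)
    by_cases hρ : ρ ∈ σ
    · have := h p hp σ hσ (inChart_of_padicValNat hx.1 hp hσ0) ρ hρ
      rwa [interMult_eq hx.1 hp hσ hσ0 hρ] at this
    · exact Or.inl (hσ0 ρ hρ)
  · intro h p hp σ hσ hc ρ hρ
    rw [interMult_eq hx.1 hp hσ (fun π hπ => padicValNat_eq_zero_of_inChart hx hp hσ hc hπ) hρ]
    exact (isFull_iff_padicValNat (hx.1 ρ)).1 (h ρ) p hp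

/-! ### Heights -/

section Height

variable {L : ι → ℚ}

theorem localHeight_mul {av : ℚ → ℝ} (hav : ∀ z : ℚˣ, 0 < av z)
    (hmul : ∀ z w : ℚˣ, av (z * w : ℚˣ) = av z * av w) {z : ι → ℚˣ}
    (hz : ∀ σ ∈ X.maxCones, ∏ ρ, av (z ρ) ^ (X.localCoeff L σ ρ : ℝ) =
      ∏ ρ, av (z ρ) ^ (L ρ : ℝ)) (x : ι → ℚˣ) :
    X.localHeight L av (z * x) = (∏ ρ, av (z ρ) ^ (L ρ : ℝ)) * X.localHeight L av x := by
  rw [localHeight, localHeight, Real.mul_iSup_of_nonneg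
    (Finset.prod_nonneg fun ρ _ => (Real.rpow_pos_of_pos (hav _) _).le)]
  congr 1
  ext σ
  rw [← hz σ σ.2, ← Finset.prod_mul_distrib]
  refine Finset.prod_congr rfl fun ρ _ => ?_
  rw [Pi.mul_apply, hmul, Real.mul_rpow (hav _).le (hav _).le]

/-- The exponents `L(σ)` and `L` differ by the divisor of a rational character, and the absolute
value of the corresponding monomial is 1 on the kernel of the torsor map. -/
theorem prod_rpow_localCoeff_of_ker {av : ℚ → ℝ} (hav : ∀ z : ℚˣ, 0 < av z)
    (hmul : ∀ z w : ℚˣ, av (z * w : ℚˣ) = av z * av w) {z : ι → ℚˣ}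
    (hz : X.torsorMap z = 1) (σ : Finset ι) :
    ∏ ρ, av (z ρ) ^ (X.localCoeff L σ ρ : ℝ) = ∏ ρ, av (z ρ) ^ (L ρ : ℝ) := by
  let φ : ℚˣ →* ℝˣ :=
    { toFun := fun u => Units.mk0 (av u) (hav u).ne'
      map_one' := by
        ext
        have h := hmul 1 1
        rw [mul_one] at h
        exact mul_right_cancel₀ (hav 1).ne' (by simpa using h.symm)
      map_mul' := fun u w => by ext; simpa using hmul u w }
  have hk : ∀ k, ∏ ρ, av (z ρ) ^ (X.gen ρ k : ℝ) = 1 := fun k => by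
    have h1 := congrArg (fun u => ((φ u : ℝˣ) : ℝ)) (congrFun hz k)
    simp only [torsorMap, map_prod, map_zpow, Units.coe_prod, Units.val_zpow_eq_zpow_val,
      Pi.one_apply, map_one, Units.val_one] at h1
    rw [← h1]
    exact Finset.prod_congr rfl fun ρ _ => by rw [Real.rpow_intCast]; rfl
  have hdiff : ∏ ρ, av (z ρ) ^ ((L ρ : ℝ) - X.localCoeff L σ ρ) = 1 := by
    simp_rw [coe_sub_localCoeff]
    have : ∀ ρ, av (z ρ) ^ (∑ k, (X.localChar L σ k : ℝ) * X.gen ρ k) =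
        ∏ k, (av (z ρ) ^ (X.gen ρ k : ℝ)) ^ (X.localChar L σ k : ℝ) := fun ρ => by
      rw [Real.rpow_sum_of_pos (hav _)]
      exact Finset.prod_congr rfl fun k _ => by rw [← Real.rpow_mul (hav _).le, mul_comm]
    simp_rw [this]
    rw [Finset.prod_comm]
    refine Finset.prod_eq_one fun k _ => ?_
    rw [Real.finsetProd_rpow _ _ fun ρ _ => (Real.rpow_pos_of_pos (hav _) _).le, hk k,
      Real.one_rpow]
  calc _ = (∏ ρ, av (z ρ) ^ (X.localCoeff L σ ρ : ℝ)) *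
        ∏ ρ, av (z ρ) ^ ((L ρ : ℝ) - X.localCoeff L σ ρ) := by rw [hdiff, mul_one]
    _ = _ := by
      rw [← Finset.prod_mul_distrib]
      refine Finset.prod_congr rfl fun ρ _ => ?_
      rw [← Real.rpow_add (hav _)]
      congr 1
      ring

theorem real_abs_pos (z : ℚˣ) : 0 < |((z : ℚ) : ℝ)| :=
  abs_pos.2 (by exact_mod_cast z.ne_zero)

theorem real_abs_mul (z w : ℚˣ) :
    |(((z * w : ℚˣ) : ℚ) : ℝ)| = |((z : ℚ) : ℝ)| * |((w : ℚ) : ℝ)| := by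
  rw [← abs_mul]; push_cast; rfl

theorem real_padicNorm_pos (p : ℕ) [Fact p.Prime] (z : ℚˣ) :
    0 < ((padicNorm p (z : ℚ) : ℚ) : ℝ) := by
  have h := padicNorm.nonneg (p := p) (z : ℚ)
  have h' := padicNorm.nonzero (p := p) z.ne_zero
  exact_mod_cast lt_of_le_of_ne h h'.symm

theorem real_padicNorm_mul (p : ℕ) [Fact p.Prime] (z w : ℚˣ) :
    ((padicNorm p ((z * w : ℚˣ) : ℚ) : ℚ) : ℝ) =
      ((padicNorm p (z : ℚ) : ℚ) : ℝ) * ((padicNorm p (w : ℚ) : ℚ) : ℝ) := by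
  rw [Units.val_mul, padicNorm.mul]; push_cast; rfl

/-- All factors are at most 1, since exponents are nonnegative and coordinates integral. The value 1
is reached at a cone `σ` outside of which all coordinates are `p`-adic units, because the exponents
vanish on `σ` itself. -/
theorem localHeight_coprimeTuple (hL : X.IsSemiample L) {x : ι → ℤ} (hx : X.IsCoprimeTuple x)
    {p : ℕ} (hp : p.Prime) :
    X.localHeight L (fun z => (padicNorm p z : ℝ)) (toUnits x) = 1 := by
  have := Fact.mk hp
  have hle : ∀ ρ, ((padicNorm p (toUnits x ρ : ℚ) : ℚ) : ℝ) ≤ 1 := fun ρ => by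
    rw [coe_toUnits hx.1]
    exact_mod_cast padicNorm.of_int (p := p) (x ρ)
  obtain ⟨σ, hσ, hxσ⟩ := hx.2 p hp
  have hbound : ∀ τ : X.maxCones, ∏ ρ, ((padicNorm p (toUnits x ρ : ℚ) : ℚ) : ℝ) ^
      (X.localCoeff L τ ρ : ℝ) ≤ 1 := fun τ =>
    Finset.prod_le_one (fun ρ _ => (Real.rpow_pos_of_pos (real_padicNorm_pos p _) _).le)
      fun ρ _ => Real.rpow_le_one (real_padicNorm_pos p _).le (hle ρ)
        (by exact_mod_cast localCoeff_nonneg hL τ.2 ρ)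
  refine le_antisymm ?_ ?_
  · have : Nonempty X.maxCones := ⟨⟨σ, hσ⟩⟩
    exact ciSup_le hbound
  · refine le_ciSup_of_le ⟨1, ?_⟩ ⟨σ, hσ⟩ (le_of_eq ?_)
    · rintro _ ⟨τ, rfl⟩; exact hbound τ
    · refine (Finset.prod_eq_one fun ρ _ => ?_).symm
      by_cases hρ : ρ ∈ σ
      · simp [localCoeff_eq_zero L hσ hρ]
      · have : padicNorm p (toUnits x ρ : ℚ) = 1 := by
          rw [coe_toUnits hx.1, padicNorm.eq_zpow_of_nonzero (by exact_mod_cast hx.1 ρ),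
            padicValRat.of_int, padicValInt, padicValNat_natAbs_eq_zero (hxσ ρ hρ)]
          simp
        change ((padicNorm p (toUnits x ρ : ℚ) : ℚ) : ℝ) ^ _ = 1
        rw [this, Rat.cast_one, Real.one_rpow]

theorem height_coprimeTuple (hL : X.IsSemiample L) {x : ι → ℤ} (hx : X.IsCoprimeTuple x) :
    X.height L (toUnits x) = X.localHeight L (fun z => |(z : ℝ)|) (toUnits x) := by
  rw [height, finprod_eq_one_of_forall_eq_one fun p : Nat.Primes =>
    localHeight_coprimeTuple hL hx p.2, mul_one]

theorem height_le_iff (hL : X.IsSemiample L) {x : ι → ℤ} (hx : X.IsCoprimeTuple x) {B : ℝ}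
    (hB : 0 < B) :
    X.height L (toUnits x) ≤ B ↔ ∀ σ ∈ X.maxCones,
      ∑ ρ, (X.localCoeff L σ ρ : ℝ) * Real.log |(x ρ : ℝ)| ≤ Real.log B := by
  obtain ⟨σ₀, hσ₀⟩ := X.exists_maxCone
  have : Nonempty X.maxCones := ⟨⟨σ₀, hσ₀⟩⟩
  rw [height_coprimeTuple hL hx, localHeight, ciSup_le_iff (Set.finite_range _).bddAbove]
  have habs : ∀ ρ, |((toUnits x ρ : ℚ) : ℝ)| = |(x ρ : ℝ)| := fun ρ => by
    rw [coe_toUnits hx.1]; simp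
  have hpos : ∀ ρ, 0 < |(x ρ : ℝ)| := fun ρ => abs_pos.2 (by exact_mod_cast hx.1 ρ)
  rw [Subtype.forall]
  refine forall₂_congr fun σ hσ => ?_
  simp only [habs]
  rw [← Real.log_le_log_iff (Finset.prod_pos fun ρ _ => Real.rpow_pos_of_pos (hpos ρ) _) hB,
    Real.log_prod fun ρ _ => (Real.rpow_pos_of_pos (hpos ρ) _).ne']
  simp_rw [Real.log_rpow (hpos _)]

/-- Each local factor is multiplied by `∏ |z_ρ|_v ^ L_ρ`. These scaling factors cancel over all
places by the product formula. -/
theorem height_mul_of_ker (hL : X.IsSemiample L) {x : ι → ℤ} (hx : X.IsCoprimeTuple x)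
    {z : ι → ℚˣ} (hz : X.torsorMap z = 1) :
    X.height L (z * toUnits x) = X.height L (toUnits x) := by
  have hinf := localHeight_mul (X := X) (L := L) (av := fun z => |(z : ℝ)|) real_abs_pos real_abs_mul
    (fun σ _ => prod_rpow_localCoeff_of_ker (av := fun z => |(z : ℝ)|) real_abs_pos real_abs_mul hz σ) (toUnits x)
  have hfin : ∀ p : Nat.Primes, X.localHeight L (fun z => (padicNorm p z : ℝ)) (z * toUnits x) =
      ∏ ρ, ((padicNorm p (z ρ : ℚ) : ℚ) : ℝ) ^ (L ρ : ℝ) := fun p => by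
    have : Fact (p : ℕ).Prime := ⟨p.2⟩
    rw [localHeight_mul (X := X) (L := L) (av := fun z => (padicNorm p z : ℝ))
      (real_padicNorm_pos p) (real_padicNorm_mul p) (fun σ _ => prod_rpow_localCoeff_of_ker
        (av := fun z => (padicNorm p z : ℝ)) (real_padicNorm_pos p) (real_padicNorm_mul p) hz σ) (toUnits x),
      localHeight_coprimeTuple hL hx p.2, mul_one]
  rw [height_coprimeTuple hL hx, height, hinf, finprod_congr hfin,
    finprod_prod_comm _ _ fun ρ _ => finite_mulSupport_padicNorm (z ρ) (L ρ)]
  simp_rw [finprod_padicNorm_rpow]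
  rw [mul_right_comm, ← Finset.prod_mul_distrib, Finset.prod_eq_one, one_mul]
  intro ρ _
  rw [← Real.rpow_add (real_abs_pos _)]
  simp

end Height

/-- The exponents of any two monomials of `g` differ by the divisor of a character, which is trivial
on `z`. Hence all monomials are multiplied by the same unit, written with a representative `D` of
the degree that may have negative entries. -/
theorem aeval_mul_of_ker {g : MvPolynomial ι ℤ} {c : X.Pic}
    (hg : MvPolynomial.IsWeightedHomogeneous X.primeClass g c) {z : ι → ℚˣ}
    (hz : X.torsorMap z = 1) :
    ∃ u : ℚˣ, ∀ x : ι → ℚˣ, MvPolynomial.aeval (fun ρ => ((z * x) ρ : ℚ)) g =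
      u * MvPolynomial.aeval (fun ρ => (x ρ : ℚ)) g := by
  have hchar : ∀ w : Fin rk → ℤ, ∏ ρ, z ρ ^ (X.charDiv w ρ) = 1 := fun w => by
    simp only [charDiv, LinearMap.coe_mk, AddHom.coe_mk, zpow_finsetSum]
    rw [Finset.prod_comm]
    refine Finset.prod_eq_one fun k _ => ?_
    have := congrFun hz k
    simp only [torsorMap, Pi.one_apply] at this
    simp_rw [mul_comm (w k), zpow_mul]
    rw [Finset.prod_zpow, this, one_zpow]
  obtain ⟨D, rfl⟩ := Submodule.Quotient.mk_surjective _ c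
  refine ⟨∏ ρ, z ρ ^ D ρ, fun x => ?_⟩
  have hmon : ∀ d ∈ g.support, ∏ ρ, z ρ ^ (d ρ) = ∏ ρ, z ρ ^ D ρ := fun d hd => by
    have h1 := hg (MvPolynomial.mem_support_iff.1 hd)
    have h2 : Finsupp.weight X.primeClass d = Submodule.Quotient.mk (fun ρ => (d ρ : ℤ)) := by
      rw [Finsupp.weight_apply, Finsupp.sum_fintype _ _ (by simp)]
      have : (fun ρ => (d ρ : ℤ)) = ∑ ρ, d ρ • (Pi.single ρ 1 : ι → ℤ) := by
        ext τ; simp [Finset.sum_apply, Pi.single_apply]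
      rw [this]
      exact (map_sum (Submodule.mkQ (LinearMap.range X.charDiv)) _ _).symm
    rw [h2] at h1
    obtain ⟨w, hw⟩ := (Submodule.Quotient.eq _).1 h1
    have h3 := hchar w
    rw [hw] at h3
    simp only [Pi.sub_apply, zpow_sub, zpow_natCast, Finset.prod_mul_distrib,
      Finset.prod_inv_distrib] at h3
    exact mul_inv_eq_one.1 h3
  rw [MvPolynomial.aeval_def, MvPolynomial.aeval_def, MvPolynomial.eval₂_eq',
    MvPolynomial.eval₂_eq', Finset.mul_sum]
  refine Finset.sum_congr rfl fun d hd => ?_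
  have h4 := congrArg (Units.val) (hmon d hd)
  rw [← h4]
  simp only [Pi.mul_apply, Units.val_mul, mul_pow, Finset.prod_mul_distrib, Units.coe_prod,
    Units.val_pow_eq_pow_val]
  ring

theorem mem_countedPoints_iff {L : ι → ℚ} (hL : X.IsSemiample L) {t : ℕ}
    {g : Fin t → MvPolynomial ι ℤ}
    (hg : ∀ l, ∃ c : X.Pic, MvPolynomial.IsWeightedHomogeneous X.primeClass (g l) c)
    {m : ι → ℕ} {B : ℝ} (hB : 0 < B) {x : ι → ℤ} (hx : X.IsCoprimeTuple x) :
    X.torsorMap (toUnits x) ∈ X.countedPoints L g m B ↔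
      (∀ ρ, IsFull (m ρ) (x ρ)) ∧ (∀ l, MvPolynomial.eval x (g l) = 0) ∧
      ∀ σ ∈ X.maxCones,
        ∑ ρ, (X.localCoeff L σ ρ : ℝ) * Real.log |(x ρ : ℝ)| ≤ Real.log B := by
  have heval : ∀ l, MvPolynomial.aeval (fun ρ => (toUnits x ρ : ℚ)) (g l) =
      ((MvPolynomial.eval x (g l) : ℤ) : ℚ) := fun l => by
    simp_rw [coe_toUnits hx.1]
    rw [MvPolynomial.aeval_def, MvPolynomial.eval₂_eq', MvPolynomial.eval_eq']
    simp
  rw [countedPoints, Set.mem_ofPred_eq, isCampana_iff hx, ← height_le_iff hL hx hB]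
  refine and_congr_right fun _ => ⟨?_, fun ⟨h1, h2⟩ => ⟨toUnits x, rfl, fun l => ?_, h2⟩⟩
  · rintro ⟨y, hy, hgy, hyB⟩
    set z := y / toUnits x with hzdef
    have hyz : y = z * toUnits x := by rw [hzdef, div_mul_cancel]
    have hz : X.torsorMap z = 1 := by
      rw [torsorMap_eq, hzdef, map_div, ← torsorMap_eq, ← torsorMap_eq, hy, div_self']
    rw [hyz] at hgy hyB
    rw [height_mul_of_ker hL hx hz] at hyB
    refine ⟨fun l => ?_, hyB⟩
    obtain ⟨c, hc⟩ := hg l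
    obtain ⟨u, hu⟩ := aeval_mul_of_ker hc hz
    have := hgy l
    rw [hu, heval, mul_eq_zero] at this
    exact_mod_cast this.resolve_left u.ne_zero
  · rw [heval, h1 l]; simp

end SmoothCompleteFan

/-! ### Coprimality by classes and the Möbius function -/

namespace SmoothCompleteFan

variable {rk s : ℕ} {n : Fin s → ℕ} {X : SmoothCompleteFan rk (Σ i : Fin s, Fin (n i))}

theorem chi_eq_one_iff (b : Fin s → ℕ) :
    X.chi b = 1 ↔ ∀ p : ℕ, p.Prime → ∃ σ ∈ X.maxCones, ∀ i ∈ groupIdx σ, ¬ p ∣ b i := by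
  have h1 : X.chi b = 1 ↔ X.maxCones.gcd (fun σ => ∏ i ∈ groupIdx σ, b i) = 1 := by
    rw [chi]; split_ifs with h <;> simp [h]
  rw [h1, Nat.eq_one_iff_not_exists_prime_dvd]
  refine forall₂_congr fun p hp => ?_
  simp only [Finset.dvd_gcd_iff, hp.prime.dvd_finsetProd_iff]
  push Not
  rfl

theorem chi_eq_zero_or_one (b : Fin s → ℕ) : X.chi b = 0 ∨ X.chi b = 1 := by
  rw [chi]; split_ifs <;> simp

/-- The condition given by `chi` only controls rays whose whole class is divisible by `p`. Every
other ray with `p ∣ x ρ` is linearly equivalent to one with `x` prime to `p`, and by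
`exists_maxCone_of_subset` such rays do not obstruct membership in a common cone. -/
theorem isCoprimeTuple_iff_chi (hX : X.GroupedByClass) {x : (Σ i : Fin s, Fin (n i)) → ℤ}
    (hx : ∀ ρ, x ρ ≠ 0) :
    X.IsCoprimeTuple x ↔
      X.chi (fun i => Finset.univ.gcd fun j => (x ⟨i, j⟩).natAbs) = 1 := by
  rw [chi_eq_one_iff, IsCoprimeTuple, and_iff_right hx]
  refine forall₂_congr fun p hp => ?_
  have hdvd : ∀ i, (p ∣ Finset.univ.gcd fun j => (x ⟨i, j⟩).natAbs) ↔
      ∀ j, (p : ℤ) ∣ x ⟨i, j⟩ := fun i => by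
    simp [Finset.dvd_gcd_iff, Int.natCast_dvd]
  constructor
  · rintro ⟨σ, hσ, h⟩
    refine ⟨σ, hσ, fun i hi hd => ?_⟩
    obtain ⟨j, hj⟩ := (Finset.mem_filter.1 hi).2
    exact h _ hj ((hdvd i).1 hd j)
  · rintro ⟨σ, hσ, h⟩
    classical
    obtain ⟨τ, hτ, hZ⟩ := exists_maxCone_of_subset (X := X)
      (Z := Finset.univ.filter fun ρ => (p : ℤ) ∣ x ρ)
      (Z₀ := Finset.univ.filter fun ρ => ∀ j, (p : ℤ) ∣ x ⟨ρ.1, j⟩)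
      (fun ρ hρ => by
        simp only [Finset.mem_filter, Finset.mem_univ, true_and] at hρ ⊢
        exact hρ ρ.2)
      (fun ρ hρ => by
        simp only [Finset.mem_sdiff, Finset.mem_filter, Finset.mem_univ, true_and,
          not_forall] at hρ
        obtain ⟨-, j, hj⟩ := hρ
        exact ⟨⟨ρ.1, j⟩, by simpa using hj, (hX.2 _ _).2 rfl⟩)
      ⟨σ, hσ, fun ρ hρ => by
        simp only [Finset.mem_filter, Finset.mem_univ, true_and] at hρ
        by_contra hn
        exact h ρ.1 (Finset.mem_filter.2 ⟨Finset.mem_univ _, ρ.2, hn⟩) ((hdvd _).2 hρ)⟩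
    exact ⟨τ, hτ, fun ρ hρ hd => hρ (hZ (by simpa using hd))⟩

/-- The condition is local at each prime, and a given prime divides entries of at most one of the
two tuples. -/
theorem chi_mul {a b : Fin s → ℕ} (hab : ∀ i j, (a i).Coprime (b j)) :
    X.chi (fun i => a i * b i) = X.chi a * X.chi b := by
  obtain ⟨σ₀, hσ₀⟩ := X.exists_maxCone
  have key : X.chi (fun i => a i * b i) = 1 ↔ X.chi a = 1 ∧ X.chi b = 1 := by
    simp only [chi_eq_one_iff]
    rw [← forall₂_and]
    refine forall₂_congr fun p hp => ?_
    simp only [hp.dvd_mul, not_or]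
    by_cases hpa : ∃ i, p ∣ a i
    · obtain ⟨i₀, hi₀⟩ := hpa
      have hb : ∀ j, ¬ p ∣ b j := fun j hj =>
        hp.one_lt.ne' (Nat.eq_one_of_dvd_coprimes (hab i₀ j) hi₀ hj)
      simp only [hb, not_false_eq_true, and_true, implies_true]
      exact ⟨fun h => ⟨h, σ₀, hσ₀⟩, fun h => h.1⟩
    · have ha : ∀ j, ¬ p ∣ a j := fun j hj => hpa ⟨j, hj⟩
      simp only [ha, not_false_eq_true, true_and, implies_true, and_true]
      exact ⟨fun h => ⟨⟨σ₀, hσ₀⟩, h⟩, fun h => h.2⟩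
  rcases chi_eq_zero_or_one (X := X) a with h1 | h1 <;>
    rcases chi_eq_zero_or_one (X := X) b with h2 | h2 <;>
    rcases chi_eq_zero_or_one (X := X) (fun i => a i * b i) with h3 | h3 <;>
    simp_all

theorem sum_divisors_mul {M : Type*} [AddCommMonoid M] {a b : Fin s → ℕ} (ha : ∀ i, a i ≠ 0)
    (hb : ∀ i, b i ≠ 0) (hab : ∀ i j, (a i).Coprime (b j)) (f : (Fin s → ℕ) → M) :
    ∑ d ∈ Fintype.piFinset (fun i => (a i * b i).divisors), f d =
      ∑ d ∈ Fintype.piFinset (fun i => (a i).divisors) ×ˢ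
        Fintype.piFinset (fun i => (b i).divisors), f (fun i => d.1 i * d.2 i) := by
  symm
  refine Finset.sum_bij' (fun d _ i => d.1 i * d.2 i)
    (fun d _ => (fun i => (d i).gcd (a i), fun i => (d i).gcd (b i))) ?_ ?_ ?_ ?_ ?_
  · rintro ⟨d, e⟩ h
    simp only [Finset.mem_product, Fintype.mem_piFinset, Nat.mem_divisors] at h ⊢
    exact fun i => ⟨mul_dvd_mul (h.1 i).1 (h.2 i).1, mul_ne_zero (ha i) (hb i)⟩
  · intro d _
    simp only [Finset.mem_product, Fintype.mem_piFinset, Nat.mem_divisors]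
    exact ⟨fun i => ⟨Nat.gcd_dvd_right _ _, ha i⟩, fun i => ⟨Nat.gcd_dvd_right _ _, hb i⟩⟩
  · rintro ⟨d, e⟩ h
    simp only [Finset.mem_product, Fintype.mem_piFinset, Nat.mem_divisors] at h
    ext i
    · have : (e i).Coprime (a i) := ((hab i i).symm).coprime_dvd_left (h.2 i).1
      simp only
      rw [Nat.Coprime.gcd_mul_right_cancel _ this, Nat.gcd_eq_left (h.1 i).1]
    · have : (d i).Coprime (b i) := ((hab i i)).coprime_dvd_left (h.1 i).1
      simp only
      rw [Nat.Coprime.gcd_mul_left_cancel _ this, Nat.gcd_eq_left (h.2 i).1]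
  · intro d h
    simp only [Fintype.mem_piFinset, Nat.mem_divisors] at h
    ext i
    simp only
    rw [← Nat.Coprime.gcd_mul _ (hab i i), Nat.gcd_eq_left (h i).1]
  · intro d _; rfl

/-- Both sides satisfy the recursion of Möbius inversion for the multiplicative function `chi`. The
bound `N` only serves to induct on `∑ a_i b_i`, which drops for proper divisors. -/
theorem mu_mul (N : ℕ) : ∀ {a b : Fin s → ℕ}, ∑ i, a i * b i < N → (∀ i, a i ≠ 0) →
    (∀ i, b i ≠ 0) → (∀ i j, (a i).Coprime (b j)) →
    X.mu (fun i => a i * b i) = X.mu a * X.mu b := by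
  induction N with
  | zero => exact fun h => absurd h (Nat.not_lt_zero _)
  | succ N ih =>
    intro a b hN ha hb hab
    have hmem : (a, b) ∈ Fintype.piFinset (fun i => (a i).divisors) ×ˢ
        Fintype.piFinset (fun i => (b i).divisors) := by
      simp [ha, hb]
    have h1 := X.sum_mu (fun i => a i * b i)
      fun i => Nat.pos_of_ne_zero (mul_ne_zero (ha i) (hb i))
    rw [chi_mul hab, ← X.sum_mu a fun i => Nat.pos_of_ne_zero (ha i),
      ← X.sum_mu b fun i => Nat.pos_of_ne_zero (hb i), sum_divisors_mul ha hb hab,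
      Finset.sum_mul_sum, ← Finset.sum_product', ← Finset.add_sum_erase _ _ hmem,
      ← Finset.add_sum_erase _ _ hmem] at h1
    have h2 : ∀ d ∈ (Fintype.piFinset (fun i => (a i).divisors) ×ˢ
        Fintype.piFinset (fun i => (b i).divisors)).erase (a, b),
        X.mu (fun i => d.1 i * d.2 i) = X.mu d.1 * X.mu d.2 := by
      rintro ⟨d, e⟩ hd
      simp only [Finset.mem_erase, Finset.mem_product, Fintype.mem_piFinset,
        Nat.mem_divisors] at hd
      obtain ⟨hne, hda, heb⟩ := hd
      have hd0 : ∀ i, d i ≠ 0 := fun i => (Nat.pos_of_dvd_of_pos (hda i).1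
        (Nat.pos_of_ne_zero (ha i))).ne'
      have he0 : ∀ i, e i ≠ 0 := fun i => (Nat.pos_of_dvd_of_pos (heb i).1
        (Nat.pos_of_ne_zero (hb i))).ne'
      refine ih ?_ hd0 he0 fun i j =>
        ((hab i j).coprime_dvd_left (hda i).1).coprime_dvd_right (heb j).1
      have hled : ∀ i, d i ≤ a i := fun i => Nat.le_of_dvd (Nat.pos_of_ne_zero (ha i)) (hda i).1
      have hlee : ∀ i, e i ≤ b i := fun i => Nat.le_of_dvd (Nat.pos_of_ne_zero (hb i)) (heb i).1
      have hlt : ∑ i, d i * e i < ∑ i, a i * b i := by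
        refine Finset.sum_lt_sum (fun i _ => Nat.mul_le_mul (hled i) (hlee i)) ?_
        by_contra! hcon
        apply hne
        have hprod : ∀ i, d i = a i ∧ e i = b i := fun i => by
          have h1 := hcon i (Finset.mem_univ i)
          have h2 := hled i
          have h3 := hlee i
          have h4 := Nat.pos_of_ne_zero (ha i)
          have h5 := Nat.pos_of_ne_zero (hb i)
          constructor
          · by_contra hn
            have : d i < a i := lt_of_le_of_ne h2 hn
            nlinarith
          · by_contra hn
            have : e i < b i := lt_of_le_of_ne h3 hn
            nlinarith
        ext i
        · exact (hprod i).1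
        · exact (hprod i).2
      exact lt_of_lt_of_le hlt (Nat.lt_succ_iff.1 hN)
    rw [Finset.sum_congr rfl h2] at h1
    exact add_right_cancel h1

theorem mu_one : X.mu (fun _ => 1) = 1 := by
  have h := X.sum_mu (fun _ => 1) fun _ => one_pos
  obtain ⟨σ₀, hσ₀⟩ := X.exists_maxCone
  rw [(chi_eq_one_iff _).2 fun p hp => ⟨σ₀, hσ₀, fun i _ h => hp.one_lt.ne' (Nat.dvd_one.1 h)⟩]
    at h
  have h1 : Fintype.piFinset (fun _ : Fin s => (1 : ℕ).divisors) = {fun _ => 1} := by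
    ext d
    simp [funext_iff]
  rwa [h1, Finset.sum_singleton] at h

theorem mu_prod_primes (S : Finset ℕ) (hS : ∀ p ∈ S, p.Prime) (e : ℕ → Fin s → ℕ) :
    X.mu (fun i => ∏ p ∈ S, p ^ e p i) = ∏ p ∈ S, X.mu (fun i => p ^ e p i) := by
  induction S using Finset.induction_on with
  | empty => simpa using mu_one
  | insert p S hp ih =>
    have hS' : ∀ q ∈ S, q.Prime := fun q hq => hS q (Finset.mem_insert_of_mem hq)
    have hp' := hS p (Finset.mem_insert_self _ _)
    simp_rw [Finset.prod_insert hp]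
    rw [← ih hS', mu_mul _ (Nat.lt_succ_self _) (fun i => pow_ne_zero _ hp'.ne_zero)
      (fun i => Finset.prod_ne_zero_iff.2 fun q hq => pow_ne_zero _ (hS' q hq).ne_zero)]
    intro i j
    refine Nat.Coprime.prod_right fun q hq => Nat.Coprime.pow _ _ ?_
    exact (Nat.coprime_primes hp' (hS' q hq)).2 fun h => hp (h ▸ hq)

theorem chi_prime_pow {p : ℕ} (hp : p.Prime) (e : Fin s → ℕ) :
    X.chi (fun i => p ^ e i) = 1 ↔ ∃ σ ∈ X.maxCones, ∀ i ∈ groupIdx σ, e i = 0 := by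
  rw [chi_eq_one_iff]
  constructor
  · intro h
    obtain ⟨σ, hσ, h⟩ := h p hp
    exact ⟨σ, hσ, fun i hi => by_contra fun hn => h i hi (dvd_pow_self _ hn)⟩
  · rintro ⟨σ, hσ, h⟩ q hq
    refine ⟨σ, hσ, fun i hi hd => ?_⟩
    rw [h i hi, pow_zero] at hd
    exact hq.one_lt.ne' (Nat.dvd_one.1 hd)

theorem chi_prime_pow_congr {p q : ℕ} (hp : p.Prime) (hq : q.Prime) {e e' : Fin s → ℕ}
    (h : ∀ i, e i = 0 ↔ e' i = 0) : X.chi (fun i => p ^ e i) = X.chi (fun i => q ^ e' i) := by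
  have key : X.chi (fun i => p ^ e i) = 1 ↔ X.chi (fun i => q ^ e' i) = 1 := by
    rw [chi_prime_pow hp, chi_prime_pow hq]
    simp only [h]
  rcases chi_eq_zero_or_one (X := X) (fun i => p ^ e i) with h1 | h1 <;>
    rcases chi_eq_zero_or_one (X := X) (fun i => q ^ e' i) with h2 | h2 <;>
    simp_all

theorem sum_mu_prime_pow {p : ℕ} (hp : p.Prime) (e : Fin s → ℕ) :
    ∑ d ∈ Fintype.piFinset (fun i => Finset.range (e i + 1)), X.mu (fun i => p ^ d i) =
      X.chi (fun i => p ^ e i) := by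
  rw [← X.sum_mu _ fun i => pow_pos hp.pos _]
  refine Finset.sum_bij (fun d _ i => p ^ d i) ?_ ?_ ?_ fun _ _ => rfl
  · intro d hd
    simp only [Fintype.mem_piFinset, Finset.mem_range, Nat.mem_divisors] at hd ⊢
    exact fun i => ⟨pow_dvd_pow _ (Nat.lt_succ_iff.1 (hd i)), pow_ne_zero _ hp.ne_zero⟩
  · intro d _ d' _ h
    ext i
    exact Nat.pow_right_injective hp.two_le (congrFun h i)
  · intro b hb
    simp only [Fintype.mem_piFinset, Nat.mem_divisors, Nat.dvd_prime_pow hp] at hb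
    choose d hd hbd using fun i => (hb i).1
    exact ⟨d, by simpa [Fintype.mem_piFinset, Nat.lt_succ_iff] using hd, (funext hbd).symm⟩

theorem mu_prime_pow_recursion {p : ℕ} (hp : p.Prime) (e : Fin s → ℕ) :
    X.mu (fun i => p ^ e i) = X.chi (fun i => p ^ e i) -
      ∑ d ∈ (Fintype.piFinset (fun i => Finset.range (e i + 1))).erase e,
        X.mu (fun i => p ^ d i) := by
  have hmem : e ∈ Fintype.piFinset (fun i => Finset.range (e i + 1)) := by simp
  rw [← sum_mu_prime_pow hp, ← Finset.add_sum_erase _ _ hmem]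
  ring

theorem sum_lt_of_mem_erase {e d : Fin s → ℕ}
    (hd : d ∈ (Fintype.piFinset (fun i => Finset.range (e i + 1))).erase e) :
    ∑ i, d i < ∑ i, e i := by
  rw [Finset.mem_erase, Fintype.mem_piFinset] at hd
  have hle : ∀ i, d i ≤ e i := fun i => Nat.lt_succ_iff.1 (Finset.mem_range.1 (hd.2 i))
  obtain ⟨i, hi⟩ := Function.ne_iff.mp hd.1
  exact Finset.sum_lt_sum (fun i _ => hle i) ⟨i, Finset.mem_univ i, lt_of_le_of_ne (hle i) hi⟩

/-- The recursion involves only values of `chi` at prime powers, and those see only which exponents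
vanish. -/
theorem mu_prime_pow_congr {p q : ℕ} (hp : p.Prime) (hq : q.Prime) (e : Fin s → ℕ) :
    X.mu (fun i => p ^ e i) = X.mu (fun i => q ^ e i) := by
  induction hN : ∑ i, e i using Nat.strong_induction_on generalizing e with
  | _ N ih =>
    rw [mu_prime_pow_recursion hp, mu_prime_pow_recursion hq,
      chi_prime_pow_congr hp hq fun _ => Iff.rfl]
    congr 1
    exact Finset.sum_congr rfl fun d hd => ih _ (hN ▸ sum_lt_of_mem_erase hd) d rfl

/-- `chi` does not change when exponents are truncated at 1, so the divisor sums for `e` and for its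
truncation agree. By induction, the only term outside the truncated range that could be nonzero is
the one at `e`. -/
theorem mu_prime_pow_eq_zero {p : ℕ} (hp : p.Prime) (e : Fin s → ℕ) (he : ∃ i, 2 ≤ e i) :
    X.mu (fun i => p ^ e i) = 0 := by
  induction hN : ∑ i, e i using Nat.strong_induction_on generalizing e with
  | _ N ih =>
    have h1 := sum_mu_prime_pow (X := X) hp e
    have h2 := sum_mu_prime_pow (X := X) hp fun i => min (e i) 1
    rw [chi_prime_pow_congr hp hp (e' := fun i => min (e i) 1) fun i => by omega, ← h2] at h1
    have hmem : e ∈ Fintype.piFinset (fun i => Finset.range (e i + 1)) := by simp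
    have hsub : Fintype.piFinset (fun i => Finset.range (min (e i) 1 + 1)) ⊆
        (Fintype.piFinset (fun i => Finset.range (e i + 1))).erase e := by
      intro d hd
      simp only [Fintype.mem_piFinset, Finset.mem_range, Finset.mem_erase] at hd ⊢
      refine ⟨?_, fun i => by have := hd i; omega⟩
      rintro rfl
      obtain ⟨i, hi⟩ := he
      have := hd i
      omega
    rw [← Finset.add_sum_erase _ _ hmem] at h1
    rw [Finset.sum_subset hsub fun d hd hd' => ih _ (hN ▸ sum_lt_of_mem_erase hd) d ?_ rfl] at h1
    · linarith
    · by_contra! hcon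
      apply hd'
      rw [Finset.mem_erase, Fintype.mem_piFinset] at hd
      simp only [Fintype.mem_piFinset, Finset.mem_range]
      intro i
      have h3 := hcon i
      have h4 := Finset.mem_range.1 (hd.2 i)
      omega

end SmoothCompleteFan

/-! ### Absolute convergence of the Möbius series -/

namespace SmoothCompleteFan

variable {rk s : ℕ} {n : Fin s → ℕ} {X : SmoothCompleteFan rk (Σ i : Fin s, Fin (n i))}

theorem exists_prod_primes (d : Fin s → ℕ+) {S : Finset ℕ}
    (hS : ∀ i, (d i : ℕ).primeFactors ⊆ S) (i : Fin s) :
    (d i : ℕ) = ∏ p ∈ S, p ^ (d i : ℕ).factorization p := by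
  conv_lhs => rw [← Nat.prod_factorization_pow_eq_self (d i).ne_zero]
  exact Finsupp.prod_of_support_subset _ (hS i) _ fun _ _ => pow_zero _

theorem prod_rpow_eq_prod_primes (d : Fin s → ℕ+) {S : Finset ℕ}
    (hS : ∀ i, (d i : ℕ).primeFactors ⊆ S) (β : Fin s → ℝ) :
    ∏ i, ((d i : ℕ) : ℝ) ^ (-β i) =
      ∏ p ∈ S, (p : ℝ) ^ (-∑ i, β i * (d i : ℕ).factorization p) := by
  have h1 : ∀ i, ((d i : ℕ) : ℝ) ^ (-β i) =
      ∏ p ∈ S, ((p : ℝ) ^ (d i : ℕ).factorization p) ^ (-β i) := fun i => by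
    rw [Real.finsetProd_rpow _ _ fun p _ => by positivity]
    congr 1
    conv_lhs => rw [exists_prod_primes d hS i]
    push_cast; rfl
  simp_rw [h1]
  rw [Finset.prod_comm]
  refine Finset.prod_congr rfl fun p _ => ?_
  rcases Nat.eq_zero_or_pos p with rfl | hp
  · simp
  · have hp' : (0 : ℝ) < p := by exact_mod_cast hp
    rw [← Finset.sum_neg_distrib, Real.rpow_sum_of_pos hp']
    refine Finset.prod_congr rfl fun i _ => ?_
    rw [← Real.rpow_natCast, ← Real.rpow_mul hp'.le]
    congr 1; ring

/-- The Dirichlet series of the Möbius function converges absolutely at `β` if `f_β > 1`. -/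
theorem summable_mu_mul {β : Fin s → ℝ} (hβ : ∀ p : ℕ, p.Prime → 1 < X.mobiusMin p β) :
    Summable fun d : Fin s → ℕ+ =>
      |(X.mu fun i => (d i : ℕ) : ℝ)| * ∏ i, ((d i : ℕ) : ℝ) ^ (-β i) := by
  classical
  set f := X.mobiusMin 2 β with hf
  have hf1 : 1 < f := hβ 2 Nat.prime_two
  -- At prime powers `mu` is supported on exponents 0 and 1. So the infimum `f` is taken over a set
  -- that is bounded below, and the local factors are finite sums.
  set D : Finset (Fin s → ℕ) := Fintype.piFinset fun _ => Finset.range 2 with hD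
  have hDmem : ∀ {p : ℕ}, p.Prime → ∀ e : Fin s → ℕ, X.mu (fun i => p ^ e i) ≠ 0 → e ∈ D := by
    intro p hp e he
    rw [hD, Fintype.mem_piFinset]
    by_contra hcon
    push Not at hcon
    obtain ⟨i, hi⟩ := hcon
    exact he (mu_prime_pow_eq_zero hp e ⟨i, Nat.succ_le_of_lt (by simpa using hi)⟩)
  have hfle : ∀ {p : ℕ}, p.Prime → ∀ e : Fin s → ℕ, e ≠ 0 → X.mu (fun i => p ^ e i) ≠ 0 →
      f ≤ ∑ i, β i * e i := by
    intro p hp e he hmu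
    refine csInf_le (Set.Finite.bddBelow ?_) ⟨e, he, ?_, rfl⟩
    · refine (D.finite_toSet.image fun e : Fin s → ℕ => ∑ i, β i * e i).subset ?_
      rintro _ ⟨e, -, he, rfl⟩
      exact ⟨e, hDmem Nat.prime_two e he, rfl⟩
    · rwa [mu_prime_pow_congr Nat.prime_two hp]
  set h : ℕ → (Fin s → ℕ) → ℝ := fun p e =>
    |(X.mu (fun i => p ^ e i) : ℝ)| * (p : ℝ) ^ (-∑ i, β i * e i) with hh
  have h0 : ∀ p e, 0 ≤ h p e := fun p e => by positivity
  set C : ℝ := ∑ e ∈ D, |(X.mu (fun i => 2 ^ e i) : ℝ)| with hC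
  -- Besides the term 1 of `e = 0`, every nonzero term carries an exponent of at least `f > 1`. The
  -- coefficients are those at the prime 2, hence the same for all `p`.
  have hloc : ∀ p : ℕ, p.Prime → ∑ e ∈ D, h p e ≤ 1 + C * (p : ℝ) ^ (-f) := by
    intro p hp
    have hp1 : (1 : ℝ) ≤ p := by exact_mod_cast hp.one_lt.le
    have h0mem : (0 : Fin s → ℕ) ∈ D := by simp [hD]
    rw [← Finset.add_sum_erase _ _ h0mem]
    have e1 : h p 0 = 1 := by
      have : X.mu (fun i => p ^ (0 : Fin s → ℕ) i) = 1 := by simpa using mu_one (X := X)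
      simp only [hh, this]; simp
    rw [e1, hC, Finset.sum_mul]
    refine add_le_add_right ?_ _
    refine (Finset.sum_le_sum fun e he => ?_).trans
      (Finset.sum_le_sum_of_subset_of_nonneg (Finset.erase_subset 0 D) fun e _ _ => by positivity)
    simp only [hh]
    rw [mu_prime_pow_congr hp Nat.prime_two]
    by_cases hmu : X.mu (fun i => 2 ^ e i) = 0
    · simp [hmu]
    · refine mul_le_mul_of_nonneg_left ?_ (abs_nonneg _)
      refine Real.rpow_le_rpow_of_exponent_le hp1 (neg_le_neg ?_)
      exact hfle Nat.prime_two e (Finset.ne_of_mem_erase he) hmu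
  have hsumf : Summable fun k : ℕ => C * (k : ℝ) ^ (-f) :=
    (Real.summable_nat_rpow.2 (by linarith)).mul_left C
  have hC0 : 0 ≤ C := Finset.sum_nonneg fun _ _ => abs_nonneg _
  refine summable_of_sum_le (c := Real.exp (∑' k : ℕ, C * (k : ℝ) ^ (-f)))
    (fun d => mul_nonneg (abs_nonneg _) (Finset.prod_nonneg fun i _ => by positivity)) fun T => ?_
  set S : Finset ℕ := T.biUnion fun d => Finset.univ.biUnion fun i => (d i : ℕ).primeFactors
    with hSdef
  have hSp : ∀ p ∈ S, p.Prime := fun p hp => by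
    simp only [hSdef, Finset.mem_biUnion] at hp
    obtain ⟨d, -, i, -, hp⟩ := hp
    exact Nat.prime_of_mem_primeFactors hp
  have hST : ∀ d ∈ T, ∀ i, (d i : ℕ).primeFactors ⊆ S := fun d hd i p hp => by
    simp only [hSdef, Finset.mem_biUnion]
    exact ⟨d, hd, i, Finset.mem_univ _, hp⟩
  -- A tuple is determined on `T` by its exponents at the primes of `S`. By multiplicativity a
  -- finite partial sum becomes part of the expansion of a finite Euler product.
  let φ : (Fin s → ℕ+) → S → Fin s → ℕ := fun d p i => (d i : ℕ).factorization p
  have hterm : ∀ d ∈ T, |(X.mu fun i => (d i : ℕ) : ℝ)| * ∏ i, ((d i : ℕ) : ℝ) ^ (-β i) =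
      ∏ p : S, h p (φ d p) := fun d hd => by
    have e1 : X.mu (fun i => (d i : ℕ)) =
        ∏ p ∈ S, X.mu (fun i => p ^ (d i : ℕ).factorization p) := by
      rw [← mu_prod_primes S hSp fun p i => (d i : ℕ).factorization p]
      congr 1
      ext i
      exact exists_prod_primes d (hST d hd) i
    rw [e1, prod_rpow_eq_prod_primes d (hST d hd)]
    push_cast
    rw [Finset.abs_prod, ← Finset.prod_mul_distrib, ← Finset.prod_coe_sort]
  have hinj : Set.InjOn φ (T : Set (Fin s → ℕ+)) := fun d hd d' hd' hdd => by
    refine funext fun i => PNat.eq ?_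
    rw [exists_prod_primes d (hST d hd) i, exists_prod_primes d' (hST d' hd') i]
    exact Finset.prod_congr rfl fun p hp => by
      rw [show (d i : ℕ).factorization p = (d' i : ℕ).factorization p from
        congrFun (congrFun hdd ⟨p, hp⟩) i]
  calc ∑ d ∈ T, |(X.mu fun i => (d i : ℕ) : ℝ)| * ∏ i, ((d i : ℕ) : ℝ) ^ (-β i)
      = ∑ d ∈ T, ∏ p : S, h p (φ d p) := Finset.sum_congr rfl hterm
    _ = ∑ e ∈ T.image φ, ∏ p : S, h p (e p) := 
        (Finset.sum_image (f := fun e : S → Fin s → ℕ => ∏ p : S, h p (e p)) hinj).symm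
    _ ≤ ∑ e ∈ Fintype.piFinset fun _ : S => D, ∏ p : S, h p (e p) := by
        rw [← Finset.sum_filter_ne_zero]
        refine Finset.sum_le_sum_of_subset_of_nonneg (fun e he => ?_)
          fun e _ _ => Finset.prod_nonneg fun p _ => h0 _ _
        replace he := (Finset.mem_filter.1 he).2
        rw [Fintype.mem_piFinset]
        intro p
        refine hDmem (hSp p p.2) (e p) fun h0 => he (Finset.prod_eq_zero (Finset.mem_univ p) ?_)
        simp [hh, h0]
    _ = ∏ p : S, ∑ e ∈ D, h p e := (Finset.prod_univ_sum _ _).symm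
    _ ≤ ∏ p : S, Real.exp (C * ((p : ℕ) : ℝ) ^ (-f)) := by
        refine Finset.prod_le_prod (fun p _ => Finset.sum_nonneg fun e _ => h0 _ _) fun p _ => ?_
        refine (hloc p (hSp p p.2)).trans ?_
        rw [add_comm]
        exact Real.add_one_le_exp _
    _ = Real.exp (∑ p ∈ S, C * (p : ℝ) ^ (-f)) := by
        rw [← Real.exp_sum]
        exact congrArg Real.exp (Finset.sum_coe_sort S fun p : ℕ => C * (p : ℝ) ^ (-f))
    _ ≤ _ := Real.exp_le_exp.2 (hsumf.sum_le_tsum S fun k _ => by positivity)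

theorem MobiusCompatible.summable {A : (Fin s → ℕ+) → ℝ} (hA : X.MobiusCompatible A) :
    Summable fun d : Fin s → ℕ+ => |(X.mu fun i => (d i : ℕ) : ℝ)| * |A d| := by
  obtain ⟨β, hβ, K, hK⟩ := hA
  refine Summable.of_nonneg_of_le (fun d => by positivity) (fun d => ?_)
    ((summable_mu_mul hβ).mul_left K)
  rw [mul_left_comm]
  exact mul_le_mul_of_nonneg_left (hK d) (abs_nonneg _)

end SmoothCompleteFan

/-! ### Slices of polytopes parallel to a face -/

/-- The map is multiplication by `a` on the range of the projection and by `b` on its kernel. -/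
theorem LinearMap.det_smul_one_add_smul_of_isIdempotentElem {V : Type*} [AddCommGroup V]
    [Module ℝ V] [FiniteDimensional ℝ V] {f : V →ₗ[ℝ] V} (hf : IsIdempotentElem f) (a b : ℝ) :
    LinearMap.det (b • (1 : V →ₗ[ℝ] V) + (a - b) • f) =
      a ^ Module.finrank ℝ (LinearMap.range f) *
        b ^ (Module.finrank ℝ V - Module.finrank ℝ (LinearMap.range f)) := by
  have hp : LinearMap.IsProj (LinearMap.range f) f :=
    (LinearMap.isProj_range_iff_isIdempotentElem f).2 hf
  set e := (LinearMap.range f).prodEquivOfIsCompl (LinearMap.ker f) hp.isCompl with he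
  have h1 : b • (1 : V →ₗ[ℝ] V) + (a - b) • f =
      e.conj (LinearMap.prodMap (a • (1 : Module.End ℝ (LinearMap.range f)))
        (b • (1 : Module.End ℝ (LinearMap.ker f)))) := by
    have h2 : f = e.conj (LinearMap.prodMap LinearMap.id 0) := hp.eq_conj_prodMap
    have h3 : (1 : V →ₗ[ℝ] V) = e.conj 1 := by
      ext v; simp [LinearEquiv.conj_apply]
    conv_lhs => rw [h2, h3, ← map_smul, ← map_smul, ← map_add]
    congr 1
    ext x <;> simp [sub_smul]
  have h4 : Module.finrank ℝ (LinearMap.ker f) =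
      Module.finrank ℝ V - Module.finrank ℝ (LinearMap.range f) := by
    have := f.finrank_range_add_finrank_ker
    omega
  rw [h1, LinearEquiv.conj_apply, LinearMap.comp_assoc, LinearMap.det_conj, LinearMap.det_prodMap,
    LinearMap.det_smul, LinearMap.det_smul]
  simp [h4]

section ScalingFunction

/-- A function that almost scales like `δ ^ N` is asymptotic to a multiple of `δ ^ N`. -/
theorem exists_asymptotic_of_scaling {V : ℝ → ℝ} {kap : ℝ} {k N : ℕ} (hkap : 0 < kap)
    (hV0 : ∀ δ, 0 ≤ V δ) {M : ℝ} (hVM : ∀ δ, V δ ≤ M)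
    (h : ∀ δ δ', 0 < δ → 0 < δ' → kap * (δ + δ') ≤ 1 →
      (1 - kap * (δ + δ')) ^ k * (δ' / δ) ^ N * V δ ≤ V δ') :
    ∃ c C : ℝ, ∀ δ, 0 < δ → |V δ - c * δ ^ N| ≤ C * δ ^ (N + 1) := by
  -- For `δ, δ' ≤ δ₁` one has `kap * (δ + δ') ≤ 1 / 2`. There `g = V / δ ^ N` is bounded and
  -- satisfies `|g δ - g δ'| ≤ Q (δ + δ')`, so it converges at 0 with a linear rate.
  set δ₁ : ℝ := 1 / (4 * kap) with hδ₁
  have hδ₁0 : 0 < δ₁ := by positivity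
  have hM0 : 0 ≤ M := (hV0 1).trans (hVM 1)
  set g : ℝ → ℝ := fun δ => V δ / δ ^ N with hg
  have hg0 : ∀ δ, 0 < δ → 0 ≤ g δ := fun δ hδ => div_nonneg (hV0 δ) (by positivity)
  have hscale : ∀ δ δ', 0 < δ → 0 < δ' → kap * (δ + δ') ≤ 1 →
      (1 - kap * (δ + δ')) ^ k * g δ ≤ g δ' := fun δ δ' hδ hδ' hk => by
    have := h δ δ' hδ hδ' hk
    rw [hg]
    simp only
    rw [le_div_iff₀ (by positivity)]
    refine le_trans (le_of_eq ?_) this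
    rw [div_pow]
    field_simp
  have hsmall : ∀ δ δ', δ ≤ δ₁ → δ' ≤ δ₁ → kap * (δ + δ') ≤ 1 / 2 := fun δ δ' h1 h2 => by
    have : kap * (δ + δ') ≤ kap * (δ₁ + δ₁) := by gcongr
    refine this.trans (le_of_eq ?_)
    rw [hδ₁]; field_simp; norm_num
  set G : ℝ := 2 ^ k * g δ₁ with hG
  have hG0 : 0 ≤ G := mul_nonneg (by positivity) (hg0 _ hδ₁0)
  have hbound : ∀ δ, 0 < δ → δ ≤ δ₁ → g δ ≤ G := fun δ hδ hδ1 => by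
    have h1 := hsmall δ δ₁ hδ1 le_rfl
    have h2 := hscale δ δ₁ hδ hδ₁0 (by linarith)
    have h3 : (1 / 2 : ℝ) ^ k * g δ ≤ g δ₁ := le_trans (mul_le_mul_of_nonneg_right
      (pow_le_pow_left₀ (by norm_num) (by linarith) k) (hg0 δ hδ)) h2
    rw [one_div, inv_pow, inv_mul_le_iff₀ (by positivity)] at h3
    exact h3
  set Q : ℝ := k * kap * G with hQ
  have hQ0 : 0 ≤ Q := by positivity
  have hdiff : ∀ δ δ', 0 < δ → δ ≤ δ₁ → 0 < δ' → δ' ≤ δ₁ → g δ - g δ' ≤ Q * (δ + δ') := by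
    intro δ δ' hδ hδ1 hδ' hδ1'
    have h1 := hsmall δ δ' hδ1 hδ1'
    have h2 := hscale δ δ' hδ hδ' (by linarith)
    have h3 : 1 - k * (kap * (δ + δ')) ≤ (1 - kap * (δ + δ')) ^ k := by
      have := one_add_mul_le_pow (a := -(kap * (δ + δ'))) (by linarith) k
      rw [← sub_eq_add_neg] at this
      linarith
    have h4 := mul_le_mul_of_nonneg_right h3 (hg0 δ hδ)
    have h5 : k * (kap * (δ + δ')) * g δ ≤ k * (kap * (δ + δ')) * G :=
      mul_le_mul_of_nonneg_left (hbound δ hδ hδ1) (by positivity)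
    rw [hQ]
    nlinarith
  have habs : ∀ δ δ', 0 < δ → δ ≤ δ₁ → 0 < δ' → δ' ≤ δ₁ → |g δ - g δ'| ≤ Q * (δ + δ') :=
    fun δ δ' hδ hδ1 hδ' hδ1' => abs_sub_le_iff.2 ⟨hdiff δ δ' hδ hδ1 hδ' hδ1',
      by rw [add_comm δ]; exact hdiff δ' δ hδ' hδ1' hδ hδ1⟩
  obtain ⟨c, hc⟩ : ∃ c, Tendsto g (𝓝[>] 0) (𝓝 c) := by
    rw [← cauchy_map_iff_exists_tendsto, Metric.cauchy_iff]
    refine ⟨inferInstance, fun ε hε => ?_⟩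
    set η : ℝ := min δ₁ (ε / (4 * (Q + 1))) with hη
    have hη0 : 0 < η := lt_min hδ₁0 (by positivity)
    refine ⟨g '' Set.Ioc 0 η, image_mem_map (Ioc_mem_nhdsGT hη0), ?_⟩
    rintro _ ⟨x, hx, rfl⟩ _ ⟨y, hy, rfl⟩
    rw [Real.dist_eq]
    refine (habs x y hx.1 (hx.2.trans (min_le_left _ _)) hy.1
      (hy.2.trans (min_le_left _ _))).trans_lt ?_
    have h1 : x + y ≤ 2 * (ε / (4 * (Q + 1))) := by
      have := hx.2.trans (min_le_right _ _)
      have := hy.2.trans (min_le_right _ _)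
      linarith
    calc Q * (x + y) ≤ Q * (2 * (ε / (4 * (Q + 1)))) := by gcongr
      _ = (Q / (Q + 1)) * (ε / 2) := by field_simp; ring
      _ ≤ 1 * (ε / 2) := by
        gcongr
        rw [div_le_one (by positivity)]; linarith
      _ < ε := by linarith
  have hlim : ∀ δ, 0 < δ → δ ≤ δ₁ → |g δ - c| ≤ Q * δ := fun δ hδ hδ1 => by
    have h1 : Tendsto (fun δ' => |g δ - g δ'|) (𝓝[>] 0) (𝓝 |g δ - c|) :=
      (tendsto_const_nhds.sub hc).abs
    have h2 : Tendsto (fun δ' => Q * (δ + δ')) (𝓝[>] 0) (𝓝 (Q * (δ + 0))) :=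
      ((continuous_const.mul (continuous_const.add continuous_id)).tendsto _).mono_left
        nhdsWithin_le_nhds
    rw [add_zero] at h2
    refine le_of_tendsto_of_tendsto h1 h2 ?_
    filter_upwards [Ioc_mem_nhdsGT hδ₁0] with δ' hδ'
    exact habs δ δ' hδ hδ1 hδ'.1 hδ'.2
  -- `Q` serves for `δ ≤ δ₁`. The other two summands absorb the bounded function `V` and the term `c
  -- * δ ^ N` for `δ > δ₁`.
  refine ⟨c, Q + M / δ₁ ^ (N + 1) + |c| / δ₁, fun δ hδ => ?_⟩
  rcases le_or_gt δ δ₁ with hδ1 | hδ1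
  · have h1 := hlim δ hδ hδ1
    have h2 : V δ - c * δ ^ N = (g δ - c) * δ ^ N := by
      rw [hg]; field_simp
    rw [h2, abs_mul, abs_of_pos (pow_pos hδ N)]
    calc _ ≤ Q * δ * δ ^ N := by gcongr
      _ = Q * δ ^ (N + 1) := by ring
      _ ≤ _ := by
        gcongr
        have : 0 ≤ M / δ₁ ^ (N + 1) := by positivity
        have : 0 ≤ |c| / δ₁ := by positivity
        linarith
  · have h1 : V δ ≤ M / δ₁ ^ (N + 1) * δ ^ (N + 1) := by
      refine (hVM δ).trans ?_
      rw [div_mul_eq_mul_div, le_div_iff₀ (by positivity)]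
      exact mul_le_mul_of_nonneg_left (pow_le_pow_left₀ hδ₁0.le hδ1.le _) hM0
    have h2 : |c| * δ ^ N ≤ |c| / δ₁ * δ ^ (N + 1) := by
      rw [div_mul_eq_mul_div, le_div_iff₀ hδ₁0, pow_succ, mul_assoc]
      have : δ ^ N * δ₁ ≤ δ ^ N * δ := by gcongr
      exact mul_le_mul_of_nonneg_left this (abs_nonneg c)
    calc _ ≤ |V δ| + |c * δ ^ N| := abs_sub _ _
      _ = V δ + |c| * δ ^ N := by
        rw [abs_of_nonneg (hV0 δ), abs_mul, abs_of_pos (pow_pos hδ N)]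
      _ ≤ M / δ₁ ^ (N + 1) * δ ^ (N + 1) + |c| / δ₁ * δ ^ (N + 1) := add_le_add h1 h2
      _ ≤ _ := by
        rw [← add_mul]
        gcongr
        linarith

end ScalingFunction

/-! The polytope `{u | ∀ j, ℓ j u ≤ b j}` and its face on which `ψ` takes the maximal value `a`. -/

section Polyhedron

variable {s : ℕ} {J : Type*} {ℓ : J → (Fin s → ℝ) →ₗ[ℝ] ℝ} {b : J → ℝ}
  {ψ : (Fin s → ℝ) →ₗ[ℝ] ℝ} {a : ℝ}

/-- Yields a point in the relative interior of the face: only the constraints that are tight on the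
whole face are tight at `z`. Constraints are treated one at a time. If some point of the face has
slack, the midpoint with it has slack there and keeps all slack gained before. -/
theorem exists_relint_point [Finite J] (hne : ∃ u, (∀ j, ℓ j u ≤ b j) ∧ ψ u = a) :
    ∃ z, ((∀ j, ℓ j z ≤ b j) ∧ ψ z = a) ∧
      ∀ j, ℓ j z = b j → ∀ u, (∀ j, ℓ j u ≤ b j) → ψ u = a → ℓ j u = b j := by
  classical
  have := Fintype.ofFinite J
  suffices H : ∀ T : Finset J, ∃ z, ((∀ j, ℓ j z ≤ b j) ∧ ψ z = a) ∧
      ∀ j ∈ T, ℓ j z = b j → ∀ u, (∀ j, ℓ j u ≤ b j) → ψ u = a → ℓ j u = b j by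
    obtain ⟨z, hz, h⟩ := H Finset.univ
    exact ⟨z, hz, fun j => h j (Finset.mem_univ j)⟩
  intro T
  induction T using Finset.induction_on with
  | empty =>
    obtain ⟨u, hu⟩ := hne
    exact ⟨u, hu, by simp⟩
  | insert j₀ T hj₀ ih =>
    obtain ⟨z, hz, h⟩ := ih
    by_cases hcase : ∀ u, (∀ j, ℓ j u ≤ b j) → ψ u = a → ℓ j₀ u = b j₀
    · refine ⟨z, hz, fun j hj hjz => ?_⟩
      rcases Finset.mem_insert.1 hj with rfl | hj
      · exact hcase
      · exact h j hj hjz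
    · push Not at hcase
      obtain ⟨w, hw, hwa, hwne⟩ := hcase
      have hval : ∀ f : (Fin s → ℝ) →ₗ[ℝ] ℝ,
          f ((1 / 2 : ℝ) • z + (1 / 2 : ℝ) • w) = 1 / 2 * f z + 1 / 2 * f w := fun f => by simp
      refine ⟨(1 / 2 : ℝ) • z + (1 / 2 : ℝ) • w, ⟨fun j => ?_, ?_⟩, fun j hj hjz => ?_⟩
      · rw [hval]; linarith [hz.1 j, hw j]
      · rw [hval, hz.2, hwa]; ring
      · rw [hval] at hjz
        have h1 := hz.1 j
        have h2 := hw j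
        rcases Finset.mem_insert.1 hj with rfl | hj
        · exact absurd (by linarith) hwne
        · exact h j hj (by linarith)

variable {z : Fin s → ℝ}

theorem exists_small_step [Finite J] (hz : ∀ j, ℓ j z ≤ b j) {v : Fin s → ℝ}
    (hv : ∀ j, ℓ j z = b j → ℓ j v ≤ 0) : ∃ ε : ℝ, 0 < ε ∧ ∀ j, ℓ j (z + ε • v) ≤ b j := by
  have h : ∀ᶠ ε : ℝ in 𝓝[>] 0, ∀ j, ℓ j (z + ε • v) ≤ b j := by
    rw [eventually_all]
    intro j
    rcases (hz j).lt_or_eq with hlt | heq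
    · have : Tendsto (fun ε : ℝ => ℓ j (z + ε • v)) (𝓝[>] 0) (𝓝 (ℓ j z + 0 * ℓ j v)) := by
        simp only [map_add, map_smul, smul_eq_mul]
        exact ((continuous_const.add (continuous_id.mul continuous_const)).tendsto 0).mono_left
          nhdsWithin_le_nhds
      rw [zero_mul, add_zero] at this
      exact (this.eventually (gt_mem_nhds hlt)).mono fun _ h => h.le
    · filter_upwards [self_mem_nhdsWithin] with ε hε
      rw [map_add, map_smul, heq, smul_eq_mul]
      have := mul_nonpos_of_nonneg_of_nonpos (le_of_lt (Set.mem_Ioi.1 hε)) (hv j heq)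
      linarith
  obtain ⟨ε, h1, h2⟩ := (h.and self_mem_nhdsWithin).exists
  exact ⟨ε, h2, h1⟩

variable (ℓ b ψ z) in
/-- The direction space of a face, in terms of a point `z` in its relative interior. -/
def faceDirection : Submodule ℝ (Fin s → ℝ) where
  carrier := {v | ψ v = 0 ∧ ∀ j, ℓ j z = b j → ℓ j v = 0}
  add_mem' := fun ⟨h1, h2⟩ ⟨h3, h4⟩ =>
    ⟨by rw [map_add, h1, h3, add_zero], fun j hj => by rw [map_add, h2 j hj, h4 j hj, add_zero]⟩
  zero_mem' := by simp
  smul_mem' := fun c v ⟨h1, h2⟩ =>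
    ⟨by rw [map_smul, h1, smul_zero], fun j hj => by rw [map_smul, h2 j hj, smul_zero]⟩

theorem vectorSpan_face_eq [Finite J] (hz : (∀ j, ℓ j z ≤ b j) ∧ ψ z = a)
    (hrel : ∀ j, ℓ j z = b j → ∀ u, (∀ j, ℓ j u ≤ b j) → ψ u = a → ℓ j u = b j) :
    vectorSpan ℝ {u | (∀ j, ℓ j u ≤ b j) ∧ ψ u = a} = faceDirection ℓ b ψ z := by
  apply le_antisymm
  · rw [vectorSpan, Submodule.span_le]
    rintro _ ⟨u, hu, w, hw, rfl⟩
    simp only [vsub_eq_sub]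
    refine ⟨by rw [map_sub, hu.2, hw.2, sub_self], fun j hj => ?_⟩
    rw [map_sub, hrel j hj u hu.1 hu.2, hrel j hj w hw.1 hw.2, sub_self]
  · intro v hv
    obtain ⟨ε, hε, h⟩ := exists_small_step hz.1 (v := v) fun j hj => (hv.2 j hj).le
    have h1 : ε • v ∈ vectorSpan ℝ {u | (∀ j, ℓ j u ≤ b j) ∧ ψ u = a} := by
      have := vsub_mem_vectorSpan ℝ (s := {u | (∀ j, ℓ j u ≤ b j) ∧ ψ u = a})
        (p₁ := z + ε • v) (p₂ := z) ⟨h, by rw [map_add, map_smul, hv.1, hz.2]; simp⟩ hz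
      simpa using this
    have := Submodule.smul_mem _ ε⁻¹ h1
    rwa [smul_smul, inv_mul_cancel₀ hε.ne', one_smul] at this

/-- On the tangent cone at `z`, the component transversal to the face is controlled by the decrease
of `ψ`. On the compact set `K` of transversal unit directions `-ψ` is positive, since a direction
with `ψ = 0` would stay in the face for a small step and be fixed by `pr`. The inverse of the
minimum of `-ψ` is the constant. -/
theorem exists_norm_le_of_cone [Finite J] (hz : (∀ j, ℓ j z ≤ b j) ∧ ψ z = a)
    (hrel : ∀ j, ℓ j z = b j → ∀ u, (∀ j, ℓ j u ≤ b j) → ψ u = a → ℓ j u = b j)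
    (hmax : ∀ u, (∀ j, ℓ j u ≤ b j) → ψ u ≤ a)
    {pr : (Fin s → ℝ) →ₗ[ℝ] (Fin s → ℝ)} (hpr : LinearMap.IsProj (faceDirection ℓ b ψ z) pr) :
    ∃ kap : ℝ, 0 ≤ kap ∧ ∀ v, (∀ j, ℓ j z = b j → ℓ j v ≤ 0) → ‖v - pr v‖ ≤ kap * (-ψ v) := by
  set K : Set (Fin s → ℝ) :=
    {w | ‖w‖ = 1 ∧ pr w = 0 ∧ ∀ j, ℓ j z = b j → ℓ j w ≤ 0} with hK
  have hcont : ∀ f : (Fin s → ℝ) →ₗ[ℝ] ℝ, Continuous f := fun f => f.continuous_of_finiteDimensional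
  have hKc : IsCompact K := by
    refine (isCompact_sphere (0 : Fin s → ℝ) 1).of_isClosed_subset ?_ fun w hw => by
      simpa using hw.1
    refine (isClosed_eq continuous_norm continuous_const).inter
      ((isClosed_eq pr.continuous_of_finiteDimensional continuous_const).inter ?_)
    have : {w : Fin s → ℝ | ∀ j, ℓ j z = b j → ℓ j w ≤ 0} =
        ⋂ j, ⋂ _ : ℓ j z = b j, {w | ℓ j w ≤ 0} := by ext; simp
    change IsClosed {w : Fin s → ℝ | ∀ j, ℓ j z = b j → ℓ j w ≤ 0}
    rw [this]
    exact isClosed_iInter fun j => isClosed_iInter fun _ => isClosed_le (hcont _) continuous_const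
  have hpos : ∀ w ∈ K, 0 < -ψ w := by
    rintro w ⟨hw1, hw2, hw3⟩
    obtain ⟨ε, hε, h⟩ := exists_small_step hz.1 hw3
    have h1 := hmax _ h
    rw [map_add, map_smul, hz.2, smul_eq_mul] at h1
    have h2 : ψ w ≤ 0 := by
      by_contra hcon
      push Not at hcon
      have := mul_pos hε hcon
      linarith
    rcases h2.lt_or_eq with hlt | heq
    · linarith
    exfalso
    have hmem : w ∈ faceDirection ℓ b ψ z := by
      refine ⟨heq, fun j hj => ?_⟩
      have h3 := hrel j hj _ h (by rw [map_add, map_smul, hz.2, heq]; simp)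
      rw [map_add, map_smul, hj, smul_eq_mul, add_eq_left] at h3
      exact (mul_eq_zero.1 h3).resolve_left hε.ne'
    have := hpr.map_id w hmem
    rw [hw2] at this
    rw [← this] at hw1
    simp at hw1
  obtain ⟨c, hc0, hc⟩ : ∃ c : ℝ, 0 < c ∧ ∀ w ∈ K, c ≤ -ψ w := by
    rcases K.eq_empty_or_nonempty with he | hne
    · exact ⟨1, one_pos, by simp [he]⟩
    · obtain ⟨w, hw, hmin⟩ := hKc.exists_isMinOn hne (hcont (-ψ)).continuousOn
      exact ⟨-ψ w, hpos w hw, fun w' hw' => by simpa using hmin hw'⟩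
  refine ⟨c⁻¹, by positivity, fun v hv => ?_⟩
  have hprv := hpr.map_mem v
  have hℓ : ∀ j, ℓ j z = b j → ℓ j (v - pr v) ≤ 0 := fun j hj => by
    rw [map_sub, hprv.2 j hj, sub_zero]; exact hv j hj
  have hψ : ψ (v - pr v) = ψ v := by rw [map_sub, hprv.1, sub_zero]
  rcases eq_or_ne (v - pr v) 0 with h0 | h0
  · rw [h0] at hψ ⊢
    rw [← hψ]; simp
  · have hn : 0 < ‖v - pr v‖ := norm_pos_iff.2 h0
    have hmem : ‖v - pr v‖⁻¹ • (v - pr v) ∈ K := by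
      refine ⟨by rw [norm_smul, norm_inv, norm_norm, inv_mul_cancel₀ hn.ne'], ?_, fun j hj => ?_⟩
      · rw [map_smul, map_sub, hpr.map_id _ hprv, sub_self, smul_zero]
      · rw [map_smul, smul_eq_mul]
        exact mul_nonpos_of_nonneg_of_nonpos (by positivity) (hℓ j hj)
    have h1 := hc _ hmem
    rw [map_smul, hψ, smul_eq_mul, ← mul_neg, le_inv_mul_iff₀ hn] at h1
    rw [le_inv_mul_iff₀ hc0]
    linarith

/-- Scaling by `μ` along a face and by `δ' / δ` transversally maps the slice at distance `δ` from
the face to the slice at distance `δ'`. -/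
theorem exists_slice_scaling [Finite J] (hz : (∀ j, ℓ j z ≤ b j) ∧ ψ z = a)
    (hrel : ∀ j, ℓ j z = b j → ∀ u, (∀ j, ℓ j u ≤ b j) → ψ u = a → ℓ j u = b j)
    (hmax : ∀ u, (∀ j, ℓ j u ≤ b j) → ψ u ≤ a)
    {pr : (Fin s → ℝ) →ₗ[ℝ] (Fin s → ℝ)} (hpr : LinearMap.IsProj (faceDirection ℓ b ψ z) pr) :
    ∃ kap : ℝ, 0 < kap ∧ ∀ δ δ' : ℝ, 0 < δ → 0 < δ' → kap * (δ + δ') ≤ 1 →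
      ∀ u, (∀ j, ℓ j u ≤ b j) → ψ u = a - δ →
      (∀ j, ℓ j (z + ((δ' / δ) • (1 : (Fin s → ℝ) →ₗ[ℝ] (Fin s → ℝ)) +
          ((1 - kap * (δ + δ')) - δ' / δ) • pr) (u - z)) ≤ b j) ∧
        ψ (z + ((δ' / δ) • (1 : (Fin s → ℝ) →ₗ[ℝ] (Fin s → ℝ)) +
          ((1 - kap * (δ + δ')) - δ' / δ) • pr) (u - z)) = a - δ' := by
  have := Fintype.ofFinite J
  obtain ⟨κ₀, hκ₀, hcone⟩ := exists_norm_le_of_cone hz hrel hmax hpr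
  have hex : ∀ j, ∃ M : ℝ, 0 ≤ M ∧ ∀ v, |ℓ j v| ≤ M * ‖v‖ := fun j =>
    ⟨‖LinearMap.toContinuousLinearMap (ℓ j)‖, norm_nonneg _, fun v =>
      (LinearMap.toContinuousLinearMap (ℓ j)).le_opNorm v⟩
  choose M hM0 hM using hex
  -- Large enough that the contraction by `1 - kap * (δ + δ')` along the face creates, in every
  -- constraint not tight at `z`, the slack lost by the transversal scaling. A tight constraint has
  -- denominator 0 and adds 0 to the sum; it is handled separately. The summand 1 keeps `kap`
  -- positive.
  set kap : ℝ := 1 + ∑ j, M j * κ₀ / |b j - ℓ j z| with hkap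
  have hterm : ∀ j, 0 ≤ M j * κ₀ / |b j - ℓ j z| := fun j =>
    div_nonneg (mul_nonneg (hM0 j) hκ₀) (abs_nonneg _)
  have hkap0 : 0 < kap := by
    have := Finset.sum_nonneg fun j (_ : j ∈ Finset.univ) => hterm j
    linarith
  refine ⟨kap, hkap0, fun δ δ' hδ hδ' hk u hu hua => ?_⟩
  set lam := δ' / δ with hlam
  set m := 1 - kap * (δ + δ') with hm
  have hlam0 : 0 < lam := div_pos hδ' hδ
  have hm0 : 0 ≤ m := by rw [hm]; linarith
  have hm1 : m ≤ 1 := by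
    have : 0 < kap * (δ + δ') := by positivity
    rw [hm]; linarith
  have hlamδ : lam * δ = δ' := by rw [hlam]; field_simp
  set v := u - z with hv
  have hψv : ψ v = -δ := by rw [hv, map_sub, hua, hz.2]; ring
  have hprv := hpr.map_mem v
  -- The map multiplies `pr v` by `m` and the transversal part `v - pr v` by `lam`. It is written as
  -- multiplication by `m` plus a transversal correction.
  have hA : ∀ f : (Fin s → ℝ) →ₗ[ℝ] ℝ,
      f (z + (lam • (1 : (Fin s → ℝ) →ₗ[ℝ] (Fin s → ℝ)) + (m - lam) • pr) v) =
        f z + m * f v + (lam - m) * f (v - pr v) := fun f => by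
    simp only [LinearMap.add_apply, LinearMap.smul_apply, Module.End.one_apply, map_add, map_smul,
      smul_eq_mul, map_sub]
    ring
  have hvtight : ∀ j, ℓ j z = b j → ℓ j v ≤ 0 := fun j hj => by
    rw [hv, map_sub, hj]; linarith [hu j]
  refine ⟨fun j => ?_, ?_⟩
  · rw [hA]
    rcases (hz.1 j).lt_or_eq with hlt | heq
    · have hd : 0 < b j - ℓ j z := sub_pos.2 hlt
      have h1 : |ℓ j (v - pr v)| ≤ M j * κ₀ * δ := by
        refine (hM j _).trans ?_
        rw [mul_assoc]
        refine mul_le_mul_of_nonneg_left ?_ (hM0 j)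
        have := hcone v hvtight
        rwa [hψv, neg_neg] at this
      have h2 : (lam - m) * ℓ j (v - pr v) ≤ M j * κ₀ * (δ + δ') := by
        have h3 : |lam - m| * δ ≤ δ + δ' := by
          have : |lam - m| ≤ lam + 1 := by rw [abs_le]; constructor <;> linarith
          nlinarith
        calc _ ≤ |(lam - m) * ℓ j (v - pr v)| := le_abs_self _
          _ = |lam - m| * |ℓ j (v - pr v)| := abs_mul _ _
          _ ≤ |lam - m| * (M j * κ₀ * δ) := by gcongr
          _ = M j * κ₀ * (|lam - m| * δ) := by ring
          _ ≤ _ := mul_le_mul_of_nonneg_left h3 (mul_nonneg (hM0 j) hκ₀)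
      have h4 : M j * κ₀ ≤ kap * (b j - ℓ j z) := by
        have h5 : M j * κ₀ / |b j - ℓ j z| ≤ kap := by
          have := Finset.single_le_sum (f := fun j => M j * κ₀ / |b j - ℓ j z|)
            (fun j _ => hterm j) (Finset.mem_univ j)
          linarith
        rwa [abs_of_pos hd, div_le_iff₀ hd] at h5
      have h6 : ℓ j v ≤ b j - ℓ j z := by rw [hv, map_sub]; linarith [hu j]
      have h7 : m * ℓ j v ≤ m * (b j - ℓ j z) := mul_le_mul_of_nonneg_left h6 hm0
      have h8 : M j * κ₀ * (δ + δ') ≤ kap * (b j - ℓ j z) * (δ + δ') :=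
        mul_le_mul_of_nonneg_right h4 (by positivity)
      rw [hm] at h7 ⊢
      rw [hm] at h2
      nlinarith
    · have h1 : ℓ j (v - pr v) = ℓ j v := by rw [map_sub (ℓ j) v, hprv.2 j heq, sub_zero]
      have h2 := mul_nonpos_of_nonneg_of_nonpos hlam0.le (hvtight j heq)
      rw [h1, heq]
      linarith
  · have h1 : ψ (v - pr v) = ψ v := by rw [map_sub ψ v, hprv.1, sub_zero]
    rw [hA, h1, hψv, hz.2, ← hlamδ]; ring

end Polyhedron

/-! ### Measures of slices in coordinates omitting one variable -/

section WeightForm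

variable {s : ℕ} (ϖ : Fin s → ℝ) (i₀ : Fin s)

/-- The linear form `u ↦ ∑ ϖ_i u_i`. -/
noncomputable def weightForm : (Fin s → ℝ) →ₗ[ℝ] ℝ := ∑ i, ϖ i • LinearMap.proj i

theorem weightForm_apply (u : Fin s → ℝ) : weightForm ϖ u = ∑ i, ϖ i * u i := by
  simp [weightForm]

/-- The projection that forgets the coordinate `i₀`. -/
def forgetCoord : (Fin s → ℝ) →ₗ[ℝ] ({i // i ≠ i₀} → ℝ) := LinearMap.funLeft ℝ ℝ Subtype.val

theorem forgetCoord_apply (u : Fin s → ℝ) (i : {i // i ≠ i₀}) : forgetCoord i₀ u i = u i := rfl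

theorem weightForm_eq_add (u : Fin s → ℝ) :
    weightForm ϖ u = ϖ i₀ * u i₀ + ∑ i : {i // i ≠ i₀}, ϖ i * u i := by
  rw [weightForm_apply, ← Finset.add_sum_erase _ _ (Finset.mem_univ i₀)]
  congr 1
  exact Finset.sum_subtype _ (by simp) _

/-- The inverse of `forgetCoord` on the kernel of `weightForm`. -/
noncomputable def liftCoord : ({i // i ≠ i₀} → ℝ) →ₗ[ℝ] (Fin s → ℝ) where
  toFun x i := if h : i = i₀ then -(∑ j : {i // i ≠ i₀}, ϖ j * x j) / ϖ i₀ else x ⟨i, h⟩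
  map_add' x y := by
    ext i
    simp only [Pi.add_apply]
    split_ifs
    · simp only [mul_add, Finset.sum_add_distrib]; ring
    · rfl
  map_smul' c x := by
    ext i
    simp only [Pi.smul_apply, RingHom.id_apply, smul_eq_mul]
    split_ifs
    · simp only [mul_left_comm _ c, ← Finset.mul_sum]; ring
    · rfl

variable {ϖ} {i₀}

theorem forgetCoord_liftCoord (x : {i // i ≠ i₀} → ℝ) :
    forgetCoord i₀ (liftCoord ϖ i₀ x) = x := by
  ext i
  simp [forgetCoord_apply, liftCoord, i.2]

theorem liftCoord_forgetCoord (h : ϖ i₀ ≠ 0) {v : Fin s → ℝ} (hv : weightForm ϖ v = 0) :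
    liftCoord ϖ i₀ (forgetCoord i₀ v) = v := by
  ext i
  rw [weightForm_eq_add ϖ i₀] at hv
  simp only [liftCoord, LinearMap.coe_mk, AddHom.coe_mk, forgetCoord_apply]
  split_ifs with hi
  · subst hi
    field_simp
    linarith
  · rfl

theorem card_ne (i₀ : Fin s) : Fintype.card {i // i ≠ i₀} = s - 1 := by
  simp

/-- If an affine map with linear part preserving the kernel of `weightForm` maps a subset of a
hyperplane into another set, the measures in the coordinates `≠ i₀` compare. -/
theorem volume_forgetCoord_le (h : ϖ i₀ ≠ 0) {pr : (Fin s → ℝ) →ₗ[ℝ] (Fin s → ℝ)}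
    {W : Submodule ℝ (Fin s → ℝ)} (hpr : LinearMap.IsProj W pr)
    (hW : ∀ v ∈ W, weightForm ϖ v = 0) {m lam t : ℝ} (hm : 0 ≤ m) (hlam : 0 ≤ lam)
    {z : Fin s → ℝ} {S S' : Set (Fin s → ℝ)} (hS : ∀ u ∈ S, weightForm ϖ u = t)
    (hSS' : ∀ u ∈ S, z + (lam • (1 : (Fin s → ℝ) →ₗ[ℝ] (Fin s → ℝ)) + (m - lam) • pr) (u - z) ∈ S') :
    ENNReal.ofReal (m ^ Module.finrank ℝ W * lam ^ (s - 1 - Module.finrank ℝ W)) *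
      volume (forgetCoord i₀ '' S) ≤ volume (forgetCoord i₀ '' S') := by
  rcases S.eq_empty_or_nonempty with rfl | ⟨u₀, hu₀⟩
  · simp
  set A := lam • (1 : (Fin s → ℝ) →ₗ[ℝ] (Fin s → ℝ)) + (m - lam) • pr with hA
  -- This is `pr` transported to the coordinates other than `i₀`. As `W` lies in the kernel of
  -- `weightForm`, where `forgetCoord` is injective, `f` is again a projection of rank `dim W`,
  -- which gives the determinant.
  set f : ({i // i ≠ i₀} → ℝ) →ₗ[ℝ] ({i // i ≠ i₀} → ℝ) :=
    forgetCoord i₀ ∘ₗ pr ∘ₗ liftCoord ϖ i₀ with hf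
  have hfid : IsIdempotentElem f := by
    refine LinearMap.ext fun x => ?_
    simp only [hf, Module.End.mul_apply, LinearMap.comp_apply]
    have hmem := hpr.map_mem (liftCoord ϖ i₀ x)
    rw [liftCoord_forgetCoord h (hW _ hmem), hpr.map_id _ hmem]
  have hrange : LinearMap.range f = LinearMap.range (forgetCoord i₀ ∘ₗ W.subtype) := by
    ext y
    constructor
    · rintro ⟨x, rfl⟩
      exact ⟨⟨_, hpr.map_mem (liftCoord ϖ i₀ x)⟩, rfl⟩
    · rintro ⟨⟨w, hw⟩, rfl⟩
      refine ⟨forgetCoord i₀ w, ?_⟩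
      simp only [hf, LinearMap.comp_apply, Submodule.subtype_apply]
      rw [liftCoord_forgetCoord h (hW w hw), hpr.map_id w hw]
  have hfin : Module.finrank ℝ (LinearMap.range f) = Module.finrank ℝ W := by
    rw [hrange]
    refine LinearMap.finrank_range_of_inj ?_
    rintro ⟨w, hw⟩ ⟨w', hw'⟩ hww
    simp only [LinearMap.comp_apply, Submodule.subtype_apply] at hww
    rw [Subtype.mk.injEq, ← liftCoord_forgetCoord h (hW w hw), hww,
      liftCoord_forgetCoord h (hW w' hw')]
  have hA' : ∀ x, forgetCoord i₀ (A (liftCoord ϖ i₀ x)) = (lam • 1 + (m - lam) • f) x := fun x => by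
    simp [hA, hf, forgetCoord_liftCoord]
  have hdet : LinearMap.det (lam • (1 : ({i // i ≠ i₀} → ℝ) →ₗ[ℝ] _) + (m - lam) • f) =
      m ^ Module.finrank ℝ W * lam ^ (s - 1 - Module.finrank ℝ W) := by
    rw [LinearMap.det_smul_one_add_smul_of_isIdempotentElem hfid, hfin,
      Module.finrank_fintype_fun_eq_card, card_ne]
  set A' := lam • (1 : ({i // i ≠ i₀} → ℝ) →ₗ[ℝ] _) + (m - lam) • f with hA'def
  set y := forgetCoord i₀ (z + A (u₀ - z)) with hy
  set x₀ := forgetCoord i₀ u₀ with hx₀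
  have hsub : (fun x => y + x) '' (A' '' ((fun x => -x₀ + x) '' (forgetCoord i₀ '' S))) ⊆
      forgetCoord i₀ '' S' := by
    rintro _ ⟨_, ⟨_, ⟨_, ⟨u, hu, rfl⟩, rfl⟩, rfl⟩, rfl⟩
    refine ⟨_, hSS' u hu, ?_⟩
    have h1 : u - u₀ = liftCoord ϖ i₀ (forgetCoord i₀ (u - u₀)) :=
      (liftCoord_forgetCoord h (by rw [map_sub, hS u hu, hS u₀ hu₀, sub_self])).symm
    have h2 : z + A (u - z) = z + A (u₀ - z) + A (u - u₀) := by
      rw [add_assoc, ← map_add]; congr 2; abel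
    rw [h2, map_add, h1, hA', hx₀]
    simp only
    rw [neg_add_eq_sub, ← map_sub]
  calc _ = volume ((fun x => y + x) '' (A' '' ((fun x => -x₀ + x) '' (forgetCoord i₀ '' S)))) := by
        rw [Set.image_add_left, measure_preimage_add, Measure.addHaar_image_linearMap, hdet,
          abs_of_nonneg (by positivity), Set.image_add_left, measure_preimage_add]
    _ ≤ _ := measure_mono hsub

end WeightForm

section Asymptotics

variable {s : ℕ} {J : Type*} [Finite J] {ℓ : J → (Fin s → ℝ) →ₗ[ℝ] ℝ} {b : J → ℝ}
  {ϖ : Fin s → ℝ} {a : ℝ}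

/-- The volume of the slices of a polytope parallel to a face of dimension `k`. -/
theorem exists_sliceVolume_asymptotic (hϖ : ∀ i, ϖ i ≠ 0)
    (hbdd : Bornology.IsBounded {u | ∀ j, ℓ j u ≤ b j})
    (hne : ∃ u, (∀ j, ℓ j u ≤ b j) ∧ weightForm ϖ u = a)
    (hmax : ∀ u, (∀ j, ℓ j u ≤ b j) → weightForm ϖ u ≤ a) (i₀ : Fin s) :
    ∃ c C : ℝ, ∀ δ : ℝ, 0 < δ →
      |(volume (forgetCoord i₀ '' {u | (∀ j, ℓ j u ≤ b j) ∧ weightForm ϖ u = a - δ})).toReal -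
        c * δ ^ (s - 1 - Module.finrank ℝ
          (vectorSpan ℝ {u | (∀ j, ℓ j u ≤ b j) ∧ weightForm ϖ u = a}))| ≤
      C * δ ^ (s - 1 - Module.finrank ℝ
          (vectorSpan ℝ {u | (∀ j, ℓ j u ≤ b j) ∧ weightForm ϖ u = a}) + 1) := by
  obtain ⟨z, hz, hrel⟩ := exists_relint_point hne
  rw [vectorSpan_face_eq hz hrel]
  set W := faceDirection ℓ b (weightForm ϖ) z with hW
  obtain ⟨W', hWW'⟩ := W.exists_isCompl
  obtain ⟨pr, hpr⟩ : ∃ pr : (Fin s → ℝ) →ₗ[ℝ] (Fin s → ℝ), LinearMap.IsProj W pr :=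
    ⟨W.subtype ∘ₗ Submodule.projectionOnto W W' hWW', ⟨fun v => Subtype.prop _, fun v hv => by
      have := Submodule.projectionOnto_apply_left hWW' ⟨v, hv⟩
      rw [LinearMap.comp_apply, this]; rfl⟩⟩
  obtain ⟨kap, hkap, hscale⟩ := exists_slice_scaling hz hrel hmax hpr
  have hbdd' : Bornology.IsBounded (forgetCoord i₀ '' {u | ∀ j, ℓ j u ≤ b j}) := by
    have := (LinearMap.toContinuousLinearMap (forgetCoord i₀)).lipschitz.isBounded_image hbdd
    exact this
  have hfin := hbdd'.measure_lt_top (μ := volume)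
  have hmono : ∀ t, volume (forgetCoord i₀ '' {u | (∀ j, ℓ j u ≤ b j) ∧ weightForm ϖ u = t}) ≤
      volume (forgetCoord i₀ '' {u | ∀ j, ℓ j u ≤ b j}) := fun t =>
    measure_mono (Set.image_mono fun u hu => hu.1)
  refine exists_asymptotic_of_scaling (k := Module.finrank ℝ W) hkap
    (fun δ => ENNReal.toReal_nonneg)
    (fun δ => ENNReal.toReal_mono hfin.ne (hmono (a - δ))) fun δ δ' hδ hδ' hk => ?_
  have h := volume_forgetCoord_le (hϖ i₀) hpr (fun v hv => hv.1)
    (m := 1 - kap * (δ + δ')) (lam := δ' / δ) (by linarith) (by positivity)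
    (S := {u | (∀ j, ℓ j u ≤ b j) ∧ weightForm ϖ u = a - δ})
    (S' := {u | (∀ j, ℓ j u ≤ b j) ∧ weightForm ϖ u = a - δ'}) (z := z)
    (fun u hu => hu.2) (fun u hu => hscale δ δ' hδ hδ' hk u hu.1 hu.2)
  have h2 := ENNReal.toReal_mono ((hmono (a - δ')).trans_lt hfin).ne h
  rw [ENNReal.toReal_mul, ENNReal.toReal_ofReal] at h2
  · exact h2
  · have : 0 ≤ 1 - kap * (δ + δ') := by linarith
    positivity

end Asymptotics

/-! ### Fubini along slices and the Laplace transform -/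

section Fubini

variable {s : ℕ} (i₀ : Fin s)

/-- The vector with coordinate `t` at `i₀` and the other coordinates given by `x`. -/
def insertCoord (t : ℝ) (x : {i // i ≠ i₀} → ℝ) : Fin s → ℝ :=
  fun i => if h : i = i₀ then t else x ⟨i, h⟩

theorem measurable_insertCoord :
    Measurable fun p : ℝ × ({i // i ≠ i₀} → ℝ) => insertCoord i₀ p.1 p.2 := by
  refine measurable_pi_lambda _ fun i => ?_
  by_cases h : i = i₀
  · simpa [insertCoord, h] using measurable_fst
  · simp only [insertCoord, h, dif_neg, not_false_eq_true]
    exact (measurable_pi_apply _).comp measurable_snd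

theorem lintegral_insertCoord {G : (Fin s → ℝ) → ENNReal} (hG : Measurable G) :
    ∫⁻ u, G u = ∫⁻ x : {i // i ≠ i₀} → ℝ, ∫⁻ t : ℝ, G (insertCoord i₀ t x) := by
  let U : Unique {i // ¬ i ≠ i₀} :=
    ⟨⟨⟨i₀, by simp⟩⟩, fun x => Subtype.ext (not_not.1 x.2)⟩
  let e := MeasurableEquiv.piEquivPiSubtypeProd (fun _ : Fin s => ℝ) (fun i => i ≠ i₀)
  have h1 : MeasurePreserving e.symm :=
    (volume_preserving_piEquivPiSubtypeProd (fun _ : Fin s => ℝ) (fun i => i ≠ i₀)).symm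
  have h3 : MeasurePreserving (MeasurableEquiv.funUnique {i // ¬ i ≠ i₀} ℝ).symm := by
    convert (volume_preserving_funUnique {i // ¬ i ≠ i₀} ℝ).symm <;> rfl
  rw [MeasurePreserving.lintegral_map_equiv G e.symm h1, Measure.volume_eq_prod,
    lintegral_prod (fun p => G (e.symm p)) (hG.comp e.symm.measurable).aemeasurable]
  refine lintegral_congr fun x => ?_
  rw [MeasurePreserving.lintegral_map_equiv _ _ h3]
  refine lintegral_congr fun t => congrArg G ?_
  ext i
  by_cases h : i = i₀
  · simp [e, MeasurableEquiv.piEquivPiSubtypeProd, Equiv.piEquivPiSubtypeProd, insertCoord, h,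
      MeasurableEquiv.funUnique]
  · simp [e, MeasurableEquiv.piEquivPiSubtypeProd, Equiv.piEquivPiSubtypeProd, insertCoord, h]

theorem ofReal_mul_lintegral_affine {g : ℝ → ENNReal} (hg : Measurable g) {w : ℝ} (hw : 0 < w)
    (c : ℝ) : ENNReal.ofReal w * ∫⁻ t, g t = ∫⁻ δ, g ((c - δ) / w) := by
  rw [lintegral_sub_left_eq_self (fun y => g (y / w)) c]
  have h := Real.map_volume_mul_left (inv_ne_zero hw.ne')
  rw [inv_inv, abs_of_pos hw] at h
  calc _ = ∫⁻ t, g t ∂(ENNReal.ofReal w • volume) := by rw [lintegral_smul_measure]; rfl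
    _ = _ := by
      rw [← h, lintegral_map hg (measurable_const_mul _)]
      exact lintegral_congr fun y => by rw [div_eq_inv_mul]

variable {i₀} {ϖ : Fin s → ℝ} {a : ℝ} {P : Set (Fin s → ℝ)}

/-- The point with given coordinates `≠ i₀` and weight `a - δ`. -/
noncomputable def slicePoint (ϖ : Fin s → ℝ) (a : ℝ) (i₀ : Fin s) (δ : ℝ)
    (x : {i // i ≠ i₀} → ℝ) : Fin s → ℝ :=
  insertCoord i₀ ((a - (∑ i : {i // i ≠ i₀}, ϖ i * x i) - δ) / ϖ i₀) x

theorem weightForm_slicePoint (hϖ : ϖ i₀ ≠ 0) (δ : ℝ) (x : {i // i ≠ i₀} → ℝ) :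
    weightForm ϖ (slicePoint ϖ a i₀ δ x) = a - δ := by
  have h1 : ∀ i : {i // i ≠ i₀}, slicePoint ϖ a i₀ δ x i = x i := fun i => by
    simp [slicePoint, insertCoord, i.2]
  rw [weightForm_eq_add ϖ i₀]
  simp_rw [h1]
  simp only [slicePoint, insertCoord, dif_pos]
  field_simp
  ring

theorem forgetCoord_image_slice (hϖ : ϖ i₀ ≠ 0) (δ : ℝ) :
    forgetCoord i₀ '' {u | u ∈ P ∧ weightForm ϖ u = a - δ} =
      {x | slicePoint ϖ a i₀ δ x ∈ P} := by
  have h1 : ∀ x, forgetCoord i₀ (slicePoint ϖ a i₀ δ x) = x := fun x => by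
    ext i; simp [forgetCoord_apply, slicePoint, insertCoord, i.2]
  ext x
  constructor
  · rintro ⟨u, ⟨hu, hψ⟩, rfl⟩
    have : slicePoint ϖ a i₀ δ (forgetCoord i₀ u) = u := by
      ext i
      rw [weightForm_eq_add ϖ i₀] at hψ
      simp only [slicePoint, insertCoord, forgetCoord_apply]
      split_ifs with hi
      · subst hi
        field_simp
        linarith
      · rfl
    simpa [this] using hu
  · intro hx
    exact ⟨_, ⟨hx, weightForm_slicePoint hϖ δ x⟩, h1 x⟩

theorem measurable_slicePoint :
    Measurable fun p : ℝ × ({i // i ≠ i₀} → ℝ) => slicePoint ϖ a i₀ p.1 p.2 := by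
  have h : Measurable fun p : ℝ × ({i // i ≠ i₀} → ℝ) =>
      (((a - (∑ i : {i // i ≠ i₀}, ϖ i * p.2 i) - p.1) / ϖ i₀, p.2) :
        ℝ × ({i // i ≠ i₀} → ℝ)) := by fun_prop
  exact (measurable_insertCoord i₀).comp h

theorem measurable_slicePoint_swap :
    Measurable fun p : ({i // i ≠ i₀} → ℝ) × ℝ => slicePoint ϖ a i₀ p.2 p.1 := by
  have h : Measurable fun p : ({i // i ≠ i₀} → ℝ) × ℝ =>
      (((a - (∑ i : {i // i ≠ i₀}, ϖ i * p.1 i) - p.2) / ϖ i₀, p.1) :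
        ℝ × ({i // i ≠ i₀} → ℝ)) := by fun_prop
  exact (measurable_insertCoord i₀).comp h

theorem measurable_volume_slice (hP : MeasurableSet P) (hϖ : ϖ i₀ ≠ 0) :
    Measurable fun δ : ℝ => volume (forgetCoord i₀ '' {u | u ∈ P ∧ weightForm ϖ u = a - δ}) := by
  simp_rw [forgetCoord_image_slice hϖ]
  exact measurable_measure_prodMk_left (measurable_slicePoint hP)

/-- Integration over a set slice by slice. -/
theorem ofReal_mul_setLIntegral_eq (hP : MeasurableSet P) (hϖ : 0 < ϖ i₀) {h : ℝ → ENNReal}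
    (hh : Measurable h) :
    ENNReal.ofReal (ϖ i₀) * ∫⁻ u in P, h (a - weightForm ϖ u) =
      ∫⁻ δ, h δ * volume (forgetCoord i₀ '' {u | u ∈ P ∧ weightForm ϖ u = a - δ}) := by
  have hψ : Measurable (weightForm ϖ) := by
    have : (weightForm ϖ : (Fin s → ℝ) → ℝ) = fun u => ∑ i, ϖ i * u i :=
      funext (weightForm_apply ϖ)
    rw [this]; fun_prop
  have hG : Measurable (P.indicator fun u => h (a - weightForm ϖ u)) :=
    (hh.comp (measurable_const.sub hψ)).indicator hP
  rw [← lintegral_indicator hP, lintegral_insertCoord i₀ hG]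
  have hmeas : Measurable fun x : {i // i ≠ i₀} → ℝ => ∫⁻ t : ℝ,
      P.indicator (fun u => h (a - weightForm ϖ u)) (insertCoord i₀ t x) :=
    Measurable.lintegral_prod_left' (hG.comp (measurable_insertCoord i₀))
  rw [← lintegral_const_mul _ hmeas]
  have h1 : ∀ x : {i // i ≠ i₀} → ℝ, ENNReal.ofReal (ϖ i₀) * ∫⁻ t : ℝ,
      P.indicator (fun u => h (a - weightForm ϖ u)) (insertCoord i₀ t x) =
      ∫⁻ δ, P.indicator (fun u => h (a - weightForm ϖ u)) (slicePoint ϖ a i₀ δ x) := fun x => by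
    have hx : Measurable fun t : ℝ => insertCoord i₀ t x :=
      (measurable_insertCoord i₀).comp (measurable_id.prodMk measurable_const)
    exact ofReal_mul_lintegral_affine (hG.comp hx) hϖ (a - ∑ i : {i // i ≠ i₀}, ϖ i * x i)
  simp_rw [h1]
  rw [lintegral_lintegral_swap]
  · refine lintegral_congr fun δ => ?_
    rw [forgetCoord_image_slice hϖ.ne']
    have hm : MeasurableSet {x : {i // i ≠ i₀} → ℝ | slicePoint ϖ a i₀ δ x ∈ P} :=
      (measurable_slicePoint.comp (measurable_const.prodMk measurable_id)) hP
    rw [← setLIntegral_const, ← lintegral_indicator hm]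
    refine lintegral_congr fun x => ?_
    by_cases hx : slicePoint ϖ a i₀ δ x ∈ P
    · rw [Set.indicator_of_mem hx, Set.indicator_of_mem (by exact hx),
        weightForm_slicePoint hϖ.ne', sub_sub_cancel]
    · rw [Set.indicator_of_notMem hx, Set.indicator_of_notMem (by exact hx)]
  · exact (hG.comp measurable_slicePoint_swap).aemeasurable

end Fubini

section Laplace

theorem integral_pow_mul_exp_neg (N : ℕ) {lam : ℝ} (hlam : 0 < lam) :
    ∫ δ in Set.Ioi (0 : ℝ), δ ^ N * Real.exp (-(lam * δ)) = N.factorial / lam ^ (N + 1) := by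
  have h := Real.integral_rpow_mul_exp_neg_mul_Ioi (a := N + 1) (r := lam) (by positivity) hlam
  rw [Real.Gamma_nat_eq_factorial, add_sub_cancel_right] at h
  simp_rw [Real.rpow_natCast] at h
  rw [h]
  have : (1 / lam) ^ ((N : ℝ) + 1) = (1 / lam) ^ (N + 1) := by
    rw [← Nat.cast_succ, Real.rpow_natCast]
  rw [this, one_div, inv_pow]
  field_simp

theorem integrableOn_pow_mul_exp_neg (N : ℕ) {lam : ℝ} (hlam : 0 < lam) :
    IntegrableOn (fun δ => δ ^ N * Real.exp (-(lam * δ))) (Set.Ioi (0 : ℝ)) := by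
  -- The Bochner integral of a nonintegrable function is 0 by convention, which would contradict the
  -- positive value of the integral.
  by_contra hcon
  have h := integral_pow_mul_exp_neg N hlam
  rw [integral_undef hcon] at h
  have : (0 : ℝ) < N.factorial / lam ^ (N + 1) := by positivity
  linarith

/-- The Laplace transform of a function asymptotic to `c * δ ^ N`. -/
theorem abs_laplace_sub_le {V : ℝ → ℝ} (hVm : Measurable V) {c C : ℝ} {N : ℕ}
    (hV : ∀ δ, 0 < δ → |V δ - c * δ ^ N| ≤ C * δ ^ (N + 1)) {lam : ℝ} (hlam : 0 < lam) :
    |(∫ δ in Set.Ioi (0 : ℝ), V δ * Real.exp (-(lam * δ))) - c * (N.factorial / lam ^ (N + 1))|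
      ≤ C * ((N + 1).factorial / lam ^ (N + 2)) := by
  have h1 := (integrableOn_pow_mul_exp_neg N hlam).const_mul c
  have h2 := (integrableOn_pow_mul_exp_neg (N + 1) hlam).const_mul C
  have hle : ∀ᵐ δ ∂(volume.restrict (Set.Ioi (0 : ℝ))),
      ‖V δ * Real.exp (-(lam * δ)) - c * (δ ^ N * Real.exp (-(lam * δ)))‖ ≤
        C * (δ ^ (N + 1) * Real.exp (-(lam * δ))) := by
    refine (ae_restrict_mem measurableSet_Ioi).mono fun δ hδ => ?_
    rw [← mul_assoc, ← mul_assoc, ← sub_mul, norm_mul, Real.norm_eq_abs, Real.norm_eq_abs,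
      Real.abs_exp]
    exact mul_le_mul_of_nonneg_right (hV δ hδ) (Real.exp_pos _).le
  have h3 : IntegrableOn (fun δ => V δ * Real.exp (-(lam * δ)) -
      c * (δ ^ N * Real.exp (-(lam * δ)))) (Set.Ioi (0 : ℝ)) :=
    Integrable.mono' h2 (by fun_prop) hle
  have h4 : IntegrableOn (fun δ => V δ * Real.exp (-(lam * δ))) (Set.Ioi (0 : ℝ)) := by
    refine (h3.add h1).congr (ae_of_all _ fun δ => ?_)
    simp
  have h5 := norm_integral_le_of_norm_le h2 hle
  rw [integral_sub h4 h1, integral_const_mul, integral_const_mul, integral_pow_mul_exp_neg N hlam,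
    integral_pow_mul_exp_neg (N + 1) hlam, Real.norm_eq_abs] at h5
  exact h5

end Laplace

section PolytopeLaplace

variable {s : ℕ} {ϖ : Fin s → ℝ} {a : ℝ}

/-- With `δ = a - weightForm ϖ u` the exponential becomes `exp (lam a) exp (-lam δ)`. Slices with `δ
< 0` are empty, so a Laplace transform over the half line remains. -/
theorem mul_integral_exp_eq {P : Set (Fin s → ℝ)} (hP : MeasurableSet P)
    (hbdd : Bornology.IsBounded P) (hmax : ∀ u ∈ P, weightForm ϖ u ≤ a) {i₀ : Fin s}
    (hϖ : 0 < ϖ i₀) (lam : ℝ) :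
    ϖ i₀ * ∫ u in P, Real.exp (lam * weightForm ϖ u) = Real.exp (lam * a) *
      ∫ δ in Set.Ioi (0 : ℝ),
        (volume (forgetCoord i₀ '' {u | u ∈ P ∧ weightForm ϖ u = a - δ})).toReal *
          Real.exp (-(lam * δ)) := by
  have hψ : Measurable (weightForm ϖ) :=
    (weightForm ϖ).continuous_of_finiteDimensional.measurable
  have hbdd' : Bornology.IsBounded (forgetCoord i₀ '' P) :=
    (LinearMap.toContinuousLinearMap (forgetCoord i₀)).lipschitz.isBounded_image hbdd
  have hfin := hbdd'.measure_lt_top (μ := volume)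
  have hslice : ∀ δ, volume (forgetCoord i₀ '' {u | u ∈ P ∧ weightForm ϖ u = a - δ}) ≠ ⊤ :=
    fun δ => ((measure_mono (Set.image_mono fun u hu => hu.1)).trans_lt hfin).ne
  have hVm := measurable_volume_slice (a := a) hP hϖ.ne'
  have h1 := ofReal_mul_setLIntegral_eq (a := a) hP hϖ
    (h := fun δ => ENNReal.ofReal (Real.exp (-(lam * δ)))) (by fun_prop)
  have h2 : ∫ u in P, Real.exp (lam * weightForm ϖ u) =
      Real.exp (lam * a) * ∫ u in P, Real.exp (-(lam * (a - weightForm ϖ u))) := by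
    rw [← integral_const_mul]
    congr 1
    ext u
    rw [← Real.exp_add]
    congr 1
    ring
  have h3 : ∫ u in P, Real.exp (-(lam * (a - weightForm ϖ u))) =
      (∫⁻ u in P, ENNReal.ofReal (Real.exp (-(lam * (a - weightForm ϖ u))))).toReal :=
    integral_eq_lintegral_of_nonneg_ae (ae_of_all _ fun u => (Real.exp_pos _).le)
      (by fun_prop)
  have h4 : ∫ δ in Set.Ioi (0 : ℝ),
        (volume (forgetCoord i₀ '' {u | u ∈ P ∧ weightForm ϖ u = a - δ})).toReal *
          Real.exp (-(lam * δ)) = ∫ δ in Set.Ici (0 : ℝ),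
        (volume (forgetCoord i₀ '' {u | u ∈ P ∧ weightForm ϖ u = a - δ})).toReal *
          Real.exp (-(lam * δ)) := integral_Ici_eq_integral_Ioi.symm
  have h5 : ∫ δ in Set.Ici (0 : ℝ),
        (volume (forgetCoord i₀ '' {u | u ∈ P ∧ weightForm ϖ u = a - δ})).toReal *
          Real.exp (-(lam * δ)) =
      (∫⁻ δ in Set.Ici (0 : ℝ), ENNReal.ofReal (Real.exp (-(lam * δ))) *
        volume (forgetCoord i₀ '' {u | u ∈ P ∧ weightForm ϖ u = a - δ})).toReal := by
    rw [integral_eq_lintegral_of_nonneg_ae (ae_of_all _ fun u =>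
      mul_nonneg ENNReal.toReal_nonneg (Real.exp_pos _).le)
      ((hVm.ennreal_toReal.mul (by fun_prop)).aestronglyMeasurable)]
    congr 1
    refine lintegral_congr fun δ => ?_
    rw [ENNReal.ofReal_mul ENNReal.toReal_nonneg, ENNReal.ofReal_toReal (hslice δ), mul_comm]
  have h6 : ∫⁻ δ in Set.Ici (0 : ℝ), ENNReal.ofReal (Real.exp (-(lam * δ))) *
        volume (forgetCoord i₀ '' {u | u ∈ P ∧ weightForm ϖ u = a - δ}) =
      ∫⁻ δ, ENNReal.ofReal (Real.exp (-(lam * δ))) *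
        volume (forgetCoord i₀ '' {u | u ∈ P ∧ weightForm ϖ u = a - δ}) := by
    refine setLIntegral_eq_of_support_subset ?_
    intro δ hδ
    by_contra hneg
    apply hδ
    have : {u | u ∈ P ∧ weightForm ϖ u = a - δ} = ∅ := by
      ext u
      simp only [Set.mem_ofPred_eq, Set.mem_empty_iff_false, iff_false, not_and]
      intro hu hw
      have := hmax u hu
      simp only [Set.mem_Ici, not_le] at hneg
      linarith
    simp [this]
  rw [h4, h5, h6, ← h1, ENNReal.toReal_mul, ENNReal.toReal_ofReal hϖ.le, h2, h3]
  ring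

end PolytopeLaplace

section PolytopeAsymptotics

variable {s : ℕ} {J : Type*} [Finite J] {ℓ : J → (Fin s → ℝ) →ₗ[ℝ] ℝ} {b : J → ℝ}
  {ϖ : Fin s → ℝ} {a : ℝ}

theorem prod_eq_mul_prod_ne (w : Fin s → ℝ) (i₀ : Fin s) :
    ∏ i, w i = w i₀ * ∏ i : {i // i ≠ i₀}, w i := by
  rw [← Finset.mul_prod_erase _ _ (Finset.mem_univ i₀)]
  congr 1
  exact Finset.prod_subtype _ (by simp) _

theorem eq_of_forall_abs_sub_le_div {x y D : ℝ} (h : ∀ lam : ℝ, 0 < lam → |x - y| ≤ D / lam) :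
    x = y := by
  have h1 : Tendsto (fun lam : ℝ => D / lam) atTop (𝓝 0) := tendsto_const_nhds.div_atTop tendsto_id
  have h2 : |x - y| ≤ 0 :=
    ge_of_tendsto h1 ((eventually_gt_atTop 0).mono fun lam hlam => h lam hlam)
  exact sub_eq_zero.1 (abs_nonpos_iff.1 h2)

/-- The measure of slices near a face, with a constant that does not depend on the coordinate
used for the parametrization, together with the Laplace transform of the polytope. -/
theorem exists_slice_and_laplace [Nonempty (Fin s)] (hϖ : ∀ i, 0 < ϖ i)
    (hbdd : Bornology.IsBounded {u | ∀ j, ℓ j u ≤ b j})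
    (hne : ∃ u, (∀ j, ℓ j u ≤ b j) ∧ weightForm ϖ u = a)
    (hmax : ∀ u, (∀ j, ℓ j u ≤ b j) → weightForm ϖ u ≤ a) {N : ℕ}
    (hN : N = s - 1 - Module.finrank ℝ
          (vectorSpan ℝ {u | (∀ j, ℓ j u ≤ b j) ∧ weightForm ϖ u = a})) :
    ∃ c C : ℝ, (∀ i₀ : Fin s, ∀ δ : ℝ, 0 < δ → |(∏ i : {i // i ≠ i₀}, ϖ i) *
        (volume (forgetCoord i₀ '' {u | (∀ j, ℓ j u ≤ b j) ∧ weightForm ϖ u = a - δ})).toReal -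
        c * δ ^ N| ≤ C * δ ^ (N + 1)) ∧
      ∀ lam : ℝ, 0 < lam →
        |(∏ i, ϖ i) * (∫ u in {u | ∀ j, ℓ j u ≤ b j}, Real.exp (lam * weightForm ϖ u)) -
          c * (N.factorial * Real.exp (lam * a) / lam ^ (N + 1))| ≤
          C * ((N + 1).factorial * Real.exp (lam * a) / lam ^ (N + 2)) := by
  have hP : MeasurableSet {u | ∀ j, ℓ j u ≤ b j} := by
    have : IsClosed {u | ∀ j, ℓ j u ≤ b j} := by
      rw [Set.ofPred_forall]
      exact isClosed_iInter fun j =>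
        isClosed_le (ℓ j).continuous_of_finiteDimensional continuous_const
    exact this.measurableSet
  have h0 : ∀ i₀ : Fin s, ∃ c C : ℝ, ∀ δ : ℝ, 0 < δ → |(∏ i : {i // i ≠ i₀}, ϖ i) *
        (volume (forgetCoord i₀ '' {u | (∀ j, ℓ j u ≤ b j) ∧ weightForm ϖ u = a - δ})).toReal -
        c * δ ^ N| ≤ C * δ ^ (N + 1) := fun i₀ => by
    obtain ⟨c, C, h⟩ := exists_sliceVolume_asymptotic (fun i => (hϖ i).ne') hbdd hne hmax i₀
    rw [← hN] at h
    have hp : 0 ≤ ∏ i : {i // i ≠ i₀}, ϖ i := Finset.prod_nonneg fun i _ => (hϖ i).le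
    refine ⟨(∏ i : {i // i ≠ i₀}, ϖ i) * c, (∏ i : {i // i ≠ i₀}, ϖ i) * C, fun δ hδ => ?_⟩
    rw [mul_assoc, ← mul_sub, abs_mul, abs_of_nonneg hp, mul_assoc]
    exact mul_le_mul_of_nonneg_left (h δ hδ) hp
  choose c C hcC using h0
  have hlap : ∀ i₀ : Fin s, ∀ lam : ℝ, 0 < lam →
      |(∏ i, ϖ i) * (∫ u in {u | ∀ j, ℓ j u ≤ b j}, Real.exp (lam * weightForm ϖ u)) -
          c i₀ * (N.factorial * Real.exp (lam * a) / lam ^ (N + 1))| ≤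
          C i₀ * ((N + 1).factorial * Real.exp (lam * a) / lam ^ (N + 2)) := fun i₀ lam hlam => by
    have h1 := mul_integral_exp_eq hP hbdd hmax (hϖ i₀) lam
    have h2 := abs_laplace_sub_le
      (V := fun δ => (∏ i : {i // i ≠ i₀}, ϖ i) *
        (volume (forgetCoord i₀ '' {u | (∀ j, ℓ j u ≤ b j) ∧ weightForm ϖ u = a - δ})).toReal)
      ((measurable_volume_slice hP (hϖ i₀).ne').ennreal_toReal.const_mul _) (hcC i₀) hlam
    have h3 := mul_le_mul_of_nonneg_left h2 (Real.exp_pos (lam * a)).le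
    have h4 : (∏ i, ϖ i) * (∫ u in {u | ∀ j, ℓ j u ≤ b j}, Real.exp (lam * weightForm ϖ u)) =
        Real.exp (lam * a) * ∫ δ in Set.Ioi (0 : ℝ), (∏ i : {i // i ≠ i₀}, ϖ i) *
        (volume (forgetCoord i₀ '' {u | (∀ j, ℓ j u ≤ b j) ∧ weightForm ϖ u = a - δ})).toReal *
          Real.exp (-(lam * δ)) := by
      simp_rw [mul_assoc (∏ i : {i // i ≠ i₀}, ϖ i)]
      rw [integral_const_mul, prod_eq_mul_prod_ne ϖ i₀, mul_right_comm, h1]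
      simp only [Set.mem_ofPred_eq]
      ring
    calc _ = |Real.exp (lam * a)| * |(∫ δ in Set.Ioi (0 : ℝ), (∏ i : {i // i ≠ i₀}, ϖ i) *
        (volume (forgetCoord i₀ '' {u | (∀ j, ℓ j u ≤ b j) ∧ weightForm ϖ u = a - δ})).toReal *
          Real.exp (-(lam * δ))) - c i₀ * (N.factorial / lam ^ (N + 1))| := by
          rw [h4, ← abs_mul]
          congr 1
          ring
      _ ≤ _ := by
          rw [Real.abs_exp]
          refine h3.trans_eq ?_
          ring
  obtain ⟨i₁⟩ := ‹Nonempty (Fin s)›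
  -- The integral on the left of `hlap` does not involve `i₀`, so all `c i₀` are leading
  -- coefficients of the same function. Letting `lam` tend to infinity identifies them.
  have hc : ∀ i₀, c i₀ = c i₁ := fun i₀ => by
    refine eq_of_forall_abs_sub_le_div (D := (C i₀ + C i₁) * (N + 1)) fun lam hlam => ?_
    have h := (abs_sub_le _ _ _).trans (add_le_add ((abs_sub_comm _ _).trans_le
      (hlap i₀ lam hlam)) (hlap i₁ lam hlam))
    have hq : 0 < N.factorial * Real.exp (lam * a) / lam ^ (N + 1) := by positivity
    rw [← sub_mul, abs_mul, abs_of_pos hq, ← add_mul] at h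
    have h5 : ((N + 1).factorial : ℝ) * Real.exp (lam * a) / lam ^ (N + 2) =
        (N + 1) / lam * (N.factorial * Real.exp (lam * a) / lam ^ (N + 1)) := by
      rw [Nat.factorial_succ, pow_succ lam (N + 1)]; push_cast; field_simp
    rw [h5, ← mul_assoc] at h
    have := le_of_mul_le_mul_right h hq
    rwa [mul_div_assoc]
  have hC : ∀ i₀, C i₀ ≤ ∑ i, |C i| := fun i₀ => (le_abs_self _).trans
    (Finset.single_le_sum (fun i _ => abs_nonneg (C i)) (Finset.mem_univ i₀))
  refine ⟨c i₁, ∑ i, |C i|, fun i₀ δ hδ => ?_, fun lam hlam => ?_⟩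
  · rw [← hc i₀]
    exact (hcC i₀ δ hδ).trans (mul_le_mul_of_nonneg_right (hC i₀) (by positivity))
  · exact (hlap i₁ lam hlam).trans (mul_le_mul_of_nonneg_right (hC i₁) (by positivity))

end PolytopeAsymptotics

/-! ### Polytopes in the positive orthant -/

section CornerPolytope

variable {s : ℕ} {K : Type*} (α : K → Fin s → ℝ)

/-- The polytope in the positive orthant given by the inequalities `∑ α_i b_i ≤ lam`. -/
def cornerPolytope (lam : ℝ) : Set (Fin s → ℝ) :=
  {b | (∀ k, ∑ i, α k i * b i ≤ lam) ∧ ∀ i, 0 ≤ b i}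

variable {α}

theorem isClosed_cornerPolytope (lam : ℝ) : IsClosed (cornerPolytope α lam) := by
  have h : cornerPolytope α lam =
      (⋂ k, {b : Fin s → ℝ | ∑ i, α k i * b i ≤ lam}) ∩ ⋂ i, {b : Fin s → ℝ | 0 ≤ b i} := by
    ext b; simp [cornerPolytope]
  rw [h]
  refine (isClosed_iInter fun k => isClosed_le (by fun_prop) continuous_const).inter
    (isClosed_iInter fun i => isClosed_le continuous_const (by fun_prop))

theorem convex_cornerPolytope (lam : ℝ) : Convex ℝ (cornerPolytope α lam) := by
  intro u hu v hv p q hp hq hpq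
  refine ⟨fun k => ?_, fun i => ?_⟩
  · calc ∑ i, α k i * (p • u + q • v) i = p * ∑ i, α k i * u i + q * ∑ i, α k i * v i := by
          rw [Finset.mul_sum, Finset.mul_sum, ← Finset.sum_add_distrib]
          exact Finset.sum_congr rfl fun i _ => by simp; ring
      _ ≤ p * lam + q * lam := add_le_add (mul_le_mul_of_nonneg_left (hu.1 k) hp)
          (mul_le_mul_of_nonneg_left (hv.1 k) hq)
      _ = lam := by rw [← add_mul, hpq, one_mul]
  · exact add_nonneg (mul_nonneg hp (hu.2 i)) (mul_nonneg hq (hv.2 i))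

theorem cornerPolytope_eq_smul {lam : ℝ} (hlam : 0 < lam) :
    cornerPolytope α lam = (fun b => lam • b) '' cornerPolytope α 1 := by
  ext b
  constructor
  · intro hb
    refine ⟨lam⁻¹ • b, ⟨fun k => ?_, fun i => ?_⟩, smul_inv_smul₀ hlam.ne' b⟩
    · have : ∑ i, α k i * (lam⁻¹ • b) i = lam⁻¹ * ∑ i, α k i * b i := by
        rw [Finset.mul_sum]
        exact Finset.sum_congr rfl fun i _ => by simp; ring
      rw [this, inv_mul_le_iff₀ hlam, mul_one]
      exact hb.1 k
    · exact mul_nonneg (inv_nonneg.2 hlam.le) (hb.2 i)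
  · rintro ⟨u, hu, rfl⟩
    refine ⟨fun k => ?_, fun i => mul_nonneg hlam.le (hu.2 i)⟩
    have : ∑ i, α k i * (lam • u) i = lam * ∑ i, α k i * u i := by
      rw [Finset.mul_sum]
      exact Finset.sum_congr rfl fun i _ => by simp; ring
    rw [this]
    exact mul_le_of_le_one_right hlam.le (hu.1 k)

theorem exists_le_of_mem_cornerPolytope (hα : ∀ k i, 0 ≤ α k i) (hα' : ∀ i, ∃ k, 0 < α k i) :
    ∃ A : ℝ, 0 ≤ A ∧ ∀ lam, ∀ b ∈ cornerPolytope α lam, ∀ i, b i ≤ A * lam := by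
  choose κ hκ using hα'
  have hpos : ∀ i ∈ Finset.univ, 0 ≤ (α (κ i) i)⁻¹ := fun i _ => (inv_pos.2 (hκ i)).le
  refine ⟨∑ i, (α (κ i) i)⁻¹, Finset.sum_nonneg hpos, fun lam b hb i => ?_⟩
  have h0 : ∀ j ∈ Finset.univ, 0 ≤ α (κ i) j * b j := fun j _ => mul_nonneg (hα _ _) (hb.2 j)
  have h1 : α (κ i) i * b i ≤ lam :=
    (Finset.single_le_sum h0 (Finset.mem_univ i)).trans (hb.1 (κ i))
  have hlam : 0 ≤ lam := (mul_nonneg (hκ i).le (hb.2 i)).trans h1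
  calc b i ≤ (α (κ i) i)⁻¹ * lam := by rwa [le_inv_mul_iff₀ (hκ i)]
    _ ≤ _ := mul_le_mul_of_nonneg_right (Finset.single_le_sum hpos (Finset.mem_univ i)) hlam

theorem isBounded_cornerPolytope (hα : ∀ k i, 0 ≤ α k i) (hα' : ∀ i, ∃ k, 0 < α k i) (lam : ℝ) :
    Bornology.IsBounded (cornerPolytope α lam) := by
  obtain ⟨A, -, hA⟩ := exists_le_of_mem_cornerPolytope hα hα'
  refine (Metric.isBounded_Icc (0 : Fin s → ℝ) fun _ => A * lam).subset fun b hb => ⟨hb.2, hA lam b hb⟩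

theorem mem_cornerPolytope_of_le (hα : ∀ k i, 0 ≤ α k i) {lam : ℝ} {b c : Fin s → ℝ}
    (hb : b ∈ cornerPolytope α lam) (hc : ∀ i, 0 ≤ c i) (hcb : ∀ i, c i ≤ b i) :
    c ∈ cornerPolytope α lam :=
  ⟨fun k => (Finset.sum_le_sum fun i _ => mul_le_mul_of_nonneg_left (hcb i) (hα k i)).trans
    (hb.1 k), hc⟩

/-- Adding a small box to a polytope leads to a slightly larger polytope. -/
theorem exists_mem_cornerPolytope_add [Finite K] (hα : ∀ k i, 0 ≤ α k i) :
    ∃ A : ℝ, 0 ≤ A ∧ ∀ lam η, 0 ≤ η → ∀ b ∈ cornerPolytope α lam, ∀ c : Fin s → ℝ,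
      (∀ i, b i ≤ c i) → (∀ i, c i ≤ b i + η) → c ∈ cornerPolytope α (lam + A * η) := by
  have := Fintype.ofFinite K
  refine ⟨∑ k, ∑ i, α k i, Finset.sum_nonneg fun k _ => Finset.sum_nonneg fun i _ => hα k i,
    fun lam η hη b hb c hbc hcb => ⟨fun k => ?_, fun i => (hb.2 i).trans (hbc i)⟩⟩
  calc ∑ i, α k i * c i ≤ ∑ i, α k i * (b i + η) :=
        Finset.sum_le_sum fun i _ => mul_le_mul_of_nonneg_left (hcb i) (hα k i)
    _ = ∑ i, α k i * b i + (∑ i, α k i) * η := by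
        simp_rw [mul_add, Finset.sum_add_distrib, Finset.sum_mul]
    _ ≤ lam + (∑ k, ∑ i, α k i) * η := by
        refine add_le_add (hb.1 k) (mul_le_mul_of_nonneg_right ?_ hη)
        exact Finset.single_le_sum (f := fun k => ∑ i, α k i)
          (fun k _ => Finset.sum_nonneg fun i _ => hα k i) (Finset.mem_univ k)

end CornerPolytope

/-! ### Thin slabs along coordinate hyperplanes -/

section Slab

variable {s : ℕ} {ϖ : Fin s → ℝ} {P : Set (Fin s → ℝ)}

theorem continuous_weightForm : Continuous (weightForm ϖ) :=
  (weightForm ϖ).continuous_of_finiteDimensional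

theorem integrableOn_exp_weightForm (hbdd : Bornology.IsBounded P) :
    IntegrableOn (fun b => Real.exp (weightForm ϖ b)) P := by
  have h : ContinuousOn (fun b => Real.exp (weightForm ϖ b)) (closure P) :=
    (Real.continuous_exp.comp continuous_weightForm).continuousOn
  exact (h.integrableOn_compact hbdd.isCompact_closure).mono_set subset_closure

/-- Contracting a slab towards a point where `weightForm` is maximal. -/
theorem integral_slab_le (hP : MeasurableSet P) (hbdd : Bornology.IsBounded P)
    (hconv : Convex ℝ P) {z : Fin s → ℝ} (hz : z ∈ P)
    (hmax : ∀ u ∈ P, weightForm ϖ u ≤ weightForm ϖ z) {i : Fin s} {T t : ℝ}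
    (ht : 0 ≤ t) (ht' : t ≤ 1 / 2) :
    ∫ b in P ∩ {b | 0 ≤ b i ∧ b i < T}, Real.exp (weightForm ϖ b) ≤
      2 ^ s * ∫ b in P ∩ {b | t * z i ≤ b i ∧ b i < t * z i + T}, Real.exp (weightForm ϖ b) := by
  have hmeas : ∀ x y : ℝ, MeasurableSet (P ∩ {b : Fin s → ℝ | x ≤ b i ∧ b i < y}) := fun x y =>
    hP.inter ((measurableSet_le measurable_const (measurable_pi_apply i)).inter
      (measurableSet_lt (measurable_pi_apply i) measurable_const))
  have hint := integrableOn_exp_weightForm (ϖ := ϖ) hbdd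
  set H : (Fin s → ℝ) → ℝ := (P ∩ {b | t * z i ≤ b i ∧ b i < t * z i + T}).indicator
    fun b => Real.exp (weightForm ϖ b) with hH
  have hHint : Integrable H :=
    (integrable_indicator_iff (hmeas _ _)).2 (hint.mono_set Set.inter_subset_left)
  have h1t : 0 < 1 - t := by linarith
  -- The substitution `b ↦ (1 - t) b + t z` moves the slab at height 0 into the one at height `t
  -- z_i`. It does not decrease `weightForm`, as `z` is maximal, and costs a Jacobian factor of at
  -- most `2 ^ s`, as `t ≤ 1 / 2`.
  have hcv : ∫ b, H ((1 - t) • b + t • z) = ((1 - t) ^ s)⁻¹ * ∫ b, H b := by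
    rw [Measure.integral_comp_smul volume (fun b => H (b + t • z)) (1 - t),
      integral_add_right_eq_self H (t • z)]
    simp only [Module.finrank_fintype_fun_eq_card, Fintype.card_fin, smul_eq_mul]
    rw [abs_of_pos (by positivity)]
  have hHint' : Integrable fun b => H ((1 - t) • b + t • z) :=
    (hHint.comp_add_right (t • z)).comp_smul h1t.ne'
  rw [← integral_indicator (hmeas _ _), ← integral_indicator (hmeas _ _), ← hH]
  calc _ ≤ ∫ b, H ((1 - t) • b + t • z) := by
        refine integral_mono ((integrable_indicator_iff (hmeas _ _)).2
          (hint.mono_set Set.inter_subset_left)) hHint' fun b => ?_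
        refine Set.indicator_le' (f := fun b => Real.exp (weightForm ϖ b))
          (g := fun b => H ((1 - t) • b + t • z)) (fun b hb => ?_) (fun b _ => ?_) b
        · have hmem : (1 - t) • b + t • z ∈ P ∩ {b | t * z i ≤ b i ∧ b i < t * z i + T} := by
            refine ⟨hconv hb.1 hz h1t.le ht (by ring), ?_, ?_⟩
            · have := mul_nonneg h1t.le hb.2.1
              simp only [Pi.add_apply, Pi.smul_apply, smul_eq_mul]
              linarith
            · have h2 : b i < T := hb.2.2
              have h3 := mul_nonneg ht hb.2.1
              simp only [Pi.add_apply, Pi.smul_apply, smul_eq_mul]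
              linarith
          simp only [hH]
          rw [Set.indicator_of_mem hmem]
          refine Real.exp_le_exp.2 ?_
          rw [map_add, map_smul, map_smul, smul_eq_mul, smul_eq_mul]
          nlinarith [hmax b hb.1]
        · exact Set.indicator_nonneg (fun _ _ => (Real.exp_pos _).le) _
    _ ≤ _ := by
        rw [hcv]
        refine mul_le_mul_of_nonneg_right ?_
          (integral_nonneg fun b => Set.indicator_nonneg (fun _ _ => (Real.exp_pos _).le) _)
        rw [← inv_pow]
        refine pow_le_pow_left₀ (inv_nonneg.2 h1t.le) ?_ s
        rw [inv_le_comm₀ h1t (by norm_num)]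
        linarith

/-- The part of the integral of `exp ∘ weightForm` over a thin slab at a coordinate hyperplane not
containing the maximal face. -/
theorem integral_inter_slab_le (hP : MeasurableSet P) (hbdd : Bornology.IsBounded P)
    (hconv : Convex ℝ P) (hnn : ∀ u ∈ P, ∀ i, 0 ≤ u i) {z : Fin s → ℝ} (hz : z ∈ P)
    (hmax : ∀ u ∈ P, weightForm ϖ u ≤ weightForm ϖ z) {i : Fin s} (hzi : 0 < z i) {T : ℝ}
    (hT : 0 < T) :
    ∫ b in P ∩ {b | b i < T}, Real.exp (weightForm ϖ b) ≤
      2 ^ (s + 1) * T / z i * ∫ b in P, Real.exp (weightForm ϖ b) := by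
  have hmeas : ∀ x y : ℝ, MeasurableSet (P ∩ {b : Fin s → ℝ | x ≤ b i ∧ b i < y}) := fun x y =>
    hP.inter ((measurableSet_le measurable_const (measurable_pi_apply i)).inter
      (measurableSet_lt (measurable_pi_apply i) measurable_const))
  have hint := integrableOn_exp_weightForm (ϖ := ϖ) hbdd
  have hset : P ∩ {b | b i < T} = P ∩ {b | 0 ≤ b i ∧ b i < T} := by
    ext b
    exact ⟨fun h => ⟨h.1, hnn b h.1 i, h.2⟩, fun h => ⟨h.1, h.2.2⟩⟩
  rw [hset]
  set I₀ := ∫ b in P ∩ {b | 0 ≤ b i ∧ b i < T}, Real.exp (weightForm ϖ b) with hI₀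
  have hI₀' : 0 ≤ I₀ := integral_nonneg fun _ => (Real.exp_pos _).le
  -- The slabs starting at heights `j * T ≤ z i / 2` are disjoint, and each carries at least `2 ^
  -- (-s)` of the integral over the lowest one. There are `n + 1 ≥ z i / (2 T)` of them.
  set n := ⌊z i / (2 * T)⌋₊ with hn
  have hj : ∀ j ∈ Finset.range (n + 1), I₀ ≤ 2 ^ s *
      ∫ b in P ∩ {b | j * T ≤ b i ∧ b i < j * T + T}, Real.exp (weightForm ϖ b) := fun j hj => by
    have hjn : (j : ℝ) ≤ z i / (2 * T) :=
      (Nat.le_floor_iff (by positivity)).1 (Nat.lt_succ_iff.1 (Finset.mem_range.1 hj))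
    rw [le_div_iff₀ (by positivity)] at hjn
    have h := integral_slab_le (T := T) (t := j * T / z i) hP hbdd hconv hz hmax (i := i)
      (by positivity) (by rw [div_le_iff₀ hzi]; linarith)
    rwa [div_mul_cancel₀ _ hzi.ne'] at h
  have hsum := Finset.sum_le_sum hj
  rw [Finset.sum_const, Finset.card_range, nsmul_eq_mul, ← Finset.mul_sum,
    ← integral_biUnion_finset _ (fun j _ => hmeas _ _)] at hsum
  · have h1 : ∫ b in ⋃ j ∈ Finset.range (n + 1), P ∩ {b : Fin s → ℝ | j * T ≤ b i ∧ b i < j * T + T},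
        Real.exp (weightForm ϖ b) ≤ ∫ b in P, Real.exp (weightForm ϖ b) :=
      setIntegral_mono_set hint (ae_of_all _ fun _ => (Real.exp_pos _).le)
        (LE.le.eventuallyLE (Set.iUnion₂_subset fun _ _ => Set.inter_subset_left))
    have h2 : z i / (2 * T) ≤ (n + 1 : ℕ) := by push_cast; exact (Nat.lt_floor_add_one _).le
    have h3 : z i / (2 * T) * I₀ ≤ 2 ^ s * ∫ b in P, Real.exp (weightForm ϖ b) :=
      (mul_le_mul_of_nonneg_right h2 hI₀').trans
        (hsum.trans (mul_le_mul_of_nonneg_left h1 (by positivity)))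
    rw [div_mul_eq_mul_div, div_le_iff₀ (by positivity)] at h3
    rw [div_mul_eq_mul_div, le_div_iff₀ hzi, pow_succ]
    linarith
  · intro j _ j' _ hjj'
    refine Set.disjoint_left.2 fun b hb hb' => hjj' ?_
    have h1 : (j : ℝ) * T < (j' + 1) * T := by linarith [hb.2.1, hb'.2.2]
    have h2 : (j' : ℝ) * T < (j + 1) * T := by linarith [hb'.2.1, hb.2.2]
    have h3 := lt_of_mul_lt_mul_right h1 hT.le
    have h4 := lt_of_mul_lt_mul_right h2 hT.le
    norm_cast at h3 h4
    omega
  · exact fun j _ => hint.mono_set Set.inter_subset_left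

end Slab

/-! ### Comparing sums over points with integrals over cubes -/

section Cells

variable {s : ℕ} {ι : Type*} {η : ℝ} {f : ι → ℝ} {v : ι → Fin s → ℝ} {Y : Finset ι}
  {Q : Set (Fin s → ℝ)} {G : (Fin s → ℝ) → ℝ}

/-- The half-open cube of side length `η` with lower corner `v`. -/
def cornerCube (η : ℝ) (v : Fin s → ℝ) : Set (Fin s → ℝ) :=
  Set.pi Set.univ fun i => Set.Ico (v i) (v i + η)

theorem measurableSet_cornerCube (η : ℝ) (v : Fin s → ℝ) : MeasurableSet (cornerCube η v) :=
  MeasurableSet.univ_pi fun _ => measurableSet_Ico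

theorem volume_cornerCube (v : Fin s → ℝ) : volume (cornerCube η v) = ENNReal.ofReal η ^ s := by
  simp [cornerCube, Real.volume_pi_Ico]

theorem setIntegral_cornerCube (hη : 0 ≤ η) (w : Fin s → ℝ) :
    IntegrableOn ((cornerCube η w).indicator fun _ => (1 : ℝ)) Q ∧
      (∫ b in Q, (cornerCube η w).indicator (fun _ => (1 : ℝ)) b) ≤ η ^ s ∧
      (cornerCube η w ⊆ Q →
        ∫ b in Q, (cornerCube η w).indicator (fun _ => (1 : ℝ)) b = η ^ s) := by
  have hm := measurableSet_cornerCube η w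
  have hfin : volume (cornerCube η w) ≠ ⊤ := by rw [volume_cornerCube]; finiteness
  have hv : volume.real (cornerCube η w) = η ^ s := by
    rw [Measure.real, volume_cornerCube, ENNReal.toReal_pow, ENNReal.toReal_ofReal hη]
  refine ⟨?_, ?_, fun hsub => ?_⟩
  · exact ((integrable_indicator_iff hm).2 (integrableOn_const hfin)).integrableOn
  · rw [setIntegral_indicator hm, setIntegral_const, smul_eq_mul, mul_one, ← hv]
    exact measureReal_mono Set.inter_subset_right hfin
  · rw [setIntegral_indicator hm, setIntegral_const, smul_eq_mul, mul_one, ← hv,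
      Set.inter_eq_right.2 hsub]

open Classical in
theorem sum_filter_cornerCube (b : Fin s → ℝ) :
    ∑ y ∈ Y with b ∈ cornerCube η (v y), f y =
      ∑ y ∈ Y, f y * (cornerCube η (v y)).indicator (fun _ => (1 : ℝ)) b := by
  rw [Finset.sum_filter]
  exact Finset.sum_congr rfl fun y _ => by by_cases h : b ∈ cornerCube η (v y) <;> simp [h]

theorem integral_sum_cornerCube (hη : 0 ≤ η) :
    IntegrableOn (fun b => ∑ y ∈ Y, f y * (cornerCube η (v y)).indicator (fun _ => (1 : ℝ)) b) Q ∧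
    ∫ b in Q, ∑ y ∈ Y, f y * (cornerCube η (v y)).indicator (fun _ => (1 : ℝ)) b =
      ∑ y ∈ Y, f y * ∫ b in Q, (cornerCube η (v y)).indicator (fun _ => (1 : ℝ)) b := by
  have hi : ∀ y ∈ Y, IntegrableOn
      (fun b => f y * (cornerCube η (v y)).indicator (fun _ => (1 : ℝ)) b) Q := fun y _ =>
    (setIntegral_cornerCube (Q := Q) hη (v y)).1.const_mul _
  refine ⟨integrable_finsetSum _ hi, ?_⟩
  rw [integral_finsetSum _ hi]
  exact Finset.sum_congr rfl fun y _ => integral_const_mul _ _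

open Classical in
/-- A sum over points whose cubes lie in `Q`, bounded by an integral over `Q`. -/
theorem pow_mul_sum_le_integral (hη : 0 ≤ η) (hQ : MeasurableSet Q) (hG : IntegrableOn G Q)
    (hsub : ∀ y ∈ Y, cornerCube η (v y) ⊆ Q)
    (hle : ∀ b ∈ Q, ∑ y ∈ Y with b ∈ cornerCube η (v y), f y ≤ G b) :
    η ^ s * ∑ y ∈ Y, f y ≤ ∫ b in Q, G b := by
  obtain ⟨h1, h2⟩ := integral_sum_cornerCube (f := f) (v := v) (Y := Y) (Q := Q) hη
  -- Summing over the `y` whose cube contains `b` and then integrating over `b` counts each `f y`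
  -- with the volume `η ^ s` of its cube.
  have h3 : η ^ s * ∑ y ∈ Y, f y = ∫ b in Q, ∑ y ∈ Y, f y *
      (cornerCube η (v y)).indicator (fun _ => (1 : ℝ)) b := by
    rw [h2, Finset.mul_sum]
    refine Finset.sum_congr rfl fun y hy => ?_
    rw [(setIntegral_cornerCube (Q := Q) hη (v y)).2.2 (hsub y hy), mul_comm]
  rw [h3]
  refine setIntegral_mono_on h1 hG hQ fun b hb => ?_
  rw [← sum_filter_cornerCube]
  exact hle b hb

open Classical in
-- Cubes that stick out of `Q` do no harm in this direction because `f` is nonnegative.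
theorem integral_le_pow_mul_sum (hη : 0 ≤ η) (hQ : MeasurableSet Q) (hG : IntegrableOn G Q)
    (hf : ∀ y ∈ Y, 0 ≤ f y)
    (hle : ∀ b ∈ Q, G b ≤ ∑ y ∈ Y with b ∈ cornerCube η (v y), f y) :
    ∫ b in Q, G b ≤ η ^ s * ∑ y ∈ Y, f y := by
  obtain ⟨h1, h2⟩ := integral_sum_cornerCube (f := f) (v := v) (Y := Y) (Q := Q) hη
  have h3 : ∫ b in Q, ∑ y ∈ Y, f y *
      (cornerCube η (v y)).indicator (fun _ => (1 : ℝ)) b ≤ η ^ s * ∑ y ∈ Y, f y := by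
    rw [h2, Finset.mul_sum]
    refine Finset.sum_le_sum fun y hy => ?_
    rw [mul_comm (η ^ s)]
    exact mul_le_mul_of_nonneg_left (setIntegral_cornerCube (Q := Q) hη (v y)).2.1 (hf y hy)
  refine (setIntegral_mono_on hG h1 hQ fun b hb => ?_).trans h3
  rw [← sum_filter_cornerCube]
  exact hle b hb

end Cells

/-! ### From box counts to counts in small cells -/

section InclusionExclusion

variable {s : ℕ}

/-- The positive integral points of the box with upper corner `exp c`. -/
noncomputable def expBox (c : Fin s → ℝ) : Finset (Fin s → ℕ) :=
  Fintype.piFinset fun i => Finset.Icc 1 ⌊Real.exp (c i)⌋₊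

theorem mem_expBox {c : Fin s → ℝ} {y : Fin s → ℕ} :
    y ∈ expBox c ↔ ∀ i, 1 ≤ y i ∧ Real.log (y i) ≤ c i := by
  simp only [expBox, Fintype.mem_piFinset, Finset.mem_Icc]
  refine forall_congr' fun i => and_congr_right fun h => ?_
  rw [Nat.le_floor_iff (Real.exp_pos _).le, Real.log_le_iff_le_exp (by exact_mod_cast h)]

open Classical in
-- The point `b` lies in the cube of `y` when `b_i - η < log y_i ≤ b_i` for all `i`. Expanding the
-- product of 1 minus the indicators of `log y_i ≤ b_i - η` gives the alternating sum over boxes.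
theorem sum_cell_eq (f : (Fin s → ℕ) → ℝ) (b : Fin s → ℝ) {η : ℝ} (hη : 0 ≤ η) :
    ∑ y ∈ expBox b with b ∈ cornerCube η (fun i => Real.log (y i)), f y =
      ∑ S ∈ (Finset.univ : Finset (Fin s)).powerset, (-1) ^ S.card *
        ∑ y ∈ expBox (fun i => if i ∈ S then b i - η else b i), f y := by
  have hstep : ∀ S : Finset (Fin s), ∑ y ∈ expBox (fun i => if i ∈ S then b i - η else b i), f y =
      ∑ y ∈ expBox b, f y * ∏ i ∈ S, if Real.log (y i) ≤ b i - η then 1 else 0 := fun S => by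
    have : expBox (fun i => if i ∈ S then b i - η else b i) =
        (expBox b).filter fun y => ∀ i ∈ S, Real.log (y i) ≤ b i - η := by
      ext y
      simp only [mem_expBox, Finset.mem_filter]
      constructor
      · intro h
        refine ⟨fun i => ⟨(h i).1, (h i).2.trans ?_⟩, fun i hi => ?_⟩
        · split_ifs <;> linarith
        · simpa [hi] using (h i).2
      · rintro ⟨h, h'⟩ i
        refine ⟨(h i).1, ?_⟩
        split_ifs with hi
        · exact h' i hi
        · exact (h i).2
    rw [this, Finset.sum_filter]
    refine Finset.sum_congr rfl fun y _ => ?_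
    rw [Finset.prod_ite_zero]
    simp
  simp_rw [hstep, Finset.mul_sum]
  rw [Finset.sum_comm, Finset.sum_filter]
  refine Finset.sum_congr rfl fun y hy => ?_
  have h1 := Finset.prod_sub (fun _ : Fin s => (1 : ℝ))
    (fun i => if Real.log (y i) ≤ b i - η then 1 else 0) Finset.univ
  have h2 : ∑ S ∈ (Finset.univ : Finset (Fin s)).powerset, (-1) ^ S.card *
      (f y * ∏ i ∈ S, if Real.log (y i) ≤ b i - η then (1 : ℝ) else 0) =
      f y * ∏ i, ((1 : ℝ) - if Real.log (y i) ≤ b i - η then 1 else 0) := by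
    rw [h1, Finset.mul_sum]
    refine Finset.sum_congr rfl fun S _ => ?_
    simp only [Finset.prod_const_one]
    ring
  rw [h2]
  rw [mem_expBox] at hy
  split_ifs with hb
  · rw [Finset.prod_eq_one, mul_one]
    intro i _
    have := (hb i trivial).2
    rw [if_neg (by simp only at this; linarith), sub_zero]
  · have : ∃ i, Real.log (y i) ≤ b i - η := by
      by_contra hcon
      push Not at hcon
      exact hb fun i _ => ⟨(hy i).2, by have := hcon i; simp only; linarith⟩
    obtain ⟨i, hi⟩ := this
    rw [Finset.prod_eq_zero (Finset.mem_univ i) (by simp [hi]), mul_zero]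

variable {ϖ : Fin s → ℝ} {ε CM CE : ℝ} {f : (Fin s → ℕ) → ℝ}

theorem exp_weightForm (c : Fin s → ℝ) :
    Real.exp (weightForm ϖ c) = ∏ i, Real.exp (ϖ i * c i) := by
  rw [weightForm_apply, Real.exp_sum]

open Classical in
/-- The sum over a small cell. -/
theorem abs_sum_cell_sub_le (hϖ : ∀ i, 0 < ϖ i) (hCE : 0 ≤ CE)
    (hf : ∀ (c : Fin s → ℝ) (m : ℝ), (∀ i, 0 ≤ c i) → (∀ i, m ≤ c i) →
      |∑ y ∈ expBox c, f y - CM * Real.exp (weightForm ϖ c)| ≤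
        CE * (Real.exp (-(ε * m)) * Real.exp (weightForm ϖ c)))
    {b : Fin s → ℝ} {η T : ℝ} (hη : 0 ≤ η) (hηT : η ≤ T) (hb : ∀ i, T ≤ b i) :
    |∑ y ∈ expBox b with b ∈ cornerCube η (fun i => Real.log (y i)), f y -
      CM * (∏ i, (1 - Real.exp (-(ϖ i * η)))) * Real.exp (weightForm ϖ b)| ≤
      2 ^ s * CE * Real.exp (-(ε * (T - η))) * Real.exp (weightForm ϖ b) := by
  -- The same inclusion-exclusion applied to the main terms: lowering `b_i` by `η` multiplies the
  -- exponential by `exp (-(ϖ i * η))`.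
  have h1 : CM * (∏ i, (1 - Real.exp (-(ϖ i * η)))) * Real.exp (weightForm ϖ b) =
      ∑ S ∈ (Finset.univ : Finset (Fin s)).powerset, (-1) ^ S.card *
        (CM * Real.exp (weightForm ϖ fun i => if i ∈ S then b i - η else b i)) := by
    rw [exp_weightForm, mul_assoc, ← Finset.prod_mul_distrib]
    simp_rw [sub_mul, one_mul, ← Real.exp_add]
    rw [Finset.prod_sub, Finset.mul_sum]
    refine Finset.sum_congr rfl fun S _ => ?_
    have h2 : Real.exp (weightForm ϖ fun i => if i ∈ S then b i - η else b i) =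
        (∏ i ∈ Finset.univ \ S, Real.exp (ϖ i * b i)) *
          ∏ i ∈ S, Real.exp (-(ϖ i * η) + ϖ i * b i) := by
      rw [exp_weightForm, ← Finset.prod_sdiff (Finset.subset_univ S)]
      congr 1
      · refine Finset.prod_congr rfl fun i hi => ?_
        rw [if_neg (Finset.mem_sdiff.1 hi).2]
      · refine Finset.prod_congr rfl fun i hi => ?_
        rw [if_pos hi]; congr 1; ring
    rw [h2]
    ring
  rw [h1, sum_cell_eq f b hη, ← Finset.sum_sub_distrib]
  refine (Finset.abs_sum_le_sum_abs _ _).trans ?_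
  have h3 : ∀ S ∈ (Finset.univ : Finset (Fin s)).powerset,
      |(-1) ^ S.card * ∑ y ∈ expBox (fun i => if i ∈ S then b i - η else b i), f y -
        (-1) ^ S.card * (CM * Real.exp (weightForm ϖ fun i => if i ∈ S then b i - η else b i))| ≤
      CE * Real.exp (-(ε * (T - η))) * Real.exp (weightForm ϖ b) := fun S _ => by
    rw [← mul_sub, abs_mul, abs_pow, abs_neg, abs_one, one_pow, one_mul]
    refine (hf _ (T - η) (fun i => ?_) fun i => ?_).trans ?_
    · have := hb i; split_ifs <;> linarith
    · have := hb i; split_ifs <;> linarith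
    · rw [mul_assoc]
      refine mul_le_mul_of_nonneg_left (mul_le_mul_of_nonneg_left (Real.exp_le_exp.2 ?_)
        (Real.exp_pos _).le) hCE
      rw [weightForm_apply, weightForm_apply]
      refine Finset.sum_le_sum fun i _ => mul_le_mul_of_nonneg_left ?_ (hϖ i).le
      split_ifs <;> linarith
  refine (Finset.sum_le_sum h3).trans_eq ?_
  rw [Finset.sum_const, Finset.card_powerset, Finset.card_univ, Fintype.card_fin, nsmul_eq_mul]
  push_cast
  ring

end InclusionExclusion

/-! ### Upper and lower bounds for sums over a dilated polytope -/

section Hyperbola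

variable {s : ℕ} {K : Type*} {α : K → Fin s → ℝ} {ϖ : Fin s → ℝ} {ε CM CE : ℝ}
  {f : (Fin s → ℕ) → ℝ} {Y : Finset (Fin s → ℕ)} {lam : ℝ}

variable (α ϖ) in
/-- The integral of `exp ∘ weightForm` over a dilated polytope. -/
noncomputable def cornerIntegral (lam : ℝ) : ℝ :=
  ∫ b in cornerPolytope α lam, Real.exp (weightForm ϖ b)

theorem cornerIntegral_nonneg (lam : ℝ) : 0 ≤ cornerIntegral α ϖ lam :=
  integral_nonneg fun _ => (Real.exp_pos _).le

theorem measurableSet_cornerPolytope (lam : ℝ) : MeasurableSet (cornerPolytope α lam) :=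
  (isClosed_cornerPolytope lam).measurableSet

theorem integrableOn_cornerPolytope (hα : ∀ k i, 0 ≤ α k i) (hα' : ∀ i, ∃ k, 0 < α k i)
    (lam : ℝ) : IntegrableOn (fun b => Real.exp (weightForm ϖ b)) (cornerPolytope α lam) :=
  integrableOn_exp_weightForm (isBounded_cornerPolytope hα hα' lam)

theorem setIntegral_le_cornerIntegral (hα : ∀ k i, 0 ≤ α k i) (hα' : ∀ i, ∃ k, 0 < α k i)
    {lam : ℝ} {Q : Set (Fin s → ℝ)} (hQ : Q ⊆ cornerPolytope α lam) :
    ∫ b in Q, Real.exp (weightForm ϖ b) ≤ cornerIntegral α ϖ lam :=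
  setIntegral_mono_set (integrableOn_cornerPolytope hα hα' lam)
    (ae_of_all _ fun _ => (Real.exp_pos _).le) (LE.le.eventuallyLE hQ)

/-- The part of the sum over points with a small coordinate. -/
theorem sum_small_coord_le (hα : ∀ k i, 0 ≤ α k i) (hα' : ∀ i, ∃ k, 0 < α k i)
    {A : ℝ} (hA : ∀ lam η, 0 ≤ η → ∀ b ∈ cornerPolytope α lam, ∀ c : Fin s → ℝ,
      (∀ i, b i ≤ c i) → (∀ i, c i ≤ b i + η) → c ∈ cornerPolytope α (lam + A * η))
    (hf0 : ∀ y, 0 ≤ f y)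
    (hf : ∀ (c : Fin s → ℝ) (m : ℝ), (∀ i, 0 ≤ c i) → (∀ i, m ≤ c i) →
      |∑ y ∈ expBox c, f y - CM * Real.exp (weightForm ϖ c)| ≤
        CE * (Real.exp (-(ε * m)) * Real.exp (weightForm ϖ c)))
    (hY : ∀ y ∈ Y, (∀ i, 1 ≤ y i) ∧ (fun i => Real.log (y i)) ∈ cornerPolytope α lam)
    (i : Fin s) (T : ℝ) :
    ∑ y ∈ Y with Real.log (y i) < T, f y ≤ (CM + CE) *
      ∫ b in cornerPolytope α (lam + A) ∩ {b | b i < T + 1}, Real.exp (weightForm ϖ b) := by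
  classical
  have hQ : MeasurableSet (cornerPolytope α (lam + A) ∩ {b : Fin s → ℝ | b i < T + 1}) :=
    (measurableSet_cornerPolytope _).inter
      (measurableSet_lt (measurable_pi_apply i) measurable_const)
  have hint : IntegrableOn (fun b => (CM + CE) * Real.exp (weightForm ϖ b))
      (cornerPolytope α (lam + A) ∩ {b | b i < T + 1}) :=
    ((integrableOn_cornerPolytope hα hα' _).mono_set Set.inter_subset_left).const_mul _
  -- An upper bound of the right order suffices here. Cubes of side 1 are used, and the sum over a
  -- cell is bounded by that over the whole box, which is at most `(CM + CE) * exp (weightForm ϖ b)`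
  -- by `hf` with `m = 0`.
  have h := pow_mul_sum_le_integral (η := 1) (f := f) (v := fun y i => Real.log (y i))
    (Y := Y.filter fun y => Real.log (y i) < T) zero_le_one hQ hint ?_ ?_
  · rwa [one_pow, one_mul, integral_const_mul] at h
  · intro y hy b hb
    obtain ⟨hyY, hyT⟩ := Finset.mem_filter.1 hy
    have h1 := hA lam 1 zero_le_one _ (hY y hyY).2 b (fun i => (hb i trivial).1)
      fun i => (hb i trivial).2.le
    rw [mul_one] at h1
    refine ⟨h1, ?_⟩
    have := (hb i trivial).2
    simp only [Set.mem_ofPred_eq] at this ⊢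
    linarith
  · intro b hb
    have h1 := hf b 0 hb.1.2 hb.1.2
    rw [mul_zero, neg_zero, Real.exp_zero, one_mul] at h1
    have h2 := (abs_sub_le_iff.1 h1).1
    have h3 : ∑ y ∈ (Y.filter fun y => Real.log (y i) < T) with
        b ∈ cornerCube 1 (fun i => Real.log (y i)), f y ≤ ∑ y ∈ expBox b, f y := by
      refine Finset.sum_le_sum_of_subset_of_nonneg (fun y hy => ?_) fun y _ _ => hf0 y
      rw [Finset.mem_filter, Finset.mem_filter] at hy
      exact mem_expBox.2 fun i => ⟨(hY y hy.1.1).1 i, (hy.2 i trivial).1⟩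
    linarith

theorem one_sub_exp_neg_le {x : ℝ} : 1 - Real.exp (-x) ≤ x := by
  linarith [Real.add_one_le_exp (-x)]

theorem mul_one_sub_le_one_sub_exp_neg {x : ℝ} (hx : 0 ≤ x) : x * (1 - x) ≤ 1 - Real.exp (-x) := by
  have h1 : Real.exp (-x) * (1 + x) ≤ 1 := by
    calc _ ≤ Real.exp (-x) * Real.exp x :=
          mul_le_mul_of_nonneg_left (by linarith [Real.add_one_le_exp x]) (Real.exp_pos _).le
      _ = 1 := by rw [← Real.exp_add]; simp
  have h2 : (1 - x * (1 - x)) * (1 + x) = 1 + x ^ 3 := by ring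
  have h3 : 0 < 1 + x := by linarith
  have h4 : 0 ≤ x ^ 3 := by positivity
  have h5 : Real.exp (-x) * (1 + x) ≤ (1 - x * (1 - x)) * (1 + x) := by linarith
  linarith [le_of_mul_le_mul_right h5 h3]

theorem prod_one_sub_exp_neg_nonneg (hϖ : ∀ i, 0 < ϖ i) {η : ℝ} (hη : 0 ≤ η) :
    0 ≤ ∏ i, (1 - Real.exp (-(ϖ i * η))) :=
  Finset.prod_nonneg fun i _ => by
    have : Real.exp (-(ϖ i * η)) ≤ 1 :=
      Real.exp_le_one_iff.2 (neg_nonpos.2 (mul_nonneg (hϖ i).le hη))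
    linarith

theorem prod_one_sub_exp_neg_le (hϖ : ∀ i, 0 < ϖ i) {η : ℝ} (hη : 0 ≤ η) :
    ∏ i, (1 - Real.exp (-(ϖ i * η))) ≤ (∏ i, ϖ i) * η ^ s := by
  calc _ ≤ ∏ i, (ϖ i * η) := Finset.prod_le_prod (fun i _ => by
        have : Real.exp (-(ϖ i * η)) ≤ 1 :=
          Real.exp_le_one_iff.2 (neg_nonpos.2 (mul_nonneg (hϖ i).le hη))
        linarith) fun i _ => one_sub_exp_neg_le
    _ = _ := by simp [Finset.prod_mul_distrib]

theorem one_sub_sum_le_prod_one_sub {ι : Type*} (S : Finset ι) {x : ι → ℝ}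
    (h0 : ∀ i ∈ S, 0 ≤ x i) (h1 : ∀ i ∈ S, x i ≤ 1) : 1 - ∑ i ∈ S, x i ≤ ∏ i ∈ S, (1 - x i) := by
  classical
  induction S using Finset.induction_on with
  | empty => simp
  | insert i S hi ih =>
    rw [Finset.sum_insert hi, Finset.prod_insert hi]
    have hle := ih (fun j hj => h0 j (Finset.mem_insert_of_mem hj))
      fun j hj => h1 j (Finset.mem_insert_of_mem hj)
    have hs : 0 ≤ ∑ j ∈ S, x j := Finset.sum_nonneg fun j hj => h0 j (Finset.mem_insert_of_mem hj)
    have hi0 := h0 i (Finset.mem_insert_self i S)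
    have hi1 := h1 i (Finset.mem_insert_self i S)
    nlinarith

theorem le_prod_one_sub_exp_neg (hϖ : ∀ i, 0 < ϖ i) {η : ℝ} (hη : 0 ≤ η)
    (hη' : ∀ i, ϖ i * η ≤ 1) :
    (∏ i, ϖ i) * η ^ s * (1 - (∑ i, ϖ i) * η) ≤ ∏ i, (1 - Real.exp (-(ϖ i * η))) := by
  have h1 : 1 - (∑ i, ϖ i) * η ≤ ∏ i, (1 - ϖ i * η) := by
    rw [Finset.sum_mul]
    exact one_sub_sum_le_prod_one_sub Finset.univ (x := fun i => ϖ i * η)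
      (fun i _ => mul_nonneg (hϖ i).le hη) fun i _ => hη' i
  calc _ ≤ (∏ i, ϖ i) * η ^ s * ∏ i, (1 - ϖ i * η) :=
        mul_le_mul_of_nonneg_left h1
          (mul_nonneg (Finset.prod_nonneg fun i _ => (hϖ i).le) (by positivity))
    _ = ∏ i, (ϖ i * η * (1 - ϖ i * η)) := by simp [Finset.prod_mul_distrib]
    _ ≤ _ := Finset.prod_le_prod
        (fun i _ => mul_nonneg (mul_nonneg (hϖ i).le hη) (by linarith [hη' i]))
        fun i _ => mul_one_sub_le_one_sub_exp_neg (mul_nonneg (hϖ i).le hη)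

theorem measurableSet_coords_ge (T : ℝ) : MeasurableSet {b : Fin s → ℝ | ∀ i, T ≤ b i} := by
  rw [Set.ofPred_forall]
  exact MeasurableSet.iInter fun i => measurableSet_le measurable_const (measurable_pi_apply i)

/-- Cubes starting in the polytope stay in a slightly larger one. The cut-off `T` makes the error of
the box counts small enough to survive the division by the cell volume `η ^ s`. -/
theorem sum_large_coords_le (hα : ∀ k i, 0 ≤ α k i) (hα' : ∀ i, ∃ k, 0 < α k i)
    {A : ℝ} (hA : ∀ lam η, 0 ≤ η → ∀ b ∈ cornerPolytope α lam, ∀ c : Fin s → ℝ,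
      (∀ i, b i ≤ c i) → (∀ i, c i ≤ b i + η) → c ∈ cornerPolytope α (lam + A * η))
    (hϖ : ∀ i, 0 < ϖ i) (hCM : 0 ≤ CM) (hCE : 0 ≤ CE) (hf0 : ∀ y, 0 ≤ f y)
    (hf : ∀ (c : Fin s → ℝ) (m : ℝ), (∀ i, 0 ≤ c i) → (∀ i, m ≤ c i) →
      |∑ y ∈ expBox c, f y - CM * Real.exp (weightForm ϖ c)| ≤
        CE * (Real.exp (-(ε * m)) * Real.exp (weightForm ϖ c)))
    (hY : ∀ y ∈ Y, (∀ i, 1 ≤ y i) ∧ (fun i => Real.log (y i)) ∈ cornerPolytope α lam)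
    {T η : ℝ} (hη : 0 < η) (hηT : η ≤ T) :
    ∑ y ∈ Y with ∀ i, T ≤ Real.log (y i), f y ≤
      (CM * ∏ i, ϖ i + 2 ^ s * CE * Real.exp (-(ε * (T - η))) / η ^ s) *
        cornerIntegral α ϖ (lam + A * η) := by
  classical
  have hQ := (measurableSet_cornerPolytope (α := α) (lam + A * η)).inter
    (measurableSet_coords_ge (s := s) T)
  set D := CM * ∏ i, (1 - Real.exp (-(ϖ i * η))) + 2 ^ s * CE * Real.exp (-(ε * (T - η))) with hD
  have hD0 : 0 ≤ D := by
    have := prod_one_sub_exp_neg_nonneg hϖ hη.le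
    positivity
  have hint : IntegrableOn (fun b => D * Real.exp (weightForm ϖ b))
      (cornerPolytope α (lam + A * η) ∩ {b | ∀ i, T ≤ b i}) :=
    ((integrableOn_cornerPolytope hα hα' _).mono_set Set.inter_subset_left).const_mul _
  have h := pow_mul_sum_le_integral (η := η) (f := f) (v := fun y i => Real.log (y i))
    (Y := Y.filter fun y => ∀ i, T ≤ Real.log (y i)) hη.le hQ hint ?_ ?_
  · rw [integral_const_mul, mul_comm (η ^ s), ← le_div_iff₀ (by positivity)] at h
    refine h.trans ?_
    rw [div_le_iff₀ (by positivity)]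
    calc _ ≤ D * cornerIntegral α ϖ (lam + A * η) := mul_le_mul_of_nonneg_left
          (setIntegral_le_cornerIntegral hα hα' Set.inter_subset_left) hD0
      _ ≤ _ := by
          rw [mul_right_comm]
          refine mul_le_mul_of_nonneg_right ?_ (cornerIntegral_nonneg _)
          rw [add_mul, div_mul_cancel₀ _ (by positivity), mul_assoc]
          have := mul_le_mul_of_nonneg_left (prod_one_sub_exp_neg_le hϖ hη.le) hCM
          linarith
  · intro y hy b hb
    obtain ⟨hyY, hyT⟩ := Finset.mem_filter.1 hy
    exact ⟨hA lam η hη.le _ (hY y hyY).2 b (fun i => (hb i trivial).1)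
      fun i => (hb i trivial).2.le, fun i => (hyT i).trans (hb i trivial).1⟩
  · intro b hb
    have h1 := abs_sum_cell_sub_le hϖ hCE hf hη.le hηT hb.2
    have h2 := (abs_sub_le_iff.1 h1).1
    have h3 : ∑ y ∈ (Y.filter fun y => ∀ i, T ≤ Real.log (y i)) with
        b ∈ cornerCube η (fun i => Real.log (y i)), f y ≤
        ∑ y ∈ expBox b with b ∈ cornerCube η (fun i => Real.log (y i)), f y := by
      refine Finset.sum_le_sum_of_subset_of_nonneg (fun y hy => ?_) fun y _ _ => hf0 y
      rw [Finset.mem_filter, Finset.mem_filter] at hy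
      exact Finset.mem_filter.2
        ⟨mem_expBox.2 fun i => ⟨(hY y hy.1.1).1 i, (hy.2 i trivial).1⟩, hy.2⟩
    rw [hD, add_mul]
    linarith

/-- The cell formula is integrated only over the part of the polytope with all coordinates at least
`T`, which misses no more than the union of the slabs `b i < T`. Going down from `b` stays in the
polytope, so no enlargement is needed. -/
theorem le_sum_of_mem_cornerPolytope (hα : ∀ k i, 0 ≤ α k i) (hα' : ∀ i, ∃ k, 0 < α k i)
    (hϖ : ∀ i, 0 < ϖ i) (hCM : 0 ≤ CM) (hCE : 0 ≤ CE) (hf0 : ∀ y, 0 ≤ f y)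
    (hf : ∀ (c : Fin s → ℝ) (m : ℝ), (∀ i, 0 ≤ c i) → (∀ i, m ≤ c i) →
      |∑ y ∈ expBox c, f y - CM * Real.exp (weightForm ϖ c)| ≤
        CE * (Real.exp (-(ε * m)) * Real.exp (weightForm ϖ c)))
    (hY : ∀ y, (∀ i, 1 ≤ y i) → (fun i => Real.log (y i)) ∈ cornerPolytope α lam → y ∈ Y)
    {T η : ℝ} (hη : 0 < η) (hηT : η ≤ T) (hη' : ∀ i, ϖ i * η ≤ 1) (hη'' : (∑ i, ϖ i) * η ≤ 1) :
    CM * (∏ i, ϖ i) * (1 - (∑ i, ϖ i) * η) * (cornerIntegral α ϖ lam -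
        ∑ i, ∫ b in cornerPolytope α lam ∩ {b | b i < T}, Real.exp (weightForm ϖ b)) -
      2 ^ s * CE * Real.exp (-(ε * (T - η))) / η ^ s * cornerIntegral α ϖ lam ≤ ∑ y ∈ Y, f y := by
  classical
  have hQ := (measurableSet_cornerPolytope (α := α) lam).inter (measurableSet_coords_ge (s := s) T)
  set Q := cornerPolytope α lam ∩ {b : Fin s → ℝ | ∀ i, T ≤ b i} with hQdef
  have hintP := integrableOn_cornerPolytope (ϖ := ϖ) hα hα' lam
  have hintQ : IntegrableOn (fun b => Real.exp (weightForm ϖ b)) Q :=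
    hintP.mono_set Set.inter_subset_left
  set M := CM * ∏ i, (1 - Real.exp (-(ϖ i * η))) with hM
  set D := 2 ^ s * CE * Real.exp (-(ε * (T - η))) with hD
  have hM0 : 0 ≤ M := mul_nonneg hCM (prod_one_sub_exp_neg_nonneg hϖ hη.le)
  have hD0 : 0 ≤ D := by positivity
  have h := integral_le_pow_mul_sum (η := η) (f := f) (v := fun y i => Real.log (y i))
    (Y := Y) (G := fun b => (M - D) * Real.exp (weightForm ϖ b)) hη.le hQ (hintQ.const_mul _)
    (fun y _ => hf0 y) ?_
  · rw [integral_const_mul, sub_mul] at h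
    set IQ := ∫ b in Q, Real.exp (weightForm ϖ b) with hIQ
    have hIQ1 : IQ ≤ cornerIntegral α ϖ lam :=
      setIntegral_le_cornerIntegral hα hα' Set.inter_subset_left
    have hIQ0 : 0 ≤ IQ := integral_nonneg fun _ => (Real.exp_pos _).le
    have hIQ2 : cornerIntegral α ϖ lam -
        ∑ i, (∫ b in cornerPolytope α lam ∩ {b | b i < T}, Real.exp (weightForm ϖ b)) ≤ IQ := by
      have hcov : cornerPolytope α lam ⊆
          Q ∪ ⋃ i ∈ Finset.univ, cornerPolytope α lam ∩ {b : Fin s → ℝ | b i < T} := by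
        intro b hb
        by_cases hT : ∀ i, T ≤ b i
        · exact Or.inl ⟨hb, hT⟩
        · push Not at hT
          obtain ⟨i, hi⟩ := hT
          exact Or.inr (Set.mem_iUnion₂.2 ⟨i, Finset.mem_univ i, hb, hi⟩)
      have hm : ∀ i : Fin s, MeasurableSet (cornerPolytope α lam ∩ {b : Fin s → ℝ | b i < T}) :=
        fun i => (measurableSet_cornerPolytope _).inter
          (measurableSet_lt (measurable_pi_apply i) measurable_const)
      have hle : ∀ b ∈ cornerPolytope α lam, Real.exp (weightForm ϖ b) ≤
          Q.indicator (fun b => Real.exp (weightForm ϖ b)) b +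
          ∑ i, (cornerPolytope α lam ∩ {b : Fin s → ℝ | b i < T}).indicator
            (fun b => Real.exp (weightForm ϖ b)) b := by
        intro b hb
        have hnn : ∀ i ∈ Finset.univ, 0 ≤
            (cornerPolytope α lam ∩ {b : Fin s → ℝ | b i < T}).indicator
              (fun b => Real.exp (weightForm ϖ b)) b := fun i _ =>
          Set.indicator_nonneg (fun _ _ => (Real.exp_pos _).le) _
        rcases hcov hb with hbQ | hbU
        · rw [Set.indicator_of_mem hbQ]
          linarith [Finset.sum_nonneg hnn]
        · obtain ⟨i, hi, hbi⟩ := Set.mem_iUnion₂.1 hbU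
          have h1 := Finset.single_le_sum hnn hi
          rw [Set.indicator_of_mem hbi] at h1
          have h2 : 0 ≤ Q.indicator (fun b => Real.exp (weightForm ϖ b)) b :=
            Set.indicator_nonneg (fun _ _ => (Real.exp_pos _).le) _
          linarith
      have hi1 : Integrable (Q.indicator fun b => Real.exp (weightForm ϖ b)) :=
        (integrable_indicator_iff hQ).2 hintQ
      have hi2 : ∀ i ∈ (Finset.univ : Finset (Fin s)), Integrable
          ((cornerPolytope α lam ∩ {b : Fin s → ℝ | b i < T}).indicator
            fun b => Real.exp (weightForm ϖ b)) := fun i _ =>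
        (integrable_indicator_iff (hm i)).2 (hintP.mono_set Set.inter_subset_left)
      have h1 : cornerIntegral α ϖ lam ≤ ∫ b in cornerPolytope α lam,
          (Q.indicator (fun b => Real.exp (weightForm ϖ b)) b +
          ∑ i, (cornerPolytope α lam ∩ {b : Fin s → ℝ | b i < T}).indicator
            (fun b => Real.exp (weightForm ϖ b)) b) :=
        setIntegral_mono_on hintP (hi1.add (integrable_finsetSum _ hi2)).integrableOn
          (measurableSet_cornerPolytope _) hle
      have h2 := h1.trans (setIntegral_le_integral (hi1.add (integrable_finsetSum _ hi2))
        (ae_of_all _ fun b => add_nonneg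
          (Set.indicator_nonneg (fun _ _ => (Real.exp_pos _).le) _)
          (Finset.sum_nonneg fun i _ =>
            Set.indicator_nonneg (fun _ _ => (Real.exp_pos _).le) _)))
      rw [integral_add hi1 (integrable_finsetSum _ hi2), integral_finsetSum _ hi2,
        integral_indicator hQ] at h2
      simp_rw [integral_indicator (hm _)] at h2
      linarith
    have hηs : 0 < η ^ s := by positivity
    have hW : 0 ≤ ∏ i, ϖ i := Finset.prod_nonneg fun i _ => (hϖ i).le
    have hML : CM * ((∏ i, ϖ i) * η ^ s * (1 - (∑ i, ϖ i) * η)) ≤ M :=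
      mul_le_mul_of_nonneg_left (le_prod_one_sub_exp_neg hϖ hη.le hη') hCM
    have hc0 : 0 ≤ CM * ((∏ i, ϖ i) * η ^ s * (1 - (∑ i, ϖ i) * η)) :=
      mul_nonneg hCM (mul_nonneg (by positivity) (by linarith))
    refine le_of_mul_le_mul_left ?_ hηs
    refine le_trans ?_ h
    have e1 := mul_le_mul_of_nonneg_left hIQ2 hc0
    have e2 := mul_le_mul_of_nonneg_right hML hIQ0
    have e3 := mul_le_mul_of_nonneg_left hIQ1 hD0
    have e4 : η ^ s * (D / η ^ s * cornerIntegral α ϖ lam) = D * cornerIntegral α ϖ lam := by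
      field_simp
    rw [mul_sub, e4]
    linarith
  · intro b hb
    have h1 := abs_sum_cell_sub_le hϖ hCE hf hη.le hηT hb.2
    have h2 := (abs_sub_le_iff.1 h1).2
    have h3 : ∑ y ∈ expBox b with b ∈ cornerCube η (fun i => Real.log (y i)), f y ≤
        ∑ y ∈ Y with b ∈ cornerCube η (fun i => Real.log (y i)), f y := by
      refine Finset.sum_le_sum_of_subset_of_nonneg (fun y hy => ?_) fun y _ _ => hf0 y
      rw [Finset.mem_filter, mem_expBox] at hy
      refine Finset.mem_filter.2 ⟨hY y (fun i => (hy.1 i).1) ?_, hy.2⟩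
      exact mem_cornerPolytope_of_le hα hb.1 (fun i => Real.log_natCast_nonneg _)
        fun i => (hy.1 i).2
    simp only [sub_mul]
    linarith

end Hyperbola

/-! ### Growth under small dilations -/

section Growth

variable {a : ℝ} {k : ℕ}

/-- Enlarging `lam` by `A / lam`, as needed for cubes of side `1 / lam`, changes the main term by a
relative error `O(1 / lam)`. -/
theorem exp_mul_pow_add_le (ha : 0 ≤ a) {A lam : ℝ} (hA : 0 ≤ A) (hlam : 1 ≤ lam) :
    Real.exp (a * (lam + A / lam)) * (lam + A / lam) ^ k ≤
      Real.exp (a * lam) * lam ^ k * (1 + (a * A + k * A) * Real.exp (a * A + k * A) / lam) := by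
  have hl : 0 < lam := by linarith
  set t := a * A + k * A with ht
  have ht0 : 0 ≤ t := by positivity
  have h1 : lam + A / lam ≤ lam * Real.exp (A / lam) := by
    have h2 : A / lam / lam ≤ A / lam := div_le_self (by positivity) hlam
    have h3 := Real.add_one_le_exp (A / lam)
    calc lam + A / lam = lam * (A / lam / lam + 1) := by field_simp; ring
      _ ≤ _ := mul_le_mul_of_nonneg_left (by linarith) hl.le
  have h4 : (lam + A / lam) ^ k ≤ lam ^ k * Real.exp (k * (A / lam)) := by
    rw [Real.exp_nat_mul, ← mul_pow]
    exact pow_le_pow_left₀ (by positivity) h1 k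
  have h5 : Real.exp (t / lam) ≤ 1 + t * Real.exp t / lam := by
    have h6 : Real.exp (-(t / lam)) ≥ 1 - t / lam := Real.one_sub_le_exp_neg _
    have h7 : Real.exp (t / lam) * Real.exp (-(t / lam)) = 1 := by rw [← Real.exp_add]; simp
    have h8 : Real.exp (t / lam) ≤ Real.exp t := Real.exp_le_exp.2 (div_le_self ht0 hlam)
    have h9 : 0 ≤ t / lam := by positivity
    have h10 : t * Real.exp t / lam = t / lam * Real.exp t := by ring
    rw [h10]
    nlinarith [Real.exp_pos (t / lam)]
  calc _ ≤ Real.exp (a * (lam + A / lam)) * (lam ^ k * Real.exp (k * (A / lam))) :=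
        mul_le_mul_of_nonneg_left h4 (Real.exp_pos _).le
    _ = Real.exp (a * lam) * lam ^ k * Real.exp (t / lam) := by
        have : Real.exp (t / lam) = Real.exp (a * (A / lam)) * Real.exp (k * (A / lam)) := by
          rw [← Real.exp_add]; congr 1; rw [ht]; ring
        rw [this, mul_add, Real.exp_add]; ring
    _ ≤ _ := mul_le_mul_of_nonneg_left h5 (by positivity)

theorem exp_mul_pow_add_const_le {A lam : ℝ} (hA : 0 ≤ A) (hlam : 1 ≤ lam) :
    Real.exp (a * (lam + A)) * (lam + A) ^ k ≤
      Real.exp (a * lam) * lam ^ k * (Real.exp (a * A) * (1 + A) ^ k) := by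
  have h1 : lam + A ≤ lam * (1 + A) := by nlinarith
  calc _ ≤ Real.exp (a * (lam + A)) * (lam * (1 + A)) ^ k :=
        mul_le_mul_of_nonneg_left (pow_le_pow_left₀ (by linarith) h1 k) (Real.exp_pos _).le
    _ = _ := by rw [mul_add, Real.exp_add, mul_pow]; ring

end Growth

/-! ### The hyperbola method on dilated polytopes -/

section Hyperbola

variable {s : ℕ} {K : Type*} {α : K → Fin s → ℝ} {ϖ : Fin s → ℝ} {ε a M : ℝ} {k : ℕ}

/-- Dilating a maximal point with positive `i`-th coordinate multiplies that coordinate by `lam`, so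
a slab of thickness `T` carries a share of order `T / lam`. This is where the face must not lie in a
coordinate hyperplane. -/
theorem exists_slab_bound (hα : ∀ k i, 0 ≤ α k i) (hα' : ∀ i, ∃ k, 0 < α k i)
    (hz : ∀ i, ∃ z ∈ cornerPolytope α 1, 0 < z i ∧
      ∀ u ∈ cornerPolytope α 1, weightForm ϖ u ≤ weightForm ϖ z) :
    ∃ C : ℝ, 0 ≤ C ∧ ∀ i : Fin s, ∀ lam T : ℝ, 0 < lam → 0 < T →
      ∫ b in cornerPolytope α lam ∩ {b | b i < T}, Real.exp (weightForm ϖ b) ≤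
        C * (T / lam) * cornerIntegral α ϖ lam := by
  choose z hzP hz0 hzmax using hz
  have hnn : ∀ i ∈ Finset.univ, 0 ≤ 2 ^ (s + 1) / z i i := fun i _ => by
    have := hz0 i; positivity
  refine ⟨∑ i, 2 ^ (s + 1) / z i i, Finset.sum_nonneg hnn, fun i lam T hlam hT => ?_⟩
  have hlz : lam • z i ∈ cornerPolytope α lam := by
    rw [cornerPolytope_eq_smul hlam]
    exact ⟨z i, hzP i, rfl⟩
  have hmax : ∀ u ∈ cornerPolytope α lam, weightForm ϖ u ≤ weightForm ϖ (lam • z i) := by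
    intro u hu
    rw [cornerPolytope_eq_smul hlam] at hu
    obtain ⟨v, hv, rfl⟩ := hu
    simp only [map_smul, smul_eq_mul]
    exact mul_le_mul_of_nonneg_left (hzmax i v hv) hlam.le
  have h := integral_inter_slab_le (ϖ := ϖ) (measurableSet_cornerPolytope lam)
    (isBounded_cornerPolytope hα hα' lam) (convex_cornerPolytope lam) (fun u hu => hu.2) hlz hmax
    (i := i) (mul_pos hlam (hz0 i)) hT
  refine h.trans (mul_le_mul_of_nonneg_right ?_ (cornerIntegral_nonneg _))
  have h1 := Finset.single_le_sum hnn (Finset.mem_univ i)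
  calc 2 ^ (s + 1) * T / (lam • z i) i = 2 ^ (s + 1) / z i i * (T / lam) := by
        simp only [Pi.smul_apply, smul_eq_mul]
        have := hz0 i
        field_simp
    _ ≤ _ := mul_le_mul_of_nonneg_right h1 (by positivity)

set_option maxHeartbeats 1000000 in
/-- The hyperbola method: a sum over a dilated polytope from sums over boxes. -/
theorem exists_hyperbola_bound [Finite K] [Nonempty (Fin s)] (hα : ∀ k i, 0 ≤ α k i)
    (hα' : ∀ i, ∃ k, 0 < α k i) (hϖ : ∀ i, 0 < ϖ i) (hε : 0 < ε) (ha : 0 ≤ a)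
    (hz : ∀ i, ∃ z ∈ cornerPolytope α 1, 0 < z i ∧
      ∀ u ∈ cornerPolytope α 1, weightForm ϖ u ≤ weightForm ϖ z)
    (hJ : ∃ D : ℝ, ∀ lam : ℝ, 1 ≤ lam →
      |(∏ i, ϖ i) * cornerIntegral α ϖ lam - M * (Real.exp (a * lam) * lam ^ k)| ≤
        D * (Real.exp (a * lam) * lam ^ k / lam)) :
    ∃ C : ℝ, ∀ᶠ lam : ℝ in atTop, ∀ (f : (Fin s → ℕ) → ℝ) (CM CE : ℝ), 0 ≤ CM → 0 ≤ CE →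
      (∀ y, 0 ≤ f y) →
      (∀ (c : Fin s → ℝ) (m : ℝ), (∀ i, 0 ≤ c i) → (∀ i, m ≤ c i) →
        |∑ y ∈ expBox c, f y - CM * Real.exp (weightForm ϖ c)| ≤
          CE * (Real.exp (-(ε * m)) * Real.exp (weightForm ϖ c))) →
      ∀ Y : Finset (Fin s → ℕ),
        (∀ y, y ∈ Y ↔ (∀ i, 1 ≤ y i) ∧ (fun i => Real.log (y i)) ∈ cornerPolytope α lam) →
        |∑ y ∈ Y, f y - CM * M * (Real.exp (a * lam) * lam ^ k)| ≤
          C * (CM + CE) * (Real.exp (a * lam) * lam ^ k * (Real.log lam / lam)) := by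
  obtain ⟨D, hD⟩ := hJ
  obtain ⟨A, hA0, hA⟩ := exists_mem_cornerPolytope_add (s := s) hα
  obtain ⟨S, hS0, hS⟩ := exists_slab_bound hα hα' hz
  set W := ∏ i, ϖ i with hWdef
  have hW : 0 < W := Finset.prod_pos fun i _ => hϖ i
  have hD0 : 0 ≤ D := by
    have h1 := (abs_nonneg _).trans (hD 1 le_rfl)
    by_contra hneg
    have : 0 < Real.exp (a * 1) * 1 ^ k / 1 := by positivity
    nlinarith
  -- the growth of the integral over dilated polytopes
  set J0 := (|M| + D) / W with hJ0
  have hJ00 : 0 ≤ J0 := by positivity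
  have hJle : ∀ lam : ℝ, 1 ≤ lam → cornerIntegral α ϖ lam ≤ J0 * (Real.exp (a * lam) * lam ^ k) := by
    intro lam hlam
    have h1 := (abs_sub_le_iff.1 (hD lam hlam)).1
    have h2 : Real.exp (a * lam) * lam ^ k / lam ≤ Real.exp (a * lam) * lam ^ k :=
      div_le_self (by positivity) hlam
    have h3 := mul_le_mul_of_nonneg_left h2 hD0
    have h4 := mul_le_mul_of_nonneg_right (le_abs_self M)
      (by positivity : 0 ≤ Real.exp (a * lam) * lam ^ k)
    rw [hJ0, div_mul_eq_mul_div, le_div_iff₀ hW]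
    linarith
  set J1 := J0 * (Real.exp (a * A) * (1 + A) ^ k) with hJ1
  have hJ10 : 0 ≤ J1 := by positivity
  have hJA : ∀ lam : ℝ, 1 ≤ lam →
      cornerIntegral α ϖ (lam + A) ≤ J1 * (Real.exp (a * lam) * lam ^ k) := fun lam hlam =>
    (hJle _ (by linarith)).trans <| by
      rw [hJ1, mul_assoc, mul_comm (Real.exp (a * A) * _)]
      exact mul_le_mul_of_nonneg_left (exp_mul_pow_add_const_le hA0 hlam) hJ00
  set G := (a * A + k * A) * Real.exp (a * A + k * A) with hG
  have hG0 : 0 ≤ G := by positivity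
  set J2 := J0 * (1 + G) with hJ2
  have hJ20 : 0 ≤ J2 := by positivity
  have hE2 : ∀ lam : ℝ, 1 ≤ lam → Real.exp (a * (lam + A / lam)) * (lam + A / lam) ^ k ≤
      Real.exp (a * lam) * lam ^ k * (1 + G) := fun lam hlam =>
    (exp_mul_pow_add_le ha hA0 hlam).trans (mul_le_mul_of_nonneg_left
      (by have := div_le_self hG0 hlam; linarith) (by positivity))
  have hJA2 : ∀ lam : ℝ, 1 ≤ lam →
      cornerIntegral α ϖ (lam + A / lam) ≤ J2 * (Real.exp (a * lam) * lam ^ k) :=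
    fun lam hlam => (hJle _ (by have : 0 ≤ A / lam := by positivity
                                linarith)).trans <| by
      rw [hJ2, mul_assoc, mul_comm (1 + G)]
      exact mul_le_mul_of_nonneg_left (hE2 lam hlam) hJ00
  set J3 := |M| * G + D * (1 + G) with hJ3
  have hJA3 : ∀ lam : ℝ, 1 ≤ lam → W * cornerIntegral α ϖ (lam + A / lam) ≤
      M * (Real.exp (a * lam) * lam ^ k) + J3 * (Real.exp (a * lam) * lam ^ k / lam) := by
    intro lam hlam
    have hl : 0 < lam := by linarith
    have hAl : 0 ≤ A / lam := by positivity
    have h1 := (abs_sub_le_iff.1 (hD (lam + A / lam) (by linarith))).1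
    set E' := Real.exp (a * (lam + A / lam)) * (lam + A / lam) ^ k with hE'
    set E := Real.exp (a * lam) * lam ^ k with hE
    have hEpos : 0 < E := by positivity
    have hE'pos : 0 < E' := by positivity
    have hEE' : E ≤ E' := by
      refine mul_le_mul (Real.exp_le_exp.2 ?_) (pow_le_pow_left₀ hl.le (by linarith) k)
        (by positivity) (by positivity)
      exact mul_le_mul_of_nonneg_left (by linarith) ha
    have h2 : E' - E ≤ E * (G / lam) := by
      have := exp_mul_pow_add_le (k := k) ha hA0 hlam
      rw [← hE', ← hE, ← hG] at this
      linarith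
    have h3 : E' / (lam + A / lam) ≤ E * (1 + G) / lam := by
      rw [div_le_div_iff₀ (by linarith) hl]
      exact mul_le_mul (hE2 lam hlam) (by linarith) hl.le (by positivity)
    have h4 : M * E' ≤ M * E + |M| * (E * (G / lam)) := by
      have h5 : M * (E' - E) ≤ |M| * (E * (G / lam)) :=
        mul_le_mul (le_abs_self M) h2 (by linarith) (abs_nonneg M)
      linarith
    have h6 := mul_le_mul_of_nonneg_left h3 hD0
    have h7 : J3 * (E / lam) = |M| * (E * (G / lam)) + D * (E * (1 + G) / lam) := by
      rw [hJ3]; ring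
    linarith
  -- the cut-off
  set τ := (s + 1 : ℝ) / ε with hτ
  have hτ0 : 0 < τ := by positivity
  set C1 := 2 ^ s * Real.exp ε with hC1
  set Ω := ∑ i, ϖ i with hΩ
  have hΩ0 : 0 < Ω := Finset.sum_pos (fun i _ => hϖ i) Finset.univ_nonempty
  set CU := J3 + C1 * J2 + s * (S * (τ + 1) * J1) with hCU
  set CL := D + W * Ω * J0 + W * (s * (S * τ * J0)) + C1 * J0 with hCL
  refine ⟨CU + CL, ?_⟩
  have hev : ∀ᶠ lam : ℝ in atTop, 1 ≤ lam ∧ 1 ≤ Real.log lam ∧ 1 / lam ≤ τ * Real.log lam ∧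
      Ω * (1 / lam) ≤ 1 := by
    filter_upwards [eventually_ge_atTop 1, Real.tendsto_log_atTop.eventually_ge_atTop 1,
      Real.tendsto_log_atTop.eventually_ge_atTop (1 / τ), eventually_ge_atTop Ω] with lam h1 h2 h3 h4
    refine ⟨h1, h2, ?_, ?_⟩
    · have : 1 / lam ≤ 1 := div_le_self zero_le_one h1
      rw [div_le_iff₀ hτ0] at h3
      linarith
    · rw [mul_one_div, div_le_one (by linarith)]
      exact h4
  -- How large `lam` must be does not depend on `f`, `CM` and `CE`. This uniformity is what permits
  -- the summation over `d` later.
  filter_upwards [hev] with lam hlam f CM CE hCM hCE hf0 hf Y hY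
  obtain ⟨hlam1, hlog, hηT, hΩη⟩ := hlam
  have hl : 0 < lam := by linarith
  set E := Real.exp (a * lam) * lam ^ k with hE
  have hE0 : 0 < E := by positivity
  set T := τ * Real.log lam with hT
  have hT0 : 0 < T := by positivity
  have hη : 0 < 1 / lam := by positivity
  have hη' : ∀ i, ϖ i * (1 / lam) ≤ 1 := fun i =>
    (mul_le_mul_of_nonneg_right (Finset.single_le_sum (fun i _ => (hϖ i).le) (Finset.mem_univ i))
      hη.le).trans hΩη
  -- With `τ = (s + 1) / ε` the factor `exp (-ε T)` is `lam ^ (-(s + 1))`. This outweighs the factor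
  -- `lam ^ s` from the cell volume and leaves `1 / lam`.
  have hcut : 2 ^ s * CE * Real.exp (-(ε * (T - 1 / lam))) / (1 / lam) ^ s ≤ C1 * CE / lam := by
    have h1 : Real.exp (-(ε * (T - 1 / lam))) ≤ Real.exp ε * (lam ^ (s + 1))⁻¹ := by
      have h2 : (lam ^ (s + 1))⁻¹ = Real.exp (-(ε * T)) := by
        rw [hT, hτ, Real.exp_neg, ← mul_assoc, mul_div_cancel₀ _ hε.ne']
        congr 1
        have : ((s : ℝ) + 1) = ((s + 1 : ℕ) : ℝ) := by push_cast; ring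
        rw [this, Real.exp_nat_mul, Real.exp_log hl]
      rw [h2, ← Real.exp_add]
      refine Real.exp_le_exp.2 ?_
      have : ε * (1 / lam) ≤ ε := mul_le_of_le_one_right hε.le (div_le_self zero_le_one hlam1)
      linarith
    calc _ ≤ 2 ^ s * CE * (Real.exp ε * (lam ^ (s + 1))⁻¹) / (1 / lam) ^ s := by gcongr
      _ = _ := by rw [hC1, pow_succ, one_div, inv_pow]; field_simp
  have hC10 : 0 ≤ C1 := by positivity
  -- Every error other than that of the slabs is `O(E / lam)`. The slabs, of thickness proportional
  -- to `log lam`, cause the extra logarithm.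
  have hratio : E / lam ≤ E * (Real.log lam / lam) := by
    rw [← mul_div_assoc, div_le_div_iff_of_pos_right hl]
    exact le_mul_of_one_le_right hE0.le hlog
  set R := E * (Real.log lam / lam) with hR
  have hR0 : 0 ≤ R := by positivity
  have hY1 : ∀ y ∈ Y, (∀ i, 1 ≤ y i) ∧ (fun i => Real.log (y i)) ∈ cornerPolytope α lam :=
    fun y hy => (hY y).1 hy
  have hEl : 0 ≤ E / lam := by positivity
  -- upper bound
  have hupper : ∑ y ∈ Y, f y ≤ CM * M * E + CU * (CM + CE) * R := by
    have hgood := sum_large_coords_le hα hα' hA hϖ hCM hCE hf0 hf hY1 hη hηT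
    rw [mul_one_div] at hgood
    have hbad : ∀ i : Fin s, ∑ y ∈ Y with Real.log (y i) < T, f y ≤
        (CM + CE) * (S * (τ + 1) * J1 * R) := fun i => by
      refine (sum_small_coord_le hα hα' hA hf0 hf hY1 i T).trans
        (mul_le_mul_of_nonneg_left ?_ (by linarith))
      refine (hS i (lam + A) (T + 1) (by linarith) (by linarith)).trans ?_
      have h1 : (T + 1) / (lam + A) ≤ (τ + 1) * (Real.log lam / lam) := by
        rw [← mul_div_assoc]
        refine div_le_div₀ (by positivity) ?_ hl (by linarith)
        rw [add_mul, one_mul]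
        linarith
      calc _ ≤ S * ((τ + 1) * (Real.log lam / lam)) * (J1 * E) :=
            mul_le_mul (mul_le_mul_of_nonneg_left h1 hS0) (hJA lam hlam1) (cornerIntegral_nonneg _)
              (by positivity)
        _ = _ := by rw [hR]; ring
    have hsplit : ∑ y ∈ Y, f y ≤ ∑ y ∈ Y with ∀ i, T ≤ Real.log (y i), f y +
        ∑ i, ∑ y ∈ Y with Real.log (y i) < T, f y := by
      classical
      simp_rw [Finset.sum_filter]
      rw [Finset.sum_comm, ← Finset.sum_add_distrib]
      refine Finset.sum_le_sum fun y _ => ?_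
      have hnn : ∀ i ∈ (Finset.univ : Finset (Fin s)),
          0 ≤ if Real.log (y i) < T then f y else 0 := fun i _ => by
        split_ifs
        · exact hf0 y
        · exact le_rfl
      by_cases hall : ∀ i, T ≤ Real.log (y i)
      · rw [if_pos hall]
        linarith [Finset.sum_nonneg hnn]
      · rw [if_neg hall, zero_add]
        push Not at hall
        obtain ⟨i, hi⟩ := hall
        have := Finset.single_le_sum hnn (Finset.mem_univ i)
        rwa [if_pos hi] at this
    have hbadsum := Finset.sum_le_sum fun i (_ : i ∈ Finset.univ) => hbad i
    rw [Finset.sum_const, Finset.card_univ, Fintype.card_fin, nsmul_eq_mul] at hbadsum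
    have h1 : (CM * W + 2 ^ s * CE * Real.exp (-(ε * (T - 1 / lam))) / (1 / lam) ^ s) *
        cornerIntegral α ϖ (lam + A / lam) ≤
        CM * (M * E + J3 * (E / lam)) + C1 * CE / lam * (J2 * E) := by
      rw [add_mul, mul_assoc CM]
      exact add_le_add (mul_le_mul_of_nonneg_left (hJA3 lam hlam1) hCM)
        (mul_le_mul hcut (hJA2 lam hlam1) (cornerIntegral_nonneg _) (by positivity))
    have hJ30 : 0 ≤ J3 := by positivity
    have e1 : CM * (J3 * (E / lam)) ≤ (CM + CE) * (J3 * R) :=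
      mul_le_mul (by linarith) (mul_le_mul_of_nonneg_left hratio hJ30) (by positivity)
        (by linarith)
    have e2 : C1 * CE / lam * (J2 * E) ≤ (CM + CE) * (C1 * J2 * R) := by
      calc _ = CE * (C1 * J2 * (E / lam)) := by ring
        _ ≤ _ := mul_le_mul (by linarith) (mul_le_mul_of_nonneg_left hratio (by positivity))
          (by positivity) (by linarith)
    have e3 : CU * (CM + CE) * R = (CM + CE) * (J3 * R) + (CM + CE) * (C1 * J2 * R) +
        s * ((CM + CE) * (S * (τ + 1) * J1 * R)) := by rw [hCU]; ring
    rw [e3]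
    linarith
  -- lower bound
  have hlower : CM * M * E - CL * (CM + CE) * R ≤ ∑ y ∈ Y, f y := by
    have h := le_sum_of_mem_cornerPolytope hα hα' hϖ hCM hCE hf0 hf
      (fun y h1 h2 => (hY y).2 ⟨h1, h2⟩) hη hηT hη' hΩη
    rw [← hΩ, ← hWdef] at h
    refine le_trans ?_ h
    set JJ := cornerIntegral α ϖ lam with hJJ
    have hJJ0 : 0 ≤ JJ := cornerIntegral_nonneg _
    have hJJ1 := hJle lam hlam1
    rw [← hJJ, ← hE] at hJJ1
    set Sl := ∑ i, ∫ b in cornerPolytope α lam ∩ {b | b i < T}, Real.exp (weightForm ϖ b) with hSl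
    have hSl0 : 0 ≤ Sl := Finset.sum_nonneg fun i _ => integral_nonneg fun _ => (Real.exp_pos _).le
    have hSl1 : Sl ≤ s * (S * τ * J0 * R) := by
      calc Sl ≤ ∑ i : Fin s, S * τ * J0 * R := Finset.sum_le_sum fun i _ => by
            refine (hS i lam T hl hT0).trans ?_
            calc _ ≤ S * (T / lam) * (J0 * E) := mul_le_mul_of_nonneg_left hJJ1 (by positivity)
              _ = _ := by rw [hR, hT]; ring
        _ = _ := by simp
    have d1 := (abs_sub_le_iff.1 (hD lam hlam1)).2
    rw [← hJJ, ← hE] at d1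
    have d2 : CM * (M * E - D * (E / lam)) ≤ CM * (W * JJ) :=
      mul_le_mul_of_nonneg_left (by linarith) hCM
    have d3 : CM * W * (Ω * (1 / lam)) * JJ ≤ CM * (W * Ω * J0 * (E / lam)) := by
      calc _ ≤ CM * W * (Ω * (1 / lam)) * (J0 * E) :=
            mul_le_mul_of_nonneg_left hJJ1 (by positivity)
        _ = _ := by ring
    have d4 : CM * W * (1 - Ω * (1 / lam)) * Sl ≤ CM * (W * (s * (S * τ * J0)) * R) := by
      calc _ ≤ CM * W * 1 * (s * (S * τ * J0 * R)) := by
            have : 0 ≤ Ω * (1 / lam) := by positivity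
            refine mul_le_mul (mul_le_mul_of_nonneg_left (by linarith) (by positivity)) hSl1 hSl0
              (by positivity)
        _ = _ := by ring
    have d5 : 2 ^ s * CE * Real.exp (-(ε * (T - 1 / lam))) / (1 / lam) ^ s * JJ ≤
        CE * (C1 * J0 * (E / lam)) := by
      calc _ ≤ C1 * CE / lam * (J0 * E) := mul_le_mul hcut hJJ1 hJJ0 (by positivity)
        _ = _ := by ring
    have f1 : CM * (D * (E / lam)) ≤ (CM + CE) * (D * R) :=
      mul_le_mul (by linarith) (mul_le_mul_of_nonneg_left hratio hD0) (by positivity) (by linarith)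
    have f2 : CM * (W * Ω * J0 * (E / lam)) ≤ (CM + CE) * (W * Ω * J0 * R) :=
      mul_le_mul (by linarith) (mul_le_mul_of_nonneg_left hratio (by positivity)) (by positivity)
        (by linarith)
    have f3 : CM * (W * (s * (S * τ * J0)) * R) ≤ (CM + CE) * (W * (s * (S * τ * J0)) * R) :=
      mul_le_mul_of_nonneg_right (by linarith) (by positivity)
    have f4 : CE * (C1 * J0 * (E / lam)) ≤ (CM + CE) * (C1 * J0 * R) :=
      mul_le_mul (by linarith) (mul_le_mul_of_nonneg_left hratio (by positivity)) (by positivity)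
        (by linarith)
    have e3 : CL * (CM + CE) * R = (CM + CE) * (D * R) + (CM + CE) * (W * Ω * J0 * R) +
        (CM + CE) * (W * (s * (S * τ * J0)) * R) + (CM + CE) * (C1 * J0 * R) := by
      rw [hCL]; ring
    rw [e3]
    linarith
  have hCU0 : 0 ≤ CU * (CM + CE) * R := by positivity
  have hCL0 : 0 ≤ CL * (CM + CE) * R := by positivity
  rw [abs_sub_le_iff]
  constructor <;> linarith

/-- The integral over a dilated polytope from the Laplace transform. -/
theorem cornerIntegral_eq {lam : ℝ} (hlam : 0 < lam) :
    cornerIntegral α ϖ lam =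
      lam ^ s * ∫ u in cornerPolytope α 1, Real.exp (lam * weightForm ϖ u) := by
  have h := Measure.setIntegral_comp_smul_of_pos volume
    (fun b => Real.exp (weightForm ϖ b)) (cornerPolytope α 1) hlam
  simp only [map_smul, smul_eq_mul, Module.finrank_fintype_fun_eq_card, Fintype.card_fin] at h
  rw [h, cornerIntegral, cornerPolytope_eq_smul hlam, mul_inv_cancel_left₀ (by positivity)]
  rfl

end Hyperbola

/-! ### Asymptotics of the integral over a dilated polytope -/

section CornerAsymptotics

variable {s : ℕ} {K : Type*} {α : K → Fin s → ℝ} {ϖ : Fin s → ℝ} {a : ℝ}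

/-- The linear forms defining a polytope in the positive orthant. -/
noncomputable def cornerForm (α : K → Fin s → ℝ) : K ⊕ Fin s → (Fin s → ℝ) →ₗ[ℝ] ℝ :=
  Sum.elim (fun k => weightForm (α k)) fun i => -LinearMap.proj i

theorem forall_cornerForm_le_iff {u : Fin s → ℝ} :
    (∀ j, cornerForm α j u ≤ Sum.elim (fun _ => (1 : ℝ)) (fun _ => 0) j) ↔
      u ∈ cornerPolytope α 1 := by
  rw [Sum.forall]
  simp [cornerForm, cornerPolytope, weightForm_apply]

/-- The directions of the face lie in the kernel of a nonzero linear form. So the natural number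
subtraction in `s - 1 - k` is not truncated. -/
theorem finrank_vectorSpan_lt [Nonempty (Fin s)] (hϖ : ∀ i, 0 < ϖ i) {F : Set (Fin s → ℝ)}
    (hF : ∀ u ∈ F, weightForm ϖ u = a) : Module.finrank ℝ (vectorSpan ℝ F) < s := by
  have hle : vectorSpan ℝ F ≤ LinearMap.ker (weightForm ϖ) := by
    rw [vectorSpan_def, Submodule.span_le]
    rintro _ ⟨u, hu, v, hv, rfl⟩
    simp [hF u hu, hF v hv]
  obtain ⟨i⟩ := ‹Nonempty (Fin s)›
  have hlt : LinearMap.ker (weightForm ϖ) < ⊤ := by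
    refine lt_top_iff_ne_top.2 fun h => ?_
    have h1 : Pi.single i (1 : ℝ) ∈ LinearMap.ker (weightForm ϖ) := h ▸ Submodule.mem_top
    rw [LinearMap.mem_ker, weightForm_apply] at h1
    simp [Pi.single_apply] at h1
    exact (hϖ i).ne' h1
  have h2 := Submodule.finrank_lt_finrank_of_lt hlt
  rw [finrank_top, Module.finrank_fintype_fun_eq_card, Fintype.card_fin] at h2
  exact (Submodule.finrank_mono hle).trans_lt h2

/-- Dilation contributes `lam ^ s` and the Laplace transform `lam ^ (-(N + 1))`, which leaves `lam ^
k`. -/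
theorem exists_cornerPolytope_asymptotics [Finite K] [Nonempty (Fin s)] (hα : ∀ k i, 0 ≤ α k i)
    (hα' : ∀ i, ∃ k, 0 < α k i) (hϖ : ∀ i, 0 < ϖ i)
    (hne : ∃ u ∈ cornerPolytope α 1, weightForm ϖ u = a)
    (hmax : ∀ u ∈ cornerPolytope α 1, weightForm ϖ u ≤ a) {k N : ℕ}
    (hk : k = Module.finrank ℝ (vectorSpan ℝ {u | u ∈ cornerPolytope α 1 ∧ weightForm ϖ u = a}))
    (hN : s = k + 1 + N) :
    ∃ c C : ℝ, (∀ i₀ : Fin s, ∀ δ : ℝ, 0 < δ → |(∏ i : {i // i ≠ i₀}, ϖ i) *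
        (volume (forgetCoord i₀ ''
          {u | u ∈ cornerPolytope α 1 ∧ weightForm ϖ u = a - δ})).toReal -
        c * δ ^ N| ≤ C * δ ^ (N + 1)) ∧
      ∃ D : ℝ, ∀ lam : ℝ, 1 ≤ lam → |(∏ i, ϖ i) * cornerIntegral α ϖ lam -
          N.factorial * c * (Real.exp (a * lam) * lam ^ k)| ≤
          D * (Real.exp (a * lam) * lam ^ k / lam) := by
  have hset : {u | ∀ j, cornerForm α j u ≤ Sum.elim (fun _ => (1 : ℝ)) (fun _ => 0) j} =
      cornerPolytope α 1 := Set.ext fun u => forall_cornerForm_le_iff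
  have hset' : {u | (∀ j, cornerForm α j u ≤ Sum.elim (fun _ => (1 : ℝ)) (fun _ => 0) j) ∧
      weightForm ϖ u = a} = {u | u ∈ cornerPolytope α 1 ∧ weightForm ϖ u = a} :=
    Set.ext fun u => and_congr_left fun _ => forall_cornerForm_le_iff
  have hbdd := isBounded_cornerPolytope hα hα' 1
  rw [← hset] at hbdd
  have h := exists_slice_and_laplace (a := a) (N := N) (ℓ := cornerForm α)
    (b := Sum.elim (fun _ => (1 : ℝ)) (fun _ => 0)) hϖ hbdd
    (by obtain ⟨u, hu, hua⟩ := hne; exact ⟨u, forall_cornerForm_le_iff.2 hu, hua⟩)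
    (fun u hu => hmax u (forall_cornerForm_le_iff.1 hu))
    (by rw [hset']; omega)
  simp_rw [forall_cornerForm_le_iff] at h
  obtain ⟨c, C, h1, h2⟩ := h
  refine ⟨c, C, h1, C * (N + 1).factorial, fun lam hlam => ?_⟩
  have hl : 0 < lam := by linarith
  have h3 := mul_le_mul_of_nonneg_left (h2 lam hl) (by positivity : (0 : ℝ) ≤ lam ^ s)
  rw [cornerIntegral_eq hl]
  calc _ = lam ^ s * |(∏ i, ϖ i) *
        (∫ u in cornerPolytope α 1, Real.exp (lam * weightForm ϖ u)) -
          c * (N.factorial * Real.exp (lam * a) / lam ^ (N + 1))| := by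
        rw [← abs_of_pos (by positivity : 0 < lam ^ s), ← abs_mul,
          abs_of_pos (by positivity : 0 < lam ^ s), mul_sub]
        congr 2
        · ring
        · rw [hN, mul_comm lam a, pow_add lam (k + 1) N, pow_succ, pow_succ lam N]
          field_simp
    _ ≤ _ := h3
    _ = _ := by
        rw [hN, mul_comm lam a]
        have : lam ^ (N + 2) = lam ^ N * lam * lam := by ring
        rw [pow_add lam (k + 1) N, pow_succ, this]
        field_simp

end CornerAsymptotics

/-! ### The polytope of a toric variety -/

namespace SmoothCompleteFan

variable {rk s : ℕ} {n : Fin s → ℕ} {X : SmoothCompleteFan rk (Σ i : Fin s, Fin (n i))}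
  {L : (Σ i : Fin s, Fin (n i)) → ℚ} {ϖ : Fin s → ℝ}

variable (X L) in
/-- The coefficients of the inequalities that define the polytope. -/
noncomputable def polytopeCoeff (σ : X.maxCones) (i : Fin s) : ℝ := X.groupCoeff L σ i

theorem polytope_eq_cornerPolytope : X.polytope L = cornerPolytope (X.polytopeCoeff L) 1 := by
  ext u
  simp [polytope, cornerPolytope, polytopeCoeff]

theorem polytopeCoeff_nonneg (hL : X.IsSemiample L) (σ : X.maxCones) (i : Fin s) :
    0 ≤ X.polytopeCoeff L σ i := by
  have := groupCoeff_nonneg hL σ.2 i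
  unfold polytopeCoeff
  exact_mod_cast this

theorem exists_polytopeCoeff_pos (hLbdd : ∀ i, ∃ σ ∈ X.maxCones, 0 < X.groupCoeff L σ i)
    (i : Fin s) : ∃ σ, 0 < X.polytopeCoeff L σ i := by
  obtain ⟨σ, hσ, h⟩ := hLbdd i
  exact ⟨⟨σ, hσ⟩, by unfold polytopeCoeff; exact_mod_cast h⟩

theorem zero_mem_polytope : (0 : Fin s → ℝ) ∈ X.polytope L := by simp [polytope]

theorem isCompact_polytope (hL : X.IsSemiample L)
    (hLbdd : ∀ i, ∃ σ ∈ X.maxCones, 0 < X.groupCoeff L σ i) : IsCompact (X.polytope L) := by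
  rw [polytope_eq_cornerPolytope]
  exact Metric.isCompact_of_isClosed_isBounded (isClosed_cornerPolytope 1)
    (isBounded_cornerPolytope (polytopeCoeff_nonneg hL) (exists_polytopeCoeff_pos hLbdd) 1)

theorem isGreatest_maxValue (hL : X.IsSemiample L)
    (hLbdd : ∀ i, ∃ σ ∈ X.maxCones, 0 < X.groupCoeff L σ i) (ϖ : Fin s → ℝ) :
    IsGreatest ((fun u => ∑ i, ϖ i * u i) '' X.polytope L) (X.maxValue L ϖ) := by
  have hc := (isCompact_polytope hL hLbdd).image
    (f := fun u : Fin s → ℝ => ∑ i, ϖ i * u i) (by fun_prop)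
  exact hc.isGreatest_sSup (Set.Nonempty.image _ ⟨0, zero_mem_polytope⟩)

theorem le_maxValue (hL : X.IsSemiample L)
    (hLbdd : ∀ i, ∃ σ ∈ X.maxCones, 0 < X.groupCoeff L σ i) {u : Fin s → ℝ}
    (hu : u ∈ X.polytope L) : ∑ i, ϖ i * u i ≤ X.maxValue L ϖ :=
  (isGreatest_maxValue hL hLbdd ϖ).2 ⟨u, hu, rfl⟩

theorem maxValue_nonneg (hL : X.IsSemiample L)
    (hLbdd : ∀ i, ∃ σ ∈ X.maxCones, 0 < X.groupCoeff L σ i) : 0 ≤ X.maxValue L ϖ := by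
  simpa using le_maxValue (ϖ := ϖ) hL hLbdd zero_mem_polytope

theorem maxFace_eq : X.maxFace L ϖ = {u | u ∈ cornerPolytope (X.polytopeCoeff L) 1 ∧
    weightForm ϖ u = X.maxValue L ϖ} := by
  ext u
  simp [maxFace, polytope_eq_cornerPolytope, weightForm_apply]

theorem maxFace_nonempty (hL : X.IsSemiample L)
    (hLbdd : ∀ i, ∃ σ ∈ X.maxCones, 0 < X.groupCoeff L σ i) : (X.maxFace L ϖ).Nonempty := by
  obtain ⟨u, hu, hua⟩ := (isGreatest_maxValue hL hLbdd ϖ).1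
  exact ⟨u, hu, hua⟩

theorem faceDim_lt [Nonempty (Fin s)] (hϖ : ∀ i, 0 < ϖ i) : X.faceDim L ϖ < s :=
  finrank_vectorSpan_lt (a := X.maxValue L ϖ) hϖ fun u hu => by
    rw [weightForm_apply]; exact hu.2

/-- The constant `c_P` and the growth of the integrals over the dilated polytopes. -/
theorem exists_sliceMeasure_limit [Nonempty (Fin s)] (hL : X.IsSemiample L)
    (hLbdd : ∀ i, ∃ σ ∈ X.maxCones, 0 < X.groupCoeff L σ i) (hϖ : ∀ i, 0 < ϖ i) :
    ∃ c : ℝ, (∀ i₀ : Fin s, Tendsto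
        (fun δ : ℝ => δ ^ ((X.faceDim L ϖ : ℤ) + 1 - s) * X.sliceMeasure L ϖ i₀ δ)
        (𝓝[>] 0) (𝓝 c)) ∧
      ∃ D : ℝ, ∀ lam : ℝ, 1 ≤ lam → |(∏ i, ϖ i) * cornerIntegral (X.polytopeCoeff L) ϖ lam -
          (s - 1 - X.faceDim L ϖ).factorial * c *
            (Real.exp (X.maxValue L ϖ * lam) * lam ^ X.faceDim L ϖ)| ≤
          D * (Real.exp (X.maxValue L ϖ * lam) * lam ^ X.faceDim L ϖ / lam) := by
  obtain ⟨N, hN⟩ : ∃ N, s = X.faceDim L ϖ + 1 + N := Nat.exists_eq_add_of_le (faceDim_lt hϖ)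
  obtain ⟨c, C, h1, D, hD⟩ := exists_cornerPolytope_asymptotics (k := X.faceDim L ϖ)
    (a := X.maxValue L ϖ) (polytopeCoeff_nonneg hL) (exists_polytopeCoeff_pos hLbdd) hϖ
    (by obtain ⟨u, hu⟩ := maxFace_nonempty (ϖ := ϖ) hL hLbdd
        rw [maxFace_eq] at hu
        exact ⟨u, hu⟩)
    (fun u hu => by
      rw [weightForm_apply]
      exact le_maxValue hL hLbdd (polytope_eq_cornerPolytope ▸ hu))
    (by rw [← maxFace_eq]; rfl) hN
  have hN' : s - 1 - X.faceDim L ϖ = N := by omega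
  refine ⟨c, fun i₀ => ?_, D, by rw [hN']; exact hD⟩
  have hslice : ∀ δ, X.sliceMeasure L ϖ i₀ δ = (∏ i : {i // i ≠ i₀}, ϖ i) *
        (volume (forgetCoord i₀ '' {u | u ∈ cornerPolytope (X.polytopeCoeff L) 1 ∧
          weightForm ϖ u = X.maxValue L ϖ - δ})).toReal := fun δ => by
    rw [← polytope_eq_cornerPolytope]
    simp_rw [weightForm_apply]
    rfl
  have hexp : (X.faceDim L ϖ : ℤ) + 1 - s = -(N : ℤ) := by omega
  simp_rw [hexp, hslice]
  rw [tendsto_iff_norm_sub_tendsto_zero]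
  have hlim : Tendsto (fun δ : ℝ => C * δ) (𝓝[>] 0) (𝓝 0) := by
    have h : Tendsto (fun δ : ℝ => C * δ) (𝓝 0) (𝓝 (C * 0)) :=
      (continuous_const_mul C).tendsto 0
    rw [mul_zero] at h
    exact h.mono_left nhdsWithin_le_nhds
  refine squeeze_zero' (Eventually.of_forall fun _ => norm_nonneg _) ?_ hlim
  filter_upwards [self_mem_nhdsWithin] with δ hδ
  have hδ0 : (0 : ℝ) < δ := hδ
  have h2 := h1 i₀ δ hδ0
  set V := (∏ i : {i // i ≠ i₀}, ϖ i) *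
        (volume (forgetCoord i₀ '' {u | u ∈ cornerPolytope (X.polytopeCoeff L) 1 ∧
          weightForm ϖ u = X.maxValue L ϖ - δ})).toReal with hV
  have h3 : δ ^ (-(N : ℤ)) * V - c = (δ ^ N)⁻¹ * (V - c * δ ^ N) := by
    rw [zpow_neg, zpow_natCast]
    field_simp
  rw [h3, norm_mul, Real.norm_eq_abs, Real.norm_eq_abs, abs_of_pos (by positivity),
    inv_mul_le_iff₀ (by positivity)]
  refine h2.trans_eq ?_
  ring

end SmoothCompleteFan

/-! ### Integral tuples grouped by their maxima -/

section Tuples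

variable {s t : ℕ} {n : Fin s → ℕ}

/-- The maxima of the absolute values of the coordinates in each class. -/
def supAbs (x : (Σ i : Fin s, Fin (n i)) → ℤ) (i : Fin s) : ℕ :=
  Finset.univ.sup fun j : Fin (n i) => (x ⟨i, j⟩).natAbs

theorem natAbs_le_supAbs (x : (Σ i : Fin s, Fin (n i)) → ℤ) (ρ : Σ i : Fin s, Fin (n i)) :
    (x ρ).natAbs ≤ supAbs x ρ.1 :=
  Finset.le_sup (f := fun j : Fin (n ρ.1) => (x ⟨ρ.1, j⟩).natAbs) (Finset.mem_univ ρ.2)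

theorem exists_natAbs_eq_supAbs (hn : ∀ i, 0 < n i) (x : (Σ i : Fin s, Fin (n i)) → ℤ)
    (i : Fin s) : ∃ j, (x ⟨i, j⟩).natAbs = supAbs x i := by
  have : Nonempty (Fin (n i)) := ⟨⟨0, hn i⟩⟩
  obtain ⟨j, -, hj⟩ := Finset.exists_mem_eq_sup (Finset.univ : Finset (Fin (n i)))
    Finset.univ_nonempty fun j => (x ⟨i, j⟩).natAbs
  exact ⟨j, hj.symm⟩

theorem finite_setOf_supAbs_mem (Y : Finset (Fin s → ℕ)) :
    {x : (Σ i : Fin s, Fin (n i)) → ℤ | supAbs x ∈ Y}.Finite := by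
  have h : {x : (Σ i : Fin s, Fin (n i)) → ℤ | supAbs x ∈ Y} ⊆
      ⋃ y ∈ Y, Set.pi Set.univ fun ρ => Set.Icc (-(y ρ.1 : ℤ)) (y ρ.1) := by
    intro x hx
    refine Set.mem_iUnion₂.2 ⟨_, hx, fun ρ _ => ?_⟩
    have h := natAbs_le_supAbs x ρ
    rw [Set.mem_Icc, ← abs_le, Int.abs_eq_natAbs]
    exact Int.ofNat_le.2 h
  exact (Y.finite_toSet.biUnion fun y _ => Set.Finite.pi' fun ρ => Set.finite_Icc _ _).subset
    (by simpa [Set.pi] using h)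

/-- The tuples of nonzero, full solutions whose maxima lie in a given set. -/
noncomputable def fullTuples (g : Fin t → MvPolynomial (Σ i : Fin s, Fin (n i)) ℤ)
    (m : (Σ i : Fin s, Fin (n i)) → ℕ) (Y : Finset (Fin s → ℕ)) :
    Finset ((Σ i : Fin s, Fin (n i)) → ℤ) :=
  ((finite_setOf_supAbs_mem Y).subset (t := {x | (∀ ρ, x ρ ≠ 0) ∧ (∀ ρ, IsFull (m ρ) (x ρ)) ∧
    (∀ l, MvPolynomial.eval x (g l) = 0) ∧ supAbs x ∈ Y}) fun _ hx => hx.2.2.2).toFinset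

theorem mem_fullTuples {g : Fin t → MvPolynomial (Σ i : Fin s, Fin (n i)) ℤ}
    {m : (Σ i : Fin s, Fin (n i)) → ℕ} {Y : Finset (Fin s → ℕ)}
    {x : (Σ i : Fin s, Fin (n i)) → ℤ} :
    x ∈ fullTuples g m Y ↔ (∀ ρ, x ρ ≠ 0) ∧ (∀ ρ, IsFull (m ρ) (x ρ)) ∧
      (∀ l, MvPolynomial.eval x (g l) = 0) ∧ supAbs x ∈ Y := by
  simp [fullTuples]

open Classical in
theorem sum_fiberCount (g : Fin t → MvPolynomial (Σ i : Fin s, Fin (n i)) ℤ)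
    (m : (Σ i : Fin s, Fin (n i)) → ℕ) (Y : Finset (Fin s → ℕ)) (d : Fin s → ℕ+) :
    ∑ y ∈ Y, fiberCount g m d y =
      ((fullTuples g m Y).filter fun x => ∀ ρ, ((d ρ.1 : ℕ) : ℤ) ∣ x ρ).card := by
  rw [Finset.card_eq_sum_card_fiberwise (f := supAbs) (t := Y)
    fun x hx => (mem_fullTuples.1 (Finset.mem_filter.1 hx).1).2.2.2]
  refine Finset.sum_congr rfl fun y hy => ?_
  rw [fiberCount, ← Set.ncard_coe_finset]
  congr 1
  ext x
  simp only [Finset.coe_filter, Finset.mem_filter, mem_fullTuples, Set.mem_ofPred_eq]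
  have hsup : (∀ i, Finset.univ.sup (fun j : Fin (n i) => (x ⟨i, j⟩).natAbs) = y i) ↔
      supAbs x = y := funext_iff.symm
  rw [hsup]
  constructor
  · rintro ⟨h1, h2, h3, h4, h5⟩
    exact ⟨⟨⟨h1, h3, h4, h5 ▸ hy⟩, h2⟩, h5⟩
  · rintro ⟨⟨⟨h1, h3, h4, -⟩, h2⟩, h5⟩
    exact ⟨h1, h2, h3, h4, h5⟩

end Tuples

/-! ### Möbius inversion on integral Cox coordinates -/

namespace SmoothCompleteFan

variable {rk s t : ℕ} {n : Fin s → ℕ} {X : SmoothCompleteFan rk (Σ i : Fin s, Fin (n i))}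
  {L : (Σ i : Fin s, Fin (n i)) → ℚ} {g : Fin t → MvPolynomial (Σ i : Fin s, Fin (n i)) ℤ}
  {m : (Σ i : Fin s, Fin (n i)) → ℕ} {B : ℝ} {Y : Finset (Fin s → ℕ)}

/-- Writes the finite divisor sum as a sum over all `d`, whose index set no longer depends on the
tuple, so that it can be exchanged with the sum over tuples. -/
theorem hasSum_mu_of_dvd (b : Fin s → ℕ) (hb : ∀ i, 0 < b i)
    [DecidablePred fun d : Fin s → ℕ+ => ∀ i, (d i : ℕ) ∣ b i] :
    HasSum (fun d : Fin s → ℕ+ =>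
      if ∀ i, (d i : ℕ) ∣ b i then (X.mu (fun i => (d i : ℕ)) : ℝ) else 0) (X.chi b : ℝ) := by
  have h1 : HasSum (fun d : Fin s → ℕ =>
      if d ∈ Fintype.piFinset (fun i => (b i).divisors) then (X.mu d : ℝ) else 0)
      (X.chi b : ℝ) := by
    rw [← X.sum_mu b hb, Int.cast_sum, ← Finset.sum_congr rfl fun d hd => if_pos hd]
    exact hasSum_sum_of_ne_finset_zero fun d hd => if_neg hd
  have hinj : Function.Injective fun (d : Fin s → ℕ+) (i : Fin s) => (d i : ℕ) := fun d d' h =>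
    funext fun i => PNat.coe_injective (congrFun h i)
  rw [← hinj.hasSum_iff] at h1
  · refine h1.congr_fun ?_
    intro d
    have : (fun i => (d i : ℕ)) ∈ Fintype.piFinset (fun i => (b i).divisors) ↔
        ∀ i, (d i : ℕ) ∣ b i := by
      simp [Fintype.mem_piFinset, (hb _).ne']
    simp only [Function.comp_apply, this]
  · intro d hd
    refine if_neg fun hmem => hd ⟨fun i => ⟨d i, ?_⟩, rfl⟩
    exact Nat.pos_of_mem_divisors (Fintype.mem_piFinset.1 hmem i)

/-- The coprime tuples among the full tuples, by Möbius inversion. -/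
theorem hasSum_mu_mul_sum_fiberCount [DecidablePred X.IsCoprimeTuple] (hX : X.GroupedByClass) :
    HasSum (fun d : Fin s → ℕ+ =>
      (X.mu (fun i => (d i : ℕ)) : ℝ) * ∑ y ∈ Y, (fiberCount g m d y : ℝ))
      (((fullTuples g m Y).filter X.IsCoprimeTuple).card : ℝ) := by
  classical
  set b : ((Σ i : Fin s, Fin (n i)) → ℤ) → Fin s → ℕ :=
    fun x i => Finset.univ.gcd fun j => (x ⟨i, j⟩).natAbs with hb
  have hbpos : ∀ x ∈ fullTuples g m Y, ∀ i, 0 < b x i := by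
    intro x hx i
    rw [Nat.pos_iff_ne_zero, hb]
    intro h0
    rw [Finset.gcd_eq_zero_iff] at h0
    exact (mem_fullTuples.1 hx).1 ⟨i, ⟨0, hX.1 i⟩⟩
      (Int.natAbs_eq_zero.1 (h0 ⟨0, hX.1 i⟩ (Finset.mem_univ _)))
  have h := hasSum_sum fun x (hx : x ∈ fullTuples g m Y) =>
    X.hasSum_mu_of_dvd (b x) (hbpos x hx)
  have h1 : ∑ x ∈ fullTuples g m Y, (X.chi (b x) : ℝ) =
      ((fullTuples g m Y).filter X.IsCoprimeTuple).card := by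
    rw [Finset.card_filter, Nat.cast_sum]
    refine Finset.sum_congr rfl fun x hx => ?_
    have hiff := isCoprimeTuple_iff_chi hX (mem_fullTuples.1 hx).1
    rcases X.chi_eq_zero_or_one (b x) with h0 | h0
    · have : ¬ X.IsCoprimeTuple x := fun hc => by
        have := hiff.1 hc
        rw [hb] at h0
        simp only at h0
        omega
      simp [h0, this]
    · simp [h0, hiff.2 h0]
  rw [h1] at h
  refine h.congr_fun fun d => ?_
  have h2 := sum_fiberCount g m Y d
  have h3 : ∑ y ∈ Y, (fiberCount g m d y : ℝ) = ((∑ y ∈ Y, fiberCount g m d y : ℕ) : ℝ) := by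
    push_cast; rfl
  rw [h3, h2, Finset.card_filter, Nat.cast_sum, Finset.mul_sum]
  refine Finset.sum_congr rfl fun x _ => ?_
  have hdvd : (∀ i, (d i : ℕ) ∣ b x i) ↔ ∀ ρ : (Σ i : Fin s, Fin (n i)),
      ((d ρ.1 : ℕ) : ℤ) ∣ x ρ := by
    simp only [hb, Finset.dvd_gcd_iff, Finset.mem_univ, true_implies, Int.natCast_dvd,
      Sigma.forall]
  simp only [hdvd]
  split_ifs <;> simp

variable (X L) in
/-- The positive integral points whose logarithms lie in the dilated polytope. -/
def logPoints (lam : ℝ) : Set (Fin s → ℕ) :=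
  {y | (∀ i, 1 ≤ y i) ∧ (fun i => Real.log (y i)) ∈ cornerPolytope (X.polytopeCoeff L) lam}

theorem finite_logPoints (hL : X.IsSemiample L)
    (hLbdd : ∀ i, ∃ σ ∈ X.maxCones, 0 < X.groupCoeff L σ i) (lam : ℝ) :
    (X.logPoints L lam).Finite := by
  obtain ⟨A, -, hA⟩ := exists_le_of_mem_cornerPolytope (polytopeCoeff_nonneg hL)
    (exists_polytopeCoeff_pos hLbdd)
  refine (expBox fun _ : Fin s => A * lam).finite_toSet.subset fun y hy => ?_
  exact mem_expBox.2 fun i => ⟨hy.1 i, hA lam _ hy.2 i⟩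

theorem mem_countedPoints_iff_supAbs (hX : X.GroupedByClass) (hL : X.IsSemiample L)
    (hg : ∀ l, ∃ c : X.Pic, MvPolynomial.IsWeightedHomogeneous X.primeClass (g l) c)
    (hB : 0 < B) {x : (Σ i : Fin s, Fin (n i)) → ℤ} (hx : X.IsCoprimeTuple x) :
    X.torsorMap (toUnits x) ∈ X.countedPoints L g m B ↔
      (∀ ρ, IsFull (m ρ) (x ρ)) ∧ (∀ l, MvPolynomial.eval x (g l) = 0) ∧
      supAbs x ∈ X.logPoints L (Real.log B) := by
  rw [mem_countedPoints_iff hL hg hB hx]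
  refine and_congr_right fun _ => and_congr_right fun _ => ?_
  have hpos : ∀ ρ, 0 < (x ρ).natAbs := fun ρ => Int.natAbs_pos.2 (hx.1 ρ)
  have habs : ∀ ρ, |(x ρ : ℝ)| = ((x ρ).natAbs : ℝ) := fun ρ => by
    rw [Nat.cast_natAbs, Int.cast_abs]
  have h1 : ∀ i, 1 ≤ supAbs x i := fun i =>
    (hpos ⟨i, ⟨0, hX.1 i⟩⟩).trans_le (natAbs_le_supAbs x ⟨i, ⟨0, hX.1 i⟩⟩)
  rw [forall_localCoeff_le_iff hX hL (v := fun i => Real.log (supAbs x i))]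
  · simp only [logPoints, cornerPolytope, polytopeCoeff, Set.mem_ofPred_eq, Subtype.forall]
    exact ⟨fun h => ⟨h1, h, fun i => Real.log_natCast_nonneg _⟩, fun h => h.2.1⟩
  · intro ρ
    rw [habs]
    exact Real.log_le_log (by exact_mod_cast hpos ρ) (by exact_mod_cast natAbs_le_supAbs x ρ)
  · intro i
    obtain ⟨j, hj⟩ := exists_natAbs_eq_supAbs hX.1 x i
    exact ⟨j, by rw [habs, hj]⟩

theorem countedPoints_eq_image [DecidablePred X.IsCoprimeTuple] (hX : X.GroupedByClass)
    (hL : X.IsSemiample L)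
    (hg : ∀ l, ∃ c : X.Pic, MvPolynomial.IsWeightedHomogeneous X.primeClass (g l) c)
    (hB : 0 < B) (hY : ∀ y, y ∈ Y ↔ y ∈ X.logPoints L (Real.log B)) :
    X.countedPoints L g m B = (fun x => X.torsorMap (toUnits x)) ''
      ((fullTuples g m Y).filter X.IsCoprimeTuple : Finset _) := by
  ext p
  simp only [Finset.coe_filter, Set.mem_image, Set.mem_ofPred_eq, mem_fullTuples, hY]
  constructor
  · intro hp
    obtain ⟨x, hx, rfl⟩ := X.exists_coprimeTuple p
    obtain ⟨h1, h2, h3⟩ := (mem_countedPoints_iff_supAbs hX hL hg hB hx).1 hp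
    exact ⟨x, ⟨⟨hx.1, h1, h2, h3⟩, hx⟩, rfl⟩
  · rintro ⟨x, ⟨⟨-, h1, h2, h3⟩, hx⟩, rfl⟩
    exact (mem_countedPoints_iff_supAbs hX hL hg hB hx).2 ⟨h1, h2, h3⟩

theorem finite_countedPoints (hX : X.GroupedByClass) (hL : X.IsSemiample L)
    (hLbdd : ∀ i, ∃ σ ∈ X.maxCones, 0 < X.groupCoeff L σ i)
    (hg : ∀ l, ∃ c : X.Pic, MvPolynomial.IsWeightedHomogeneous X.primeClass (g l) c) (B : ℝ) :
    (X.countedPoints L g m B).Finite := by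
  classical
  -- The description by `Real.log B` requires a positive bound, so `B` is enlarged to `max B 1`.
  have hsub : X.countedPoints L g m B ⊆ X.countedPoints L g m (max B 1) :=
    fun p ⟨h1, x, h2, h3, h4⟩ => ⟨h1, x, h2, h3, h4.trans (le_max_left _ _)⟩
  refine Set.Finite.subset ?_ hsub
  rw [countedPoints_eq_image hX hL hg (by positivity)
    (Y := (finite_logPoints hL hLbdd (Real.log (max B 1))).toFinset) (by simp)]
  exact (Finset.finite_toSet _).image _

/-- Being counted depends only on the point of the torus, so all of its `2 ^ rank Pic(X)` integral
lifts occur in the set. -/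
theorem card_coprimeTuples_eq [DecidablePred X.IsCoprimeTuple] (hX : X.GroupedByClass)
    (hL : X.IsSemiample L)
    (hg : ∀ l, ∃ c : X.Pic, MvPolynomial.IsWeightedHomogeneous X.primeClass (g l) c)
    (hB : 0 < B) (hY : ∀ y, y ∈ Y ↔ y ∈ X.logPoints L (Real.log B)) :
    ((fullTuples g m Y).filter X.IsCoprimeTuple).card =
      2 ^ Module.finrank ℤ X.Pic * X.pointCount L g m B := by
  classical
  set S := (fullTuples g m Y).filter X.IsCoprimeTuple with hS
  have himage := countedPoints_eq_image (m := m) hX hL hg hB hY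
  rw [← Finset.coe_image] at himage
  rw [Finset.card_eq_sum_card_image (fun x => X.torsorMap (toUnits x)) S, pointCount, himage,
    Set.ncard_coe_finset, mul_comm, ← smul_eq_mul, ← Finset.sum_const]
  refine Finset.sum_congr rfl fun p hp => ?_
  rw [← X.ncard_coprimeTuple p, ← Set.ncard_coe_finset]
  congr 1
  ext x
  rw [← Finset.mem_coe, ← himage] at hp
  simp only [hS, Finset.coe_filter, Finset.mem_filter, Set.mem_ofPred_eq, mem_fullTuples, hY]
  constructor
  · rintro ⟨⟨-, h1⟩, h2⟩
    exact ⟨h1, h2⟩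
  · rintro ⟨hx, rfl⟩
    exact ⟨⟨⟨hx.1, (mem_countedPoints_iff_supAbs hX hL hg hB hx).1 hp⟩, hx⟩, rfl⟩

theorem hasSum_mu_mul_fiberCount (hX : X.GroupedByClass) (hL : X.IsSemiample L)
    (hg : ∀ l, ∃ c : X.Pic, MvPolynomial.IsWeightedHomogeneous X.primeClass (g l) c)
    (hB : 0 < B) (hY : ∀ y, y ∈ Y ↔ y ∈ X.logPoints L (Real.log B)) :
    HasSum (fun d : Fin s → ℕ+ =>
      (X.mu (fun i => (d i : ℕ)) : ℝ) * ∑ y ∈ Y, (fiberCount g m d y : ℝ))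
      (2 ^ Module.finrank ℤ X.Pic * (X.pointCount L g m B : ℝ)) := by
  classical
  have h := hasSum_mu_mul_sum_fiberCount (g := g) (m := m) (Y := Y) hX
  rw [card_coprimeTuples_eq hX hL hg hB hY] at h
  exact_mod_cast h

end SmoothCompleteFan

/-! ### The asymptotic formula for the counting function -/

namespace SmoothCompleteFan

variable {rk s t : ℕ} {n : Fin s → ℕ} {X : SmoothCompleteFan rk (Σ i : Fin s, Fin (n i))}
  {L : (Σ i : Fin s, Fin (n i)) → ℚ} {g : Fin t → MvPolynomial (Σ i : Fin s, Fin (n i)) ℤ}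
  {m : (Σ i : Fin s, Fin (n i)) → ℕ} {CM CE : (Fin s → ℕ+) → ℝ} {ϖ : Fin s → ℝ} {ε : ℝ}

/-- The hypothesis on box counts in logarithmic coordinates `B_i = exp (c i)`, with the minimum
replaced by a lower bound `exp b`. Taking `|K|` makes the new error constant nonnegative. -/
theorem abs_sum_expBox_sub_le [Nonempty (Fin s)] {K : ℝ} (hCE : ∀ d, 0 < CE d) (hε : 0 < ε)
    (hF : ∀ (d : Fin s → ℕ+) (B : Fin s → ℝ), (∀ i, 1 ≤ B i) →
      |(boxCount g m d B : ℝ) - CM d * ∏ i, B i ^ ϖ i| ≤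
        K * (CE d * (⨅ i, B i) ^ (-ε) * ∏ i, B i ^ ϖ i))
    (d : Fin s → ℕ+) {c : Fin s → ℝ} {b : ℝ} (hc : ∀ i, 0 ≤ c i) (hb : ∀ i, b ≤ c i) :
    |∑ y ∈ expBox c, (fiberCount g m d y : ℝ) - CM d * Real.exp (weightForm ϖ c)| ≤
      |K| * CE d * (Real.exp (-(ε * b)) * Real.exp (weightForm ϖ c)) := by
  have h := hF d (fun i => Real.exp (c i)) fun i => Real.one_le_exp (hc i)
  have h1 : ∏ i, Real.exp (c i) ^ ϖ i = Real.exp (weightForm ϖ c) := by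
    rw [exp_weightForm]
    exact Finset.prod_congr rfl fun i _ => by rw [← Real.exp_mul, mul_comm]
  have h2 : (boxCount g m d fun i => Real.exp (c i) : ℝ) =
      ∑ y ∈ expBox c, (fiberCount g m d y : ℝ) := by
    rw [boxCount, expBox, Nat.cast_sum]
  rw [h1, h2] at h
  have h3 : (⨅ i, Real.exp (c i)) ^ (-ε) ≤ Real.exp (-(ε * b)) := by
    have h4 : Real.exp b ≤ ⨅ i, Real.exp (c i) := le_ciInf fun i => Real.exp_le_exp.2 (hb i)
    have h5 : Real.exp (-(ε * b)) = Real.exp b ^ (-ε) := by rw [← Real.exp_mul]; ring_nf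
    rw [h5]
    exact Real.rpow_le_rpow_of_nonpos (Real.exp_pos b) h4 (by linarith)
  have h6 : 0 ≤ (⨅ i, Real.exp (c i)) ^ (-ε) :=
    Real.rpow_nonneg (Real.iInf_nonneg fun i => (Real.exp_pos _).le) _
  have hCEd := (hCE d).le
  calc _ ≤ |K| * (CE d * (⨅ i, Real.exp (c i)) ^ (-ε) * Real.exp (weightForm ϖ c)) :=
        h.trans (mul_le_mul_of_nonneg_right (le_abs_self K) (by positivity))
    _ ≤ |K| * (CE d * Real.exp (-(ε * b)) * Real.exp (weightForm ϖ c)) := by gcongr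
    _ = _ := by ring

theorem summable_mu_mul_of_compatible {A : (Fin s → ℕ+) → ℝ} (hA : X.MobiusCompatible A) :
    Summable fun d : Fin s → ℕ+ => (X.mu (fun i => (d i : ℕ)) : ℝ) * A d :=
  Summable.of_norm <| hA.summable.congr fun d => by
    rw [norm_mul, Real.norm_eq_abs, Real.norm_eq_abs]

/-- The counting function in terms of `lam = log B`. -/
theorem exists_abs_pointCount_sub_le [Nonempty (Fin s)] (hX : X.GroupedByClass)
    (hL : X.IsSemiample L) (hLbdd : ∀ i, ∃ σ ∈ X.maxCones, 0 < X.groupCoeff L σ i)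
    (hg : ∀ l, ∃ c : X.Pic, MvPolynomial.IsWeightedHomogeneous X.primeClass (g l) c)
    (hCM : ∀ d, 0 < CM d) (hCE : ∀ d, 0 < CE d) (hϖ : ∀ i, 0 < ϖ i) (hε : 0 < ε)
    (hF : ∃ K : ℝ, ∀ (d : Fin s → ℕ+) (B : Fin s → ℝ), (∀ i, 1 ≤ B i) →
      |(boxCount g m d B : ℝ) - CM d * ∏ i, B i ^ ϖ i| ≤
        K * (CE d * (⨅ i, B i) ^ (-ε) * ∏ i, B i ^ ϖ i))
    (hCMc : X.MobiusCompatible CM) (hCEc : X.MobiusCompatible CE)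
    (hface : ∀ i, ¬ X.maxFace L ϖ ⊆ {u | u i = 0}) {M : ℝ} {k : ℕ}
    (hJ : ∃ D : ℝ, ∀ lam : ℝ, 1 ≤ lam →
      |(∏ i, ϖ i) * cornerIntegral (X.polytopeCoeff L) ϖ lam -
          M * (Real.exp (X.maxValue L ϖ * lam) * lam ^ k)| ≤
          D * (Real.exp (X.maxValue L ϖ * lam) * lam ^ k / lam)) :
    ∃ C : ℝ, ∀ᶠ lam : ℝ in atTop,
      |(X.pointCount L g m (Real.exp lam) : ℝ) - M * (2 : ℝ)⁻¹ ^ Module.finrank ℤ X.Pic *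
          (∑' d : Fin s → ℕ+, (X.mu (fun i => (d i : ℕ)) : ℝ) * CM d) *
          (Real.exp (X.maxValue L ϖ * lam) * lam ^ k)| ≤
        C * (Real.exp (X.maxValue L ϖ * lam) * lam ^ k * (Real.log lam / lam)) := by
  obtain ⟨K, hK⟩ := hF
  have hz : ∀ i, ∃ z ∈ cornerPolytope (X.polytopeCoeff L) 1, 0 < z i ∧
      ∀ u ∈ cornerPolytope (X.polytopeCoeff L) 1, weightForm ϖ u ≤ weightForm ϖ z := by
    intro i
    obtain ⟨z, hz, hzi⟩ := Set.not_subset.1 (hface i)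
    rw [← polytope_eq_cornerPolytope]
    refine ⟨z, hz.1, lt_of_le_of_ne (hz.1.2 i) (Ne.symm hzi), fun u hu => ?_⟩
    rw [weightForm_apply, weightForm_apply, hz.2]
    exact le_maxValue hL hLbdd hu
  obtain ⟨C, hC⟩ := exists_hyperbola_bound (polytopeCoeff_nonneg hL)
    (exists_polytopeCoeff_pos hLbdd) hϖ hε (maxValue_nonneg (ϖ := ϖ) hL hLbdd) hz hJ
  -- The error constants in the hyperbola bound are linear in `CM d + |K| * CE d`, so compatibility
  -- of both functions makes the total error converge.
  have hsum : Summable fun d : Fin s → ℕ+ =>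
      |(X.mu (fun i => (d i : ℕ)) : ℝ)| * (C * (CM d + |K| * CE d)) := by
    have := (hCMc.summable.add (hCEc.summable.mul_left |K|)).mul_left C
    refine this.congr fun d => ?_
    rw [abs_of_pos (hCM d), abs_of_pos (hCE d)]
    ring
  refine ⟨(2 : ℝ)⁻¹ ^ Module.finrank ℤ X.Pic *
    ∑' d : Fin s → ℕ+, |(X.mu (fun i => (d i : ℕ)) : ℝ)| * (C * (CM d + |K| * CE d)), ?_⟩
  filter_upwards [hC] with lam hlam
  set E := Real.exp (X.maxValue L ϖ * lam) * lam ^ k with hE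
  set R := E * (Real.log lam / lam) with hR
  set r := Module.finrank ℤ X.Pic with hr
  set Y := (finite_logPoints hL hLbdd lam).toFinset with hY
  have hS := hasSum_mu_mul_fiberCount (g := g) (m := m) (Y := Y) hX hL hg (Real.exp_pos lam)
    (by simp [hY])
  have hM := (summable_mu_mul_of_compatible hCMc).hasSum.mul_right (M * E)
  have hbound : ∀ d : Fin s → ℕ+,
      ‖(X.mu (fun i => (d i : ℕ)) : ℝ) * ∑ y ∈ Y, (fiberCount g m d y : ℝ) -
        (X.mu (fun i => (d i : ℕ)) : ℝ) * CM d * (M * E)‖ ≤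
      |(X.mu (fun i => (d i : ℕ)) : ℝ)| * (C * (CM d + |K| * CE d)) * R := fun d => by
    have h := hlam (fun y => (fiberCount g m d y : ℝ)) (CM d) (|K| * CE d) (hCM d).le
      (mul_nonneg (abs_nonneg K) (hCE d).le) (fun y => Nat.cast_nonneg _)
      (fun c b hc hb => abs_sum_expBox_sub_le hCE hε hK d hc hb) Y (by simp [hY, logPoints])
    rw [mul_assoc, ← mul_sub, norm_mul, Real.norm_eq_abs, Real.norm_eq_abs,
      mul_assoc |_|, ← mul_assoc (CM d)]
    exact mul_le_mul_of_nonneg_left h (abs_nonneg _)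
  -- The exact identity and the main terms are subtracted term by term in `d`. The differences are
  -- dominated by a convergent series times the common factor `R`.
  have htot := tsum_of_norm_bounded (hsum.hasSum.mul_right R) hbound
  rw [(hS.sub hM).tsum_eq, Real.norm_eq_abs] at htot
  have h2 : (0 : ℝ) < 2 ^ r := by positivity
  have hfin := mul_le_mul_of_nonneg_left htot (inv_nonneg.2 h2.le)
  rw [← abs_of_nonneg (inv_nonneg.2 h2.le), ← abs_mul, abs_of_nonneg (inv_nonneg.2 h2.le),
    mul_sub, inv_mul_cancel_left₀ h2.ne', ← inv_pow] at hfin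
  calc _ = _ := by congr 1; ring
    _ ≤ _ := hfin
    _ = _ := by ring

theorem pointCount_isBigO [Nonempty (Fin s)] (hX : X.GroupedByClass)
    (hL : X.IsSemiample L) (hLbdd : ∀ i, ∃ σ ∈ X.maxCones, 0 < X.groupCoeff L σ i)
    (hg : ∀ l, ∃ c : X.Pic, MvPolynomial.IsWeightedHomogeneous X.primeClass (g l) c)
    (hCM : ∀ d, 0 < CM d) (hCE : ∀ d, 0 < CE d) (hϖ : ∀ i, 0 < ϖ i) (hε : 0 < ε)
    (hF : ∃ K : ℝ, ∀ (d : Fin s → ℕ+) (B : Fin s → ℝ), (∀ i, 1 ≤ B i) →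
      |(boxCount g m d B : ℝ) - CM d * ∏ i, B i ^ ϖ i| ≤
        K * (CE d * (⨅ i, B i) ^ (-ε) * ∏ i, B i ^ ϖ i))
    (hCMc : X.MobiusCompatible CM) (hCEc : X.MobiusCompatible CE)
    (hface : ∀ i, ¬ X.maxFace L ϖ ⊆ {u | u i = 0}) {M : ℝ} {k : ℕ}
    (hJ : ∃ D : ℝ, ∀ lam : ℝ, 1 ≤ lam →
      |(∏ i, ϖ i) * cornerIntegral (X.polytopeCoeff L) ϖ lam -
          M * (Real.exp (X.maxValue L ϖ * lam) * lam ^ k)| ≤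
          D * (Real.exp (X.maxValue L ϖ * lam) * lam ^ k / lam)) :
    (fun B : ℝ => (X.pointCount L g m B : ℝ) - (M * (2 : ℝ)⁻¹ ^ Module.finrank ℤ X.Pic *
              ∑' d : Fin s → ℕ+, (X.mu (fun i => (d i : ℕ)) : ℝ) * CM d) *
            (B ^ X.maxValue L ϖ * Real.log B ^ k))
          =O[atTop] fun B : ℝ => B ^ X.maxValue L ϖ *
            Real.log B ^ ((k : ℤ) - 1) * Real.log (Real.log B) ^ s := by
  obtain ⟨C, hC⟩ := exists_abs_pointCount_sub_le hX hL hLbdd hg hCM hCE hϖ hε hF hCMc hCEc hface hJ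
  have hs : s ≠ 0 := fun h => by subst h; exact isEmptyElim (Classical.arbitrary (Fin 0))
  have hlog2 := Real.tendsto_log_atTop.comp Real.tendsto_log_atTop
  refine IsBigO.of_bound |C| ?_
  filter_upwards [Real.tendsto_log_atTop.eventually hC, eventually_gt_atTop 0,
    Real.tendsto_log_atTop.eventually_gt_atTop 0, hlog2.eventually_ge_atTop 1]
    with B hB hB0 hlogB hloglogB
  simp only [Function.comp_apply] at hloglogB
  rw [Real.exp_log hB0, mul_comm (X.maxValue L ϖ), Real.exp_mul, Real.exp_log hB0] at hB
  rw [Real.norm_eq_abs]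
  have hBa : 0 < B ^ X.maxValue L ϖ := Real.rpow_pos_of_pos hB0 _
  refine hB.trans ?_
  -- The exponent `k - 1` is an integer, as `k` may be 0. The error found has one factor `log (log
  -- B)`, which is at most its `s`-th power for large `B` because `s ≥ 1`.
  have h1 : B ^ X.maxValue L ϖ * Real.log B ^ k * (Real.log (Real.log B) / Real.log B) =
      B ^ X.maxValue L ϖ * Real.log B ^ ((k : ℤ) - 1) * Real.log (Real.log B) := by
    rw [zpow_sub_one₀ hlogB.ne', zpow_natCast]
    ring
  rw [h1]
  have h2 : Real.log (Real.log B) ≤ Real.log (Real.log B) ^ s := le_self_pow₀ hloglogB hs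
  have h3 : 0 < Real.log B ^ ((k : ℤ) - 1) := zpow_pos hlogB _
  rw [Real.norm_of_nonneg (by positivity)]
  exact mul_le_mul (le_abs_self C) (mul_le_mul_of_nonneg_left h2 (by positivity)) (by positivity)
    (abs_nonneg C)

theorem nonempty_of_two_le_finrank (hr : 2 ≤ Module.finrank ℤ X.Pic) : Nonempty (Fin s) := by
  by_contra h
  have : IsEmpty (Fin s) := not_nonempty_iff.1 h
  have h1 := X.finrank_pic_add
  have h2 : Fintype.card (Σ i : Fin s, Fin (n i)) = 0 := Fintype.card_eq_zero
  omega

end SmoothCompleteFan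

/-! ### Farkas' lemma -/

section Farkas

variable {V ι : Type*} [AddCommGroup V] [Module ℝ V]

/-- Farkas' lemma for finitely generated cones. -/
theorem exists_nonneg_combination (S : Finset ι) {v : ι → V} {x : V}
    (h : ∀ ℓ : Module.Dual ℝ V, (∀ i ∈ S, 0 ≤ ℓ (v i)) → 0 ≤ ℓ x) :
    ∃ c : ι → ℝ, (∀ i, 0 ≤ c i) ∧ x = ∑ i ∈ S, c i • v i := by
  classical
  induction S using Finset.induction_on generalizing v x with
  | empty =>
    refine ⟨0, fun _ => le_rfl, ?_⟩
    rw [Finset.sum_empty, ← Module.forall_dual_apply_eq_zero_iff ℝ]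
    intro ℓ
    have h1 := h ℓ (by simp)
    have h2 := h (-ℓ) (by simp)
    rw [LinearMap.neg_apply] at h2
    linarith
  | insert j S hj ih =>
    by_cases hS : ∀ ℓ : Module.Dual ℝ V, (∀ i ∈ S, 0 ≤ ℓ (v i)) → 0 ≤ ℓ x
    · obtain ⟨c, hc, hx⟩ := ih hS
      refine ⟨fun i => if i = j then 0 else c i, fun i => ?_, ?_⟩
      · dsimp only
        split_ifs
        exacts [le_rfl, hc i]
      · simp only [Finset.sum_insert hj, if_true, zero_smul, zero_add]
        rw [hx]
        refine Finset.sum_congr rfl fun i hi => ?_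
        rw [if_neg (ne_of_mem_of_not_mem hi hj)]
    · push Not at hS
      obtain ⟨y, hy, hyx⟩ := hS
      have hyj : y (v j) < 0 := by
        by_contra hcon
        push Not at hcon
        refine absurd (h y fun i hi => ?_) (not_le.2 hyx)
        rcases Finset.mem_insert.1 hi with rfl | hi
        exacts [hcon, hy i hi]
      -- Everything is projected to the kernel of `y` along `v j`. A form `ℓ` on the projected
      -- vectors is tested by `ℓ - (ℓ (v j) / y (v j)) • y`, which vanishes at `v j`, so the
      -- hypothesis for `insert j S` applies.
      obtain ⟨c, hc, hx⟩ := ih (v := fun i => v i - (y (v i) / y (v j)) • v j)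
        (x := x - (y x / y (v j)) • v j) fun ℓ hℓ => by
          have h1 := h (ℓ - (ℓ (v j) / y (v j)) • y) fun i hi => by
            rcases Finset.mem_insert.1 hi with rfl | hi
            · simp only [LinearMap.sub_apply, LinearMap.smul_apply, smul_eq_mul]
              rw [div_mul_cancel₀ _ hyj.ne, sub_self]
            · have := hℓ i hi
              simp only [map_sub, map_smul, LinearMap.sub_apply, LinearMap.smul_apply,
                smul_eq_mul] at this ⊢
              convert this using 2
              ring
          simp only [map_sub, map_smul, LinearMap.sub_apply, LinearMap.smul_apply,
            smul_eq_mul] at h1 ⊢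
          convert h1 using 2
          ring
      -- The coefficient of `v j` forced by undoing the projection. It is nonnegative because `y` is
      -- negative at `x` and `v j` and nonnegative at the other generators.
      set e := y x / y (v j) - ∑ i ∈ S, c i * (y (v i) / y (v j)) with he
      have he0 : 0 ≤ e := by
        have h1 : 0 ≤ y x / y (v j) := div_nonneg_of_nonpos hyx.le hyj.le
        have h2 : ∑ i ∈ S, c i * (y (v i) / y (v j)) ≤ 0 := Finset.sum_nonpos fun i hi =>
          mul_nonpos_of_nonneg_of_nonpos (hc i)
            (div_nonpos_of_nonneg_of_nonpos (hy i hi) hyj.le)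
        linarith
      refine ⟨fun i => if i = j then e else c i, fun i => ?_, ?_⟩
      · dsimp only
        split_ifs
        exacts [he0, hc i]
      · simp only [Finset.sum_insert hj, if_true]
        have h3 : ∑ i ∈ S, (if i = j then e else c i) • v i = ∑ i ∈ S, c i • v i :=
          Finset.sum_congr rfl fun i hi => by rw [if_neg (ne_of_mem_of_not_mem hi hj)]
        rw [h3, he, sub_smul, Finset.sum_smul]
        have h4 : ∑ i ∈ S, c i • (v i - (y (v i) / y (v j)) • v j) =
            ∑ i ∈ S, c i • v i - ∑ i ∈ S, (c i * (y (v i) / y (v j))) • v j := by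
          rw [← Finset.sum_sub_distrib]
          exact Finset.sum_congr rfl fun i _ => by rw [smul_sub, mul_smul]
        rw [h4] at hx
        refine (sub_eq_iff_eq_add.1 hx).trans ?_
        abel

end Farkas

/-! ### Minimal faces of cones and their codimension -/

section MinimalFace

variable {V : Type*} [AddCommGroup V] [Module ℝ V]

/-- The minimal face of a cone that contains a given point of the cone. -/
def minimalFace (C : PointedCone ℝ V) (x₀ : V) : PointedCone ℝ V where
  carrier := {x | x ∈ C ∧ ∃ t : ℝ, 0 ≤ t ∧ t • x₀ - x ∈ C}
  add_mem' := by
    rintro x y ⟨hx, t, ht, hx'⟩ ⟨hy, t', ht', hy'⟩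
    refine ⟨add_mem hx hy, t + t', add_nonneg ht ht', ?_⟩
    have : (t + t') • x₀ - (x + y) = (t • x₀ - x) + (t' • x₀ - y) := by rw [add_smul]; abel
    rw [this]
    exact add_mem hx' hy'
  zero_mem' := ⟨zero_mem _, 0, le_rfl, by simp⟩
  smul_mem' := by
    rintro ⟨c, hc⟩ x ⟨hx, t, ht, hx'⟩
    refine ⟨C.smul_mem hc hx, c * t, mul_nonneg hc ht, ?_⟩
    have : (c * t) • x₀ - c • x = c • (t • x₀ - x) := by rw [smul_sub, mul_smul]
    change (c * t) • x₀ - c • x ∈ C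
    rw [this]
    exact C.smul_mem hc hx'

variable {C : PointedCone ℝ V} {x₀ : V}

theorem self_mem_minimalFace (hx₀ : x₀ ∈ C) : x₀ ∈ minimalFace C x₀ :=
  ⟨hx₀, 1, zero_le_one, by simp⟩

theorem isFaceOf_minimalFace : (minimalFace C x₀).IsFaceOf C where
  le _ hx := hx.1
  mem_of_smul_add_mem := by
    rintro x y b hx hy hb ⟨-, t, ht, h⟩
    refine ⟨hx, b⁻¹ * t, by positivity, ?_⟩
    have h1 : (b⁻¹ * t) • x₀ - x = b⁻¹ • ((t • x₀ - (b • x + y)) + y) := by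
      rw [sub_add_eq_sub_sub, sub_add_cancel, smul_sub, smul_smul, smul_smul,
        inv_mul_cancel₀ hb.ne', one_smul]
    rw [h1]
    exact C.smul_mem (inv_pos.2 hb).le (add_mem h hy)

theorem minimalFace_le {F : PointedCone ℝ V} (hF : F.IsFaceOf C) (hx₀ : x₀ ∈ F) :
    minimalFace C x₀ ≤ F := by
  rintro x ⟨hx, t, ht, h⟩
  refine hF.mem_of_smul_add_mem hx h one_pos ?_
  rw [one_smul, add_sub_cancel]
  exact F.smul_mem ht hx₀

/-- The codimension of the minimal face is the dimension of the span of the linear forms that are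
nonnegative on the cone and vanish at the point. -/
theorem finrank_span_minimalFace_add [FiniteDimensional ℝ V] {ι : Type*} [Fintype ι] {v : ι → V}
    (hC : ∀ x, x ∈ C ↔ ∃ c : ι → ℝ, (∀ i, 0 ≤ c i) ∧ x = ∑ i, c i • v i) (hx₀ : x₀ ∈ C) :
    Module.finrank ℝ (Submodule.span ℝ (minimalFace C x₀ : Set V)) +
      Module.finrank ℝ (Submodule.span ℝ
        {ℓ : Module.Dual ℝ V | (∀ x ∈ C, 0 ≤ ℓ x) ∧ ℓ x₀ = 0}) = Module.finrank ℝ V := by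
  set G := {ℓ : Module.Dual ℝ V | (∀ x ∈ C, 0 ≤ ℓ x) ∧ ℓ x₀ = 0} with hG
  have hv : ∀ i, v i ∈ C := fun i => by
    classical
    refine (hC _).2 ⟨Pi.single i 1, fun j => ?_, ?_⟩
    · by_cases h : j = i
      · subst h; simp
      · simp [h]
    · simp [Pi.single_apply, ite_smul]
  -- Farkas' lemma for the generators together with `-x₀`: a form that is nonnegative on all of
  -- these is nonnegative on `C` and vanishes at `x₀`, hence lies in `G`.
  have hmem : ∀ x : V, (∀ ℓ ∈ G, 0 ≤ ℓ x) → ∃ t : ℝ, 0 ≤ t ∧ x + t • x₀ ∈ C := by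
    intro x hx
    obtain ⟨c, hc, hxc⟩ := exists_nonneg_combination (Finset.univ : Finset (Option ι))
      (v := fun o => o.elim (-x₀) v) (x := x) fun ℓ hℓ => by
        have h1 : ∀ y ∈ C, 0 ≤ ℓ y := fun y hy => by
          obtain ⟨c, hc, rfl⟩ := (hC y).1 hy
          simp only [map_sum, map_smul, smul_eq_mul]
          exact Finset.sum_nonneg fun i _ => mul_nonneg (hc i) (hℓ (some i) (Finset.mem_univ _))
        have h2 : 0 ≤ ℓ (-x₀) := hℓ none (Finset.mem_univ _)
        rw [map_neg] at h2
        exact hx ℓ ⟨h1, le_antisymm (by linarith) (h1 x₀ hx₀)⟩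
    rw [Fintype.sum_option] at hxc
    simp only [Option.elim] at hxc
    refine ⟨c none, hc none, (hC _).2 ⟨fun i => c (some i), fun i => hc _, ?_⟩⟩
    rw [hxc, smul_neg]
    abel
  -- If all forms in `G` vanish at `x`, then both `x` and `-x` lie in `C` after adding multiples of
  -- `x₀`. So `x` is a difference of two elements of the minimal face.
  have hco : Submodule.span ℝ (minimalFace C x₀ : Set V) =
      (Submodule.span ℝ G).dualCoannihilator := by
    apply le_antisymm
    · rw [Submodule.span_le]
      rintro x ⟨hx, t, ht, h⟩
      rw [SetLike.mem_coe, Submodule.mem_dualCoannihilator]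
      intro ℓ hℓ
      induction hℓ using Submodule.span_induction with
      | mem ℓ hℓ =>
        have h1 := hℓ.1 _ h
        rw [map_sub, map_smul, hℓ.2, smul_zero, zero_sub] at h1
        exact le_antisymm (by linarith) (hℓ.1 x hx)
      | zero => simp
      | add f g _ _ hf hg => simp [hf, hg]
      | smul c f _ hf => simp [hf]
    · intro x hx
      rw [Submodule.mem_dualCoannihilator] at hx
      have h0 : ∀ ℓ ∈ G, ℓ x = 0 := fun ℓ hℓ => hx ℓ (Submodule.subset_span hℓ)
      obtain ⟨t, ht, h1⟩ := hmem x fun ℓ hℓ => (h0 ℓ hℓ).ge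
      obtain ⟨t', ht', h2⟩ := hmem (-x) fun ℓ hℓ => by rw [map_neg, h0 ℓ hℓ, neg_zero]
      have h3 : x + t • x₀ ∈ minimalFace C x₀ := by
        refine ⟨h1, t + t', by positivity, ?_⟩
        have : (t + t') • x₀ - (x + t • x₀) = -x + t' • x₀ := by rw [add_smul]; abel
        rwa [this]
      have h4 : x = (x + t • x₀) - t • x₀ := by abel
      rw [h4]
      exact sub_mem (Submodule.subset_span h3)
        (Submodule.smul_mem _ _ (Submodule.subset_span (self_mem_minimalFace hx₀)))
  rw [hco, add_comm]
  exact Subspace.finrank_add_finrank_dualCoannihilator_eq _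

end MinimalFace

section SpanFace

/-- `F` lies in an affine hyperplane that misses the origin, so its linear span has one dimension
more than its affine span. -/
theorem finrank_span_eq_finrank_vectorSpan_add_one {V : Type*} [AddCommGroup V] [Module ℝ V]
    [FiniteDimensional ℝ V] {F : Set V} (hF : F.Nonempty) {ψ : V →ₗ[ℝ] ℝ} {a : ℝ} (ha : a ≠ 0)
    (hψ : ∀ u ∈ F, ψ u = a) :
    Module.finrank ℝ (Submodule.span ℝ F) = Module.finrank ℝ (vectorSpan ℝ F) + 1 := by
  obtain ⟨z, hz⟩ := hF
  have hker : vectorSpan ℝ F ≤ LinearMap.ker ψ := by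
    rw [vectorSpan_def, Submodule.span_le]
    rintro _ ⟨u, hu, v, hv, rfl⟩
    simp [hψ u hu, hψ v hv]
  have hzn : z ∉ vectorSpan ℝ F := fun h => ha (by rw [← hψ z hz]; exact hker h)
  have hsup : Submodule.span ℝ F = vectorSpan ℝ F ⊔ Submodule.span ℝ {z} := by
    apply le_antisymm
    · rw [Submodule.span_le]
      intro u hu
      have h1 : u = (u - z) + z := by abel
      rw [SetLike.mem_coe, h1]
      exact add_mem (Submodule.mem_sup_left (vsub_mem_vectorSpan ℝ hu hz))
        (Submodule.mem_sup_right (Submodule.mem_span_singleton_self z))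
    · refine sup_le ?_ (Submodule.span_mono (Set.singleton_subset_iff.2 hz))
      rw [vectorSpan_def, Submodule.span_le]
      rintro _ ⟨u, hu, v, hv, rfl⟩
      exact sub_mem (Submodule.subset_span hu) (Submodule.subset_span hv)
  rw [hsup, Submodule.finrank_sup_span_singleton hzn]

end SpanFace

/-! ### Duality between the polytope and the effective cone -/

namespace SmoothCompleteFan

variable {rk s : ℕ} {n : Fin s → ℕ} {X : SmoothCompleteFan rk (Σ i : Fin s, Fin (n i))}
  {L : (Σ i : Fin s, Fin (n i)) → ℚ} {ϖ : Fin s → ℝ}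

variable (X) in
/-- The map `w ↦ ∑ w_i 𝔇_i` as a linear map. -/
noncomputable def groupClassHom : (Fin s → ℝ) →ₗ[ℝ] X.PicReal :=
  (LinearMap.range X.charDivReal).mkQ ∘ₗ
    LinearMap.pi fun ρ => (n ρ.1 : ℝ)⁻¹ • LinearMap.proj ρ.1

theorem groupClassHom_apply (w : Fin s → ℝ) : X.groupClassHom w = X.groupClass w := by
  rw [groupClassHom, groupClass, realClass, LinearMap.comp_apply, Submodule.mkQ_apply]
  congr 1
  ext ρ
  simp [div_eq_inv_mul]

theorem sum_div_card (hX : X.GroupedByClass) (w : Fin s → ℝ) (i : Fin s) :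
    ∑ _j : Fin (n i), w i / n i = w i := by
  have : (n i : ℝ) ≠ 0 := by exact_mod_cast (hX.1 i).ne'
  rw [Finset.sum_const, Finset.card_univ, Fintype.card_fin, nsmul_eq_mul]
  field_simp

theorem realClass_eq_groupClassHom (hX : X.GroupedByClass) (D : (Σ i : Fin s, Fin (n i)) → ℝ) :
    X.realClass D = X.groupClassHom fun i => ∑ j, D ⟨i, j⟩ := by
  rw [groupClassHom_apply, groupClass, realClass, realClass, Submodule.Quotient.eq]
  refine mem_range_of_group_sum_eq_zero hX fun i => ?_
  simp only [Pi.sub_apply, Finset.sum_sub_distrib]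
  rw [sum_div_card hX (fun i => ∑ j, D ⟨i, j⟩) i, sub_self]

theorem realClass_eq_groupCoeff (hX : X.GroupedByClass) (L : (Σ i : Fin s, Fin (n i)) → ℚ)
    (σ : Finset (Σ i : Fin s, Fin (n i))) :
    X.realClass (fun ρ => (L ρ : ℝ)) = X.groupClassHom fun i => (X.groupCoeff L σ i : ℝ) := by
  have h : X.realClass (fun ρ => (L ρ : ℝ)) = X.realClass fun ρ => (X.localCoeff L σ ρ : ℝ) := by
    rw [realClass, realClass, eq_comm, Submodule.Quotient.eq]
    exact localCoeff_sub_mem_range L σ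
  rw [h, realClass_eq_groupClassHom hX]
  simp_rw [coe_groupCoeff]

theorem groupClassHom_surjective (hX : X.GroupedByClass) :
    Function.Surjective X.groupClassHom := fun x => by
  obtain ⟨D, rfl⟩ := Submodule.Quotient.mk_surjective _ x
  exact ⟨_, (realClass_eq_groupClassHom hX D).symm⟩


theorem groupClassHom_eq_sum (w : Fin s → ℝ) :
    X.groupClassHom w = ∑ i, w i • X.groupClassHom (Pi.single i 1) := by
  conv_lhs => rw [pi_eq_sum_univ' w]
  rw [map_sum]
  exact Finset.sum_congr rfl fun i _ => map_smul _ _ _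

theorem dual_groupClassHom (ℓ : Module.Dual ℝ X.PicReal) (w : Fin s → ℝ) :
    ℓ (X.groupClassHom w) = ∑ i, w i * ℓ (X.groupClassHom (Pi.single i 1)) := by
  rw [groupClassHom_eq_sum, map_sum]
  exact Finset.sum_congr rfl fun i _ => by rw [map_smul, smul_eq_mul]

theorem realClass_single (hX : X.GroupedByClass) (ρ : Σ i : Fin s, Fin (n i)) :
    X.realClass (Pi.single ρ 1) = X.groupClassHom (Pi.single ρ.1 1) := by
  rw [realClass_eq_groupClassHom hX]
  congr 1
  ext i
  obtain ⟨i', j'⟩ := ρ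
  by_cases h : i = i'
  · subst h
    simp [Pi.single_apply]
  · simp only [Pi.single_apply, h, if_false]
    refine Finset.sum_eq_zero fun j _ => if_neg fun hcon => h (congrArg Sigma.fst hcon)

theorem mem_effectiveCone_iff (hX : X.GroupedByClass) (x : X.PicReal) :
    x ∈ X.effectiveCone ↔ ∃ w : Fin s → ℝ, (∀ i, 0 ≤ w i) ∧ x = X.groupClassHom w := by
  constructor
  · intro hx
    rw [effectiveCone, PointedCone.hull] at hx
    induction hx using Submodule.span_induction with
    | mem x hx =>
      obtain ⟨ρ, rfl⟩ := hx
      refine ⟨Pi.single ρ.1 1, fun i => ?_, realClass_single hX ρ⟩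
      rw [Pi.single_apply]
      split_ifs <;> norm_num
    | zero => exact ⟨0, fun _ => le_rfl, by simp⟩
    | add x y _ _ hx hy =>
      obtain ⟨w, hw, rfl⟩ := hx
      obtain ⟨w', hw', rfl⟩ := hy
      exact ⟨w + w', fun i => add_nonneg (hw i) (hw' i), (map_add _ _ _).symm⟩
    | smul c x _ hx =>
      obtain ⟨w, hw, rfl⟩ := hx
      exact ⟨(c : ℝ) • w, fun i => mul_nonneg c.2 (hw i), (map_smul X.groupClassHom (c : ℝ) w).symm⟩
  · rintro ⟨w, hw, rfl⟩
    rw [groupClassHom_eq_sum]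
    refine sum_mem fun i _ => PointedCone.smul_mem _ (hw i) ?_
    rw [← realClass_single hX ⟨i, ⟨0, hX.1 i⟩⟩]
    exact Submodule.subset_span ⟨_, rfl⟩

/-- A relation between the generators of the rays defines a linear form on `Pic(X) ⊗ ℝ`. -/
theorem exists_dual_of_relation {y : (Σ i : Fin s, Fin (n i)) → ℝ}
    (hy : ∀ k, ∑ ρ, y ρ * X.gen ρ k = 0) :
    ∃ ℓ : Module.Dual ℝ X.PicReal, ∀ D, ℓ (X.realClass D) = ∑ ρ, D ρ * y ρ := by
  refine ⟨(LinearMap.range X.charDivReal).liftQ (∑ ρ, y ρ • LinearMap.proj ρ) ?_, fun D => ?_⟩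
  · rintro _ ⟨w, rfl⟩
    rw [LinearMap.mem_ker]
    simp only [charDivReal, LinearMap.coe_mk, AddHom.coe_mk, LinearMap.sum_apply,
      LinearMap.smul_apply, LinearMap.proj_apply, smul_eq_mul, Finset.mul_sum]
    rw [Finset.sum_comm]
    refine Finset.sum_eq_zero fun k _ => ?_
    calc _ = w k * ∑ ρ, y ρ * X.gen ρ k := by
          rw [Finset.mul_sum]
          exact Finset.sum_congr rfl fun ρ _ => by ring
      _ = 0 := by rw [hy k, mul_zero]
  · rw [realClass, Submodule.liftQ_apply]
    simp [mul_comm]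

theorem exists_dual_of_group_relation (hX : X.GroupedByClass) {u : Fin s → ℝ}
    (hu : ∀ k, ∑ ρ : (Σ i : Fin s, Fin (n i)), u ρ.1 * X.gen ρ k = 0) :
    ∃ ℓ : Module.Dual ℝ X.PicReal, ∀ w, ℓ (X.groupClassHom w) = ∑ i, w i * u i := by
  obtain ⟨ℓ, hℓ⟩ := exists_dual_of_relation hu
  refine ⟨ℓ, fun w => ?_⟩
  rw [groupClassHom_apply, groupClass, hℓ, Fintype.sum_sigma]
  refine Finset.sum_congr rfl fun i _ => ?_
  simp only
  rw [← Finset.sum_mul, sum_div_card hX]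

/-- The class `a [L] - ∑ ϖ_i 𝔇_i`. -/
noncomputable def adjointClass (X : SmoothCompleteFan rk (Σ i : Fin s, Fin (n i)))
    (L : (Σ i : Fin s, Fin (n i)) → ℚ) (ϖ : Fin s → ℝ) : X.PicReal :=
  X.maxValue L ϖ • X.realClass (fun ρ => (L ρ : ℝ)) - X.groupClass ϖ

/-- A linear form that is nonnegative on the effective cone is positive on `L` or zero. -/
theorem dual_eq_zero_or_pos (hX : X.GroupedByClass) (hL : X.IsSemiample L)
    (hLbdd : ∀ i, ∃ σ ∈ X.maxCones, 0 < X.groupCoeff L σ i) {ℓ : Module.Dual ℝ X.PicReal}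
    (hℓ : ∀ i, 0 ≤ ℓ (X.groupClassHom (Pi.single i 1))) :
    (∀ i, ℓ (X.groupClassHom (Pi.single i 1)) = 0) ∨
      0 < ℓ (X.realClass fun ρ => (L ρ : ℝ)) := by
  by_cases h : ∀ i, ℓ (X.groupClassHom (Pi.single i 1)) = 0
  · exact Or.inl h
  · right
    push Not at h
    obtain ⟨i, hi⟩ := h
    obtain ⟨σ, hσ, hpos⟩ := hLbdd i
    rw [realClass_eq_groupCoeff hX L σ, dual_groupClassHom]
    refine Finset.sum_pos' (fun j _ => mul_nonneg ?_ (hℓ j)) ⟨i, Finset.mem_univ i, ?_⟩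
    · exact_mod_cast groupCoeff_nonneg hL hσ j
    · exact mul_pos (by exact_mod_cast hpos) (lt_of_le_of_ne (hℓ i) (Ne.symm hi))

/-- A linear form that is nonnegative on the effective cone, normalized to take the value `1` at
`L`, lies in the polytope. -/
theorem mem_polytope_of_dual (hX : X.GroupedByClass) {ℓ : Module.Dual ℝ X.PicReal}
    (hℓ : ∀ i, 0 ≤ ℓ (X.groupClassHom (Pi.single i 1)))
    (hpos : 0 < ℓ (X.realClass fun ρ => (L ρ : ℝ))) :
    (fun i => (ℓ (X.realClass fun ρ => (L ρ : ℝ)))⁻¹ * ℓ (X.groupClassHom (Pi.single i 1))) ∈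
      X.polytope L := by
  refine ⟨fun σ hσ => ?_, fun i => mul_nonneg (inv_nonneg.2 hpos.le) (hℓ i)⟩
  have h : ∑ i, (X.groupCoeff L σ i : ℝ) * ((ℓ (X.realClass fun ρ => (L ρ : ℝ)))⁻¹ *
      ℓ (X.groupClassHom (Pi.single i 1))) = (ℓ (X.realClass fun ρ => (L ρ : ℝ)))⁻¹ *
      ℓ (X.groupClassHom fun i => (X.groupCoeff L σ i : ℝ)) := by
    rw [dual_groupClassHom, Finset.mul_sum]
    exact Finset.sum_congr rfl fun i _ => by ring
  rw [h, ← realClass_eq_groupCoeff hX L σ, inv_mul_cancel₀ hpos.ne']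

theorem sum_mul_normalized (ℓ : Module.Dual ℝ X.PicReal) (b : ℝ) :
    ∑ i, ϖ i * (b⁻¹ * ℓ (X.groupClassHom (Pi.single i 1))) = b⁻¹ * ℓ (X.groupClass ϖ) := by
  rw [← groupClassHom_apply, dual_groupClassHom, Finset.mul_sum]
  exact Finset.sum_congr rfl fun i _ => by ring

/-- By Farkas' lemma it suffices to test forms that are nonnegative on the effective cone. A nonzero
one is, up to scaling, a point of the polytope, where the weight is at most `maxValue`. -/
theorem adjointClass_mem_effectiveCone (hX : X.GroupedByClass) (hL : X.IsSemiample L)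
    (hLbdd : ∀ i, ∃ σ ∈ X.maxCones, 0 < X.groupCoeff L σ i) :
    X.adjointClass L ϖ ∈ X.effectiveCone := by
  obtain ⟨c, hc, hx⟩ := exists_nonneg_combination (Finset.univ : Finset (Fin s))
    (v := fun i => X.groupClassHom (Pi.single i 1)) (x := X.adjointClass L ϖ) fun ℓ hℓ => by
      replace hℓ := fun i => hℓ i (Finset.mem_univ i)
      rw [adjointClass, map_sub, map_smul, smul_eq_mul, sub_nonneg]
      rcases dual_eq_zero_or_pos hX hL hLbdd hℓ with h0 | hpos
      · obtain ⟨σ, -⟩ := X.exists_maxCone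
        rw [realClass_eq_groupCoeff hX L σ, ← groupClassHom_apply, dual_groupClassHom ℓ ϖ,
          dual_groupClassHom]
        simp [h0]
      · have h := le_maxValue (ϖ := ϖ) hL hLbdd (mem_polytope_of_dual hX hℓ hpos)
        rwa [sum_mul_normalized, inv_mul_le_iff₀ hpos, mul_comm] at h
  exact (mem_effectiveCone_iff hX _).2 ⟨c, hc, by rw [groupClassHom_eq_sum, hx]⟩

theorem maxValue_pos [Nonempty (Fin s)] (hL : X.IsSemiample L)
    (hLbdd : ∀ i, ∃ σ ∈ X.maxCones, 0 < X.groupCoeff L σ i) (hϖ : ∀ i, 0 < ϖ i) :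
    0 < X.maxValue L ϖ := by
  set S := ∑ σ ∈ X.maxCones, ∑ i, (X.groupCoeff L σ i : ℝ) with hS
  have hnn : ∀ σ ∈ X.maxCones, 0 ≤ ∑ i, (X.groupCoeff L σ i : ℝ) := fun σ hσ =>
    Finset.sum_nonneg fun i _ => by exact_mod_cast groupCoeff_nonneg hL hσ i
  have hS0 : 0 ≤ S := Finset.sum_nonneg hnn
  have hmem : (fun _ => (S + 1)⁻¹) ∈ X.polytope L := by
    refine ⟨fun σ hσ => ?_, fun i => by positivity⟩
    rw [← Finset.sum_mul, ← div_eq_mul_inv, div_le_one (by linarith)]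
    linarith [Finset.single_le_sum hnn hσ]
  refine lt_of_lt_of_le ?_ (le_maxValue hL hLbdd hmem)
  exact Finset.sum_pos (fun i _ => mul_pos (hϖ i) (by positivity)) Finset.univ_nonempty

/-- The pairing of a point of the polytope with an effective divisor class `τ [L] - ∑ ϖ_i 𝔇_i`. -/
theorem exists_pairing_bound (hX : X.GroupedByClass) (hL : X.IsSemiample L) {z : Fin s → ℝ}
    (hz : z ∈ X.polytope L) {τ : ℝ} {w : Fin s → ℝ}
    (hw : τ • X.realClass (fun ρ => (L ρ : ℝ)) - X.groupClass ϖ = X.groupClassHom w) :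
    ∃ h : ℝ, 0 ≤ h ∧ h ≤ 1 ∧ ∃ σ ∈ X.maxCones, ∃ c : (Σ i : Fin s, Fin (n i)) → ℝ,
      (∀ ρ ∈ σ, 0 ≤ c ρ) ∧
      (∀ k, ∑ ρ : (Σ i : Fin s, Fin (n i)), z ρ.1 * X.gen ρ k = -∑ ρ ∈ σ, c ρ * X.gen ρ k) ∧
      ∑ i, w i * z i + ∑ i, ϖ i * z i = τ * h - ∑ ρ ∈ σ, c ρ * ((w ρ.1 + ϖ ρ.1) / n ρ.1) := by
  obtain ⟨σ, hσ, c, hc, hrel, hpair⟩ := X.exists_pairing_eq fun ρ => z ρ.1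
  refine ⟨∑ i, (X.groupCoeff L σ i : ℝ) * z i, ?_, hz.1 σ hσ, σ, hσ, c, hc, hrel, ?_⟩
  · exact Finset.sum_nonneg fun i _ =>
      mul_nonneg (by exact_mod_cast groupCoeff_nonneg hL hσ i) (hz.2 i)
  · have h := hpair L τ (fun ρ => (w ρ.1 + ϖ ρ.1) / n ρ.1) (by
      have h1 : X.realClass (fun ρ => (w ρ.1 + ϖ ρ.1) / n ρ.1) =
          X.realClass (τ • fun ρ => (L ρ : ℝ)) := by
        change X.groupClass (w + ϖ) = τ • X.realClass (fun ρ => (L ρ : ℝ))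
        rw [← groupClassHom_apply, map_add, ← hw, groupClassHom_apply, sub_add_cancel]
      exact (Submodule.Quotient.eq _).1 h1)
    rw [← sum_groupCoeff_mul] at h
    rw [← h, Fintype.sum_sigma, ← Finset.sum_add_distrib]
    refine Finset.sum_congr rfl fun i _ => ?_
    simp only
    rw [← Finset.sum_mul, sum_div_card hX (fun i => w i + ϖ i), add_mul]

/-- The infimum is attained. For an effective class `τ [L] - ∑ ϖ_i 𝔇_i`, pairing with a point of the
maximal face gives `a ≤ τ h` with `0 ≤ h ≤ 1`, and `a > 0` then forces `τ ≥ a`. -/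
theorem isGLB_maxValue [Nonempty (Fin s)] (hX : X.GroupedByClass) (hL : X.IsSemiample L)
    (hLbdd : ∀ i, ∃ σ ∈ X.maxCones, 0 < X.groupCoeff L σ i) (hϖ : ∀ i, 0 < ϖ i) :
    IsGLB {τ : ℝ | τ • X.realClass (fun ρ => (L ρ : ℝ)) - X.groupClass ϖ ∈ X.effectiveCone}
      (X.maxValue L ϖ) := by
  refine IsLeast.isGLB ⟨adjointClass_mem_effectiveCone hX hL hLbdd, fun τ hτ => ?_⟩
  obtain ⟨w, hw, hwτ⟩ := (mem_effectiveCone_iff hX _).1 hτ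
  obtain ⟨z, hz, hza⟩ := maxFace_nonempty (ϖ := ϖ) hL hLbdd
  obtain ⟨h, h0, h1, σ, hσ, c, hc, -, heq⟩ := exists_pairing_bound hX hL hz hwτ
  rw [hza] at heq
  have e1 : 0 ≤ ∑ i, w i * z i := Finset.sum_nonneg fun i _ => mul_nonneg (hw i) (hz.2 i)
  have e2 : 0 ≤ ∑ ρ ∈ σ, c ρ * ((w ρ.1 + ϖ ρ.1) / n ρ.1) := Finset.sum_nonneg fun ρ hρ =>
    mul_nonneg (hc ρ hρ) (div_nonneg (add_nonneg (hw _) (hϖ _).le) (Nat.cast_nonneg _))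
  have ha := maxValue_pos hL hLbdd hϖ
  have e3 : X.maxValue L ϖ ≤ τ * h := by linarith
  rcases le_or_gt τ 0 with hneg | hpos
  · have := mul_nonpos_of_nonpos_of_nonneg hneg h0
    linarith
  · exact e3.trans (mul_le_of_le_one_right hpos.le h1)

/-- The points of the maximal face define linear forms that are nonnegative on the effective cone
and vanish at the adjoint class. -/
theorem exists_dual_of_mem_maxFace [Nonempty (Fin s)] (hX : X.GroupedByClass)
    (hL : X.IsSemiample L) (hLbdd : ∀ i, ∃ σ ∈ X.maxCones, 0 < X.groupCoeff L σ i)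
    (hϖ : ∀ i, 0 < ϖ i) {z : Fin s → ℝ} (hz : z ∈ X.maxFace L ϖ) :
    ∃ ℓ : Module.Dual ℝ X.PicReal, (∀ w, ℓ (X.groupClassHom w) = ∑ i, w i * z i) ∧
      (∀ x ∈ X.effectiveCone, 0 ≤ ℓ x) ∧ ℓ (X.adjointClass L ϖ) = 0 := by
  obtain ⟨w, hw, hwτ⟩ :=
    (mem_effectiveCone_iff hX _).1 (adjointClass_mem_effectiveCone (ϖ := ϖ) hX hL hLbdd)
  obtain ⟨h, h0, h1, σ, hσ, c, hc, hrel, heq⟩ := exists_pairing_bound hX hL hz.1 hwτ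
  rw [hz.2] at heq
  have e1 : 0 ≤ ∑ i, w i * z i := Finset.sum_nonneg fun i _ => mul_nonneg (hw i) (hz.1.2 i)
  have hE : ∀ ρ : (Σ i : Fin s, Fin (n i)), 0 < (w ρ.1 + ϖ ρ.1) / n ρ.1 := fun ρ =>
    div_pos (add_pos_of_nonneg_of_pos (hw _) (hϖ _)) (by exact_mod_cast hX.1 ρ.1)
  have e2 : ∀ ρ ∈ σ, 0 ≤ c ρ * ((w ρ.1 + ϖ ρ.1) / n ρ.1) := fun ρ hρ =>
    mul_nonneg (hc ρ hρ) (hE ρ).le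
  have e3 := Finset.sum_nonneg e2
  have ha := maxValue_pos hL hLbdd hϖ
  have e4 := mul_le_of_le_one_right ha.le h1
  -- In the pairing identity for `τ = a` every estimate must be an equality. As `w + ϖ` is positive,
  -- all `c ρ` vanish, so the coordinates of `z` form a relation between the generators and define a
  -- linear form on `Pic(X) ⊗ ℝ`.
  have e5 : ∑ ρ ∈ σ, c ρ * ((w ρ.1 + ϖ ρ.1) / n ρ.1) = 0 := by linarith
  have hc0 : ∀ ρ ∈ σ, c ρ = 0 := fun ρ hρ =>
    (mul_eq_zero.1 ((Finset.sum_eq_zero_iff_of_nonneg e2).1 e5 ρ hρ)).resolve_right (hE ρ).ne'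
  obtain ⟨ℓ, hℓ⟩ := exists_dual_of_group_relation hX (u := z) fun k => by
    rw [hrel k, Finset.sum_eq_zero fun ρ hρ => by rw [hc0 ρ hρ, zero_mul], neg_zero]
  refine ⟨ℓ, hℓ, fun x hx => ?_, ?_⟩
  · obtain ⟨w', hw', rfl⟩ := (mem_effectiveCone_iff hX x).1 hx
    rw [hℓ]
    exact Finset.sum_nonneg fun i _ => mul_nonneg (hw' i) (hz.1.2 i)
  · rw [hwτ, hℓ]
    linarith

theorem effectiveCone_single_mem (hX : X.GroupedByClass) (i : Fin s) :
    X.groupClassHom (Pi.single i 1) ∈ X.effectiveCone :=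
  (mem_effectiveCone_iff hX _).2 ⟨Pi.single i 1, fun j => by
    rw [Pi.single_apply]; split_ifs <;> norm_num, rfl⟩

/-- The span of the linear forms defining the minimal face that contains the adjoint class. -/
theorem finrank_span_dual [Nonempty (Fin s)] (hX : X.GroupedByClass)
    (hL : X.IsSemiample L) (hLbdd : ∀ i, ∃ σ ∈ X.maxCones, 0 < X.groupCoeff L σ i)
    (hϖ : ∀ i, 0 < ϖ i) :
    Module.finrank ℝ (Submodule.span ℝ {ℓ : Module.Dual ℝ X.PicReal |
      (∀ x ∈ X.effectiveCone, 0 ≤ ℓ x) ∧ ℓ (X.adjointClass L ϖ) = 0}) = X.faceDim L ϖ + 1 := by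
  set G := {ℓ : Module.Dual ℝ X.PicReal |
      (∀ x ∈ X.effectiveCone, 0 ≤ ℓ x) ∧ ℓ (X.adjointClass L ϖ) = 0} with hG
  -- Evaluation at the classes `𝔇_i` embeds the dual space in `ℝ^s`. Under it, the nonzero forms in
  -- `G` become the positive multiples of points of the maximal face.
  let Θ : Module.Dual ℝ X.PicReal →ₗ[ℝ] (Fin s → ℝ) :=
    LinearMap.pi fun i => LinearMap.applyₗ (X.groupClassHom (Pi.single i 1))
  have hΘ : ∀ ℓ i, Θ ℓ i = ℓ (X.groupClassHom (Pi.single i 1)) := fun ℓ i => rfl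
  have hinj : Function.Injective Θ := by
    intro ℓ ℓ' h
    refine LinearMap.ext fun x => ?_
    obtain ⟨w, rfl⟩ := groupClassHom_surjective hX x
    rw [dual_groupClassHom, dual_groupClassHom ℓ']
    exact Finset.sum_congr rfl fun i _ => by rw [← hΘ, ← hΘ, h]
  have hspan : (Submodule.span ℝ G).map Θ = Submodule.span ℝ (X.maxFace L ϖ) := by
    rw [Submodule.map_span]
    apply le_antisymm
    · rw [Submodule.span_le]
      rintro _ ⟨ℓ, ⟨hℓ, hℓ0⟩, rfl⟩
      have hnn : ∀ i, 0 ≤ ℓ (X.groupClassHom (Pi.single i 1)) := fun i =>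
        hℓ _ (effectiveCone_single_mem hX i)
      rcases dual_eq_zero_or_pos hX hL hLbdd hnn with h0 | hpos
      · have : Θ ℓ = 0 := funext fun i => (hΘ ℓ i).trans (h0 i)
        rw [this]
        exact zero_mem _
      · have hmem := mem_polytope_of_dual hX hnn hpos
        set b := ℓ (X.realClass fun ρ => (L ρ : ℝ)) with hb
        rw [adjointClass, map_sub, map_smul, smul_eq_mul, ← hb, sub_eq_zero] at hℓ0
        have hface : (fun i => b⁻¹ * ℓ (X.groupClassHom (Pi.single i 1))) ∈ X.maxFace L ϖ := by
          refine ⟨hmem, ?_⟩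
          rw [sum_mul_normalized, ← hℓ0]
          field_simp
        have : Θ ℓ = b • fun i => b⁻¹ * ℓ (X.groupClassHom (Pi.single i 1)) := by
          ext i
          rw [hΘ, Pi.smul_apply, smul_eq_mul, mul_inv_cancel_left₀ hpos.ne']
        rw [this]
        exact Submodule.smul_mem _ _ (Submodule.subset_span hface)
    · refine Submodule.span_mono fun z hz => ?_
      obtain ⟨ℓ, h1, h2, h3⟩ := exists_dual_of_mem_maxFace hX hL hLbdd hϖ hz
      refine ⟨ℓ, ⟨h2, h3⟩, funext fun i => ?_⟩
      rw [hΘ, h1]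
      simp [Pi.single_apply]
  rw [(Submodule.equivMapOfInjective Θ hinj (Submodule.span ℝ G)).finrank_eq, hspan]
  exact finrank_span_eq_finrank_vectorSpan_add_one (maxFace_nonempty hL hLbdd)
    (maxValue_pos hL hLbdd hϖ).ne' (ψ := weightForm ϖ) fun u hu => by
      rw [weightForm_apply]; exact hu.2

theorem finrank_span_minimalFace_adjointClass [Nonempty (Fin s)] (hX : X.GroupedByClass)
    (hL : X.IsSemiample L) (hLbdd : ∀ i, ∃ σ ∈ X.maxCones, 0 < X.groupCoeff L σ i)
    (hϖ : ∀ i, 0 < ϖ i) :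
    Module.finrank ℝ (Submodule.span ℝ
        (minimalFace X.effectiveCone (X.adjointClass L ϖ) : Set X.PicReal)) +
      (X.faceDim L ϖ + 1) = Module.finrank ℝ X.PicReal := by
  rw [← finrank_span_dual hX hL hLbdd hϖ]
  refine finrank_span_minimalFace_add (v := fun i => X.groupClassHom (Pi.single i 1))
    (fun x => ?_) (adjointClass_mem_effectiveCone hX hL hLbdd)
  simp_rw [← groupClassHom_eq_sum]
  exact mem_effectiveCone_iff hX x

/-- A linear form that is positive on all torus-invariant prime divisors. -/
theorem exists_dual_pos (hX : X.GroupedByClass) : ∃ ℓ : Module.Dual ℝ X.PicReal,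
    ∀ i, 0 < ℓ (X.groupClassHom (Pi.single i 1)) := by
  classical
  -- Minus the sum of all generators lies in some cone. Moving it to the other side gives a relation
  -- with all coefficients at least 1.
  obtain ⟨σ, -, c, hc, hrel, -⟩ := X.exists_pairing_eq fun _ => 1
  obtain ⟨ℓ, hℓ⟩ := exists_dual_of_relation (X := X)
    (y := fun ρ => 1 + if ρ ∈ σ then c ρ else 0) fun k => by
      simp_rw [add_mul, Finset.sum_add_distrib]
      rw [hrel k]
      simp [ite_mul]
  refine ⟨ℓ, fun i => ?_⟩
  rw [← realClass_single hX ⟨i, ⟨0, hX.1 i⟩⟩, hℓ]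
  simp only [Pi.single_apply, ite_mul, one_mul, zero_mul, Finset.sum_ite_eq', Finset.mem_univ,
    if_true]
  split_ifs with h
  · linarith [hc _ h]
  · norm_num

/-- Here `a = 1` and the adjoint class is 0. A form that is positive on all prime divisors shows
that the effective cone is pointed, so its minimal face at 0 is trivial. Normalized at `L`, the same
form is a point of the maximal face with all coordinates positive. -/
theorem maxFace_of_class_eq [Nonempty (Fin s)] (hX : X.GroupedByClass) (hL : X.IsSemiample L)
    (hLbdd : ∀ i, ∃ σ ∈ X.maxCones, 0 < X.groupCoeff L σ i) (hϖ : ∀ i, 0 < ϖ i)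
    (hLϖ : X.realClass (fun ρ => (L ρ : ℝ)) = X.groupClass ϖ) :
    (∀ i, ¬ X.maxFace L ϖ ⊆ {u | u i = 0}) ∧ X.maxValue L ϖ = 1 ∧
      X.faceDim L ϖ + 1 = Module.finrank ℤ X.Pic := by
  obtain ⟨ℓ, hℓ⟩ := exists_dual_pos hX
  have hnn : ∀ i, 0 ≤ ℓ (X.groupClassHom (Pi.single i 1)) := fun i => (hℓ i).le
  have hpos : 0 < ℓ (X.realClass fun ρ => (L ρ : ℝ)) := by
    rw [hLϖ, ← groupClassHom_apply, dual_groupClassHom]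
    exact Finset.sum_pos (fun i _ => mul_pos (hϖ i) (hℓ i)) Finset.univ_nonempty
  have hmem := mem_polytope_of_dual hX hnn hpos
  have hone := sum_mul_normalized (ϖ := ϖ) ℓ (ℓ (X.realClass fun ρ => (L ρ : ℝ)))
  rw [← hLϖ, inv_mul_cancel₀ hpos.ne'] at hone
  have ha : X.maxValue L ϖ = 1 := by
    refine le_antisymm ((isGLB_maxValue hX hL hLbdd hϖ).1 ?_) ?_
    · rw [Set.mem_ofPred_eq, one_smul, hLϖ, sub_self]
      exact zero_mem _
    · exact hone.ge.trans (le_maxValue hL hLbdd hmem)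
  refine ⟨fun i hsub => ?_, ha, ?_⟩
  · have h0 := hsub ⟨hmem, hone.trans ha.symm⟩
    exact (mul_pos (inv_pos.2 hpos) (hℓ i)).ne' h0
  · have hadj : X.adjointClass L ϖ = 0 := by
      rw [adjointClass, ha, one_smul, hLϖ, sub_self]
    have h := finrank_span_minimalFace_adjointClass hX hL hLbdd hϖ
    have hbot : Submodule.span ℝ
        (minimalFace X.effectiveCone (X.adjointClass L ϖ) : Set X.PicReal) = ⊥ := by
      rw [Submodule.span_eq_bot]
      rintro x ⟨hx, t, -, hx'⟩
      rw [hadj, smul_zero, zero_sub] at hx'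
      obtain ⟨w, hw, rfl⟩ := (mem_effectiveCone_iff hX x).1 hx
      obtain ⟨w', hw', hww'⟩ := (mem_effectiveCone_iff hX _).1 hx'
      have e1 := dual_groupClassHom ℓ w
      have e2 := dual_groupClassHom ℓ w'
      rw [← hww', map_neg] at e2
      have e3 : 0 ≤ ∑ i, w' i * ℓ (X.groupClassHom (Pi.single i 1)) :=
        Finset.sum_nonneg fun i _ => mul_nonneg (hw' i) (hnn i)
      have e4 : ∀ i ∈ Finset.univ, 0 ≤ w i * ℓ (X.groupClassHom (Pi.single i 1)) :=
        fun i _ => mul_nonneg (hw i) (hnn i)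
      have e5 : ∑ i, w i * ℓ (X.groupClassHom (Pi.single i 1)) = 0 :=
        le_antisymm (by linarith) (Finset.sum_nonneg e4)
      have hw0 : w = 0 := funext fun i =>
        (mul_eq_zero.1 ((Finset.sum_eq_zero_iff_of_nonneg e4).1 e5 i
          (Finset.mem_univ i))).resolve_right (hℓ i).ne'
      rw [hw0, map_zero]
    rwa [hbot, finrank_bot, zero_add, finrank_picReal] at h

end SmoothCompleteFan

theorem lemma3p1 {rk s t : ℕ} {n : Fin s → ℕ}
    (X : SmoothCompleteFan rk (Σ i : Fin s, Fin (n i)))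
    (hX : X.GroupedByClass)
    (hr : 2 ≤ Module.finrank ℤ X.Pic)
    (L : (Σ i : Fin s, Fin (n i)) → ℚ)
    (hL : X.IsSemiample L)
    (hLbdd : ∀ i, ∃ σ ∈ X.maxCones, 0 < X.groupCoeff L σ i)
    (g : Fin t → MvPolynomial (Σ i : Fin s, Fin (n i)) ℤ)
    (hg : ∀ l, ∃ c : X.Pic, MvPolynomial.IsWeightedHomogeneous X.primeClass (g l) c)
    (m : (Σ i : Fin s, Fin (n i)) → ℕ)
    (hm : ∀ ρ, 1 ≤ m ρ)
    (CM CE : (Fin s → ℕ+) → ℝ) (ϖ : Fin s → ℝ) (ε : ℝ)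
    (hCM : ∀ d, 0 < CM d) (hCE : ∀ d, 0 < CE d) (hϖ : ∀ i, 0 < ϖ i) (hε : 0 < ε)
    (hF : ∃ K : ℝ, ∀ (d : Fin s → ℕ+) (B : Fin s → ℝ), (∀ i, 1 ≤ B i) →
      |(boxCount g m d B : ℝ) - CM d * ∏ i, B i ^ ϖ i| ≤
        K * (CE d * (⨅ i, B i) ^ (-ε) * ∏ i, B i ^ ϖ i))
    (hCMc : X.MobiusCompatible CM) (hCEc : X.MobiusCompatible CE) :
    -- the maximum defining `a` is attained, and `N_V(B)` is a finite number
    IsGreatest ((fun u => ∑ i, ϖ i * u i) '' X.polytope L) (X.maxValue L ϖ) ∧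
    (∀ B : ℝ, (X.countedPoints L g m B).Finite) ∧
    -- (i)
    ((∀ i, ¬ X.maxFace L ϖ ⊆ {u | u i = 0}) →
      Summable (fun d : Fin s → ℕ+ => (X.mu (fun i => (d i : ℕ)) : ℝ) * CM d) ∧
      ∃ cP : ℝ,
        (∀ i₀ : Fin s, Tendsto
          (fun δ : ℝ => δ ^ ((X.faceDim L ϖ : ℤ) + 1 - s) * X.sliceMeasure L ϖ i₀ δ)
          (𝓝[>] 0) (𝓝 cP)) ∧
        (fun B : ℝ => (X.pointCount L g m B : ℝ) -
            ((s - 1 - X.faceDim L ϖ).factorial * cP * (2 : ℝ)⁻¹ ^ Module.finrank ℤ X.Pic *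
              ∑' d : Fin s → ℕ+, (X.mu (fun i => (d i : ℕ)) : ℝ) * CM d) *
            (B ^ X.maxValue L ϖ * Real.log B ^ X.faceDim L ϖ))
          =O[atTop] fun B : ℝ => B ^ X.maxValue L ϖ *
            Real.log B ^ ((X.faceDim L ϖ : ℤ) - 1) * Real.log (Real.log B) ^ s) ∧
    -- (ii)
    (X.IsAmple L →
      IsGLB {τ : ℝ | τ • X.realClass (fun ρ => (L ρ : ℝ)) - X.groupClass ϖ ∈ X.effectiveCone}
        (X.maxValue L ϖ) ∧
      ∃ Φ : PointedCone ℝ X.PicReal,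
        Φ.IsFaceOf X.effectiveCone ∧
        X.maxValue L ϖ • X.realClass (fun ρ => (L ρ : ℝ)) - X.groupClass ϖ ∈ Φ ∧
        (∀ Ψ : PointedCone ℝ X.PicReal, Ψ.IsFaceOf X.effectiveCone →
          X.maxValue L ϖ • X.realClass (fun ρ => (L ρ : ℝ)) - X.groupClass ϖ ∈ Ψ → Φ ≤ Ψ) ∧
        Module.finrank ℝ (Submodule.span ℝ (Φ : Set X.PicReal)) + (X.faceDim L ϖ + 1) =
          Module.finrank ℝ X.PicReal) ∧
    -- (iii)
    (X.IsAmple L → X.realClass (fun ρ => (L ρ : ℝ)) = X.groupClass ϖ →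
      (∀ i, ¬ X.maxFace L ϖ ⊆ {u | u i = 0}) ∧ X.maxValue L ϖ = 1 ∧
        X.faceDim L ϖ + 1 = Module.finrank ℤ X.Pic) := by
  have hne : Nonempty (Fin s) := SmoothCompleteFan.nonempty_of_two_le_finrank hr
  refine ⟨SmoothCompleteFan.isGreatest_maxValue hL hLbdd ϖ,
    SmoothCompleteFan.finite_countedPoints hX hL hLbdd hg, fun hface => ?_, fun _ => ?_,
    fun _ hLϖ => SmoothCompleteFan.maxFace_of_class_eq hX hL hLbdd hϖ hLϖ⟩
  · obtain ⟨cP, hcP, hJ⟩ := SmoothCompleteFan.exists_sliceMeasure_limit (ϖ := ϖ) hL hLbdd hϖ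
    exact ⟨SmoothCompleteFan.summable_mu_mul_of_compatible hCMc, cP, hcP,
      SmoothCompleteFan.pointCount_isBigO hX hL hLbdd hg hCM hCE hϖ hε hF hCMc hCEc hface hJ⟩
  · exact ⟨SmoothCompleteFan.isGLB_maxValue hX hL hLbdd hϖ,
      minimalFace X.effectiveCone (X.adjointClass L ϖ), isFaceOf_minimalFace,
      self_mem_minimalFace (SmoothCompleteFan.adjointClass_mem_effectiveCone hX hL hLbdd),
      fun F hF hmem => minimalFace_le hF hmem,
      SmoothCompleteFan.finrank_span_minimalFace_adjointClass hX hL hLbdd hϖ⟩
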